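/- Conventions. All fields are smooth. Let $X$ be a vector field on a smooth manifold $M$. A critical element is a rest point or a closed orbit. The index of a hyperbolic rest point is the number of eigenvalues of its linearization with positive real part, and the index of a hyperbolic closed orbit is the number of its Floquet multipliers of modulus greater than $1$, both counted with multiplicity. $W^u(\beta)$ and $W^s(\beta)$ denote the unstable and stable manifolds of a critical element $\beta$. $X$ is Morse–Smale if it has finitely many critical elements, all of them hyperbolic, if every nonwandering point lies on a critical element, and if $W^u(\beta)$ and $W^s(\beta')$ are transverse for all critical elements $\beta,\beta'$. For critical elements $\beta\ne\beta'$ let $\alpha(\beta,\beta')\in\mathbb Z_2$ be the number modulo $2$ of connected components of $W^u(\beta)\cap W^s(\beta')$, and put $\alpha(\beta,\beta)=0$. The Eidi–Jost space $C_k$ is the $\mathbb Z_2$-vector space with basis $\mathcal B_k$ consisting of the rest points of index $k$, an element $\gamma^-$ for each closed orbit $\gamma$ of index $k$, and an element $\gamma^+$ for each closed orbit $\gamma$ of index $k-1$; and $\partial_k\colon C_k\to C_{k-1}$ is the linear map with $\partial_k\beta=\sum_{\beta'\in\mathcal B_{k-1}}\alpha(\beta,\beta')\beta'$ for $\beta\in\mathcal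 B_k$. Claim. There is a Morse–Smale vector field $X=(X_1,X_2)$ on $\mathbb R^2$ whose rest points are exactly three sources $p_1,p_2,p_3$ (index $2$) and two saddles $s_1,s_2$ (index $1$), with $s_2=0$, whose only closed orbit is an orbit $\gamma$ of index $0$, and with $X(x)=x$ for all $x$ of large norm, such that for every $0<\varepsilon<\frac12$ there is a Morse–Smale vector field $V$ on $\mathbb R^3$ with $$V(x,y,z)=\begin{cases}(X_1(x,y),X_2(x,y),-z)&\text{if }|z|<\varepsilon,\\(x,y,z-1)&\text{if }z>\frac34,\\(x,y,z+1)&\text{if }z<-\frac34,\end{cases}$$ with the following properties. The critical elements of $V$ are exactly those of $X$ (placed in $\mathbb R^2\times\{0\}$, with the same indices) and two further rest points $r_1=(0,0,1)$, $r_2=(0,0,-1)$ of index $3$. There are a smooth function $\lambda>0$ on $\mathbb R^3$ with $\lambda(v)V(v)\to0$ as $\|v\|\to\infty$, a point $q_0\in S^3$, and a diffeomorphism $\Phi\colon\mathbb R^3\to S^3\setminus\{q_0\}$ such that $\Phi_*(\lambda V)$ extends to a Morse–Smale vector field $W$ on $S^3$. Identifying critical elements with their images under $\Phi$, the Eidi–Jost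 bases of $W$ are $$\mathcal B_3=\{r_1,r_2\},\quad \mathcal B_2=\{p_1,p_2,p_3\},\quad \mathcal B_1=\{s_1,s_2,\gamma^+\},\quad \mathcal B_0=\{q_0,\gamma^-\},\quad \mathcal B_k=\emptyset\ (k\ge4);$$ in particular $q_0$ is a rest point of index $0$. For all $k\ge0$, $\beta\in\mathcal B_{k+1}$ and $\beta'\in\mathcal B_k$, the intersection of the unstable manifold of the critical element underlying $\beta$ with the stable manifold of the one underlying $\beta'$ has finitely many connected components, and in these bases $$\partial_3=\begin{bmatrix}1&1\\1&1\\1&1\end{bmatrix},\qquad \partial_2=\begin{bmatrix}0&0&0\\0&1&1\\1&1&1\end{bmatrix},\qquad \partial_1=\begin{bmatrix}1&0&0\\1&0&0\end{bmatrix}.$$ Hence $\partial_2\circ\partial_3\ne0$. Consequently the assertion that $\partial_k\circ\partial_{k+1}=0$ for all $k$, for every Morse–Smale vector field on every closed smooth manifold (part of Theorem 2.5 of Eidi and Jost), is false. -/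

import Mathlib

open scoped Manifold ContDiff Topology

/- A Euclidean space is a manifold over itself through the identity chart; this line makes
instance search find this structure first. -/
attribute [local instance 2000] chartedSpaceSelf

noncomputable section

namespace MorseSmale

section General

variable {n : ℕ} {M : Type*} [TopologicalSpace M] [ChartedSpace (EuclideanSpace ℝ (Fin n)) M]

/-- The complex eigenvalues of a real endomorphism, repeated according to algebraic
multiplicity. -/
def eigenvaluesC (A : EuclideanSpace ℝ (Fin n) →L[ℝ] EuclideanSpace ℝ (Fin n)) : Multiset ℂ :=
  ((A : EuclideanSpace ℝ (Fin n) →ₗ[ℝ] EuclideanSpace ℝ (Fin n)).charpoly.map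
    (algebraMap ℝ ℂ)).roots

/-! ### Rest points -/

/-- The local representative of the vector field `X` in the preferred chart at `p`. -/
def chartField (X : (x : M) → TangentSpace (𝓡 n) x) (p : M) (u : EuclideanSpace ℝ (Fin n)) :
    EuclideanSpace ℝ (Fin n) :=
  mfderiv (𝓡 n) 𝓘(ℝ, EuclideanSpace ℝ (Fin n)) (extChartAt (𝓡 n) p)
    ((extChartAt (𝓡 n) p).symm u) (X ((extChartAt (𝓡 n) p).symm u))

/-- The linearization of `X` at a rest point `p`: the derivative at `p` of the local
representative of `X`. -/
def linearization (X : (x : M) → TangentSpace (𝓡 n) x) (p : M) :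
    EuclideanSpace ℝ (Fin n) →L[ℝ] EuclideanSpace ℝ (Fin n) :=
  fderiv ℝ (chartField X p) (extChartAt (𝓡 n) p p)

/-- A rest point is hyperbolic if its linearization has no purely imaginary eigenvalue. -/
def IsHyperbolicRest (X : (x : M) → TangentSpace (𝓡 n) x) (p : M) : Prop :=
  ∀ μ ∈ eigenvaluesC (linearization X p), μ.re ≠ 0

open Classical in
/-- The index of a rest point: the number of eigenvalues with positive real part (the dimension
of the unstable manifold, if the rest point is hyperbolic). -/
def restIndex (X : (x : M) → TangentSpace (𝓡 n) x) (p : M) : ℕ :=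
  (eigenvaluesC (linearization X p)).countP fun μ => 0 < μ.re

/-! ### Closed orbits -/

open Classical in
/-- The time-`t` map of the flow of `X` (the identity at points without a global integral curve;
there are none if the field is complete, for instance smooth on a closed manifold). -/
def flowMap (X : (x : M) → TangentSpace (𝓡 n) x) (t : ℝ) (x : M) : M :=
  if h : ∃ c : ℝ → M, c 0 = x ∧ IsMIntegralCurve (I := 𝓡 n) c X then h.choose t else x

/-- A closed orbit, as a subset of `M`: the image of a nonconstant periodic integral curve. -/
def IsClosedOrbit (X : (x : M) → TangentSpace (𝓡 n) x) (γ : Set M) : Prop :=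
  ∃ c : ℝ → M, IsMIntegralCurve (I := 𝓡 n) c X ∧ (∃ T, 0 < T ∧ Function.Periodic c T) ∧
    (∃ t, c t ≠ c 0) ∧ γ = Set.range c

/-- The least positive period of a point on a closed orbit. -/
def period (X : (x : M) → TangentSpace (𝓡 n) x) (x : M) : ℝ :=
  sInf {T | 0 < T ∧ flowMap X T x = x}

/-- The derivative at `x` of the flow over one period, an endomorphism of the tangent space at
the periodic point `x`. -/
def monodromy (X : (x : M) → TangentSpace (𝓡 n) x) (x : M) :
    EuclideanSpace ℝ (Fin n) →L[ℝ] EuclideanSpace ℝ (Fin n) :=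
  mfderiv (𝓡 n) (𝓡 n) (flowMap X (period X x)) x

/-- A closed orbit is hyperbolic if the multiplier `1` (in the flow direction) is simple and no
other multiplier lies on the unit circle. -/
def IsHyperbolicOrbit (X : (x : M) → TangentSpace (𝓡 n) x) (γ : Set M) : Prop :=
  ∀ x ∈ γ, (eigenvaluesC (monodromy X x)).count 1 = 1 ∧
    ∀ μ ∈ eigenvaluesC (monodromy X x), μ ≠ 1 → ‖μ‖ ≠ 1

open Classical in
/-- A closed orbit has index `k` if `k` of its multipliers lie outside the unit circle (so that
its unstable manifold has dimension `k + 1`, if it is hyperbolic). The multipliers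
are the same at all points of the orbit. -/
def HasOrbitIndex (X : (x : M) → TangentSpace (𝓡 n) x) (γ : Set M) (k : ℕ) : Prop :=
  ∀ x ∈ γ, (eigenvaluesC (monodromy X x)).countP (fun μ => 1 < ‖μ‖) = k

/-! ### Critical elements, stable and unstable manifolds -/

/-- Critical elements: rest points (as one-point sets) and closed orbits. -/
def IsCritical (X : (x : M) → TangentSpace (𝓡 n) x) (β : Set M) : Prop :=
  (∃ p, X p = 0 ∧ β = {p}) ∨ IsClosedOrbit X β

/-- The stable manifold: the points whose orbits tend to `β` in forward time. -/
def stableSet (X : (x : M) → TangentSpace (𝓡 n) x) (β : Set M) : Set M :=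
  {x | ∃ c : ℝ → M, c 0 = x ∧ IsMIntegralCurve (I := 𝓡 n) c X ∧
    Filter.Tendsto c Filter.atTop (𝓝ˢ β)}

/-- The unstable manifold: the points whose orbits tend to `β` in backward time. -/
def unstableSet (X : (x : M) → TangentSpace (𝓡 n) x) (β : Set M) : Set M :=
  {x | ∃ c : ℝ → M, c 0 = x ∧ IsMIntegralCurve (I := 𝓡 n) c X ∧
    Filter.Tendsto c Filter.atBot (𝓝ˢ β)}

variable (n) in
/-- The velocities at `x` of the smooth curves in `S` through `x` (the tangent space of `S`
at `x`, if `S` is a submanifold). -/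
def tangentVectors (S : Set M) (x : M) : Set (EuclideanSpace ℝ (Fin n)) :=
  {v | ∃ c : ℝ → M, c 0 = x ∧ ContMDiffAt 𝓘(ℝ, ℝ) (𝓡 n) ∞ c 0 ∧ (∀ᶠ t in 𝓝 (0 : ℝ), c t ∈ S) ∧
    mfderiv 𝓘(ℝ, ℝ) (𝓡 n) c 0 (1 : ℝ) = v}

variable (n) in
/-- `S` and `S'` are transverse: their tangent spaces span at every common point. -/
def Transverse (S S' : Set M) : Prop :=
  ∀ x ∈ S ∩ S', Submodule.span ℝ (tangentVectors n S x ∪ tangentVectors n S' x) = ⊤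

/-- `x` is nonwandering: every neighbourhood of `x` is met again, after arbitrarily long times,
by orbits starting in it. -/
def IsNonwandering (X : (x : M) → TangentSpace (𝓡 n) x) (x : M) : Prop :=
  ∀ U ∈ 𝓝 x, ∀ T : ℝ, ∃ t ≥ T, ∃ c : ℝ → M,
    IsMIntegralCurve (I := 𝓡 n) c X ∧ c 0 ∈ U ∧ c t ∈ U

/-- Morse-Smale vector fields. -/
structure IsMorseSmale [IsManifold (𝓡 n) ∞ M] (X : (x : M) → TangentSpace (𝓡 n) x) : Prop where
  smooth : ContMDiff (𝓡 n) (𝓡 n).tangent ∞ (fun x => (⟨x, X x⟩ : TangentBundle (𝓡 n) M))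
  finite_critical : {β : Set M | IsCritical X β}.Finite
  hyperbolic_rest : ∀ p, X p = 0 → IsHyperbolicRest X p
  hyperbolic_orbit : ∀ γ, IsClosedOrbit X γ → IsHyperbolicOrbit X γ
  nonwandering : ∀ x, IsNonwandering X x → ∃ β, IsCritical X β ∧ x ∈ β
  transverse : ∀ β β', IsCritical X β → IsCritical X β' →
    Transverse n (unstableSet X β) (stableSet X β')

/-! ### The Eidi-Jost sequence over the field with two elements -/

/-- The connected components of the intersection of the unstable manifold of `β` with the stable
manifold of `β'`. -/
abbrev Connections (X : (x : M) → TangentSpace (𝓡 n) x) (β β' : Set M) : Type _ :=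
  ConnectedComponents ↥(unstableSet X β ∩ stableSet X β')

open Classical in
/-- The number modulo 2 of connected components of the intersection of the unstable manifold
of `β` with the stable manifold of `β'`, for two different critical elements; no connection of a
critical element with itself is counted. -/
def connectionNumber (X : (x : M) → TangentSpace (𝓡 n) x) (β β' : Set M) : ZMod 2 :=
  if β = β' then 0 else (Nat.card (Connections X β β') : ZMod 2)

/-- The generators in degree `k`: the rest points of index `k`, the closed orbits of index `k`
(written `γ⁻`), and the closed orbits of index `k - 1` (written `γ⁺`). -/
abbrev Gen (X : (x : M) → TangentSpace (𝓡 n) x) (k : ℕ) : Type _ :=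
  {p : M // X p = 0 ∧ restIndex X p = k} ⊕
    ({γ : Set M // IsClosedOrbit X γ ∧ HasOrbitIndex X γ k} ⊕
      {γ : Set M // IsClosedOrbit X γ ∧ ∃ j, HasOrbitIndex X γ j ∧ j + 1 = k})

/-- The critical element underlying a generator. -/
def Gen.carrier {X : (x : M) → TangentSpace (𝓡 n) x} {k : ℕ} : Gen X k → Set M
  | .inl p => {p.1}
  | .inr (.inl γ) => γ.1
  | .inr (.inr γ) => γ.1

/-- The space of chains in degree `k`. -/
abbrev Chain (X : (x : M) → TangentSpace (𝓡 n) x) (k : ℕ) : Type _ := Gen X k →₀ ZMod 2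

/-- The map from degree `k + 1` to degree `k`. -/
def boundary (X : (x : M) → TangentSpace (𝓡 n) x) (k : ℕ) :
    Chain X (k + 1) →ₗ[ZMod 2] Chain X k :=
  Finsupp.linearCombination (ZMod 2) fun b : Gen X (k + 1) =>
    ∑ᶠ b' : Gen X k, Finsupp.single b' (connectionNumber X b.carrier b'.carrier)

/-- The basis of the chain space given by an enumeration of the generators. -/
def genBasis {X : (x : M) → TangentSpace (𝓡 n) x} {k m : ℕ} (e : Fin m ≃ Gen X k) :
    Module.Basis (Fin m) (ZMod 2) (Chain X k) :=
  (Finsupp.basisSingleOne (R := ZMod 2)).reindex e.symm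

end General

/-- The inclusion of the plane into space. -/
def planeIncl (x : EuclideanSpace ℝ (Fin 2)) : EuclideanSpace ℝ (Fin 3) := !₂[x 0, x 1, 0]

/-- The three-dimensional sphere, with its standard smooth structure. -/
abbrev S3 : Type := Metric.sphere (0 : EuclideanSpace ℝ (Fin (3 + 1))) 1

end MorseSmale

end

/-!
The example is built from explicit fields, so that every orbit can be followed by hand.

The planar field is put together with weights that depend only on
`sqn v = x ^ 2 + y ^ 2`: near the origin it is `(x (16 x ^ 2 - 1), y)`, with two sources and the
saddle `0` on one axis; the unit circle attracts everything between the circles `sqn = 1 / 8` and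
`sqn = 4`; the circle `sqn = 4` is invariant, repels, and carries one source and one saddle; further
out the field is the Euler field `v ↦ v`. Since `sqn` is monotone along orbits outside a small disc,
and the orbits in that disc and on the invariant circles are explicit, all stable and unstable
manifolds and their intersections can be described. The two arcs of the circle `sqn = 4` are two
connections from the outer source to the outer saddle, and the two halves of the unstable manifold
of the saddle `0` are two connections to the closed orbit; both numbers vanish modulo `2`. On the
other hand each of the three sources is joined to the closed orbit by a connected set
(`isConnected_source_circle`).

On three-space, `spaceField` is the planar field times a vertical contraction near the plane
`z = 0`, and a translate of the Euler field around each of the two added sources `(0, 0, ±1)`. The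
plane attracts the slab `|z| < 1`, so the connections among critical elements in the plane are those
of the planar field (`connections_planeIncl`), and each added source is joined to each planar source
by a single orbit (`isConnected_top_source`). In `∂ ∘ ∂` the coefficient of the closed orbit at an
added source is therefore `1 + 1 + 1`, which is nonzero modulo `2`.

To close up at infinity, the vertical component is chosen so that `height / depth` decays like
`exp (-t)`. Then a function `straight` of `x ^ 2 + y ^ 2` and `z`, the root of a quadratic equation,
grows like `exp t`, and taking it as the height near infinity gives a diffeomorphism of three-space
that turns the field into the Euler field there (`fderiv_unbend`). Dividing by `1 + |u| ^ 2` in the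
straightened coordinate `u` makes the field tend to zero, and the map
`u ↦ exp (|u| ^ 2 / 2) u` turns `u / (1 + |u| ^ 2)` back into the Euler field. In the stereographic
parametrization from the antipode this becomes `w ↦ -w` near the added point
(`exists_sphereField_eq`), so the field extends smoothly to the sphere, with a sink at infinity.

For the nonwandering set no recurrence theory is needed: a point is wandering if some function that
does not decrease along orbits increases strictly along its own orbit (`IsTransient`), and such
functions pass from the plane to three-space and to the sphere. Closed orbits are excluded off the
unit circle by the same certificates. Transversality and the eigenvalues are computed on the plane
and on three-space, and carried to the sphere by the compactification, which is a local
diffeomorphism conjugating the flows up to a change of time; the rescaling factor is `1` near all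
critical elements, so that linearizations and multipliers do not change.
-/

noncomputable section

namespace MorseSmale

open Filter Set

local notation "E2" => EuclideanSpace ℝ (Fin 2)
local notation "E3" => EuclideanSpace ℝ (Fin 3)

/-! ### Flows of complete vector fields -/

section Flow

variable {n : ℕ} {M : Type*} [TopologicalSpace M] [ChartedSpace (EuclideanSpace ℝ (Fin n)) M]
  {X : (x : M) → TangentSpace (𝓡 n) x}

/-- Every point lies on a global integral curve, and this curve is unique. -/
structure HasFlow (X : (x : M) → TangentSpace (𝓡 n) x) : Prop where
  exists_curve : ∀ x, ∃ c : ℝ → M, c 0 = x ∧ IsMIntegralCurve (I := 𝓡 n) c X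
  unique : ∀ c c' : ℝ → M, IsMIntegralCurve (I := 𝓡 n) c X → IsMIntegralCurve (I := 𝓡 n) c' X →
    c 0 = c' 0 → c = c'

namespace HasFlow

lemma flowMap_spec (h : HasFlow X) (x : M) :
    flowMap X 0 x = x ∧ IsMIntegralCurve (I := 𝓡 n) (fun t => flowMap X t x) X := by
  have key : (fun t => flowMap X t x) = (h.exists_curve x).choose := by
    funext t
    simp only [flowMap, dif_pos (h.exists_curve x)]
  have := (h.exists_curve x).choose_spec
  rw [← key] at this
  exact this

lemma flowMap_zero (h : HasFlow X) (x : M) : flowMap X 0 x = x := (h.flowMap_spec x).1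

lemma isMIntegralCurve (h : HasFlow X) (x : M) :
    IsMIntegralCurve (I := 𝓡 n) (fun t => flowMap X t x) X := (h.flowMap_spec x).2

lemma eq_flowMap (h : HasFlow X) {c : ℝ → M} (hc : IsMIntegralCurve (I := 𝓡 n) c X) :
    c = fun t => flowMap X t (c 0) :=
  h.unique _ _ hc (h.isMIntegralCurve _) (h.flowMap_zero _).symm

lemma flowMap_add (h : HasFlow X) (s t : ℝ) (x : M) :
    flowMap X (s + t) x = flowMap X s (flowMap X t x) := by
  have h1 := h.eq_flowMap ((h.isMIntegralCurve x).comp_add t)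
  have h2 := congrFun h1 s
  simpa using h2

lemma flowMap_neg_flowMap (h : HasFlow X) (t : ℝ) (x : M) :
    flowMap X (-t) (flowMap X t x) = x := by
  rw [← h.flowMap_add, neg_add_cancel, h.flowMap_zero]

lemma flowMap_of_zero (h : HasFlow X) {p : M} (hp : X p = 0) (t : ℝ) : flowMap X t p = p :=
  (congrFun (h.eq_flowMap (isMIntegralCurve_const hp)) t).symm

lemma continuous_flowMap (h : HasFlow X) (x : M) : Continuous fun t => flowMap X t x :=
  (h.isMIntegralCurve x).continuous

lemma mem_stableSet (h : HasFlow X) {β : Set M} {x : M} :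
    x ∈ stableSet X β ↔ Tendsto (fun t => flowMap X t x) atTop (𝓝ˢ β) := by
  constructor
  · rintro ⟨c, rfl, hc, ht⟩
    rwa [h.eq_flowMap hc] at ht
  · exact fun ht => ⟨_, h.flowMap_zero x, h.isMIntegralCurve x, ht⟩

lemma mem_unstableSet (h : HasFlow X) {β : Set M} {x : M} :
    x ∈ unstableSet X β ↔ Tendsto (fun t => flowMap X t x) atBot (𝓝ˢ β) := by
  constructor
  · rintro ⟨c, rfl, hc, ht⟩
    rwa [h.eq_flowMap hc] at ht
  · exact fun ht => ⟨_, h.flowMap_zero x, h.isMIntegralCurve x, ht⟩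

lemma flowMap_mem_stableSet (h : HasFlow X) {β : Set M} {x : M} (t : ℝ) :
    flowMap X t x ∈ stableSet X β ↔ x ∈ stableSet X β := by
  have key : ∀ (x : M) (t : ℝ), x ∈ stableSet X β → flowMap X t x ∈ stableSet X β := by
    intro x t hx
    rw [h.mem_stableSet] at hx ⊢
    simp_rw [← h.flowMap_add]
    exact hx.comp (tendsto_atTop_add_const_right _ _ tendsto_id)
  refine ⟨fun hx => ?_, key x t⟩
  simpa [h.flowMap_neg_flowMap] using key _ (-t) hx

lemma flowMap_mem_unstableSet (h : HasFlow X) {β : Set M} {x : M} (t : ℝ) :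
    flowMap X t x ∈ unstableSet X β ↔ x ∈ unstableSet X β := by
  have key : ∀ (x : M) (t : ℝ), x ∈ unstableSet X β → flowMap X t x ∈ unstableSet X β := by
    intro x t hx
    rw [h.mem_unstableSet] at hx ⊢
    simp_rw [← h.flowMap_add]
    exact hx.comp (tendsto_atBot_add_const_right _ _ tendsto_id)
  refine ⟨fun hx => ?_, key x t⟩
  simpa [h.flowMap_neg_flowMap] using key _ (-t) hx

lemma stableSet_singleton_of_zero (h : HasFlow X) {p : M} (hp : X p = 0) :
    p ∈ stableSet X {p} := by
  rw [h.mem_stableSet, nhdsSet_singleton]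
  simp_rw [h.flowMap_of_zero hp]
  exact tendsto_const_nhds

lemma unstableSet_singleton_of_zero (h : HasFlow X) {p : M} (hp : X p = 0) :
    p ∈ unstableSet X {p} := by
  rw [h.mem_unstableSet, nhdsSet_singleton]
  simp_rw [h.flowMap_of_zero hp]
  exact tendsto_const_nhds

/-- A point that flows into a neighbourhood contained in an invariant set `S` has a neighbourhood
contained in `S`. -/
lemma mem_nhds_of_flowMap {S : Set M} (hS : ∀ x t, flowMap X t x ∈ S → x ∈ S)
    {x : M} {t : ℝ} (hc : ContinuousAt (flowMap X t) x) (hx : S ∈ 𝓝 (flowMap X t x)) :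
    S ∈ 𝓝 x :=
  mem_of_superset (hc hx) fun y hy => hS y t hy

lemma isClosedOrbit_eq (h : HasFlow X) {γ γ' : Set M} (hγ : IsClosedOrbit X γ)
    (hγ' : IsClosedOrbit X γ') {x : M} (hx : x ∈ γ) (hx' : x ∈ γ') : γ = γ' := by
  have key : ∀ γ : Set M, IsClosedOrbit X γ → x ∈ γ → γ = range fun t => flowMap X t x := by
    rintro γ ⟨c, hc, -, -, rfl⟩ ⟨t, rfl⟩
    rw [h.eq_flowMap hc]
    simp only
    ext y
    constructor
    · rintro ⟨s, rfl⟩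
      exact ⟨s - t, by simp [← h.flowMap_add]⟩
    · rintro ⟨s, rfl⟩
      exact ⟨s + t, by simp [← h.flowMap_add]⟩
  rw [key γ hγ hx, key γ' hγ' hx']

lemma ne_zero_of_mem_isClosedOrbit (h : HasFlow X) {γ : Set M} (hγ : IsClosedOrbit X γ) {x : M}
    (hx : x ∈ γ) : X x ≠ 0 := by
  obtain ⟨c, hc, -, ⟨t, ht⟩, rfl⟩ := hγ
  obtain ⟨s, rfl⟩ := hx
  intro h0
  have h1 : ∀ r, c r = c s := by
    intro r
    have := congrFun (h.eq_flowMap (hc.comp_add s)) (r - s)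
    simp only [Function.comp_apply, sub_add_cancel, zero_add] at this
    rw [this, h.flowMap_of_zero h0]
  exact ht (by rw [h1 t, h1 0])

end HasFlow

/-! ### Transient points -/

/-- A certificate that `x` is wandering: a function, not necessarily continuous, that does not
decrease along any orbit, increases strictly along the orbit of `x` between two points, and is
continuous at these two points. -/
def IsTransient (X : (x : M) → TangentSpace (𝓡 n) x) (x : M) : Prop :=
  ∃ F : M → ℝ, (∀ y t, 0 ≤ t → F y ≤ F (flowMap X t y)) ∧
    ∃ t, 0 ≤ t ∧ ContinuousAt F x ∧ ContinuousAt F (flowMap X t x) ∧ F x < F (flowMap X t x)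

lemma IsTransient.not_isNonwandering (h : HasFlow X) {x : M} (hx : IsTransient X x)
    (hc : ∀ t, ContinuousAt (flowMap X t) x) : ¬ IsNonwandering X x := by
  obtain ⟨F, hF, t, -, hcx, hct, hlt⟩ := hx
  intro hw
  obtain ⟨m, hm1, hm2⟩ := exists_between hlt
  have h1 : ∀ᶠ y in 𝓝 x, F y < m := hcx.eventually_lt continuousAt_const hm1
  have h2 : ∀ᶠ y in 𝓝 x, m < F (flowMap X t y) :=
    (hc t).eventually (continuousAt_const.eventually_lt hct hm2)
  obtain ⟨s, hs, c, hcc, h0, hs0⟩ := hw _ (h1.and h2) t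
  have e : c s = flowMap X (s - t) (flowMap X t (c 0)) := by
    rw [← h.flowMap_add, sub_add_cancel]
    exact congrFun (h.eq_flowMap hcc) s
  have h3 := hF (flowMap X t (c 0)) (s - t) (by linarith)
  rw [← e] at h3
  have h4 := h0.2
  have h5 := hs0.1
  simp only [mem_ofPred_eq] at *
  linarith

lemma IsTransient.notMem_isClosedOrbit (h : HasFlow X) {x : M} (hx : IsTransient X x)
    {γ : Set M} (hγ : IsClosedOrbit X γ) : x ∉ γ := by
  obtain ⟨F, hF, t, ht0, -, -, hlt⟩ := hx
  obtain ⟨c, hc, ⟨T, hT, hper⟩, -, rfl⟩ := hγ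
  rintro ⟨s, rfl⟩
  obtain ⟨k, hk⟩ := exists_nat_gt (t / T)
  have hk' : t < k * T := by rwa [div_lt_iff₀ hT] at hk
  have e : flowMap X (k * T - t) (flowMap X t (c s)) = c s := by
    rw [← h.flowMap_add, sub_add_cancel]
    have := congrFun (h.eq_flowMap (hc.comp_add s)) (k * T)
    simp only [Function.comp_apply, zero_add] at this
    rw [← this, add_comm]
    exact hper.nat_mul k s
  have h3 := hF (flowMap X t (c s)) (k * T - t) (by linarith)
  rw [e] at h3
  linarith

lemma HasFlow.closedOrbits_eq (h : HasFlow X) {γ : Set M} (hγ : IsClosedOrbit X γ)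
    (htr : ∀ x, X x ≠ 0 → x ∉ γ → IsTransient X x) : {c | IsClosedOrbit X c} = {γ} := by
  ext c
  simp only [mem_ofPred_eq, mem_singleton_iff]
  refine ⟨fun hc => ?_, fun hc => hc ▸ hγ⟩
  obtain ⟨f, hf, -, -, rfl⟩ := id hc
  have hx : f 0 ∈ range f := ⟨0, rfl⟩
  refine h.isClosedOrbit_eq hc hγ hx ?_
  by_contra hn
  exact (htr _ (h.ne_zero_of_mem_isClosedOrbit hc hx) hn).notMem_isClosedOrbit h hc hx

/-- A vector field whose orbits are transient except for finitely many rest points and one closed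
orbit is Morse-Smale as soon as hyperbolicity and transversality hold. -/
lemma HasFlow.isMorseSmale [IsManifold (𝓡 n) ∞ M] (h : HasFlow X)
    (hs : ContMDiff (𝓡 n) (𝓡 n).tangent ∞ (fun x => (⟨x, X x⟩ : TangentBundle (𝓡 n) M)))
    (hfin : {x | X x = 0}.Finite) {γ : Set M} (hγ : IsClosedOrbit X γ)
    (htr : ∀ x, X x ≠ 0 → x ∉ γ → IsTransient X x)
    (hc : ∀ x, X x ≠ 0 → ∀ t, ContinuousAt (flowMap X t) x)
    (hrest : ∀ p, X p = 0 → IsHyperbolicRest X p) (horb : IsHyperbolicOrbit X γ)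
    (htv : ∀ β β', IsCritical X β → IsCritical X β' →
      Transverse n (unstableSet X β) (stableSet X β')) : IsMorseSmale X where
  smooth := hs
  finite_critical := by
    have h1 := h.closedOrbits_eq hγ htr
    refine ((hfin.image fun p => ({p} : Set M)).union (finite_singleton γ)).subset ?_
    rintro β (⟨p, hp, rfl⟩ | hβ)
    · exact Or.inl ⟨p, hp, rfl⟩
    · exact Or.inr (h1 ▸ hβ)
  hyperbolic_rest := hrest
  hyperbolic_orbit := by
    intro c hc
    have h1 : c ∈ ({γ} : Set (Set M)) := h.closedOrbits_eq hγ htr ▸ hc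
    rw [mem_singleton_iff.1 h1]
    exact horb
  nonwandering := by
    intro x hx
    by_cases h0 : X x = 0
    · exact ⟨{x}, Or.inl ⟨x, h0, rfl⟩, rfl⟩
    by_cases h1 : x ∈ γ
    · exact ⟨γ, Or.inr hγ, h1⟩
    · exact absurd hx ((htr x h0 h1).not_isNonwandering h (hc x h0))
  transverse := htv

end Flow

/-! ### Vector fields on Euclidean spaces -/

section Euclidean

variable {n : ℕ}

local notation "E" => EuclideanSpace ℝ (Fin n)

lemma hasMFDerivAt_curve_iff {c : ℝ → E} {t : ℝ} {v : E} :
    HasMFDerivAt 𝓘(ℝ, ℝ) (𝓡 n) c t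
      ((1 : ℝ →L[ℝ] ℝ).smulRight v : ℝ →L[ℝ] E) ↔ HasDerivAt c v t := by
  refine hasMFDerivAt_iff_hasFDerivAt.trans ?_
  rw [hasDerivAt_iff_hasFDerivAt]
  congr!

lemma isMIntegralCurve_iff {X : E → E} {c : ℝ → E} :
    IsMIntegralCurve (I := 𝓡 n) c (X : (x : E) → TangentSpace (𝓡 n) x) ↔
      ∀ t, HasDerivAt c (X (c t)) t :=
  forall_congr' fun _ => hasMFDerivAt_curve_iff

lemma isMIntegralCurveOn_Ioo_iff {X : E → E} {c : ℝ → E} {a b : ℝ} :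
    IsMIntegralCurveOn (I := 𝓡 n) c (X : (x : E) → TangentSpace (𝓡 n) x) (Ioo a b) ↔
      ∀ t ∈ Ioo a b, HasDerivAt c (X (c t)) t :=
  forall₂_congr fun _ ht =>
    ⟨fun h => hasMFDerivAt_curve_iff.1 (h.hasMFDerivAt (Ioo_mem_nhds ht.1 ht.2)),
      fun h => (hasMFDerivAt_curve_iff.2 h).hasMFDerivWithinAt⟩

lemma contMDiff_section {X : E → E} {m : ℕ∞ω} (hX : ContDiff ℝ m X) :
    ContMDiff (𝓡 n) (𝓡 n).tangent m (fun x => (⟨x, X x⟩ : TangentBundle (𝓡 n) E)) :=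
  contMDiff_vectorSpace_iff_contDiff.2 hX

lemma eq_of_hasDerivAt {X : E → E} (hX : ContDiff ℝ 1 X) {a b t₀ : ℝ} (ht₀ : t₀ ∈ Ioo a b)
    {c c' : ℝ → E} (hc : ∀ t ∈ Ioo a b, HasDerivAt c (X (c t)) t)
    (hc' : ∀ t ∈ Ioo a b, HasDerivAt c' (X (c' t)) t) (h : c t₀ = c' t₀) :
    EqOn c c' (Ioo a b) :=
  isMIntegralCurveOn_Ioo_eqOn_of_contMDiff_boundaryless (I := 𝓡 n) ht₀ (contMDiff_section hX)
    (isMIntegralCurveOn_Ioo_iff.2 hc) (isMIntegralCurveOn_Ioo_iff.2 hc') h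

lemma hasFlow_of_exists {X : E → E} (hX : ContDiff ℝ 1 X)
    (hex : ∀ x, ∃ c : ℝ → E, c 0 = x ∧ ∀ t, HasDerivAt c (X (c t)) t) :
    HasFlow (n := n) (X : (x : E) → TangentSpace (𝓡 n) x) where
  exists_curve x := by
    obtain ⟨c, h0, hc⟩ := hex x
    exact ⟨c, h0, isMIntegralCurve_iff.2 hc⟩
  unique c c' hc hc' h :=
    isMIntegralCurve_Ioo_eq_of_contMDiff_boundaryless (contMDiff_section hX) hc hc' h

lemma HasFlow.hasDerivAt {X : E → E} (h : HasFlow (n := n) X) (x : E) (t : ℝ) :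
    HasDerivAt (fun t => flowMap (n := n) X t x) (X (flowMap (n := n) X t x)) t :=
  isMIntegralCurve_iff.1 (h.isMIntegralCurve x) t

open scoped NNReal in
/-- A globally Lipschitz vector field has local solutions of a uniform lifetime, hence is
complete. -/
lemma hasFlow_of_lipschitz {X : E → E} (hX : ContDiff ℝ 1 X) {K : ℝ≥0} (hK : LipschitzWith K X) :
    HasFlow (n := n) (X : (x : E) → TangentSpace (𝓡 n) x) where
  exists_curve := by
    have hpos : (0 : ℝ) < 1 / (1 + K) := by positivity
    refine exists_isMIntegralCurve_of_isMIntegralCurveOn (contMDiff_section hX) hpos fun x => ?_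
    set a : ℝ≥0 := ‖X x‖₊ + 1 with ha
    have hpl : IsPicardLindelof (fun _ => X) (tmin := -(1 / (1 + K : ℝ))) (tmax := 1 / (1 + K : ℝ))
        ⟨0, by simp only [mem_Icc]; constructor <;> linarith⟩ x a 0 ((1 + K) * a) K := by
      refine IsPicardLindelof.of_time_independent (fun y hy => ?_) hK.lipschitzOnWith ?_
      · have h1 := hK.dist_le_mul y x
        rw [dist_eq_norm] at h1
        have h2 : dist y x ≤ a := Metric.mem_closedBall.1 hy
        have h3 : ‖X y‖ ≤ ‖X y - X x‖ + ‖X x‖ := norm_le_norm_sub_add _ _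
        have h4 : ‖X x‖ ≤ a := by simp [ha]
        have h5 : (K : ℝ) * dist y x ≤ K * a := by gcongr
        push_cast
        linarith
      · have hne : (1 + (K : ℝ)) ≠ 0 := by positivity
        simp only [sub_zero, zero_sub, neg_neg, max_self]
        push_cast
        field_simp
        simp
    obtain ⟨α, h0, hα⟩ := hpl.exists_eq_forall_mem_Icc_hasDerivWithinAt₀
    refine ⟨α, h0, isMIntegralCurveOn_Ioo_iff.2 fun t ht => ?_⟩
    exact (hα t (Ioo_subset_Icc_self ht)).hasDerivAt (Icc_mem_nhds ht.1 ht.2)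
  unique c c' hc hc' h :=
    isMIntegralCurve_Ioo_eq_of_contMDiff_boundaryless (contMDiff_section hX) hc hc' h

open scoped NNReal in
lemma dist_le_of_lipschitz {X : E → E} {K : ℝ≥0} (hK : LipschitzWith K X) {c c' : ℝ → E}
    (hc : ∀ t, HasDerivAt c (X (c t)) t) (hc' : ∀ t, HasDerivAt c' (X (c' t)) t) (t : ℝ) :
    dist (c t) (c' t) ≤ dist (c 0) (c' 0) * Real.exp (K * |t|) := by
  have key : ∀ (X : E → E) (c c' : ℝ → E), LipschitzWith K X →
      (∀ t, HasDerivAt c (X (c t)) t) → (∀ t, HasDerivAt c' (X (c' t)) t) → ∀ t, 0 ≤ t →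
      dist (c t) (c' t) ≤ dist (c 0) (c' 0) * Real.exp (K * t) := by
    intro X c c' hK hc hc' t ht
    have := dist_le_of_trajectories_ODE (v := fun _ => X) (K := K) (f := c) (g := c') (a := 0)
      (b := t) (δ := dist (c 0) (c' 0)) (fun _ => hK)
      (fun s _ => (hc s).continuousAt.continuousWithinAt) (fun s _ => (hc s).hasDerivWithinAt)
      (fun s _ => (hc' s).continuousAt.continuousWithinAt) (fun s _ => (hc' s).hasDerivWithinAt)
      le_rfl t ⟨ht, le_rfl⟩
    simpa using this
  rcases le_total 0 t with ht | ht
  · rw [abs_of_nonneg ht]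
    exact key X c c' hK hc hc' t ht
  · have hrev : ∀ c : ℝ → E, (∀ t, HasDerivAt c (X (c t)) t) →
        ∀ t, HasDerivAt (fun s => c (-s)) ((fun x => -X x) (c (-t))) t := by
      intro c hc t
      have := (hc (-t)).scomp t (hasDerivAt_neg t)
      rw [neg_one_smul] at this
      exact this
    have h1 := key (fun x => -X x) _ _ hK.neg (hrev c hc) (hrev c' hc') (-t) (by linarith)
    rw [abs_of_nonpos ht]
    simpa using h1

/-- The flow of a complete field of class `C^1` is jointly continuous: near a given orbit segment
the field can be cut off, which makes it globally Lipschitz. -/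
lemma HasFlow.continuous_uncurry {X : E → E} (hX : ContDiff ℝ 1 X)
    (h : HasFlow (n := n) X) :
    Continuous fun p : ℝ × E => flowMap (n := n) X p.1 p.2 := by
  rw [continuous_iff_continuousAt]
  rintro ⟨t₀, x₀⟩
  set T : ℝ := |t₀| + 1 with hT
  have hT0 : 0 < T := by positivity
  obtain ⟨R, hR⟩ := (isCompact_Icc.image_of_continuousOn
    (h.continuous_flowMap x₀).continuousOn (s := Icc (-T) T)).isBounded.subset_ball 0
  have hR0 : 0 < R := by
    have := hR ⟨0, ⟨by linarith, hT0.le⟩, rfl⟩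
    exact lt_of_le_of_lt (norm_nonneg _) (mem_ball_zero_iff.1 this)
  let b : ContDiffBump (0 : E) := ⟨R + 1, R + 2, by linarith, by linarith⟩
  set Y : E → E := fun x => b x • X x with hY
  have hYs : ContDiff ℝ 1 Y := b.contDiff.smul hX
  have hYX : ∀ x, ‖x‖ < R + 1 → Y x = X x := by
    intro x hx
    have : b x = 1 := b.one_of_mem_closedBall (by simpa using hx.le)
    simp [hY, this]
  obtain ⟨K, hK⟩ := hYs.lipschitzWith_of_hasCompactSupport (b.hasCompactSupport.smul_right)
    one_ne_zero
  have hYf := hasFlow_of_lipschitz hYs hK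
  have e0 : ∀ t ∈ Ioo (-T) T, flowMap (n := n) Y t x₀ = flowMap (n := n) X t x₀ := by
    intro t ht
    refine eq_of_hasDerivAt hYs (c := fun t => flowMap (n := n) Y t x₀)
      (c' := fun t => flowMap (n := n) X t x₀) (t₀ := 0) (a := -T) (b := T) ⟨by linarith, hT0⟩
      (fun s _ => hYf.hasDerivAt x₀ s) (fun s hs => ?_) ?_ ht
    · have h1 := hR ⟨s, Ioo_subset_Icc_self hs, rfl⟩
      rw [hYX _ (by linarith [mem_ball_zero_iff.1 h1])]
      exact h.hasDerivAt x₀ s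
    · rw [hYf.flowMap_zero, h.flowMap_zero]
  have hd : ∀ x, ∀ t ∈ Ioo (-T) T, dist (flowMap (n := n) Y t x) (flowMap (n := n) X t x₀) ≤
      dist x x₀ * Real.exp (K * T) := by
    intro x t ht
    have h1 := dist_le_of_lipschitz hK (hYf.hasDerivAt x) (hYf.hasDerivAt x₀) t
    rw [e0 t ht, hYf.flowMap_zero, hYf.flowMap_zero] at h1
    refine h1.trans ?_
    have : |t| ≤ T := abs_le.2 ⟨ht.1.le, ht.2.le⟩
    gcongr
  have e1 : ∀ x, dist x x₀ * Real.exp (K * T) < 1 → ∀ t ∈ Ioo (-T) T,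
      flowMap (n := n) Y t x = flowMap (n := n) X t x := by
    intro x hx t ht
    refine eq_of_hasDerivAt hX (c := fun t => flowMap (n := n) Y t x)
      (c' := fun t => flowMap (n := n) X t x) (t₀ := 0) (a := -T) (b := T) ⟨by linarith, hT0⟩
      (fun s hs => ?_) (fun s hs => h.hasDerivAt x s) ?_ ht
    · have h1 := hR ⟨s, Ioo_subset_Icc_self hs, rfl⟩
      have h2 := (hd x s hs).trans_lt hx
      have h3 : ‖flowMap (n := n) Y s x‖ < R + 1 := by
        have := dist_triangle (flowMap (n := n) Y s x) (flowMap (n := n) X s x₀) 0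
        rw [dist_zero_right, dist_zero_right] at this
        linarith [mem_ball_zero_iff.1 h1]
      rw [← hYX _ h3]
      exact hYf.hasDerivAt x s
    · rw [hYf.flowMap_zero, h.flowMap_zero]
  have hnear : ∀ᶠ p : ℝ × E in 𝓝 (t₀, x₀), p.1 ∈ Ioo (-T) T ∧
      dist p.2 x₀ * Real.exp (K * T) < 1 := by
    have ht₀ : t₀ ∈ Ioo (-T) T := abs_lt.1 (by rw [hT]; linarith)
    refine (continuousAt_fst.eventually (Ioo_mem_nhds ht₀.1 ht₀.2)).and ?_
    have : ContinuousAt (fun p : ℝ × E => dist p.2 x₀ * Real.exp (K * T)) (t₀, x₀) := by fun_prop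
    exact this.eventually_lt continuousAt_const (by simp)
  rw [ContinuousAt, tendsto_iff_dist_tendsto_zero]
  have hb : Tendsto (fun p : ℝ × E => dist p.2 x₀ * Real.exp (K * T) +
      dist (flowMap (n := n) X p.1 x₀) (flowMap (n := n) X t₀ x₀)) (𝓝 (t₀, x₀)) (𝓝 0) := by
    have hc : Continuous fun t => flowMap (n := n) X t x₀ := h.continuous_flowMap x₀
    have : Continuous fun p : ℝ × E => dist p.2 x₀ * Real.exp (K * T) +
      dist (flowMap (n := n) X p.1 x₀) (flowMap (n := n) X t₀ x₀) := by fun_prop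
    simpa using this.tendsto (t₀, x₀)
  refine squeeze_zero' (Eventually.of_forall fun _ => dist_nonneg) ?_ hb
  filter_upwards [hnear] with p hp
  refine (dist_triangle _ (flowMap (n := n) X p.1 x₀) _).trans ?_
  gcongr
  rw [← e1 p.2 hp.2 p.1 hp.1]
  exact hd p.2 p.1 hp.1

lemma HasFlow.continuous_flowMap_right {X : E → E} (hX : ContDiff ℝ 1 X)
    (h : HasFlow (n := n) X) (t : ℝ) : Continuous (flowMap (n := n) X t) :=
  (h.continuous_uncurry hX).comp (Continuous.prodMk_right t)

end Euclidean

/-! ### Eigenvalues -/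

section Eigenvalues

variable {n : ℕ}

local notation "E" => EuclideanSpace ℝ (Fin n)

lemma eigenvaluesC_of_linearIndependent {A : E →L[ℝ] E} {v : Fin n → E}
    (hv : LinearIndependent ℝ v) {a : Fin n → ℝ} (h : ∀ i, A (v i) = a i • v i) :
    eigenvaluesC A = Finset.univ.val.map fun i => (a i : ℂ) := by
  rcases isEmpty_or_nonempty (Fin n) with he | he
  · have h0 : Module.finrank ℝ E = 0 := by simp [Fintype.card_eq_zero]
    have h1 : (A : E →ₗ[ℝ] E).charpoly.natDegree = 0 := by rw [LinearMap.charpoly_natDegree, h0]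
    have h2 : ((A : E →ₗ[ℝ] E).charpoly.map (algebraMap ℝ ℂ)).natDegree = 0 := by
      rw [Polynomial.natDegree_map, h1]
    rw [eigenvaluesC, Polynomial.eq_C_of_natDegree_eq_zero h2, Polynomial.roots_C]
    simp
  let b := basisOfLinearIndependentOfCardEqFinrank hv (by simp)
  have hb : ∀ i, b i = v i := fun i => by simp [b]
  have hm : LinearMap.toMatrix b b (A : E →ₗ[ℝ] E) = Matrix.diagonal a := by
    ext i j
    rw [LinearMap.toMatrix_apply]
    have : (A : E →ₗ[ℝ] E) (b j) = a j • b j := by rw [hb]; exact h j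
    rw [this, map_smul, Module.Basis.repr_self, Matrix.diagonal_apply]
    by_cases hij : i = j
    · subst hij; simp
    · simp [hij]
  rw [eigenvaluesC, ← LinearMap.charpoly_toMatrix _ b, hm, Matrix.charpoly_diagonal,
    Polynomial.map_prod]
  simp only [Polynomial.map_sub, Polynomial.map_X, Polynomial.map_C]
  have hp : (∏ i, (Polynomial.X - Polynomial.C (algebraMap ℝ ℂ (a i)))) =
      ((Finset.univ.val.map fun i => (a i : ℂ)).map fun z => Polynomial.X - Polynomial.C z).prod := by
    rw [Multiset.map_map]
    rfl
  rw [hp, Polynomial.roots_multiset_prod_X_sub_C]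

lemma eigenvaluesC_of_single {A : E →L[ℝ] E} {a : Fin n → ℝ}
    (h : ∀ i, A (EuclideanSpace.single i 1) = a i • EuclideanSpace.single i 1) :
    eigenvaluesC A = Finset.univ.val.map fun i => (a i : ℂ) := by
  have := (EuclideanSpace.basisFun (Fin n) ℝ).toBasis.linearIndependent
  refine eigenvaluesC_of_linearIndependent (v := fun i => EuclideanSpace.single i 1) ?_ h
  have e : (fun i => EuclideanSpace.single i 1) = ⇑(EuclideanSpace.basisFun (Fin n) ℝ).toBasis := by
    funext i
    simp
  rw [e]
  exact this

lemma eigenvaluesC_conj (L : E ≃L[ℝ] E) {A B : E →L[ℝ] E} (h : ∀ v, B (L v) = L (A v)) :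
    eigenvaluesC B = eigenvaluesC A := by
  have : (B : E →ₗ[ℝ] E) = L.toLinearEquiv.conj (A : E →ₗ[ℝ] E) := by
    ext1 v
    have := h (L.symm v)
    simp only [ContinuousLinearEquiv.apply_symm_apply] at this
    simpa [LinearEquiv.conj_apply] using this
  rw [eigenvaluesC, eigenvaluesC, this, LinearEquiv.charpoly_conj]

end Eigenvalues

/-! ### Transport along local diffeomorphisms -/

section Transport

variable {n : ℕ}

local notation "E" => EuclideanSpace ℝ (Fin n)

lemma linearization_eq (X : E → E) (p : E) :
    linearization (n := n) (X : (x : E) → TangentSpace (𝓡 n) x) p = fderiv ℝ X p := by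
  have h1 : chartField (n := n) (X : (x : E) → TangentSpace (𝓡 n) x) p = X := by
    funext u
    simp only [chartField, extChartAt_model_space_eq_id, PartialEquiv.refl_coe,
      PartialEquiv.refl_symm, id]
    exact congrArg (fun L : E →L[ℝ] E => L (X u)) (mfderiv_id (I := 𝓡 n) (x := u))
  unfold linearization
  rw [h1]
  simp only [extChartAt_model_space_eq_id, PartialEquiv.refl_coe, id]

variable {N : Type*} [TopologicalSpace N] [ChartedSpace (EuclideanSpace ℝ (Fin n)) N]

/-- The eigenvalues of the linearization at a rest point do not change when the field is carried
over to another manifold by a local diffeomorphism. -/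
lemma eigenvaluesC_linearization_of_related [IsManifold (𝓡 n) ∞ N] {f : E → N} {p : E}
    (hf : IsLocalDiffeomorphAt (𝓡 n) (𝓡 n) ∞ f p) {X : E → E}
    {Y : (x : N) → TangentSpace (𝓡 n) x} (hX : DifferentiableAt ℝ X p) (hX0 : X p = 0)
    (h : ∀ᶠ v in 𝓝 p, Y (f v) = mfderiv (𝓡 n) (𝓡 n) f v (X v)) :
    eigenvaluesC (linearization Y (f p)) = eigenvaluesC (fderiv ℝ X p) := by
  set φ := extChartAt (𝓡 n) (f p) with hφ
  set g : E → E := fun v => φ (f v) with hg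
  set k : E → E := fun u => hf.localInverse (φ.symm u) with hk
  have hfc : ContMDiffAt (𝓡 n) (𝓡 n) ∞ f p := hf.contMDiffAt
  have hsrc : φ.source ∈ 𝓝 (f p) := extChartAt_source_mem_nhds (f p)
  have hfs : ∀ᶠ v in 𝓝 p, f v ∈ φ.source := hfc.continuousAt hsrc
  have hgs : ContDiffAt ℝ ∞ g p :=
    contMDiffAt_iff_contDiffAt.1 ((contMDiffAt_extChartAt (x := f p)).comp p hfc)
  have hkg : ∀ᶠ v in 𝓝 p, k (g v) = v := by
    filter_upwards [hfs, hf.localInverse_eventuallyEq_left] with v h1 h2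
    simp only [hk, hg, φ.left_inv h1]
    exact h2
  have hksymm : ContMDiffAt (𝓡 n) (𝓡 n) ∞ φ.symm (g p) :=
    (contMDiffOn_extChartAt_symm (f p)).contMDiffAt (extChartAt_target_mem_nhds (f p))
  have hkp : k (g p) = p := hkg.self_of_nhds
  have hsp : φ.symm (g p) = f p := φ.left_inv (mem_extChartAt_source (f p))
  have hks : ContDiffAt ℝ ∞ k (g p) := by
    refine contMDiffAt_iff_contDiffAt.1 (ContMDiffAt.comp (g p) ?_ hksymm)
    rw [hsp]
    exact hf.localInverse_contMDiffAt
  have hfk : ∀ᶠ u in 𝓝 (g p), f (k u) = φ.symm u := by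
    have h2 : ∀ᶠ y in 𝓝 (φ.symm (g p)), f (hf.localInverse y) = y := by
      rw [hsp]; exact hf.localInverse_eventuallyEq_right
    exact hksymm.continuousAt.eventually h2
  have hgk : ∀ᶠ u in 𝓝 (g p), g (k u) = u := by
    filter_upwards [hfk, extChartAt_target_mem_nhds (I := 𝓡 n) (f p)] with u h1 h2
    simp only [hg, h1]
    exact φ.right_inv h2
  have htk : Tendsto k (𝓝 (g p)) (𝓝 p) := by
    have := hks.continuousAt.tendsto
    rwa [hkp] at this
  have hgd : DifferentiableAt ℝ g p := hgs.differentiableAt (by simp)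
  have hkd : DifferentiableAt ℝ k (g p) := hks.differentiableAt (by simp)
  -- the local representative in terms of `g`
  have hcf : chartField Y (f p) =ᶠ[𝓝 (g p)] fun u => fderiv ℝ g (k u) (X (k u)) := by
    have hmd : ∀ᶠ v in 𝓝 p, MDifferentiableAt (𝓡 n) (𝓡 n) f v := by
      obtain ⟨Θ, hp, heq⟩ := id hf
      filter_upwards [Θ.open_source.mem_nhds hp] with v hv
      exact IsLocalDiffeomorphAt.mdifferentiableAt ⟨Θ, hv, heq⟩ (by simp)
    filter_upwards [hfk, htk.eventually h, htk.eventually hmd, htk.eventually hfs]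
      with u h1 h2 h3 h4
    have h5 : mfderiv (𝓡 n) (𝓡 n) g (k u) =
        (mfderiv (𝓡 n) (𝓡 n) φ (f (k u))).comp (mfderiv (𝓡 n) (𝓡 n) f (k u)) := by
      refine mfderiv_comp (k u) (mdifferentiableAt_extChartAt (by simpa [hφ] using h4)) h3
    rw [← mfderiv_eq_fderiv]
    rw [chartField, ← hφ, ← h1, h2]
    exact (congrArg (fun L : E →L[ℝ] E => L (X (k u))) h5).symm
  have hder : HasFDerivAt (fun v => fderiv ℝ g v (X v)) ((fderiv ℝ g p).comp (fderiv ℝ X p)) p := by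
    have h1 : DifferentiableAt ℝ (fderiv ℝ g) p :=
      (hgs.fderiv_right (m := 1) (by norm_cast)).differentiableAt (by simp)
    have := h1.hasFDerivAt.clm_apply hX.hasFDerivAt
    simpa [hX0] using this
  have hlin : linearization Y (f p) =
      ((fderiv ℝ g p).comp (fderiv ℝ X p)).comp (fderiv ℝ k (g p)) := by
    rw [linearization]
    refine HasFDerivAt.fderiv (HasFDerivAt.congr_of_eventuallyEq ?_ hcf)
    exact HasFDerivAt.comp (g p) (by rw [hkp]; exact hder) hkd.hasFDerivAt
  have e1 : (fderiv ℝ k (g p)).comp (fderiv ℝ g p) = ContinuousLinearMap.id ℝ E := by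
    rw [← fderiv_comp p hkd hgd]
    have : k ∘ g =ᶠ[𝓝 p] id := hkg
    rw [this.fderiv_eq, fderiv_id]
  have e2 : (fderiv ℝ g p).comp (fderiv ℝ k (g p)) = ContinuousLinearMap.id ℝ E := by
    have h0 : DifferentiableAt ℝ g (k (g p)) := by rwa [hkp]
    have := fderiv_comp (g p) h0 hkd
    rw [hkp] at this
    rw [← this]
    have : g ∘ k =ᶠ[𝓝 (g p)] id := hgk
    rw [this.fderiv_eq, fderiv_id]
  let L : E ≃L[ℝ] E := ContinuousLinearEquiv.equivOfInverse (fderiv ℝ g p) (fderiv ℝ k (g p))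
    (fun v => congrArg (fun A : E →L[ℝ] E => A v) e1)
    (fun v => congrArg (fun A : E →L[ℝ] E => A v) e2)
  refine eigenvaluesC_conj L fun v => ?_
  rw [hlin]
  have : fderiv ℝ k (g p) (L v) = v := congrArg (fun A : E →L[ℝ] E => A v) e1
  simp only [ContinuousLinearMap.comp_apply, this]
  rfl

/-- The multipliers of a fixed point do not change under conjugacy by a local diffeomorphism. -/
lemma eigenvaluesC_mfderiv_of_conj {f : E → N} {p : E}
    (hf : IsLocalDiffeomorphAt (𝓡 n) (𝓡 n) ∞ f p) {F : E → E} {G : N → N}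
    (hF : DifferentiableAt ℝ F p) (hp : F p = p) (h : ∀ᶠ v in 𝓝 p, G (f v) = f (F v)) :
    eigenvaluesC (mfderiv (𝓡 n) (𝓡 n) G (f p) : E →L[ℝ] E) = eigenvaluesC (fderiv ℝ F p) := by
  have hF' : MDifferentiableAt (𝓡 n) (𝓡 n) F p := hF.mdifferentiableAt
  have hfd : MDifferentiableAt (𝓡 n) (𝓡 n) f p := hf.contMDiffAt.mdifferentiableAt (by simp)
  have hfd' : MDifferentiableAt (𝓡 n) (𝓡 n) f (F p) := by rwa [hp]
  have hid : MDifferentiableAt (𝓡 n) (𝓡 n) hf.localInverse (f p) :=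
    hf.localInverse_mdifferentiableAt (by simp)
  have hip : hf.localInverse (f p) = p := hf.localInverse_eventuallyEq_left.self_of_nhds
  have hG : MDifferentiableAt (𝓡 n) (𝓡 n) G (f p) := by
    have h1 : G =ᶠ[𝓝 (f p)] fun y => f (F (hf.localInverse y)) := by
      have ht : Tendsto hf.localInverse (𝓝 (f p)) (𝓝 p) := by
        have := hid.continuousAt.tendsto
        rwa [hip] at this
      filter_upwards [ht.eventually h, hf.localInverse_eventuallyEq_right] with y h2 h3
      rw [← h2]
      exact congrArg G h3.symm
    refine MDifferentiableAt.congr_of_eventuallyEq ?_ h1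
    refine MDifferentiableAt.comp (f p) (g := fun v => f (F v)) ?_ hid
    rw [hip]
    exact MDifferentiableAt.comp p hfd' hF'
  have e : (mfderiv (𝓡 n) (𝓡 n) G (f p)).comp (mfderiv (𝓡 n) (𝓡 n) f p) =
      ((mfderiv (𝓡 n) (𝓡 n) f p : E →L[ℝ] E).comp (fderiv ℝ F p) : E →L[ℝ] E) := by
    have h1 := mfderiv_comp p hG hfd
    have h2 := mfderiv_comp p hfd' hF'
    have h3 : mfderiv (𝓡 n) (𝓡 n) (G ∘ f) p = mfderiv (𝓡 n) (𝓡 n) (f ∘ F) p := by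
      exact Filter.EventuallyEq.mfderiv_eq h
    rw [mfderiv_eq_fderiv] at h2
    have h4 : ∀ q, q = p → (mfderiv (𝓡 n) (𝓡 n) f q : E →L[ℝ] E) =
      (mfderiv (𝓡 n) (𝓡 n) f p : E →L[ℝ] E) := fun q hq => by rw [hq]
    have h5 : (mfderiv (𝓡 n) (𝓡 n) (f ∘ F) p : E →L[ℝ] E) =
      (mfderiv (𝓡 n) (𝓡 n) f p : E →L[ℝ] E).comp (fderiv ℝ F p) := by
      rw [← h4 _ hp]; exact h2
    rw [← h5]
    exact h1.symm.trans h3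
  refine eigenvaluesC_conj (hf.mfderivToContinuousLinearEquiv (by simp)) fun v => ?_
  exact congrArg (fun A : E →L[ℝ] E => A v) e

variable {M : Type*} [TopologicalSpace M] [ChartedSpace (EuclideanSpace ℝ (Fin n)) M] {m : ℕ}
  {N' : Type*} [TopologicalSpace N'] [ChartedSpace (EuclideanSpace ℝ (Fin m)) N']

lemma mfderiv_mem_tangentVectors {f : M → N'} {x : M}
    (hf : ContMDiffAt (𝓡 n) (𝓡 m) ∞ f x) {S : Set M} {S' : Set N'}
    (h : ∀ᶠ y in 𝓝 x, y ∈ S → f y ∈ S') {v : E} (hv : v ∈ tangentVectors n S x) :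
    (mfderiv (𝓡 n) (𝓡 m) f x : E →L[ℝ] EuclideanSpace ℝ (Fin m)) v ∈
      tangentVectors m S' (f x) := by
  obtain ⟨c, rfl, hc, hS, rfl⟩ := hv
  refine ⟨fun t => f (c t), rfl, hf.comp 0 hc, ?_, ?_⟩
  · filter_upwards [hS, hc.continuousAt.eventually h] with t h1 h2 using h2 h1
  · have := mfderiv_comp (0 : ℝ) (hf.mdifferentiableAt (by simp)) (hc.mdifferentiableAt (by simp))
    exact congrArg (fun A : ℝ →L[ℝ] EuclideanSpace ℝ (Fin m) => A 1) this

lemma mem_tangentVectors {S : Set E} {x v : E} {c : ℝ → E} (h0 : c 0 = x) (hc : ContDiff ℝ ∞ c)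
    (hS : ∀ᶠ t in 𝓝 (0 : ℝ), c t ∈ S) (hd : HasDerivAt c v 0) : v ∈ tangentVectors n S x := by
  refine ⟨c, h0, hc.contDiffAt.contMDiffAt, hS, ?_⟩
  rw [mfderiv_eq_fderiv, hd.hasFDerivAt.fderiv]
  exact one_smul ℝ v

lemma mem_tangentVectors_of_line {S : Set E} {x v : E}
    (hS : ∀ᶠ t in 𝓝 (0 : ℝ), x + t • v ∈ S) : v ∈ tangentVectors n S x := by
  refine mem_tangentVectors (c := fun t => x + t • v) (by simp) (by fun_prop) hS ?_
  simpa using ((hasDerivAt_id (0 : ℝ)).smul_const v).const_add x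

lemma mem_tangentVectors_of_mem_nhds {S : Set E} {x : E} (hS : S ∈ 𝓝 x) (v : E) :
    v ∈ tangentVectors n S x := by
  refine mem_tangentVectors_of_line ?_
  have : ContinuousAt (fun t : ℝ => x + t • v) 0 := by fun_prop
  exact this.eventually (by simpa using hS)

/-- Transversality at a point is preserved by local diffeomorphisms. -/
lemma span_tangentVectors_image_eq_top {f : E → N} {p : E}
    (hf : IsLocalDiffeomorphAt (𝓡 n) (𝓡 n) ∞ f p) {S₁ S₂ : Set E} {T₁ T₂ : Set N}
    (h₁ : ∀ᶠ y in 𝓝 p, y ∈ S₁ → f y ∈ T₁) (h₂ : ∀ᶠ y in 𝓝 p, y ∈ S₂ → f y ∈ T₂)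
    (h : Submodule.span ℝ (tangentVectors n S₁ p ∪ tangentVectors n S₂ p) = ⊤) :
    Submodule.span ℝ (tangentVectors n T₁ (f p) ∪ tangentVectors n T₂ (f p)) = ⊤ := by
  let A : E →L[ℝ] E := mfderiv (𝓡 n) (𝓡 n) f p
  let L : E →ₗ[ℝ] E := A.toLinearMap
  have hsurj : LinearMap.range L = ⊤ := by
    rw [LinearMap.range_eq_top]
    exact (hf.mfderivToContinuousLinearEquiv (by simp)).surjective
  rw [eq_top_iff, ← hsurj, LinearMap.range_eq_map, ← h, Submodule.map_span]
  refine Submodule.span_mono ?_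
  rintro _ ⟨v, hv | hv, rfl⟩
  · exact Or.inl (mfderiv_mem_tangentVectors hf.contMDiffAt h₁ hv)
  · exact Or.inr (mfderiv_mem_tangentVectors hf.contMDiffAt h₂ hv)

end Transport

/-! ### Differential inequalities on the line -/

section Scalar

variable {u u' : ℝ → ℝ}

lemma hasDerivAt_comp_neg (hu : ∀ t, HasDerivAt u (u' t) t) (t : ℝ) :
    HasDerivAt (fun t => u (-t)) (-u' (-t)) t := by
  have := (hu (-t)).comp t (hasDerivAt_neg t)
  rwa [mul_neg_one] at this

lemma add_mul_le_of_le_deriv (hu : ∀ t, HasDerivAt u (u' t) t) {δ s t : ℝ} (hst : s ≤ t)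
    (h : ∀ r ∈ Ioo s t, δ ≤ u' r) : u s + δ * (t - s) ≤ u t := by
  have := Convex.mul_sub_le_image_sub_of_le_deriv (convex_Icc s t) (f := u) (C := δ)
    (fun r _ => (hu r).continuousAt.continuousWithinAt)
    (fun r _ => (hu r).differentiableAt.differentiableWithinAt)
    (fun r hr => by rw [(hu r).deriv]; exact h r (by rwa [interior_Icc] at hr))
    s (left_mem_Icc.2 hst) t (right_mem_Icc.2 hst) hst
  linarith

lemma le_of_deriv_nonneg (hu : ∀ t, HasDerivAt u (u' t) t) {s t : ℝ} (hst : s ≤ t)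
    (h : ∀ r ∈ Ioo s t, 0 ≤ u' r) : u s ≤ u t := by
  simpa using add_mul_le_of_le_deriv hu hst h

/-- A function that does not decrease while its values lie in `(a, b)` becomes monotone when it
is truncated to `[a, b]`. -/
lemma clamp_le_clamp (hu : ∀ t, HasDerivAt u (u' t) t) {a b s t : ℝ} (hst : s ≤ t)
    (h : ∀ r ∈ Ioo s t, a < u r → u r < b → 0 ≤ u' r) :
    max a (min (u s) b) ≤ max a (min (u t) b) := by
  by_contra! hlt
  obtain ⟨m₂, h1, h2⟩ := exists_between hlt
  obtain ⟨m₁, h3, h4⟩ := exists_between h2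
  have ha : a < m₂ := (le_max_left _ _).trans_lt h1
  have h5 : m₁ < min (u s) b := by
    rcases lt_max_iff.1 h4 with h | h
    · linarith
    · exact h
  have h6 : u t < m₂ := by
    have := (le_max_right _ _).trans_lt h1
    rcases min_lt_iff.1 this with h | h
    · exact h
    · have := h5.trans_le (min_le_right _ _)
      linarith
  have hus : m₁ < u s := h5.trans_le (min_le_left _ _)
  have hb : m₁ < b := h5.trans_le (min_le_right _ _)
  have huc : Continuous u := continuous_iff_continuousAt.2 fun r => (hu r).continuousAt
  -- the last time in `[s, t]` with value at least `m₁`, then the first time with value at most `m₂`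
  obtain ⟨s', ⟨hs1, hs2⟩, hs3⟩ := (isCompact_Icc.inter_right
    (isClosed_le continuous_const huc) : IsCompact (Icc s t ∩ {r | m₁ ≤ u r})).exists_isGreatest
    ⟨s, left_mem_Icc.2 hst, hus.le⟩
  obtain ⟨t', ⟨ht1, ht2⟩, ht3⟩ := (isCompact_Icc.inter_right
    (isClosed_le huc continuous_const) : IsCompact (Icc s' t ∩ {r | u r ≤ m₂})).exists_isLeast
    ⟨t, right_mem_Icc.2 hs1.2, h6.le⟩
  have hs2' : m₁ ≤ u s' := hs2
  have ht2' : u t' ≤ m₂ := ht2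
  have := le_of_deriv_nonneg hu ht1.1 fun r hr => by
    refine h r ⟨hs1.1.trans_lt hr.1, hr.2.trans_le ht1.2⟩ ?_ ?_
    · by_contra! hn
      have := ht3 ⟨⟨hr.1.le, hr.2.le.trans ht1.2⟩, show u r ≤ m₂ by linarith⟩
      exact absurd hr.2 this.not_gt
    · by_contra! hn
      have := hs3 ⟨⟨hs1.1.trans hr.1.le, hr.2.le.trans ht1.2⟩, show m₁ ≤ u r by linarith⟩
      exact absurd hr.1 this.not_gt
  linarith

lemma monotone_clamp (hu : ∀ t, HasDerivAt u (u' t) t) {a b : ℝ}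
    (h : ∀ t, a < u t → u t < b → 0 ≤ u' t) : Monotone fun t => max a (min (u t) b) :=
  fun _ _ hst => clamp_le_clamp hu hst fun r _ => h r

lemma antitone_clamp (hu : ∀ t, HasDerivAt u (u' t) t) {a b : ℝ}
    (h : ∀ t, a < u t → u t < b → u' t ≤ 0) : Antitone fun t => max a (min (u t) b) := by
  have h1 := monotone_clamp (u := fun t => u (-t)) (u' := fun t => -u' (-t)) (a := a) (b := b)
    (hasDerivAt_comp_neg hu)
    (fun t h1 h2 => by have := h (-t) h1 h2; linarith)
  intro s t hst
  simpa using h1 (neg_le_neg hst)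

lemma le_of_clamp_le {a b c x y : ℝ} (h : max a (min x b) ≤ max a (min y b)) (hy : y ≤ c)
    (hac : a ≤ c) (hcb : c < b) : x ≤ c := by
  have h1 : max a (min x b) ≤ c := h.trans (max_le hac ((min_le_left _ _).trans hy))
  exact (min_le_iff.1 ((le_max_right _ _).trans h1)).resolve_right hcb.not_ge

lemma le_of_le_clamp {a b c x y : ℝ} (h : max a (min x b) ≤ max a (min y b)) (hx : c ≤ x)
    (hac : a < c) (hcb : c ≤ b) : c ≤ y := by
  have h1 : c ≤ max a (min y b) := ((le_min hx hcb).trans (le_max_right _ _)).trans h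
  exact ((le_max_iff.1 h1).resolve_left hac.not_ge).trans (min_le_left _ _)

/-- A bounded increasing quantity converges to `b` if it can rest only at the level `b`. -/
lemma tendsto_atTop_of_le_deriv (hu : ∀ t, HasDerivAt u (u' t) t) {t₀ b : ℝ}
    (hb : ∀ t, t₀ ≤ t → u t ≤ b) (h0 : ∀ t, t₀ ≤ t → 0 ≤ u' t)
    (h : ∀ b' < b, ∃ δ > 0, ∀ t, t₀ ≤ t → u t ≤ b' → δ ≤ u' t) :
    Tendsto u atTop (𝓝 b) := by
  have hmono : ∀ s t, t₀ ≤ s → s ≤ t → u s ≤ u t := fun s t hs hst =>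
    le_of_deriv_nonneg hu hst fun r hr => h0 r (hs.trans hr.1.le)
  refine tendsto_order.2 ⟨fun b' hb' => ?_, fun b' hb' => ?_⟩
  · obtain ⟨δ, hδ, hd⟩ := h b' hb'
    have : ∃ t₁, t₀ ≤ t₁ ∧ b' < u t₁ := by
      by_contra! hn
      set t := t₀ + (b' - u t₀) / δ + 1 with ht
      have h1 : u t₀ ≤ b' := hn t₀ le_rfl
      have h2 : t₀ ≤ t := by
        have : 0 ≤ (b' - u t₀) / δ := div_nonneg (by linarith) hδ.le
        linarith
      have h3 := add_mul_le_of_le_deriv hu h2 fun r hr => hd r hr.1.le (hn r hr.1.le)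
      have h4 : δ * (t - t₀) = b' - u t₀ + δ := by rw [ht]; field_simp; ring
      have := hn t h2
      linarith
    obtain ⟨t₁, ht₁, hlt⟩ := this
    filter_upwards [eventually_ge_atTop t₁] with t ht
    exact hlt.trans_le (hmono t₁ t ht₁ ht)
  · filter_upwards [eventually_ge_atTop t₀] with t ht
    exact (hb t ht).trans_lt hb'

lemma tendsto_atTop_of_deriv_le (hu : ∀ t, HasDerivAt u (u' t) t) {t₀ a : ℝ}
    (ha : ∀ t, t₀ ≤ t → a ≤ u t) (h0 : ∀ t, t₀ ≤ t → u' t ≤ 0)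
    (h : ∀ a' > a, ∃ δ > 0, ∀ t, t₀ ≤ t → a' ≤ u t → u' t ≤ -δ) :
    Tendsto u atTop (𝓝 a) := by
  have := tendsto_atTop_of_le_deriv (u := fun t => -u t) (u' := fun t => -u' t) (t₀ := t₀)
    (b := -a) (fun t => (hu t).neg) (fun t ht => neg_le_neg (ha t ht))
    (fun t ht => by have := h0 t ht; linarith) (fun b' hb' => by
      obtain ⟨δ, hδ, hd⟩ := h (-b') (by linarith)
      exact ⟨δ, hδ, fun t ht hb => by have := hd t ht (by linarith); linarith⟩)
  simpa using this.neg

lemma tendsto_atBot_of_le_deriv (hu : ∀ t, HasDerivAt u (u' t) t) {t₀ a : ℝ}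
    (ha : ∀ t, t ≤ t₀ → a ≤ u t) (h0 : ∀ t, t ≤ t₀ → 0 ≤ u' t)
    (h : ∀ a' > a, ∃ δ > 0, ∀ t, t ≤ t₀ → a' ≤ u t → δ ≤ u' t) :
    Tendsto u atBot (𝓝 a) := by
  have := tendsto_atTop_of_deriv_le (u := fun t => u (-t)) (u' := fun t => -u' (-t)) (t₀ := -t₀)
    (a := a) (hasDerivAt_comp_neg hu)
    (fun t ht => ha _ (by linarith)) (fun t ht => by have := h0 (-t) (by linarith); linarith)
    (fun a' ha' => by
      obtain ⟨δ, hδ, hd⟩ := h a' ha'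
      exact ⟨δ, hδ, fun t ht hb => by have := hd (-t) (by linarith) hb; linarith⟩)
  simpa [Function.comp_def] using this.comp tendsto_neg_atBot_atTop

lemma tendsto_atBot_of_deriv_le (hu : ∀ t, HasDerivAt u (u' t) t) {t₀ b : ℝ}
    (hb : ∀ t, t ≤ t₀ → u t ≤ b) (h0 : ∀ t, t ≤ t₀ → u' t ≤ 0)
    (h : ∀ b' < b, ∃ δ > 0, ∀ t, t ≤ t₀ → u t ≤ b' → u' t ≤ -δ) :
    Tendsto u atBot (𝓝 b) := by
  have := tendsto_atBot_of_le_deriv (u := fun t => -u t) (u' := fun t => -u' t) (t₀ := t₀)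
    (a := -b) (fun t => (hu t).neg) (fun t ht => neg_le_neg (hb t ht))
    (fun t ht => by have := h0 t ht; linarith) (fun b' hb' => by
      obtain ⟨δ, hδ, hd⟩ := h (-b') (by linarith)
      exact ⟨δ, hδ, fun t ht hb => by have := hd t ht (by linarith); linarith⟩)
  simpa using this.neg

lemma eq_mul_exp_of_deriv {k : ℝ} {s : Set ℝ} (hs : Convex ℝ s)
    (hu : ∀ t ∈ s, HasDerivAt u (k * u t) t) {a b : ℝ} (ha : a ∈ s) (hb : b ∈ s) :
    u b = u a * Real.exp (k * (b - a)) := by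
  have h1 : ∀ t ∈ s, HasDerivWithinAt (fun t => u t * Real.exp (-(k * t))) 0 s t := by
    intro t ht
    have h2 : HasDerivAt (fun t : ℝ => Real.exp (-(k * t))) (Real.exp (-(k * t)) * (-(k * 1))) t :=
      (((hasDerivAt_id t).const_mul k).neg).exp
    have h3 := (hu t ht).mul h2
    exact (h3.congr_deriv (by ring)).hasDerivWithinAt
  have h2 := hs.norm_image_sub_le_of_norm_hasDerivWithin_le (C := 0) h1
    (fun t _ => by simp) ha hb
  have h3 : u b * Real.exp (-(k * b)) = u a * Real.exp (-(k * a)) := by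
    have : ‖u b * Real.exp (-(k * b)) - u a * Real.exp (-(k * a))‖ ≤ 0 := by simpa using h2
    exact sub_eq_zero.1 (norm_le_zero_iff.1 this)
  have h4 : Real.exp (k * (b - a)) = Real.exp (-(k * a)) * Real.exp (k * b) := by
    rw [← Real.exp_add]; congr 1; ring
  rw [h4, ← mul_assoc, ← h3, mul_assoc, ← Real.exp_add]
  simp

/-- A solution of a linear differential inequality that vanishes at one time vanishes later. -/
lemma eq_zero_of_abs_deriv_le (hu : ∀ t, HasDerivAt u (u' t) t) {K s t : ℝ} (hst : s ≤ t)
    (h : ∀ r ∈ Icc s t, |u' r| ≤ K * |u r|) (h0 : u s = 0) : u t = 0 := by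
  refine eq_zero_of_abs_deriv_le_mul_abs_self_of_eq_zero_right (f := u) (f' := u') (K := K)
    (a := s) (b := t) (fun r _ => (hu r).continuousAt.continuousWithinAt)
    (fun r _ => (hu r).hasDerivWithinAt) h0 (fun r hr => ?_) t (right_mem_Icc.2 hst)
  simpa using h r (Ico_subset_Icc_self hr)

lemma eq_zero_of_abs_deriv_le' (hu : ∀ t, HasDerivAt u (u' t) t) {K s t : ℝ} (hst : s ≤ t)
    (h : ∀ r ∈ Icc s t, |u' r| ≤ K * |u r|) (h0 : u t = 0) : u s = 0 := by
  have := eq_zero_of_abs_deriv_le (hasDerivAt_comp_neg hu) (K := K) (neg_le_neg hst)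
    (fun r hr => by rw [abs_neg]; exact h (-r) ⟨by linarith [hr.2], by linarith [hr.1]⟩)
    (by simpa using h0)
  simpa using this

end Scalar

lemma tendsto_nhdsSet_of_level {α : Type*} [TopologicalSpace α] {ι : Type*} {l : Filter ι}
    {c : ι → α} {K : Set α} (hK : IsCompact K) (hc : ∀ᶠ t in l, c t ∈ K) {f : α → ℝ}
    (hf : Continuous f) {a : ℝ} (h : Tendsto (fun t => f (c t)) l (𝓝 a)) :
    Tendsto c l (𝓝ˢ (K ∩ f ⁻¹' {a})) := by
  refine (hasBasis_nhdsSet _).tendsto_right_iff.2 fun U ⟨hU, hKU⟩ => ?_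
  have h1 : IsCompact (f '' (K \ U)) := (hK.diff hU).image hf
  have h2 : a ∉ f '' (K \ U) := by
    rintro ⟨x, ⟨hx1, hx2⟩, rfl⟩
    exact hx2 (hKU ⟨hx1, rfl⟩)
  filter_upwards [hc, h.eventually (h1.isClosed.isOpen_compl.mem_nhds h2)] with t ht1 ht2
  by_contra hn
  exact ht2 ⟨c t, ⟨ht1, hn⟩, rfl⟩

/-! ### Counting connected components -/

section Components

variable {α β : Type*} [TopologicalSpace α] [TopologicalSpace β]

/-- `S` has exactly `k` connected components. -/
def HasComponents (S : Set α) (k : ℕ) : Prop :=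
  Finite (ConnectedComponents S) ∧ Nat.card (ConnectedComponents S) = k

lemma hasComponents_empty : HasComponents (∅ : Set α) 0 := by
  have : IsEmpty (ConnectedComponents (∅ : Set α)) :=
    ⟨fun x => by obtain ⟨y, -⟩ := ConnectedComponents.surjective_coe x; exact y.2⟩
  exact ⟨inferInstance, by simp⟩

lemma mk_eq_mk_of_isPreconnected {S A : Set α} (hA : IsPreconnected A) (hAS : A ⊆ S) {x y : S}
    (hx : x.1 ∈ A) (hy : y.1 ∈ A) : (x : ConnectedComponents S) = y := by
  rw [ConnectedComponents.coe_eq_coe']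
  have h1 : IsPreconnected ((↑) ⁻¹' A : Set S) := by
    rw [← Topology.IsInducing.subtypeVal.isPreconnected_image, Subtype.image_preimage_coe,
      inter_eq_self_of_subset_right hAS]
    exact hA
  exact h1.subset_connectedComponent hy hx

lemma _root_.IsConnected.hasComponents {S : Set α} (hS : IsConnected S) : HasComponents S 1 := by
  obtain ⟨⟨x, hx⟩, hp⟩ := hS
  have : Unique (ConnectedComponents S) :=
    { default := ((⟨x, hx⟩ : S) : ConnectedComponents S)
      uniq := fun y => by
        obtain ⟨y, rfl⟩ := ConnectedComponents.surjective_coe y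
        exact mk_eq_mk_of_isPreconnected hp Subset.rfl y.2 hx }
  exact ⟨inferInstance, Nat.card_unique⟩

lemma hasComponents_two {A B U V : Set α} (hA : IsConnected A) (hB : IsConnected B)
    (hU : IsOpen U) (hV : IsOpen V) (hAU : A ⊆ U) (hBV : B ⊆ V) (hUB : Disjoint U B)
    (hVA : Disjoint V A) : HasComponents (A ∪ B) 2 := by
  obtain ⟨x, hx⟩ := hA.1
  obtain ⟨y, hy⟩ := hB.1
  set S := A ∪ B with hS
  let x' : S := ⟨x, Or.inl hx⟩
  let y' : S := ⟨y, Or.inr hy⟩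
  have hUS : ((↑) ⁻¹' U : Set S) = (↑) ⁻¹' A := by
    ext ⟨z, hz⟩
    refine ⟨fun h => hz.resolve_right fun hzB => disjoint_left.1 hUB h hzB, fun h => hAU h⟩
  have hVS : ((↑) ⁻¹' V : Set S) = (↑) ⁻¹' B := by
    ext ⟨z, hz⟩
    refine ⟨fun h => hz.resolve_left fun hzA => disjoint_left.1 hVA h hzA, fun h => hBV h⟩
  have hcompl : ((↑) ⁻¹' U : Set S)ᶜ = (↑) ⁻¹' V := by
    rw [hUS, hVS]
    ext ⟨z, hz⟩
    refine ⟨fun h => hz.resolve_left h, fun h h' => ?_⟩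
    exact disjoint_left.1 hUB (hAU h') h
  have hclopen : IsClopen ((↑) ⁻¹' U : Set S) :=
    ⟨⟨by rw [hcompl]; exact hV.preimage continuous_subtype_val⟩,
      hU.preimage continuous_subtype_val⟩
  have hne : (x' : ConnectedComponents S) ≠ y' := by
    rw [Ne, ConnectedComponents.coe_eq_coe]
    intro h
    have h1 := hclopen.connectedComponent_subset (x := x') (hAU hx)
    have h2 : y' ∈ connectedComponent x' := by rw [h]; exact mem_connectedComponent
    exact disjoint_left.1 hUB (h1 h2) hy
  have hbij : Function.Bijective fun b : Bool =>
      bif b then (x' : ConnectedComponents S) else (y' : ConnectedComponents S) := by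
    constructor
    · intro b b' h
      rcases b with _ | _ <;> rcases b' with _ | _ <;> simp_all
    · intro z
      obtain ⟨⟨z, hz⟩, rfl⟩ := ConnectedComponents.surjective_coe z
      rcases id hz with h | h
      · exact ⟨true, mk_eq_mk_of_isPreconnected hA.2 subset_union_left hx h⟩
      · exact ⟨false, mk_eq_mk_of_isPreconnected hB.2 subset_union_right hy h⟩
  have e := Equiv.ofBijective _ hbij
  exact ⟨Finite.of_equiv _ e, by rw [← Nat.card_congr e]; simp⟩

lemma HasComponents.congr {S : Set α} {T : Set β} {k : ℕ} (h : HasComponents S k) (e : S ≃ₜ T) :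
    HasComponents T k := by
  let f : ConnectedComponents S ≃ ConnectedComponents T :=
    { toFun := e.continuous.connectedComponentsMap
      invFun := e.symm.continuous.connectedComponentsMap
      left_inv := fun x => by
        obtain ⟨x, rfl⟩ := ConnectedComponents.surjective_coe x
        exact congrArg _ (e.symm_apply_apply x)
      right_inv := fun x => by
        obtain ⟨x, rfl⟩ := ConnectedComponents.surjective_coe x
        exact congrArg _ (e.apply_symm_apply x) }
  have := h.1
  exact ⟨Finite.of_equiv _ f, by rw [← Nat.card_congr f]; exact h.2⟩

lemma HasComponents.image {S : Set α} {k : ℕ} (h : HasComponents S k) {f : α → β}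
    (hf : Topology.IsEmbedding f) : HasComponents (f '' S) k :=
  h.congr (hf.homeomorphImage S)

end Components

/-! ### The planar vector field -/

/-- A smooth step from `0` on `(-∞, a]` to `1` on `[b, ∞)`. -/
def cutoff (a b x : ℝ) : ℝ := Real.smoothTransition ((x - a) / (b - a))

section Cutoff

variable {a b x : ℝ}

lemma cutoff_of_le (hab : a < b) (h : x ≤ a) : cutoff a b x = 0 :=
  Real.smoothTransition.zero_of_nonpos
    (div_nonpos_of_nonpos_of_nonneg (by linarith) (by linarith))

lemma cutoff_of_ge (hab : a < b) (h : b ≤ x) : cutoff a b x = 1 :=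
  Real.smoothTransition.one_of_one_le ((one_le_div (by linarith)).2 (by linarith))

lemma cutoff_nonneg : 0 ≤ cutoff a b x := Real.smoothTransition.nonneg _

lemma cutoff_le_one : cutoff a b x ≤ 1 := Real.smoothTransition.le_one _

lemma monotone_cutoff (hab : a < b) : Monotone (cutoff a b) := fun x y h =>
  Real.smoothTransition.monotone (by gcongr)

@[fun_prop]
lemma contDiff_cutoff (a b : ℝ) : ContDiff ℝ ∞ (cutoff a b) :=
  Real.smoothTransition.contDiff.comp (by fun_prop)

end Cutoff

/-- The square of the distance to the origin. -/
def sqn (v : E2) : ℝ := v 0 ^ 2 + v 1 ^ 2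

/-- The weight of the field `(x (16 x ^ 2 - 1), y)` that is used near the origin. -/
def innerWeight (q : ℝ) : ℝ := 1 - cutoff (1 / 8) (1 / 4) q

/-- The radial growth rate away from the origin: positive for `q < 1`, negative for `1 < q < 4`
and positive for `q > 4`. -/
def radial (q : ℝ) : ℝ :=
  (1 - cutoff (3 / 2) 2 q) * (1 - q) +
    cutoff (3 / 2) 2 q * ((1 - cutoff 5 6 q) * (q / 4 - 1) + cutoff 5 6 q)

/-- The angular velocity near the circle `q = 1`. -/
def rotation (q : ℝ) : ℝ := cutoff (1 / 4) (1 / 2) q - cutoff (3 / 2) 2 q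

/-- The weight of the angular velocity `y` that is used near the circle `q = 4`. -/
def swing (q : ℝ) : ℝ := cutoff 2 3 q - cutoff 5 6 q

/-- The planar vector field: sources at `(±1/4, 0)` and `(2, 0)`, saddles at `(0, 0)` and
`(-2, 0)`, and the unit circle as an attracting closed orbit. -/
def planarField (v : E2) : E2 :=
  !₂[innerWeight (sqn v) * (v 0 * (16 * v 0 ^ 2 - 1)) +
      (1 - innerWeight (sqn v)) * (radial (sqn v) * v 0) -
      (rotation (sqn v) + swing (sqn v) * v 1) * v 1,
    innerWeight (sqn v) * v 1 + (1 - innerWeight (sqn v)) * (radial (sqn v) * v 1) +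
      (rotation (sqn v) + swing (sqn v) * v 1) * v 0]

/-- The derivative of `sqn` in the direction of the planar field. -/
def sqnRate (v : E2) : ℝ :=
  2 * (innerWeight (sqn v) * (v 0 ^ 2 * (16 * v 0 ^ 2 - 1) + v 1 ^ 2) +
    (1 - innerWeight (sqn v)) * (radial (sqn v) * sqn v))

section Weights

variable {q : ℝ}

lemma innerWeight_of_le (h : q ≤ 1 / 8) : innerWeight q = 1 := by
  rw [innerWeight, cutoff_of_le (by norm_num) h, sub_zero]

lemma innerWeight_of_ge (h : 1 / 4 ≤ q) : innerWeight q = 0 := by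
  rw [innerWeight, cutoff_of_ge (by norm_num) h, sub_self]

lemma innerWeight_nonneg : 0 ≤ innerWeight q := sub_nonneg.2 cutoff_le_one

lemma innerWeight_le_one : innerWeight q ≤ 1 := sub_le_self _ cutoff_nonneg

lemma radial_of_le (h : q ≤ 3 / 2) : radial q = 1 - q := by
  rw [radial, cutoff_of_le (by norm_num) h]; ring

lemma radial_of_mem (h : 2 ≤ q) (h' : q ≤ 5) : radial q = q / 4 - 1 := by
  rw [radial, cutoff_of_ge (by norm_num) h, cutoff_of_le (by norm_num) h']; ring

lemma radial_of_ge (h : 6 ≤ q) : radial q = 1 := by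
  rw [radial, cutoff_of_ge (by norm_num) (show (2 : ℝ) ≤ q by linarith),
    cutoff_of_ge (by norm_num) h]; ring

lemma radial_pos_of_lt (h : q < 1) : 0 < radial q := by
  rw [radial_of_le (by linarith)]; linarith

lemma radial_pos_of_gt (h : 4 < q) : 0 < radial q := by
  rw [radial, cutoff_of_ge (by norm_num) (show (2 : ℝ) ≤ q by linarith)]
  have h1 : (0 : ℝ) ≤ cutoff 5 6 q := cutoff_nonneg
  have h2 : cutoff 5 6 q ≤ 1 := cutoff_le_one
  rcases h1.eq_or_lt with h3 | h3
  · rw [← h3]; linarith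
  · nlinarith

lemma radial_neg (h : 1 < q) (h' : q < 4) : radial q < 0 := by
  rw [radial, cutoff_of_le (a := 5) (b := 6) (by norm_num) (by linarith)]
  have h1 : (0 : ℝ) ≤ cutoff (3 / 2) 2 q := cutoff_nonneg
  have h2 : cutoff (3 / 2) 2 q ≤ 1 := cutoff_le_one
  rcases h1.eq_or_lt with h3 | h3
  · rw [← h3]; linarith
  · nlinarith

lemma rotation_of_le (h : q ≤ 1 / 4) : rotation q = 0 := by
  rw [rotation, cutoff_of_le (by norm_num) h, cutoff_of_le (by norm_num) (by linarith), sub_zero]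

lemma rotation_of_mem (h : 1 / 2 ≤ q) (h' : q ≤ 3 / 2) : rotation q = 1 := by
  rw [rotation, cutoff_of_ge (by norm_num) h, cutoff_of_le (by norm_num) h', sub_zero]

lemma rotation_of_ge (h : 2 ≤ q) : rotation q = 0 := by
  rw [rotation, cutoff_of_ge (by norm_num) (by linarith), cutoff_of_ge (by norm_num) h, sub_self]

lemma swing_of_le (h : q ≤ 2) : swing q = 0 := by
  rw [swing, cutoff_of_le (by norm_num) h, cutoff_of_le (by norm_num) (by linarith), sub_zero]

lemma swing_of_mem (h : 3 ≤ q) (h' : q ≤ 5) : swing q = 1 := by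
  rw [swing, cutoff_of_ge (by norm_num) h, cutoff_of_le (by norm_num) h', sub_zero]

lemma swing_of_ge (h : 6 ≤ q) : swing q = 0 := by
  rw [swing, cutoff_of_ge (by norm_num) (by linarith), cutoff_of_ge (by norm_num) h, sub_self]

lemma swing_nonneg : 0 ≤ swing q := by
  rcases le_total q 5 with h | h
  · rw [swing, cutoff_of_le (a := 5) (b := 6) (by norm_num) h, sub_zero]
    exact cutoff_nonneg
  · rw [swing, cutoff_of_ge (a := 2) (b := 3) (by norm_num) (by linarith)]
    exact sub_nonneg.2 cutoff_le_one

end Weights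

lemma sqn_nonneg (v : E2) : 0 ≤ sqn v := by unfold sqn; positivity

lemma contDiff_innerWeight : ContDiff ℝ ∞ innerWeight := by unfold innerWeight; fun_prop
lemma contDiff_radial : ContDiff ℝ ∞ radial := by unfold radial; fun_prop
lemma contDiff_rotation : ContDiff ℝ ∞ rotation := by unfold rotation; fun_prop
lemma contDiff_swing : ContDiff ℝ ∞ swing := by unfold swing; fun_prop
lemma contDiff_sqn : ContDiff ℝ ∞ sqn := by unfold sqn; fun_prop

lemma continuous_sqn : Continuous sqn := contDiff_sqn.continuous

lemma contDiff_planarField : ContDiff ℝ ∞ planarField := by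
  have h1 : ContDiff ℝ ∞ fun v : E2 => innerWeight (sqn v) := contDiff_innerWeight.comp contDiff_sqn
  have h2 : ContDiff ℝ ∞ fun v : E2 => radial (sqn v) := contDiff_radial.comp contDiff_sqn
  have h3 : ContDiff ℝ ∞ fun v : E2 => rotation (sqn v) := contDiff_rotation.comp contDiff_sqn
  have h4 : ContDiff ℝ ∞ fun v : E2 => swing (sqn v) := contDiff_swing.comp contDiff_sqn
  rw [contDiff_euclidean]
  intro i
  fin_cases i <;> simp only [planarField, Fin.zero_eta, Fin.mk_one, Matrix.cons_val_zero,
    Matrix.cons_val_one, PiLp.toLp_apply] <;> fun_prop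

lemma continuous_sqnRate : Continuous sqnRate := by
  have h1 : Continuous fun v : E2 => innerWeight (sqn v) :=
    contDiff_innerWeight.continuous.comp continuous_sqn
  have h2 : Continuous fun v : E2 => radial (sqn v) :=
    contDiff_radial.continuous.comp continuous_sqn
  have h3 := continuous_sqn
  unfold sqnRate
  fun_prop

lemma planarField_zero (v : E2) : planarField v 0 =
    innerWeight (sqn v) * (v 0 * (16 * v 0 ^ 2 - 1)) +
      (1 - innerWeight (sqn v)) * (radial (sqn v) * v 0) -
      (rotation (sqn v) + swing (sqn v) * v 1) * v 1 := rfl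

lemma planarField_one (v : E2) : planarField v 1 =
    innerWeight (sqn v) * v 1 + (1 - innerWeight (sqn v)) * (radial (sqn v) * v 1) +
      (rotation (sqn v) + swing (sqn v) * v 1) * v 0 := rfl

lemma ext2 {v w : E2} (h0 : v 0 = w 0) (h1 : v 1 = w 1) : v = w := by
  ext i
  fin_cases i
  · exact h0
  · exact h1

lemma planarField_of_disc {v : E2} (h : sqn v ≤ 1 / 8) :
    planarField v = !₂[v 0 * (16 * v 0 ^ 2 - 1), v 1] := by
  apply ext2
  · simp [planarField_zero, innerWeight_of_le h, rotation_of_le (h.trans (by norm_num)),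
      swing_of_le (h.trans (by norm_num))]
  · simp [planarField_one, innerWeight_of_le h, rotation_of_le (h.trans (by norm_num)),
      swing_of_le (h.trans (by norm_num))]

lemma planarField_of_annulus {v : E2} (h : 1 / 2 ≤ sqn v) (h' : sqn v ≤ 3 / 2) :
    planarField v = !₂[(1 - sqn v) * v 0 - v 1, (1 - sqn v) * v 1 + v 0] := by
  have h1 := innerWeight_of_ge (show 1 / 4 ≤ sqn v by linarith)
  apply ext2
  · simp [planarField_zero, h1, rotation_of_mem h h', radial_of_le h',
      swing_of_le (show sqn v ≤ 2 by linarith)]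
  · simp [planarField_one, h1, rotation_of_mem h h', radial_of_le h',
      swing_of_le (show sqn v ≤ 2 by linarith)]

lemma planarField_of_two_le {v : E2} (h : 2 ≤ sqn v) :
    planarField v = !₂[radial (sqn v) * v 0 - swing (sqn v) * v 1 * v 1,
      radial (sqn v) * v 1 + swing (sqn v) * v 1 * v 0] := by
  have h1 := innerWeight_of_ge (show 1 / 4 ≤ sqn v by linarith)
  apply ext2
  · simp [planarField_zero, h1, rotation_of_ge h]
  · simp [planarField_one, h1, rotation_of_ge h]

lemma planarField_of_six_le {v : E2} (h : 6 ≤ sqn v) : planarField v = v := by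
  rw [planarField_of_two_le (by linarith), radial_of_ge h, swing_of_ge h]
  apply ext2 <;> simp

lemma sqnRate_eq (v : E2) :
    sqnRate v = 2 * (v 0 * planarField v 0 + v 1 * planarField v 1) := by
  rw [planarField_zero, planarField_one, sqnRate, show sqn v = v 0 ^ 2 + v 1 ^ 2 from rfl]
  ring

lemma sqnRate_of_ge {v : E2} (h : 1 / 4 ≤ sqn v) :
    sqnRate v = 2 * (radial (sqn v) * sqn v) := by
  rw [sqnRate, innerWeight_of_ge h]; ring

lemma sqnRate_pos_inner {v : E2} (h : 5 / 64 < sqn v) (h' : sqn v < 1) : 0 < sqnRate v := by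
  have h1 : 0 < v 0 ^ 2 * (16 * v 0 ^ 2 - 1) + v 1 ^ 2 := by
    unfold sqn at h
    nlinarith [sq_nonneg (16 * v 0 ^ 2 - 1)]
  have h2 : 0 < radial (sqn v) * sqn v := mul_pos (radial_pos_of_lt h') (by linarith)
  have h3 : 0 ≤ innerWeight (sqn v) := innerWeight_nonneg
  have h4 : innerWeight (sqn v) ≤ 1 := innerWeight_le_one
  unfold sqnRate
  rcases h3.eq_or_lt with h5 | h5
  · rw [← h5]; linarith
  · have := mul_pos h5 h1
    have := mul_nonneg (sub_nonneg.2 h4) h2.le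
    linarith

lemma sqnRate_neg {v : E2} (h : 1 < sqn v) (h' : sqn v < 4) : sqnRate v < 0 := by
  rw [sqnRate_of_ge (by linarith)]
  have := mul_pos_of_neg_of_neg (radial_neg h h') (show -sqn v < 0 by linarith)
  linarith

lemma sqnRate_pos_outer {v : E2} (h : 4 < sqn v) : 0 < sqnRate v := by
  rw [sqnRate_of_ge (by linarith)]
  have := mul_pos (radial_pos_of_gt h) (show 0 < sqn v by linarith)
  linarith

/-- The three sources of the planar field. -/
def source : Fin 3 → E2 := ![!₂[2, 0], !₂[1 / 4, 0], !₂[-(1 / 4), 0]]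

/-- The two saddles of the planar field. -/
def saddle : Fin 2 → E2 := ![!₂[-2, 0], 0]

/-- The closed orbit of the planar field. -/
def unitCircle : Set E2 := {v | sqn v = 1}

lemma planarField_eq_zero_iff {v : E2} :
    planarField v = 0 ↔ v ∈ range source ∪ range saddle := by
  constructor
  · intro h
    have h0 : planarField v 0 = 0 := by rw [h]; rfl
    have h1 : planarField v 1 = 0 := by rw [h]; rfl
    have hr : sqnRate v = 0 := by rw [sqnRate_eq, h0, h1]; ring
    rcases le_or_gt (sqn v) (5 / 64) with h2 | h2
    · rw [planarField_of_disc (h2.trans (by norm_num))] at h0 h1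
      simp only [Matrix.cons_val_zero, Matrix.cons_val_one] at h0 h1
      have h3 : v 0 * ((4 * v 0 - 1) * (4 * v 0 + 1)) = 0 := by linear_combination h0
      rcases mul_eq_zero.1 h3 with h4 | h4
      · exact Or.inr ⟨1, (ext2 (by simp [saddle, h4]) (by simp [saddle, h1]))⟩
      rcases mul_eq_zero.1 h4 with h4 | h4
      · exact Or.inl ⟨1, (ext2 (by simp [source]; linarith) (by simp [source, h1]))⟩
      · exact Or.inl ⟨2, (ext2 (by simp [source]; linarith) (by simp [source, h1]))⟩
    rcases lt_trichotomy (sqn v) 1 with h3 | h3 | h3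
    · exact absurd hr (sqnRate_pos_inner h2 h3).ne'
    · rw [planarField_of_annulus (by linarith) (by linarith)] at h0 h1
      simp only [Matrix.cons_val_zero, Matrix.cons_val_one, h3] at h0 h1
      have h4 : v 0 = 0 := by linarith
      have h5 : v 1 = 0 := by linarith
      simp [sqn, h4, h5] at h3
    rcases lt_trichotomy (sqn v) 4 with h4 | h4 | h4
    · exact absurd hr (sqnRate_neg h3 h4).ne
    · rw [planarField_of_two_le (by linarith), h4, radial_of_mem (by norm_num) (by norm_num),
        swing_of_mem (by norm_num) (by norm_num)] at h0
      simp only [Matrix.cons_val_zero] at h0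
      have h5 : v 1 = 0 := by nlinarith
      have h6 : (v 0 - 2) * (v 0 + 2) = 0 := by
        simp only [sqn, h5] at h4; linear_combination h4
      rcases mul_eq_zero.1 h6 with h7 | h7
      · exact Or.inl ⟨0, (ext2 (by simp [source]; linarith) (by simp [source, h5]))⟩
      · exact Or.inr ⟨0, (ext2 (by simp [saddle]; linarith) (by simp [saddle, h5]))⟩
    · exact absurd hr (sqnRate_pos_outer h4).ne'
  · rintro (⟨i, rfl⟩ | ⟨i, rfl⟩)
    · fin_cases i
      · have : sqn (source 0) = 4 := by simp [source, sqn]; norm_num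
        simp only [Fin.zero_eta]
        rw [planarField_of_two_le (by linarith), this,
          radial_of_mem (by norm_num) (by norm_num)]
        apply ext2 <;> simp [source]
      · have : sqn (source 1) = 1 / 16 := by simp [source, sqn]; norm_num
        simp only [Fin.mk_one]
        rw [planarField_of_disc (by linarith)]
        apply ext2 <;> simp [source]; norm_num
      · have : sqn (source 2) = 1 / 16 := by simp [source, sqn]; norm_num
        simp only [Fin.reduceFinMk]
        rw [planarField_of_disc (by linarith)]
        apply ext2 <;> simp [source]; norm_num
    · fin_cases i
      · have : sqn (saddle 0) = 4 := by simp [saddle, sqn]; norm_num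
        simp only [Fin.zero_eta]
        rw [planarField_of_two_le (by linarith), this,
          radial_of_mem (by norm_num) (by norm_num)]
        apply ext2 <;> simp [saddle]
      · have : sqn (saddle 1) = 0 := by simp [saddle, sqn]
        simp only [Fin.mk_one]
        rw [planarField_of_disc (by linarith)]
        apply ext2 <;> simp [saddle]

/-! ### The planar flow: radial behaviour -/

local notation "φ" => flowMap (n := 2) planarField

lemma hasDerivAt_coord {n : ℕ} {c : ℝ → EuclideanSpace ℝ (Fin n)} {v : EuclideanSpace ℝ (Fin n)}
    {t : ℝ} (h : HasDerivAt c v t) (i : Fin n) : HasDerivAt (fun t => c t i) (v i) t :=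
  (EuclideanSpace.proj (𝕜 := ℝ) i).hasFDerivAt.comp_hasDerivAt t h

lemma hasDerivAt_euclidean {n : ℕ} {c : ℝ → EuclideanSpace ℝ (Fin n)}
    {v : EuclideanSpace ℝ (Fin n)} {t : ℝ} (h : ∀ i, HasDerivAt (fun t => c t i) (v i) t) :
    HasDerivAt c v t := by
  have h1 : HasDerivAt (fun t i => c t i) (fun i => v i) t := hasDerivAt_pi.2 h
  exact (PiLp.continuousLinearEquiv 2 ℝ
    (fun _ : Fin n => ℝ)).symm.hasFDerivAt.comp_hasDerivAt t h1

lemma sqn_eq_norm_sq (v : E2) : sqn v = ‖v‖ ^ 2 := by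
  rw [EuclideanSpace.real_norm_sq_eq, Fin.sum_univ_two, sqn]

lemma isCompact_sqn_le (b : ℝ) : IsCompact {v : E2 | sqn v ≤ b} := by
  refine Metric.isCompact_of_isClosed_isBounded (isClosed_le continuous_sqn continuous_const) ?_
  refine (Metric.isBounded_closedBall (x := (0 : E2)) (r := |b| + 1)).subset fun v hv => ?_
  rw [mem_closedBall_zero_iff]
  have h1 : ‖v‖ ^ 2 ≤ b := by rw [← sqn_eq_norm_sq]; exact hv
  nlinarith [norm_nonneg v, le_abs_self b, abs_nonneg b]

lemma hasCompactSupport_planarField_sub : HasCompactSupport fun v : E2 => planarField v - v :=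
  HasCompactSupport.intro (isCompact_sqn_le 6) fun v hv => by
    rw [planarField_of_six_le (by simpa using (not_le.1 hv).le), sub_self]

lemma planar_hasFlow : HasFlow (n := 2) planarField := by
  obtain ⟨K, hK⟩ := ((contDiff_planarField.sub contDiff_id).of_le
    (show (1 : ℕ∞ω) ≤ ∞ by norm_cast)).lipschitzWith_of_hasCompactSupport
    hasCompactSupport_planarField_sub one_ne_zero
  have h := hK.add (LipschitzWith.id (α := E2))
  simp only [id, sub_add_cancel] at h
  exact hasFlow_of_lipschitz (contDiff_planarField.of_le (by norm_cast)) h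

lemma contDiff_one_planarField : ContDiff ℝ 1 planarField :=
  contDiff_planarField.of_le (by norm_cast)

lemma continuous_planarFlow : Continuous fun p : ℝ × E2 => φ p.1 p.2 :=
  planar_hasFlow.continuous_uncurry contDiff_one_planarField

lemma hasDerivAt_flow_coord (v : E2) (i : Fin 2) (t : ℝ) :
    HasDerivAt (fun t => φ t v i) (planarField (φ t v) i) t :=
  hasDerivAt_coord (planar_hasFlow.hasDerivAt v t) i

lemma hasDerivAt_sqn_flow (v : E2) (t : ℝ) :
    HasDerivAt (fun t => sqn (φ t v)) (sqnRate (φ t v)) t := by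
  have h := ((hasDerivAt_flow_coord v 0 t).pow 2).add ((hasDerivAt_flow_coord v 1 t).pow 2)
  refine h.congr_deriv ?_
  rw [sqnRate_eq]
  ring

lemma eq_planarFlow {c : ℝ → E2} (hc : ∀ t, HasDerivAt c (planarField (c t)) t) (t : ℝ) :
    c t = φ t (c 0) :=
  congrFun (planar_hasFlow.eq_flowMap (isMIntegralCurve_iff.2 hc)) t

section Radial

variable {v : E2} {a b c s t : ℝ}

lemma inner_le_sqn (hst : s ≤ t) (h : c ≤ sqn (φ s v)) (hc : 5 / 64 < c) (hc' : c ≤ 1) :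
    c ≤ sqn (φ t v) :=
  le_of_le_clamp (monotone_clamp (a := 5 / 64) (b := 1) (hasDerivAt_sqn_flow v)
    (fun _ h1 h2 => (sqnRate_pos_inner h1 h2).le) hst) h hc hc'

lemma sqn_le_inner (hst : s ≤ t) (h : sqn (φ t v) ≤ c) (hc : 5 / 64 ≤ c) (hc' : c < 1) :
    sqn (φ s v) ≤ c :=
  le_of_clamp_le (monotone_clamp (a := 5 / 64) (b := 1) (hasDerivAt_sqn_flow v)
    (fun _ h1 h2 => (sqnRate_pos_inner h1 h2).le) hst) h hc hc'

lemma sqn_le_middle (hst : s ≤ t) (h : sqn (φ s v) ≤ c) (hc : 1 ≤ c) (hc' : c < 4) :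
    sqn (φ t v) ≤ c :=
  le_of_clamp_le (antitone_clamp (a := 1) (b := 4) (hasDerivAt_sqn_flow v)
    (fun _ h1 h2 => (sqnRate_neg h1 h2).le) hst) h hc hc'

lemma middle_le_sqn (hst : s ≤ t) (h : c ≤ sqn (φ t v)) (hc : 1 < c) (hc' : c ≤ 4) :
    c ≤ sqn (φ s v) :=
  le_of_le_clamp (antitone_clamp (a := 1) (b := 4) (hasDerivAt_sqn_flow v)
    (fun _ h1 h2 => (sqnRate_neg h1 h2).le) hst) h hc hc'

lemma outer_le_sqn (hst : s ≤ t) (h : c ≤ sqn (φ s v)) (hc : 4 < c) : c ≤ sqn (φ t v) :=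
  le_of_le_clamp (monotone_clamp (a := 4) (b := c) (hasDerivAt_sqn_flow v)
    (fun _ h1 _ => (sqnRate_pos_outer h1).le) hst) h hc le_rfl

lemma sqn_le_outer (hst : s ≤ t) (h : sqn (φ t v) ≤ c) (hc : 4 ≤ c) : sqn (φ s v) ≤ c :=
  le_of_clamp_le (monotone_clamp (a := 4) (b := c + 1) (hasDerivAt_sqn_flow v)
    (fun _ h1 _ => (sqnRate_pos_outer h1).le) hst) h hc (by linarith)

lemma exists_le_sqnRate (h : ∀ v, a ≤ sqn v → sqn v ≤ b → 0 < sqnRate v) :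
    ∃ δ > 0, ∀ v, a ≤ sqn v → sqn v ≤ b → δ ≤ sqnRate v := by
  have hK : IsCompact ({v : E2 | sqn v ≤ b} ∩ {v | a ≤ sqn v}) :=
    (isCompact_sqn_le b).inter_right (isClosed_le continuous_const continuous_sqn)
  rcases ({v : E2 | sqn v ≤ b} ∩ {v | a ≤ sqn v}).eq_empty_or_nonempty with he | hne
  · refine ⟨1, one_pos, fun v h1 h2 => ?_⟩
    have : v ∈ ({v : E2 | sqn v ≤ b} ∩ {v | a ≤ sqn v}) := ⟨h2, h1⟩
    rw [he] at this
    exact this.elim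
  · obtain ⟨w, ⟨hw1, hw2⟩, hw⟩ := hK.exists_isMinOn hne continuous_sqnRate.continuousOn
    exact ⟨sqnRate w, h w hw2 hw1, fun v h1 h2 => hw ⟨h2, h1⟩⟩

lemma exists_sqnRate_le (h : ∀ v, a ≤ sqn v → sqn v ≤ b → sqnRate v < 0) :
    ∃ δ > 0, ∀ v, a ≤ sqn v → sqn v ≤ b → sqnRate v ≤ -δ := by
  have hK : IsCompact ({v : E2 | sqn v ≤ b} ∩ {v | a ≤ sqn v}) :=
    (isCompact_sqn_le b).inter_right (isClosed_le continuous_const continuous_sqn)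
  rcases ({v : E2 | sqn v ≤ b} ∩ {v | a ≤ sqn v}).eq_empty_or_nonempty with he | hne
  · refine ⟨1, one_pos, fun v h1 h2 => ?_⟩
    have : v ∈ ({v : E2 | sqn v ≤ b} ∩ {v | a ≤ sqn v}) := ⟨h2, h1⟩
    rw [he] at this
    exact this.elim
  · obtain ⟨w, ⟨hw1, hw2⟩, hw⟩ := hK.exists_isMaxOn hne continuous_sqnRate.continuousOn
    refine ⟨-sqnRate w, by linarith [h w hw2 hw1], fun v h1 h2 => ?_⟩
    rw [neg_neg]
    exact hw ⟨h2, h1⟩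

lemma sqnRate_eq_zero_of_one (h : sqn v = 1) : sqnRate v = 0 := by
  rw [sqnRate_of_ge (by linarith), h, radial_of_le (by norm_num)]; ring

lemma sqnRate_eq_zero_of_four (h : sqn v = 4) : sqnRate v = 0 := by
  rw [sqnRate_of_ge (by linarith), h, radial_of_mem (by norm_num) (by norm_num)]; ring

lemma flow_zero (v : E2) : φ 0 v = v := planar_hasFlow.flowMap_zero v

lemma tendsto_sqn_one_of_inner (h : 5 / 64 < sqn v) (h' : sqn v ≤ 1) :
    Tendsto (fun t => sqn (φ t v)) atTop (𝓝 1) := by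
  have hlo : ∀ t, 0 ≤ t → sqn v ≤ sqn (φ t v) := fun t ht =>
    inner_le_sqn ht (by rw [flow_zero]) h h'
  have hhi : ∀ t, 0 ≤ t → sqn (φ t v) ≤ 1 := fun t ht =>
    sqn_le_middle ht (by rw [flow_zero]; exact h') le_rfl (by norm_num)
  refine tendsto_atTop_of_le_deriv (hasDerivAt_sqn_flow v) (t₀ := 0) hhi (fun t ht => ?_)
    fun b' hb' => ?_
  · rcases (hhi t ht).eq_or_lt with h1 | h1
    · rw [sqnRate_eq_zero_of_one h1]
    · exact (sqnRate_pos_inner (h.trans_le (hlo t ht)) h1).le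
  · obtain ⟨δ, hδ, hd⟩ := exists_le_sqnRate (a := sqn v) (b := b')
      fun w h1 h2 => sqnRate_pos_inner (h.trans_le h1) (h2.trans_lt hb')
    exact ⟨δ, hδ, fun t ht h1 => hd _ (hlo t ht) h1⟩

lemma tendsto_sqn_one_of_middle (h : 1 ≤ sqn v) (h' : sqn v < 4) :
    Tendsto (fun t => sqn (φ t v)) atTop (𝓝 1) := by
  have hhi : ∀ t, 0 ≤ t → sqn (φ t v) ≤ sqn v := fun t ht =>
    sqn_le_middle ht (by rw [flow_zero]) h h'
  have hlo : ∀ t, 0 ≤ t → 1 ≤ sqn (φ t v) := fun t ht =>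
    inner_le_sqn ht (by rw [flow_zero]; exact h) (by norm_num) le_rfl
  refine tendsto_atTop_of_deriv_le (hasDerivAt_sqn_flow v) (t₀ := 0) hlo (fun t ht => ?_)
    fun a' ha' => ?_
  · rcases (hlo t ht).eq_or_lt with h1 | h1
    · rw [sqnRate_eq_zero_of_one h1.symm]
    · exact (sqnRate_neg h1 ((hhi t ht).trans_lt h')).le
  · obtain ⟨δ, hδ, hd⟩ := exists_sqnRate_le (a := a') (b := sqn v)
      fun w h1 h2 => sqnRate_neg (lt_of_lt_of_le ha' h1) (h2.trans_lt h')
    exact ⟨δ, hδ, fun t ht h1 => hd _ h1 (hhi t ht)⟩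

lemma tendsto_sqn_four_of_middle (h : 1 < sqn v) (h' : sqn v ≤ 4) :
    Tendsto (fun t => sqn (φ t v)) atBot (𝓝 4) := by
  have hhi : ∀ t, t ≤ 0 → sqn (φ t v) ≤ 4 := fun t ht =>
    sqn_le_outer ht (by rw [flow_zero]; exact h') le_rfl
  have hlo : ∀ t, t ≤ 0 → sqn v ≤ sqn (φ t v) := fun t ht =>
    middle_le_sqn ht (by rw [flow_zero]) h h'
  refine tendsto_atBot_of_deriv_le (hasDerivAt_sqn_flow v) (t₀ := 0) hhi (fun t ht => ?_)
    fun b' hb' => ?_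
  · rcases (hhi t ht).eq_or_lt with h1 | h1
    · rw [sqnRate_eq_zero_of_four h1]
    · exact (sqnRate_neg (h.trans_le (hlo t ht)) h1).le
  · obtain ⟨δ, hδ, hd⟩ := exists_sqnRate_le (a := sqn v) (b := b')
      fun w h1 h2 => sqnRate_neg (h.trans_le h1) (h2.trans_lt hb')
    exact ⟨δ, hδ, fun t ht h1 => hd _ (hlo t ht) h1⟩

lemma tendsto_sqn_four_of_outer (h : 4 ≤ sqn v) :
    Tendsto (fun t => sqn (φ t v)) atBot (𝓝 4) := by
  have hlo : ∀ t, t ≤ 0 → 4 ≤ sqn (φ t v) := fun t ht =>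
    middle_le_sqn ht (by rw [flow_zero]; exact h) (by norm_num) le_rfl
  have hhi : ∀ t, t ≤ 0 → sqn (φ t v) ≤ sqn v := fun t ht =>
    sqn_le_outer ht (by rw [flow_zero]) h
  refine tendsto_atBot_of_le_deriv (hasDerivAt_sqn_flow v) (t₀ := 0) hlo (fun t ht => ?_)
    fun a' ha' => ?_
  · rcases (hlo t ht).eq_or_lt with h1 | h1
    · rw [sqnRate_eq_zero_of_four h1.symm]
    · exact (sqnRate_pos_outer h1).le
  · obtain ⟨δ, hδ, hd⟩ := exists_le_sqnRate (a := a') (b := sqn v)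
      fun w h1 h2 => sqnRate_pos_outer (lt_of_lt_of_le ha' h1)
    exact ⟨δ, hδ, fun t ht h1 => hd _ h1 (hhi t ht)⟩

lemma tendsto_sqn_four (h : 1 < sqn v) : Tendsto (fun t => sqn (φ t v)) atBot (𝓝 4) :=
  (le_total (sqn v) 4).elim (tendsto_sqn_four_of_middle h) tendsto_sqn_four_of_outer

lemma exists_lower_bound_outer (h : 4 < a) : ∃ δ > 0, ∀ v, a ≤ sqn v → δ ≤ sqnRate v := by
  obtain ⟨δ, hδ, hd⟩ := exists_le_sqnRate (a := a) (b := 6)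
    fun w h1 _ => sqnRate_pos_outer (lt_of_lt_of_le h h1)
  refine ⟨min δ 12, lt_min hδ (by norm_num), fun v hv => ?_⟩
  rcases le_total (sqn v) 6 with h1 | h1
  · exact (min_le_left _ _).trans (hd v hv h1)
  · refine (min_le_right _ _).trans ?_
    rw [sqnRate_of_ge (by linarith), radial_of_ge h1]
    linarith

lemma tendsto_sqn_atTop (h : 4 < sqn v) : Tendsto (fun t => sqn (φ t v)) atTop atTop := by
  obtain ⟨δ, hδ, hd⟩ := exists_lower_bound_outer h
  have h1 : ∀ t, 0 ≤ t → sqn v + δ * t ≤ sqn (φ t v) := fun t ht => by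
    have := add_mul_le_of_le_deriv (hasDerivAt_sqn_flow v) ht fun r hr =>
      hd _ (outer_le_sqn hr.1.le (by rw [flow_zero]) h)
    rwa [flow_zero, sub_zero] at this
  refine tendsto_atTop_mono' _ ((eventually_ge_atTop 0).mono h1) ?_
  exact tendsto_atTop_add_const_left _ _ (tendsto_id.const_mul_atTop hδ)

lemma exists_sqn_le_of_inner (h : sqn v < 1) : ∃ t ≤ 0, sqn (φ t v) ≤ 1 / 8 := by
  by_contra! hn
  have h0 : 1 / 8 < sqn v := by simpa [flow_zero] using hn 0 le_rfl
  obtain ⟨δ, hδ, hd⟩ := exists_le_sqnRate (a := 1 / 8) (b := sqn v)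
    fun w h1 h2 => sqnRate_pos_inner (by linarith) (by linarith)
  have h1 : ∀ t, t ≤ 0 → sqn (φ t v) ≤ sqn v := fun t ht =>
    sqn_le_inner ht (by rw [flow_zero]) (by linarith) h
  have ht : -(sqn v / δ) ≤ 0 := by
    rw [neg_nonpos]; exact div_nonneg (sqn_nonneg v) hδ.le
  have h2 := add_mul_le_of_le_deriv (hasDerivAt_sqn_flow v) ht fun r hr =>
    hd _ (hn r hr.2.le).le (h1 r hr.2.le)
  rw [flow_zero] at h2
  have h3 : δ * (0 - -(sqn v / δ)) = sqn v := by field_simp; ring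
  linarith [hn _ ht]

lemma exists_two_le_sqn (h : 1 < sqn v) : ∃ t ≤ 0, 2 ≤ sqn (φ t v) := by
  have h1 := (tendsto_sqn_four h).eventually (lt_mem_nhds (show (2 : ℝ) < 4 by norm_num))
  obtain ⟨t, ht, ht'⟩ := (h1.and (eventually_le_atBot 0)).exists
  exact ⟨t, ht', ht.le⟩

end Radial

/-! ### The planar flow: limits of orbits -/

lemma tendsto_ext2 {ι : Type*} {l : Filter ι} {c : ι → E2} {w : E2}
    (h0 : Tendsto (fun t => c t 0) l (𝓝 (w 0))) (h1 : Tendsto (fun t => c t 1) l (𝓝 (w 1))) :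
    Tendsto c l (𝓝 w) := by
  have h : Tendsto (fun t i => c t i) l (𝓝 fun i => w i) := by
    rw [tendsto_pi_nhds]
    intro i
    fin_cases i
    · exact h0
    · exact h1
  exact ((PiLp.continuous_toLp 2 (fun _ : Fin 2 => ℝ)).tendsto _).comp h

lemma tendsto_zero_of_sq {ι : Type*} {l : Filter ι} {c : ι → ℝ}
    (h : Tendsto (fun t => c t ^ 2) l (𝓝 0)) : Tendsto c l (𝓝 0) := by
  have h1 := (Real.continuous_sqrt.tendsto 0).comp h
  rw [Real.sqrt_zero] at h1
  refine (tendsto_zero_iff_abs_tendsto_zero _).2 (h1.congr fun t => ?_)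
  simp [Real.sqrt_sq_eq_abs]

lemma pos_of_ne_zero {u : ℝ → ℝ} (hu : Continuous u) {s t : ℝ} (hst : s ≤ t)
    (h : ∀ r ∈ Icc s t, u r ≠ 0) (ht : 0 < u t) : 0 < u s := by
  by_contra! hn
  obtain ⟨r, hr, h0⟩ := intermediate_value_Icc hst hu.continuousOn ⟨hn, ht.le⟩
  exact h r hr h0

lemma continuous_flow_coord (v : E2) (i : Fin 2) : Continuous fun t => φ t v i :=
  continuous_iff_continuousAt.2 fun t => (hasDerivAt_flow_coord v i t).continuousAt

lemma continuous_sqn_flow (v : E2) : Continuous fun t => sqn (φ t v) :=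
  continuous_sqn.comp (planar_hasFlow.continuous_flowMap v)

lemma flow_add (s t : ℝ) (v : E2) : φ (s + t) v = φ s (φ t v) := planar_hasFlow.flowMap_add s t v

/-- The cosine of the polar angle. -/
def cosAngle (v : E2) : ℝ := v 0 / √(sqn v)

section Outer

variable {v : E2}

lemma two_le_sqn_flow (h : 2 ≤ sqn v) {t : ℝ} (ht : t ≤ 0) : 2 ≤ sqn (φ t v) :=
  middle_le_sqn ht (by rwa [flow_zero]) (by norm_num) (by norm_num)

lemma hasDerivAt_cosAngle {t : ℝ} (h : 2 ≤ sqn (φ t v)) :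
    HasDerivAt (fun t => cosAngle (φ t v))
      (-(swing (sqn (φ t v)) * φ t v 1 ^ 2 / √(sqn (φ t v)))) t := by
  have hq : 0 < sqn (φ t v) := by linarith
  have hs : √(sqn (φ t v)) ≠ 0 := (Real.sqrt_pos.2 hq).ne'
  have h1 := (hasDerivAt_flow_coord v 0 t).div ((hasDerivAt_sqn_flow v t).sqrt hq.ne') hs
  refine h1.congr_deriv ?_
  rw [sqnRate_of_ge (by linarith), planarField_of_two_le h]
  simp only [Matrix.cons_val_zero]
  set q := sqn (φ t v)
  have h2 : √q ^ 2 = q := Real.sq_sqrt hq.le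
  field_simp
  rw [h2]
  ring

lemma cosAngle_sq (h : 0 < sqn v) : cosAngle v ^ 2 = v 0 ^ 2 / sqn v := by
  rw [cosAngle, div_pow, Real.sq_sqrt h.le]

lemma cosAngle_le_one (h : 0 < sqn v) : cosAngle v ≤ 1 := by
  have : cosAngle v ^ 2 ≤ 1 := by
    rw [cosAngle_sq h, div_le_one h, sqn]
    nlinarith [sq_nonneg (v 1)]
  nlinarith

lemma neg_one_lt_cosAngle (h : 0 < sqn v) (h' : ¬ (v 1 = 0 ∧ v 0 < 0)) : -1 < cosAngle v := by
  by_cases h1 : v 1 = 0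
  · have h2 : 0 ≤ v 0 := by
      by_contra! hn
      exact h' ⟨h1, hn⟩
    have : 0 ≤ cosAngle v := div_nonneg h2 (Real.sqrt_nonneg _)
    linarith
  · have : cosAngle v ^ 2 < 1 := by
      rw [cosAngle_sq h, div_lt_one h, sqn]
      have := sq_pos_of_ne_zero h1
      linarith
    nlinarith

lemma sq_one_eq (h : 0 < sqn v) : v 1 ^ 2 = sqn v * (1 - cosAngle v ^ 2) := by
  rw [cosAngle_sq h, mul_sub, mul_div_cancel₀ _ h.ne', sqn]; ring

lemma cosAngle_antitone {s t : ℝ} (hst : s ≤ t)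
    (ht : ∀ r ≤ t, 2 ≤ sqn (φ r v)) : cosAngle (φ t v) ≤ cosAngle (φ s v) := by
  have h1 : AntitoneOn (fun t => cosAngle (φ t v)) (Iic t) := by
    have hi : ∀ r ∈ interior (Iic t), r ≤ t := fun r hr => by
      rw [interior_Iic] at hr
      exact hr.le
    refine antitoneOn_of_deriv_nonpos (convex_Iic t)
      (fun r hr => (hasDerivAt_cosAngle (ht r hr)).continuousAt.continuousWithinAt)
      (fun r hr => (hasDerivAt_cosAngle
        (ht r (hi r hr))).differentiableAt.differentiableWithinAt) fun r hr => ?_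
    rw [(hasDerivAt_cosAngle (ht r (hi r hr))).deriv, neg_nonpos]
    have : 0 ≤ swing (sqn (φ r v)) := swing_nonneg
    positivity
  exact h1 (mem_Iic.2 hst) (mem_Iic.2 le_rfl) hst

lemma tendsto_cosAngle (h : 2 ≤ sqn v) (h' : ¬ (v 1 = 0 ∧ v 0 < 0)) :
    Tendsto (fun t => cosAngle (φ t v)) atBot (𝓝 1) := by
  have hpos : ∀ t, 0 < sqn (φ t v) := by
    intro t
    rcases le_total t 0 with ht | ht
    · linarith [two_le_sqn_flow h ht]
    · have := inner_le_sqn (v := v) (c := 1 / 8) ht (by rw [flow_zero]; linarith) (by norm_num)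
        (by norm_num)
      linarith
  have hdiff : ∀ t, HasDerivAt (fun t => cosAngle (φ t v))
      (deriv (fun t => cosAngle (φ t v)) t) t := fun t =>
    ((hasDerivAt_flow_coord v 0 t).differentiableAt.div
      ((hasDerivAt_sqn_flow v t).sqrt (hpos t).ne').differentiableAt
      (Real.sqrt_pos.2 (hpos t)).ne').hasDerivAt
  have hd : ∀ t ≤ 0, deriv (fun t => cosAngle (φ t v)) t =
      -(swing (sqn (φ t v)) * φ t v 1 ^ 2 / √(sqn (φ t v))) := fun t ht =>
    (hasDerivAt_cosAngle (two_le_sqn_flow h ht)).deriv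
  have hlim := tendsto_sqn_four (show 1 < sqn v by linarith)
  obtain ⟨t₀, ht₀⟩ := eventually_atBot.1 ((hlim.eventually (lt_mem_nhds
    (show (3 : ℝ) < 4 by norm_num))).and ((hlim.eventually (gt_mem_nhds
    (show (4 : ℝ) < 5 by norm_num))).and (eventually_le_atBot 0)))
  have h00 : t₀ ≤ 0 := (ht₀ t₀ le_rfl).2.2
  have hm : ∀ t ≤ 0, cosAngle v ≤ cosAngle (φ t v) := fun t ht => by
    have := cosAngle_antitone ht fun r hr => two_le_sqn_flow h hr
    rwa [flow_zero] at this
  have hv := neg_one_lt_cosAngle (show 0 < sqn v by linarith) h'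
  refine tendsto_atBot_of_deriv_le hdiff (t₀ := t₀) (fun t _ => cosAngle_le_one (hpos t))
    (fun t ht => ?_) fun b' hb' => ?_
  · rw [hd t (ht.trans h00), neg_nonpos]
    have : 0 ≤ swing (sqn (φ t v)) := swing_nonneg
    positivity
  · refine ⟨(1 - b') * (1 + cosAngle v), mul_pos (by linarith) (by linarith), fun t ht hb => ?_⟩
    have h3 := ht₀ t ht
    rw [hd t h3.2.2, swing_of_mem h3.1.le h3.2.1.le, sq_one_eq (hpos t), one_mul, neg_le_neg_iff]
    set u := cosAngle (φ t v) with hu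
    have h4 : 1 ≤ √(sqn (φ t v)) := Real.one_le_sqrt.2 (by linarith)
    have h5 : sqn (φ t v) * (1 - u ^ 2) / √(sqn (φ t v)) = √(sqn (φ t v)) * (1 - u ^ 2) := by
      rw [mul_div_right_comm, Real.div_sqrt]
    rw [h5]
    have h6 := hm t h3.2.2
    have h7 : (1 - b') * (1 + cosAngle v) ≤ (1 - u) * (1 + u) :=
      mul_le_mul (by linarith) (by linarith) (by linarith) (by linarith)
    have h8 : 0 ≤ (1 - u) * (1 + u) := mul_nonneg (by linarith) (by linarith)
    nlinarith

lemma tendsto_source_zero (h : 2 ≤ sqn v) (h' : ¬ (v 1 = 0 ∧ v 0 < 0)) :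
    Tendsto (fun t => φ t v) atBot (𝓝 (source 0)) := by
  have h1 := tendsto_sqn_four (show 1 < sqn v by linarith)
  have h2 := tendsto_cosAngle h h'
  have h3 : Tendsto (fun t => φ t v 0) atBot (𝓝 2) := by
    have := h2.mul ((Real.continuous_sqrt.tendsto 4).comp h1)
    rw [one_mul, show √(4 : ℝ) = 2 by rw [show (4 : ℝ) = 2 ^ 2 by norm_num]; simp] at this
    refine this.congr' ?_
    filter_upwards [eventually_le_atBot 0] with t ht
    have := two_le_sqn_flow h ht
    have : √(sqn (φ t v)) ≠ 0 := (Real.sqrt_pos.2 (by linarith)).ne'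
    simp [cosAngle, this]
  refine tendsto_ext2 (by simpa [source] using h3) (tendsto_zero_of_sq ?_)
  have h4 := h1.sub (h3.pow 2)
  norm_num at h4
  simpa [source, sqn] using h4

lemma flow_one_eq_zero (h : 2 ≤ sqn v) (h1 : v 1 = 0) {t : ℝ} (ht : t ≤ 0) : φ t v 1 = 0 := by
  have hc : Continuous fun r => radial (sqn (φ r v)) + swing (sqn (φ r v)) * φ r v 0 :=
    (contDiff_radial.continuous.comp (continuous_sqn_flow v)).add
      ((contDiff_swing.continuous.comp (continuous_sqn_flow v)).mul (continuous_flow_coord v 0))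
  obtain ⟨K, hK⟩ := isCompact_Icc.exists_bound_of_continuousOn (s := Icc t 0) hc.continuousOn
  refine eq_zero_of_abs_deriv_le' (hasDerivAt_flow_coord v 1) (K := K) ht (fun r hr => ?_)
    (by rw [flow_zero, h1])
  rw [planarField_of_two_le (two_le_sqn_flow h hr.2)]
  have h2 := hK r hr
  rw [Real.norm_eq_abs] at h2
  have h3 : (!₂[radial (sqn (φ r v)) * φ r v 0 - swing (sqn (φ r v)) * φ r v 1 * φ r v 1,
      radial (sqn (φ r v)) * φ r v 1 + swing (sqn (φ r v)) * φ r v 1 * φ r v 0] : E2) 1 =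
      (radial (sqn (φ r v)) + swing (sqn (φ r v)) * φ r v 0) * φ r v 1 := by
    change _ + _ = _; ring
  rw [h3, abs_mul]
  gcongr

lemma tendsto_saddle_zero (h : 2 ≤ sqn v) (h1 : v 1 = 0) (h0 : v 0 < 0) :
    Tendsto (fun t => φ t v) atBot (𝓝 (saddle 0)) := by
  have hy : ∀ t ≤ 0, φ t v 1 = 0 := fun t ht => flow_one_eq_zero h h1 ht
  have hx : ∀ t ≤ 0, φ t v 0 = -√(sqn (φ t v)) := by
    intro t ht
    have h2 : 0 < -(φ t v 0) := by
      refine pos_of_ne_zero (u := fun t => -(φ t v 0)) (continuous_flow_coord v 0).neg ht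
        (fun r hr h3 => ?_) (by rw [flow_zero]; linarith)
      have h4 := two_le_sqn_flow h hr.2
      simp only [neg_eq_zero] at h3
      rw [sqn, h3, hy r hr.2] at h4
      norm_num at h4
    rw [sqn, hy t ht, zero_pow two_ne_zero, add_zero, Real.sqrt_sq_eq_abs, abs_of_neg (by linarith),
      neg_neg]
  have h2 := (Real.continuous_sqrt.tendsto 4).comp (tendsto_sqn_four (show 1 < sqn v by linarith))
  rw [show √(4 : ℝ) = 2 by rw [show (4 : ℝ) = 2 ^ 2 by norm_num]; simp] at h2
  refine tendsto_ext2 ?_ ?_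
  · have h3 : Tendsto (fun t => φ t v 0) atBot (𝓝 (-2)) := h2.neg.congr' (by
      filter_upwards [eventually_le_atBot 0] with t ht
      exact (hx t ht).symm)
    simpa [saddle] using h3
  · have h3 : Tendsto (fun t => φ t v 1) atBot (𝓝 0) := tendsto_const_nhds.congr' (by
      filter_upwards [eventually_le_atBot 0] with t ht
      exact (hy t ht).symm)
    simpa [saddle] using h3

end Outer

section Disc

variable {v : E2}

lemma sqn_flow_le_of_disc (h : sqn v ≤ 1 / 8) {t : ℝ} (ht : t ≤ 0) : sqn (φ t v) ≤ 1 / 8 :=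
  sqn_le_inner ht (by rwa [flow_zero]) (by norm_num) (by norm_num)

lemma flow_one_of_disc {a b : ℝ} (h : ∀ r ∈ Icc a b, sqn (φ r v) ≤ 1 / 8) {s t : ℝ}
    (hs : s ∈ Icc a b) (ht : t ∈ Icc a b) : φ t v 1 = φ s v 1 * Real.exp (t - s) := by
  have := eq_mul_exp_of_deriv (u := fun t => φ t v 1) (k := 1) (convex_Icc a b) (fun r hr => by
    have h1 := hasDerivAt_flow_coord v 1 r
    rw [planarField_of_disc (h r hr)] at h1
    simpa using h1) hs ht
  simpa using this

lemma flow_one_of_disc_atBot (h : sqn v ≤ 1 / 8) {t : ℝ} (ht : t ≤ 0) :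
    φ t v 1 = v 1 * Real.exp t := by
  have := flow_one_of_disc (v := v) (a := t) (b := 0)
    (fun r hr => sqn_flow_le_of_disc h hr.2) (right_mem_Icc.2 ht) (left_mem_Icc.2 ht)
  simpa [flow_zero] using this

lemma tendsto_flow_one_of_disc (h : sqn v ≤ 1 / 8) :
    Tendsto (fun t => φ t v 1) atBot (𝓝 0) := by
  have h1 := Real.tendsto_exp_atBot.const_mul (v 1)
  rw [mul_zero] at h1
  refine h1.congr' ?_
  filter_upwards [eventually_le_atBot 0] with t ht
  exact (flow_one_of_disc_atBot h ht).symm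

/-- Backward solutions of `ξ' = ξ (16 ξ ^ 2 - 1)` starting at a positive value tend to `1 / 4`:
the quantity `1 / ξ ^ 2 - 16` satisfies the linear equation `w' = 2 w`. -/
lemma tendsto_quarter {ξ ξ' : ℝ → ℝ} (hξ : ∀ t, HasDerivAt ξ (ξ' t) t)
    (hd : ∀ t ≤ 0, ξ' t = ξ t * (16 * ξ t ^ 2 - 1)) (hb : ∀ t ≤ 0, ξ t ^ 2 ≤ 1 / 8)
    (h0 : 0 < ξ 0) : Tendsto ξ atBot (𝓝 (1 / 4)) := by
  have hne : ∀ t ≤ 0, ξ t ≠ 0 := by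
    intro t ht h1
    refine h0.ne' (eq_zero_of_abs_deriv_le hξ (K := 1) ht (fun r hr => ?_) h1)
    rw [hd r hr.2, abs_mul, mul_comm]
    refine mul_le_mul_of_nonneg_right (abs_le.2 ⟨?_, ?_⟩) (abs_nonneg _)
    · nlinarith [sq_nonneg (ξ r)]
    · nlinarith [hb r hr.2]
  have hpos : ∀ t ≤ 0, 0 < ξ t := fun t ht =>
    pos_of_ne_zero (continuous_iff_continuousAt.2 fun r => (hξ r).continuousAt) ht
      (fun r hr => hne r hr.2) h0
  have hw : ∀ t ≤ 0, HasDerivAt (fun t => (ξ t ^ 2)⁻¹ - 16) (2 * ((ξ t ^ 2)⁻¹ - 16)) t := by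
    intro t ht
    have h1 := (((hξ t).pow 2).inv (pow_ne_zero 2 (hne t ht))).sub_const 16
    refine h1.congr_deriv ?_
    have := hne t ht
    simp only [hd t ht, Nat.cast_ofNat]
    field_simp
    simp
    ring
  have hsol : ∀ t ≤ 0, (ξ t ^ 2)⁻¹ - 16 = ((ξ 0 ^ 2)⁻¹ - 16) * Real.exp (2 * t) := by
    intro t ht
    have := eq_mul_exp_of_deriv (u := fun t => (ξ t ^ 2)⁻¹ - 16) (convex_Iic (0 : ℝ)) hw
      (mem_Iic.2 le_rfl) (mem_Iic.2 ht)
    simpa using this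
  have h1 : Tendsto (fun t => √(((ξ 0 ^ 2)⁻¹ - 16) * Real.exp (2 * t) + 16)⁻¹) atBot
      (𝓝 (√(((ξ 0 ^ 2)⁻¹ - 16) * 0 + 16)⁻¹)) := by
    have h2 : Tendsto (fun t : ℝ => Real.exp (2 * t)) atBot (𝓝 0) :=
      Real.tendsto_exp_atBot.comp (tendsto_id.const_mul_atBot (by norm_num))
    refine (Real.continuous_sqrt.tendsto _).comp ?_
    exact ((h2.const_mul _).add_const _).inv₀ (by norm_num)
  have h3 : √(((ξ 0 ^ 2)⁻¹ - 16) * 0 + 16)⁻¹ = 1 / 4 := by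
    rw [show (((ξ 0 ^ 2)⁻¹ - 16) * 0 + 16)⁻¹ = (1 / 4 : ℝ) ^ 2 by norm_num]
    exact Real.sqrt_sq (by norm_num)
  rw [h3] at h1
  refine h1.congr' ?_
  filter_upwards [eventually_le_atBot 0] with t ht
  rw [← hsol t ht, sub_add_cancel, inv_inv, Real.sqrt_sq (hpos t ht).le]

lemma tendsto_source_of_disc (h : sqn v ≤ 1 / 8) {σ : ℝ} (hσ : σ ^ 2 = 1) (h0 : 0 < σ * v 0) :
    Tendsto (fun t => φ t v) atBot (𝓝 !₂[σ * (1 / 4), 0]) := by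
  have h1 : Tendsto (fun t => σ * φ t v 0) atBot (𝓝 (1 / 4)) := by
    refine tendsto_quarter (fun t => (hasDerivAt_flow_coord v 0 t).const_mul σ) (fun t ht => ?_)
      (fun t ht => ?_) (by rwa [flow_zero])
    · rw [planarField_of_disc (sqn_flow_le_of_disc h ht), mul_pow, hσ]
      simp only [Matrix.cons_val_zero]
      ring
    · rw [mul_pow, hσ, one_mul]
      have := sqn_flow_le_of_disc h ht
      unfold sqn at this
      nlinarith [sq_nonneg (φ t v 1)]
  refine tendsto_ext2 ?_ (by simpa using tendsto_flow_one_of_disc h)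
  have h2 := h1.const_mul σ
  simp only [Matrix.cons_val_zero]
  refine h2.congr fun t => ?_
  rw [← mul_assoc, ← sq, hσ, one_mul]

lemma tendsto_source_one (h : sqn v ≤ 1 / 8) (h0 : 0 < v 0) :
    Tendsto (fun t => φ t v) atBot (𝓝 (source 1)) := by
  have := tendsto_source_of_disc h (σ := 1) (by norm_num) (by simpa using h0)
  simpa [source] using this

lemma tendsto_source_two (h : sqn v ≤ 1 / 8) (h0 : v 0 < 0) :
    Tendsto (fun t => φ t v) atBot (𝓝 (source 2)) := by
  have := tendsto_source_of_disc h (σ := -1) (by norm_num) (by simpa using h0)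
  simpa [source] using this

lemma tendsto_saddle_one (h : sqn v ≤ 1 / 8) (h0 : v 0 = 0) :
    Tendsto (fun t => φ t v) atBot (𝓝 (saddle 1)) := by
  refine tendsto_ext2 ?_ (by simpa [saddle] using tendsto_flow_one_of_disc h)
  have h1 : Tendsto (fun t => φ t v 0) atBot (𝓝 0) := tendsto_const_nhds.congr' (by
    filter_upwards [eventually_le_atBot 0] with t ht
    refine (eq_zero_of_abs_deriv_le' (hasDerivAt_flow_coord v 0) (K := 1) ht (fun r hr => ?_)
      (by rw [flow_zero, h0])).symm
    have h2 := sqn_flow_le_of_disc h hr.2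
    rw [planarField_of_disc h2]
    simp only [Matrix.cons_val_zero]
    rw [abs_mul, mul_comm]
    unfold sqn at h2
    refine mul_le_mul_of_nonneg_right (abs_le.2 ⟨?_, ?_⟩) (abs_nonneg _)
    · nlinarith [sq_nonneg (φ r v 0)]
    · nlinarith [sq_nonneg (φ r v 1)])
  simpa [saddle] using h1

/-- Every orbit in the unit disc off the segment joining the two inner sources leaves the region
where `sqn` may decrease. -/
lemma exists_lt_sqn (h : sqn v < 1) (h' : ¬ (v 1 = 0 ∧ |v 0| ≤ 1 / 4)) :
    ∃ t, 0 ≤ t ∧ 5 / 64 < sqn (φ t v) := by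
  by_contra! hn
  have hdisc : ∀ T, ∀ r ∈ Icc 0 T, sqn (φ r v) ≤ 1 / 8 := fun T r hr =>
    (hn r hr.1).trans (by norm_num)
  have hy : ∀ t, 0 ≤ t → φ t v 1 = v 1 * Real.exp t := fun t ht => by
    have := flow_one_of_disc (hdisc t) (left_mem_Icc.2 ht) (right_mem_Icc.2 ht)
    simpa [flow_zero] using this
  by_cases h1 : v 1 = 0
  · have h2 : 1 / 4 < |v 0| := by
      by_contra! h2
      exact h' ⟨h1, h2⟩
    have h3 : 1 / 16 < sqn v := by
      have : (1 / 4) ^ 2 < |v 0| ^ 2 := by gcongr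
      rw [sq_abs] at this
      rw [sqn, h1]
      linarith
    have hrate : ∀ r, 0 ≤ r → sqnRate (φ r v) = 2 * (sqn (φ r v) * (16 * sqn (φ r v) - 1)) := by
      intro r hr
      have h4 := hn r hr
      rw [sqnRate, innerWeight_of_le (by linarith), sqn, hy r hr, h1]
      ring
    have hlo : ∀ t, 0 ≤ t → sqn v ≤ sqn (φ t v) := fun t ht => by
      refine le_of_le_clamp (a := 1 / 16) (b := 1) (clamp_le_clamp (a := 1 / 16) (b := 1)
        (hasDerivAt_sqn_flow v) ht fun r hr h5 _ => ?_) (by rw [flow_zero]) h3 h.le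
      rw [hrate r hr.1.le]
      have : 0 ≤ 16 * sqn (φ r v) - 1 := by linarith
      have := sqn_nonneg (φ r v)
      positivity
    set δ := 2 * (sqn v * (16 * sqn v - 1)) with hδ
    have hδ0 : 0 < δ := by
      have : 0 < 16 * sqn v - 1 := by linarith
      have : 0 < sqn v := by linarith
      positivity
    have h6 := add_mul_le_of_le_deriv (hasDerivAt_sqn_flow v) (δ := δ) (s := 0) (t := 1 / δ)
      (by positivity) fun r hr => by
        rw [hrate r hr.1.le]
        have := hlo r hr.1.le
        have : 0 < 16 * sqn v - 1 := by linarith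
        have : 0 < sqn v := by linarith
        rw [hδ]
        nlinarith
    have h7 := hn (1 / δ) (by positivity)
    rw [sub_zero, mul_one_div_cancel hδ0.ne'] at h6
    have := sqn_nonneg (φ 0 v)
    linarith
  · have h2 : Tendsto (fun t => |v 1| * Real.exp t) atTop atTop :=
      Real.tendsto_exp_atTop.const_mul_atTop (abs_pos.2 h1)
    obtain ⟨t, ht, ht0⟩ := ((h2.eventually_ge_atTop 1).and (eventually_ge_atTop 0)).exists
    have h3 := hn t ht0
    rw [sqn, hy t ht0] at h3
    have h4 : (v 1 * Real.exp t) ^ 2 = (|v 1| * Real.exp t) ^ 2 := by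
      rw [mul_pow, mul_pow, sq_abs]
    rw [h4] at h3
    nlinarith [sq_nonneg (φ t v 0)]

end Disc

/-! ### Limit sets determine the critical element -/

section Limits

variable {n : ℕ} {M : Type*} [TopologicalSpace M] [ChartedSpace (EuclideanSpace ℝ (Fin n)) M]
  {X : (x : M) → TangentSpace (𝓡 n) x}

lemma IsCritical.isCompact {β : Set M} (hβ : IsCritical X β) : IsCompact β := by
  obtain ⟨p, -, rfl⟩ | ⟨c, hc, ⟨T, hT, hper⟩, -, rfl⟩ := hβ
  · exact isCompact_singleton
  · exact hper.compact_of_continuous hT.ne' hc.continuous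

namespace HasFlow

lemma eq_or_disjoint (h : HasFlow X) {β β' : Set M} (hβ : IsCritical X β)
    (hβ' : IsCritical X β') : β = β' ∨ Disjoint β β' := by
  rw [or_iff_not_imp_right, not_disjoint_iff]
  rintro ⟨x, hx, hx'⟩
  rcases hβ with ⟨p, hp, rfl⟩ | hγ <;> rcases hβ' with ⟨p', hp', rfl⟩ | hγ'
  · rw [mem_singleton_iff.1 hx] at hx'
    rw [mem_singleton_iff.1 hx']
  · exact absurd (mem_singleton_iff.1 hx ▸ hp) (h.ne_zero_of_mem_isClosedOrbit hγ' hx')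
  · exact absurd (mem_singleton_iff.1 hx' ▸ hp') (h.ne_zero_of_mem_isClosedOrbit hγ hx)
  · exact h.isClosedOrbit_eq hγ hγ' hx hx'

lemma eq_of_tendsto_nhdsSet [T2Space M] (h : HasFlow X) {β β' : Set M} (hβ : IsCritical X β)
    (hβ' : IsCritical X β') {ι : Type*} {l : Filter ι} [l.NeBot] {c : ι → M}
    (hc : Tendsto c l (𝓝ˢ β)) (hc' : Tendsto c l (𝓝ˢ β')) : β = β' := by
  refine (h.eq_or_disjoint hβ hβ').resolve_right fun hd => ?_
  have h1 : Disjoint (𝓝ˢ β) (𝓝ˢ β') :=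
    (SeparatedNhds.of_isCompact_isCompact hβ.isCompact hβ'.isCompact hd).disjoint_nhdsSet
  exact hc.not_tendsto h1 hc'

lemma eq_of_mem_stableSet [T2Space M] (h : HasFlow X) {β β' : Set M} (hβ : IsCritical X β)
    (hβ' : IsCritical X β') {x : M} (hx : x ∈ stableSet X β) (hx' : x ∈ stableSet X β') :
    β = β' :=
  h.eq_of_tendsto_nhdsSet hβ hβ' (h.mem_stableSet.1 hx) (h.mem_stableSet.1 hx')

lemma eq_of_mem_unstableSet [T2Space M] (h : HasFlow X) {β β' : Set M} (hβ : IsCritical X β)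
    (hβ' : IsCritical X β') {x : M} (hx : x ∈ unstableSet X β) (hx' : x ∈ unstableSet X β') :
    β = β' :=
  h.eq_of_tendsto_nhdsSet hβ hβ' (h.mem_unstableSet.1 hx) (h.mem_unstableSet.1 hx')

lemma mem_of_isClosedOrbit (h : HasFlow X) {γ : Set M} (hγ : IsClosedOrbit X γ) {x : M}
    (hx : x ∈ γ) (t : ℝ) : flowMap X t x ∈ γ := by
  obtain ⟨c, hc, -, -, rfl⟩ := hγ
  obtain ⟨s, rfl⟩ := hx
  have := congrFun (h.eq_flowMap (hc.comp_add s)) t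
  simp only [Function.comp_apply, zero_add] at this
  exact ⟨t + s, this⟩

lemma subset_stableSet (h : HasFlow X) {β : Set M} (hβ : IsCritical X β) :
    β ⊆ stableSet X β := by
  rcases hβ with ⟨p, hp, rfl⟩ | hγ
  · rw [singleton_subset_iff]
    exact h.stableSet_singleton_of_zero hp
  · intro x hx
    rw [h.mem_stableSet]
    exact (tendsto_principal.2 (Eventually.of_forall fun t => h.mem_of_isClosedOrbit hγ hx t)).mono_right
      principal_le_nhdsSet

lemma subset_unstableSet (h : HasFlow X) {β : Set M} (hβ : IsCritical X β) :
    β ⊆ unstableSet X β := by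
  rcases hβ with ⟨p, hp, rfl⟩ | hγ
  · rw [singleton_subset_iff]
    exact h.unstableSet_singleton_of_zero hp
  · intro x hx
    rw [h.mem_unstableSet]
    exact (tendsto_principal.2 (Eventually.of_forall fun t => h.mem_of_isClosedOrbit hγ hx t)).mono_right
      principal_le_nhdsSet

end HasFlow

end Limits

/-! ### The planar flow: explicit orbits -/

lemma exists_stereographic_four {v : E2} (h : sqn v = 4) (hv : v ≠ saddle 0) :
    ∃ m : ℝ, v 0 = 2 * (1 - m ^ 2) / (1 + m ^ 2) ∧ v 1 = 4 * m / (1 + m ^ 2) := by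
  unfold sqn at h
  have h2 : 2 + v 0 ≠ 0 := by
    intro h2
    have h3 : v 0 = -2 := by linarith
    have h4 : v 1 = 0 := by
      rw [h3] at h
      nlinarith
    exact hv (ext2 (by simp [saddle, h3]) (by simp [saddle, h4]))
  have h5 : (2 + v 0) ^ 2 + v 1 ^ 2 ≠ 0 := by positivity
  refine ⟨v 1 / (2 + v 0), ?_, ?_⟩
  · rw [eq_div_iff (by positivity)]
    field_simp
    linear_combination (v 0 + 2) * h
  · rw [eq_div_iff (by positivity)]
    field_simp
    linear_combination v 1 * h

/-- On the circle of radius `2` the stereographic coordinate `m` satisfies `m' = 2 m`. -/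
lemma flow_of_sqn_eq_four {v : E2} {m : ℝ} (h0 : v 0 = 2 * (1 - m ^ 2) / (1 + m ^ 2))
    (h1 : v 1 = 4 * m / (1 + m ^ 2)) (t : ℝ) :
    φ t v = !₂[2 * (1 - (m * Real.exp (2 * t)) ^ 2) / (1 + (m * Real.exp (2 * t)) ^ 2),
      4 * (m * Real.exp (2 * t)) / (1 + (m * Real.exp (2 * t)) ^ 2)] := by
  set c : ℝ → E2 := fun t =>
    !₂[2 * (1 - (m * Real.exp (2 * t)) ^ 2) / (1 + (m * Real.exp (2 * t)) ^ 2),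
      4 * (m * Real.exp (2 * t)) / (1 + (m * Real.exp (2 * t)) ^ 2)] with hc
  have hv : c 0 = v := ext2 (by simp [hc, h0]) (by simp [hc, h1])
  rw [← hv]
  refine (eq_planarFlow (c := c) (fun t => ?_) t).symm
  have hm : HasDerivAt (fun t => m * Real.exp (2 * t)) (2 * (m * Real.exp (2 * t))) t := by
    have := (((hasDerivAt_id t).const_mul 2).exp).const_mul m
    simp only [id, mul_one] at this
    exact this.congr_deriv (by ring)
  have hq : sqn (c t) = 4 := by
    simp only [hc, sqn, Matrix.cons_val_zero, Matrix.cons_val_one]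
    have : 1 + (m * Real.exp (2 * t)) ^ 2 ≠ 0 := by positivity
    field_simp
    ring
  have hp : 1 + (m * Real.exp (2 * t)) ^ 2 ≠ 0 := by positivity
  have hden : HasDerivAt (fun t => 1 + (m * Real.exp (2 * t)) ^ 2)
      (2 * (m * Real.exp (2 * t)) * (2 * (m * Real.exp (2 * t)))) t := by
    simpa using (hm.pow 2).const_add 1
  rw [planarField_of_two_le (by rw [hq]; norm_num), hq, radial_of_mem (by norm_num) (by norm_num),
    swing_of_mem (by norm_num) (by norm_num)]
  refine hasDerivAt_euclidean fun i => ?_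
  fin_cases i
  · have hnum : HasDerivAt (fun t => 2 * (1 - (m * Real.exp (2 * t)) ^ 2))
        (2 * (-(2 * (m * Real.exp (2 * t)) * (2 * (m * Real.exp (2 * t)))))) t := by
      simpa using ((hm.pow 2).const_sub 1).const_mul 2
    refine (hnum.div hden hp).congr_deriv ?_
    simp only [hc, Fin.zero_eta, Matrix.cons_val_zero, Matrix.cons_val_one, PiLp.toLp_apply]
    field_simp
    ring
  · refine ((hm.const_mul 4).div hden hp).congr_deriv ?_
    simp only [hc, Fin.mk_one, Matrix.cons_val_zero, Matrix.cons_val_one, PiLp.toLp_apply]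
    field_simp
    ring

lemma tendsto_saddle_zero_atTop {v : E2} (h : sqn v = 4) (hv : v ≠ source 0) :
    Tendsto (fun t => φ t v) atTop (𝓝 (saddle 0)) := by
  by_cases hs : v = saddle 0
  · have h0 : planarField v = 0 := planarField_eq_zero_iff.2 (Or.inr ⟨0, hs.symm⟩)
    simp_rw [planar_hasFlow.flowMap_of_zero h0, hs]
    exact tendsto_const_nhds
  obtain ⟨m, h0, h1⟩ := exists_stereographic_four h hs
  have hm : m ≠ 0 := by
    rintro rfl
    exact hv (ext2 (by simp [source, h0]) (by simp [source, h1]))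
  have he : Tendsto (fun t : ℝ => Real.exp (-(2 * t))) atTop (𝓝 0) :=
    Real.tendsto_exp_neg_atTop_nhds_zero.comp (tendsto_id.const_mul_atTop (by norm_num))
  have e0 : ∀ t, φ t v 0 = 2 * (Real.exp (-(2 * t)) ^ 2 - m ^ 2) /
      (Real.exp (-(2 * t)) ^ 2 + m ^ 2) := by
    intro t
    rw [flow_of_sqn_eq_four h0 h1, Real.exp_neg]
    have := Real.exp_pos (2 * t)
    have : m ^ 2 ≠ 0 := by positivity
    simp only [Matrix.cons_val_zero]
    field_simp
  have e1 : ∀ t, φ t v 1 = 4 * m * Real.exp (-(2 * t)) / (Real.exp (-(2 * t)) ^ 2 + m ^ 2) := by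
    intro t
    rw [flow_of_sqn_eq_four h0 h1, Real.exp_neg]
    have := Real.exp_pos (2 * t)
    have : m ^ 2 ≠ 0 := by positivity
    simp only [Matrix.cons_val_one, Matrix.cons_val_fin_one]
    field_simp
  have hd : Tendsto (fun t => Real.exp (-(2 * t)) ^ 2 + m ^ 2) atTop (𝓝 (0 ^ 2 + m ^ 2)) :=
    (he.pow 2).add_const _
  have hd0 : (0 : ℝ) ^ 2 + m ^ 2 ≠ 0 := by positivity
  refine tendsto_ext2 ?_ ?_
  · simp_rw [e0]
    have := ((((he.pow 2).sub_const (m ^ 2)).const_mul 2).div hd hd0)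
    have e : (saddle 0) 0 = 2 * (0 ^ 2 - m ^ 2) / (0 ^ 2 + m ^ 2) := by
      rw [show (saddle 0) 0 = -2 by simp [saddle]]
      field_simp
      ring
    rw [e]
    exact this
  · simp_rw [e1]
    have := ((he.const_mul (4 * m)).div hd hd0)
    have e : (saddle 0) 1 = 4 * m * 0 / (0 ^ 2 + m ^ 2) := by
      rw [show (saddle 0) 1 = 0 by simp [saddle]]
      ring
    rw [e]
    exact this

/-- The unit circle is traversed with angular velocity `1`. -/
lemma flow_of_sqn_eq_one {v : E2} (h : sqn v = 1) (t : ℝ) :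
    φ t v = !₂[v 0 * Real.cos t - v 1 * Real.sin t, v 0 * Real.sin t + v 1 * Real.cos t] := by
  set c : ℝ → E2 := fun t =>
    !₂[v 0 * Real.cos t - v 1 * Real.sin t, v 0 * Real.sin t + v 1 * Real.cos t] with hc
  have hv : c 0 = v := ext2 (by simp [hc]) (by simp [hc])
  conv_lhs => rw [← hv]
  refine (eq_planarFlow (c := c) (fun t => ?_) t).symm
  have hq : sqn (c t) = 1 := by
    unfold sqn at h
    simp only [hc, sqn, Matrix.cons_val_zero, Matrix.cons_val_one]
    linear_combination (v 0 ^ 2 + v 1 ^ 2) * Real.sin_sq_add_cos_sq t + h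
  rw [planarField_of_annulus (by rw [hq]; norm_num) (by rw [hq]; norm_num), hq]
  refine hasDerivAt_euclidean fun i => ?_
  fin_cases i
  · refine (((Real.hasDerivAt_cos t).const_mul (v 0)).sub
      ((Real.hasDerivAt_sin t).const_mul (v 1))).congr_deriv ?_
    simp [hc]
    ring
  · refine (((Real.hasDerivAt_sin t).const_mul (v 0)).add
      ((Real.hasDerivAt_cos t).const_mul (v 1))).congr_deriv ?_
    simp [hc]
    ring

lemma exists_angle {v : E2} (h : sqn v = 1) : ∃ t, v = !₂[Real.cos t, Real.sin t] := by
  have h1 : ‖(⟨v 0, v 1⟩ : ℂ)‖ = 1 := by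
    rw [Complex.norm_def, Complex.normSq_mk, Real.sqrt_eq_one]
    unfold sqn at h
    linarith
  obtain ⟨t, ht⟩ := (Complex.norm_eq_one_iff _).1 h1
  refine ⟨t, ext2 ?_ ?_⟩
  · have := congrArg Complex.re ht
    simpa [Complex.exp_ofReal_mul_I_re] using this.symm
  · have := congrArg Complex.im ht
    simpa [Complex.exp_ofReal_mul_I_im] using this.symm

lemma isClosedOrbit_unitCircle : IsClosedOrbit (n := 2) planarField unitCircle := by
  have h1 : sqn (!₂[1, 0] : E2) = 1 := by simp [sqn]
  refine ⟨fun t => φ t !₂[1, 0], planar_hasFlow.isMIntegralCurve _, ⟨2 * Real.pi, by positivity,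
    fun t => ?_⟩, ⟨Real.pi, fun h => ?_⟩, ?_⟩
  · simp only [flow_of_sqn_eq_one h1, Real.cos_add_two_pi, Real.sin_add_two_pi]
  · simp only [flow_of_sqn_eq_one h1] at h
    have := congrArg (fun w : E2 => w 0) h
    norm_num at this
  · ext v
    constructor
    · intro hv
      obtain ⟨t, rfl⟩ := exists_angle hv
      exact ⟨t, by simp [flow_of_sqn_eq_one h1]⟩
    · rintro ⟨t, rfl⟩
      simp [unitCircle, flow_of_sqn_eq_one h1, sqn]

/-- Between the two inner sources the orbits tend to the saddle at the origin. -/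
lemma tendsto_saddle_one_atTop {v : E2} (h1 : v 1 = 0) (h0 : |v 0| < 1 / 4) :
    Tendsto (fun t => φ t v) atTop (𝓝 (saddle 1)) := by
  by_cases hv : v 0 = 0
  · have hs : v = saddle 1 := ext2 (by simp [saddle, hv]) (by simp [saddle, h1])
    have h0 : planarField v = 0 := planarField_eq_zero_iff.2 (Or.inr ⟨1, hs.symm⟩)
    simp_rw [planar_hasFlow.flowMap_of_zero h0, hs]
    exact tendsto_const_nhds
  have hx2 : 0 < v 0 ^ 2 := by positivity
  have hx : v 0 ^ 2 < 1 / 16 := by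
    rw [← sq_abs]
    nlinarith [abs_nonneg (v 0)]
  set k : ℝ := (1 / 16 - v 0 ^ 2) with hk
  have hk0 : 0 < k := by linarith
  -- the solution is `v 0 / (4 * sqrt (v 0 ^ 2 + k * exp (2 * t)))`
  set d : ℝ → ℝ := fun t => v 0 ^ 2 + k * Real.exp (2 * t) with hd
  have hdpos : ∀ t, 0 < d t := fun t => by positivity
  set c : ℝ → E2 := fun t => !₂[v 0 / (4 * √(d t)), 0] with hc
  have hd0 : √(d 0) = 1 / 4 := by
    have : d 0 = (1 / 4) ^ 2 := by simp [hd, hk]; norm_num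
    rw [this, Real.sqrt_sq (by norm_num)]
  have hcv : c 0 = v := ext2 (by simp [hc, hd0]) (by simp [hc, h1])
  have hsol : ∀ t, φ t v = c t := by
    intro t
    rw [← hcv]
    refine (eq_planarFlow (c := c) (fun t => ?_) t).symm
    have hs : √(d t) ^ 2 = d t := Real.sq_sqrt (hdpos t).le
    have hs0 : 0 < √(d t) := Real.sqrt_pos.2 (hdpos t)
    have hdd : HasDerivAt d (k * (Real.exp (2 * t) * 2)) t := by
      have := (((hasDerivAt_id t).const_mul 2).exp.const_mul k).const_add (v 0 ^ 2)
      exact this.congr_deriv (by simp)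
    have hq : sqn (c t) ≤ 1 / 8 := by
      have : v 0 ^ 2 ≤ d t := by
        have : 0 ≤ k * Real.exp (2 * t) := by positivity
        simp only [hd]; linarith
      simp only [hc, sqn, Matrix.cons_val_zero, Matrix.cons_val_one]
      rw [div_pow, mul_pow, hs]
      have := hdpos t
      rw [show (v 0 ^ 2 / (4 ^ 2 * d t) + (0 : ℝ) ^ 2) = v 0 ^ 2 / (4 ^ 2 * d t) by ring,
        div_le_iff₀ (by positivity)]
      linarith
    rw [planarField_of_disc hq]
    refine hasDerivAt_euclidean fun i => ?_
    fin_cases i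
    · have h4 := (((hdd.sqrt (hdpos t).ne').const_mul 4).inv (by positivity)).const_mul (v 0)
      refine (h4.congr_deriv ?_)
      simp only [hc, Fin.zero_eta, Matrix.cons_val_zero]
      have h5 : k * Real.exp (2 * t) = √(d t) ^ 2 - v 0 ^ 2 := by rw [hs]; simp [hd]
      rw [← mul_assoc, h5]
      field_simp
      ring
    · simpa [hc] using hasDerivAt_const t (0 : ℝ)
  have hlim : Tendsto d atTop atTop := by
    have h2 : Tendsto (fun t : ℝ => Real.exp (2 * t)) atTop atTop :=
      Real.tendsto_exp_atTop.comp (tendsto_id.const_mul_atTop (by norm_num))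
    exact tendsto_atTop_add_const_left _ _ (h2.const_mul_atTop hk0)
  refine tendsto_ext2 ?_ ?_
  · simp_rw [hsol]
    have h3 : Tendsto (fun t => 4 * √(d t)) atTop atTop :=
      (Real.tendsto_sqrt_atTop.comp hlim).const_mul_atTop (by norm_num)
    simpa [saddle, hc] using h3.const_div_atTop (v 0)
  · simp_rw [hsol]
    simp [saddle, hc]

/-! ### Stable and unstable manifolds of the planar field -/

lemma HasFlow.isConnected_of_crossing {n : ℕ} {M : Type*} [TopologicalSpace M]
    [ChartedSpace (EuclideanSpace ℝ (Fin n)) M] {X : (x : M) → TangentSpace (𝓡 n) x}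
    (h : HasFlow X) (hc : Continuous fun p : ℝ × M => flowMap X p.1 p.2) {A S : Set M}
    (hA : IsConnected A) (hAS : ∀ x ∈ A, ∀ t, flowMap X t x ∈ S)
    (hS : ∀ x ∈ S, ∃ t, flowMap X t x ∈ A) : IsConnected S := by
  have h1 := (isConnected_univ (α := ℝ)).prod hA |>.image _ hc.continuousOn
  convert h1 using 1
  ext x
  constructor
  · intro hx
    obtain ⟨t, ht⟩ := hS x hx
    exact ⟨(-t, flowMap X t x), ⟨mem_univ _, ht⟩, h.flowMap_neg_flowMap t x⟩
  · rintro ⟨⟨t, y⟩, ⟨-, hy⟩, rfl⟩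
    exact hAS y hy t

local notation "Ws" => stableSet (n := 2) planarField
local notation "Wu" => unstableSet (n := 2) planarField

lemma isCritical_source (i : Fin 3) : IsCritical (n := 2) planarField {source i} :=
  Or.inl ⟨_, planarField_eq_zero_iff.2 (Or.inl ⟨i, rfl⟩), rfl⟩

lemma isCritical_saddle (i : Fin 2) : IsCritical (n := 2) planarField {saddle i} :=
  Or.inl ⟨_, planarField_eq_zero_iff.2 (Or.inr ⟨i, rfl⟩), rfl⟩

lemma isCritical_unitCircle : IsCritical (n := 2) planarField unitCircle :=
  Or.inr isClosedOrbit_unitCircle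

lemma source_injective : Function.Injective source := by
  intro i j h
  have := congrArg (fun w : E2 => w 0) h
  fin_cases i <;> fin_cases j <;> first | rfl | (norm_num [source] at this)

lemma saddle_injective : Function.Injective saddle := by
  intro i j h
  have := congrArg (fun w : E2 => w 0) h
  fin_cases i <;> fin_cases j <;> first | rfl | (norm_num [saddle] at this)

lemma source_ne_saddle (i : Fin 3) (j : Fin 2) : source i ≠ saddle j := by
  intro h
  have := congrArg (fun w : E2 => w 0) h
  fin_cases i <;> fin_cases j <;> norm_num [source, saddle] at this

lemma singleton_ne_unitCircle (p : E2) : {p} ≠ unitCircle := by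
  intro h
  have h1 : (!₂[1, 0] : E2) ∈ ({p} : Set E2) := h ▸ by simp [unitCircle, sqn]
  have h2 : (!₂[-1, 0] : E2) ∈ ({p} : Set E2) := h ▸ by simp [unitCircle, sqn]
  rw [mem_singleton_iff] at h1 h2
  have := congrArg (fun w : E2 => w 0) (h1.trans h2.symm)
  norm_num at this

lemma mem_stable_of_tendsto {v p : E2} (h : Tendsto (fun t => φ t v) atTop (𝓝 p)) : v ∈ Ws {p} := by
  rwa [planar_hasFlow.mem_stableSet, nhdsSet_singleton]

lemma mem_unstable_of_tendsto {v p : E2} (h : Tendsto (fun t => φ t v) atBot (𝓝 p)) :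
    v ∈ Wu {p} := by
  rwa [planar_hasFlow.mem_unstableSet, nhdsSet_singleton]

lemma mem_stable_circle_of_tendsto {v : E2} (h : Tendsto (fun t => sqn (φ t v)) atTop (𝓝 1)) :
    v ∈ Ws unitCircle := by
  rw [planar_hasFlow.mem_stableSet]
  have h1 := tendsto_nhdsSet_of_level (isCompact_sqn_le 2) (h.eventually (ge_mem_nhds
    (show (1 : ℝ) < 2 by norm_num))) continuous_sqn h
  refine h1.mono_right (nhdsSet_mono ?_)
  rintro v ⟨-, hv⟩
  exact hv

/-- Orbits in `4 < sqn v` tend to infinity. -/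
lemma notMem_stable_of_four_lt {v : E2} (h : 4 < sqn v) {β : Set E2}
    (hβ : IsCritical (n := 2) planarField β) : v ∉ Ws β := by
  intro hv
  rw [planar_hasFlow.mem_stableSet] at hv
  obtain ⟨b, hb⟩ := hβ.isCompact.exists_bound_of_continuousOn continuous_sqn.continuousOn
  have h1 : {w : E2 | sqn w < b + 1} ∈ 𝓝ˢ β :=
    (isOpen_lt continuous_sqn continuous_const).mem_nhdsSet.2 fun w hw => by
      have := (le_abs_self _).trans (hb w hw)
      simp only [mem_ofPred_eq]
      linarith
  have h2 : ∀ᶠ t in atTop, sqn (φ t v) < b + 1 := hv h1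
  obtain ⟨t, ht, ht'⟩ := (h2.and ((tendsto_sqn_atTop h).eventually_ge_atTop (b + 1))).exists
  exact absurd ht (not_lt.2 ht')

lemma eq_source_zero {v : E2} (h : sqn v = 4) (h1 : v 1 = 0) (h0 : 0 ≤ v 0) : v = source 0 := by
  rw [sqn, h1] at h
  refine ext2 ?_ (by simp [source, h1])
  simp only [source, Matrix.cons_val_zero]
  nlinarith

lemma eq_saddle_zero {v : E2} (h : sqn v = 4) (h1 : v 1 = 0) (h0 : v 0 ≤ 0) : v = saddle 0 := by
  rw [sqn, h1] at h
  refine ext2 ?_ (by simp [saddle, h1])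
  simp only [saddle, Matrix.cons_val_zero]
  nlinarith

lemma sqn_source_zero : sqn (source 0) = 4 := by norm_num [source, sqn]
lemma sqn_source_one : sqn (source 1) = 1 / 16 := by norm_num [source, sqn]
lemma sqn_source_two : sqn (source 2) = 1 / 16 := by
  simp [source, sqn]
  norm_num

lemma forward_cases (v : E2) : 4 < sqn v ∨ (∃ i, v = source i) ∨
    (sqn v = 4 ∧ v ∈ Ws {saddle 0}) ∨ (v 1 = 0 ∧ |v 0| < 1 / 4 ∧ v ∈ Ws {saddle 1}) ∨
    (sqn v < 4 ∧ ¬ (v 1 = 0 ∧ |v 0| ≤ 1 / 4) ∧ v ∈ Ws unitCircle) := by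
  rcases lt_trichotomy (sqn v) 4 with h | h | h
  · by_cases hseg : v 1 = 0 ∧ |v 0| ≤ 1 / 4
    · rcases hseg.2.lt_or_eq with h2 | h2
      · exact Or.inr (Or.inr (Or.inr (Or.inl ⟨hseg.1, h2,
          mem_stable_of_tendsto (tendsto_saddle_one_atTop hseg.1 h2)⟩)))
      · refine Or.inr (Or.inl ?_)
        rcases (abs_eq (by norm_num)).1 h2 with h3 | h3
        · exact ⟨1, ext2 (by simp [source, h3]) (by simp [source, hseg.1])⟩
        · exact ⟨2, ext2 (by simp [source, h3]) (by simp [source, hseg.1])⟩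
    · refine Or.inr (Or.inr (Or.inr (Or.inr ⟨h, hseg, ?_⟩)))
      rcases le_or_gt 1 (sqn v) with h1 | h1
      · exact mem_stable_circle_of_tendsto (tendsto_sqn_one_of_middle h1 h)
      · obtain ⟨t, -, ht⟩ := exists_lt_sqn h1 hseg
        rw [← planar_hasFlow.flowMap_mem_stableSet t]
        rcases le_or_gt 1 (sqn (φ t v)) with h2 | h2
        · by_cases h3 : sqn (φ t v) < 4
          · exact mem_stable_circle_of_tendsto (tendsto_sqn_one_of_middle h2 h3)
          · exfalso
            rcases le_total 0 t with ht0 | ht0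
            · have := sqn_le_middle (v := v) (c := 1) ht0 (by rw [flow_zero]; exact h1.le) le_rfl
                (by norm_num)
              linarith
            · have := middle_le_sqn (v := v) (c := 4) ht0 (by
                have := inner_le_sqn (v := v) (c := 1) ht0 h2 (by norm_num) le_rfl
                rw [flow_zero] at this
                linarith) (by norm_num) le_rfl
              have := inner_le_sqn (v := v) (c := 1) ht0 h2 (by norm_num) le_rfl
              rw [flow_zero] at this
              linarith
        · exact mem_stable_circle_of_tendsto (tendsto_sqn_one_of_inner ht h2.le)
  · by_cases hv : v = source 0
    · exact Or.inr (Or.inl ⟨0, hv⟩)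
    · exact Or.inr (Or.inr (Or.inl ⟨h, mem_stable_of_tendsto (tendsto_saddle_zero_atTop h hv)⟩))
  · exact Or.inl h

lemma saddle_zero_ne_one : ({saddle 0} : Set E2) ≠ {saddle 1} := fun h =>
  absurd (saddle_injective (singleton_injective h)) (by decide)

lemma source_ne_saddle' (i : Fin 3) (j : Fin 2) : ({source i} : Set E2) ≠ {saddle j} := fun h =>
  source_ne_saddle i j (singleton_injective h)

lemma eq_of_mem_stable {β β' : Set E2} (hβ : IsCritical (n := 2) planarField β)
    (hβ' : IsCritical (n := 2) planarField β') {v : E2} (h : v ∈ Ws β) (h' : v ∈ Ws β') : β = β' :=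
  planar_hasFlow.eq_of_mem_stableSet hβ hβ' h h'

lemma eq_of_mem_unstable {β β' : Set E2} (hβ : IsCritical (n := 2) planarField β)
    (hβ' : IsCritical (n := 2) planarField β') {v : E2} (h : v ∈ Wu β) (h' : v ∈ Wu β') : β = β' :=
  planar_hasFlow.eq_of_mem_unstableSet hβ hβ' h h'

lemma mem_stable_source_iff {v : E2} {i : Fin 3} : v ∈ Ws {source i} ↔ v = source i := by
  refine ⟨fun h => ?_, fun h => ?_⟩
  · rcases forward_cases v with h1 | ⟨j, rfl⟩ | ⟨-, h1⟩ | ⟨-, -, h1⟩ | ⟨-, -, h1⟩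
    · exact absurd h (notMem_stable_of_four_lt h1 (isCritical_source i))
    · exact (singleton_injective (eq_of_mem_stable (isCritical_source i) (isCritical_source j) h
        (planar_hasFlow.subset_stableSet (isCritical_source j) rfl))).symm
    · exact absurd (eq_of_mem_stable (isCritical_source i) (isCritical_saddle 0) h h1)
        (source_ne_saddle' _ _)
    · exact absurd (eq_of_mem_stable (isCritical_source i) (isCritical_saddle 1) h h1)
        (source_ne_saddle' _ _)
    · exact absurd (eq_of_mem_stable (isCritical_source i) isCritical_unitCircle h h1)
        (singleton_ne_unitCircle _)
  · exact h ▸ planar_hasFlow.subset_stableSet (isCritical_source i) rfl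

lemma mem_stable_saddle_zero_iff {v : E2} : v ∈ Ws {saddle 0} ↔ sqn v = 4 ∧ v ≠ source 0 := by
  refine ⟨fun h => ⟨?_, ?_⟩, fun h => mem_stable_of_tendsto (tendsto_saddle_zero_atTop h.1 h.2)⟩
  · rcases forward_cases v with h1 | ⟨j, rfl⟩ | ⟨h1, -⟩ | ⟨-, -, h1⟩ | ⟨-, -, h1⟩
    · exact absurd h (notMem_stable_of_four_lt h1 (isCritical_saddle 0))
    · exact absurd (eq_of_mem_stable (isCritical_source j) (isCritical_saddle 0)
        (mem_stable_source_iff.2 rfl) h) (source_ne_saddle' _ _)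
    · exact h1
    · exact absurd (eq_of_mem_stable (isCritical_saddle 0) (isCritical_saddle 1) h h1)
        saddle_zero_ne_one
    · exact absurd (eq_of_mem_stable (isCritical_saddle 0) isCritical_unitCircle h h1)
        (singleton_ne_unitCircle _)
  · rintro rfl
    exact absurd (eq_of_mem_stable (isCritical_source 0) (isCritical_saddle 0)
      (mem_stable_source_iff.2 rfl) h) (source_ne_saddle' _ _)

lemma mem_stable_saddle_one_iff {v : E2} : v ∈ Ws {saddle 1} ↔ v 1 = 0 ∧ |v 0| < 1 / 4 := by
  refine ⟨fun h => ?_, fun h => mem_stable_of_tendsto (tendsto_saddle_one_atTop h.1 h.2)⟩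
  rcases forward_cases v with h1 | ⟨j, rfl⟩ | ⟨-, h1⟩ | ⟨h1, h2, -⟩ | ⟨-, -, h1⟩
  · exact absurd h (notMem_stable_of_four_lt h1 (isCritical_saddle 1))
  · exact absurd (eq_of_mem_stable (isCritical_source j) (isCritical_saddle 1)
      (mem_stable_source_iff.2 rfl) h) (source_ne_saddle' _ _)
  · exact absurd (eq_of_mem_stable (isCritical_saddle 0) (isCritical_saddle 1) h1 h)
      saddle_zero_ne_one
  · exact ⟨h1, h2⟩
  · exact absurd (eq_of_mem_stable (isCritical_saddle 1) isCritical_unitCircle h h1)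
      (singleton_ne_unitCircle _)

lemma mem_stable_circle_iff {v : E2} :
    v ∈ Ws unitCircle ↔ sqn v < 4 ∧ ¬ (v 1 = 0 ∧ |v 0| ≤ 1 / 4) := by
  have key : ∀ p, IsCritical (n := 2) planarField {p} → v ∈ Ws {p} → v ∉ Ws unitCircle :=
    fun p hp h h' => singleton_ne_unitCircle p (eq_of_mem_stable hp isCritical_unitCircle h h')
  rcases forward_cases v with h1 | ⟨j, rfl⟩ | ⟨h1, h2⟩ | ⟨h1, h2, h3⟩ | ⟨h1, h2, h3⟩
  · exact iff_of_false (notMem_stable_of_four_lt h1 isCritical_unitCircle) fun h => by linarith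
  · refine iff_of_false (key _ (isCritical_source j) (mem_stable_source_iff.2 rfl)) ?_
    fin_cases j
    · exact fun h => by
        have := sqn_source_zero
        simp only [Fin.zero_eta] at h
        linarith
    · exact fun h => h.2 (by norm_num [source])
    · exact fun h => h.2 (by norm_num [source])
  · exact iff_of_false (key _ (isCritical_saddle 0) h2) fun h => by linarith
  · exact iff_of_false (key _ (isCritical_saddle 1) h3) fun h => h.2 ⟨h1, h2.le⟩
  · exact iff_of_true h3 ⟨h1, h2⟩

/-! ### Unstable manifolds -/

lemma mem_unstable_source_zero_iff {v : E2} (h : 2 ≤ sqn v) :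
    v ∈ Wu {source 0} ↔ ¬ (v 1 = 0 ∧ v 0 < 0) := by
  refine ⟨fun h1 h2 => ?_, fun h1 => mem_unstable_of_tendsto (tendsto_source_zero h h1)⟩
  exact source_ne_saddle' 0 0 (eq_of_mem_unstable (isCritical_source 0) (isCritical_saddle 0) h1
    (mem_unstable_of_tendsto (tendsto_saddle_zero h h2.1 h2.2)))

lemma mem_unstable_saddle_zero_iff {v : E2} (h : 2 ≤ sqn v) :
    v ∈ Wu {saddle 0} ↔ v 1 = 0 ∧ v 0 < 0 := by
  refine ⟨fun h1 => ?_, fun h1 => mem_unstable_of_tendsto (tendsto_saddle_zero h h1.1 h1.2)⟩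
  by_contra h2
  exact source_ne_saddle' 0 0 (eq_of_mem_unstable (isCritical_source 0) (isCritical_saddle 0)
    ((mem_unstable_source_zero_iff h).2 h2) h1)

lemma disc_cases {v : E2} (h : sqn v ≤ 1 / 8) : (0 < v 0 ∧ v ∈ Wu {source 1}) ∨
    (v 0 < 0 ∧ v ∈ Wu {source 2}) ∨ (v 0 = 0 ∧ v ∈ Wu {saddle 1}) := by
  rcases lt_trichotomy (v 0) 0 with h0 | h0 | h0
  · exact Or.inr (Or.inl ⟨h0, mem_unstable_of_tendsto (tendsto_source_two h h0)⟩)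
  · exact Or.inr (Or.inr ⟨h0, mem_unstable_of_tendsto (tendsto_saddle_one h h0)⟩)
  · exact Or.inl ⟨h0, mem_unstable_of_tendsto (tendsto_source_one h h0)⟩

lemma source_one_ne_two : ({source 1} : Set E2) ≠ {source 2} := fun h =>
  absurd (source_injective (singleton_injective h)) (by decide)

lemma mem_unstable_source_one_iff {v : E2} (h : sqn v ≤ 1 / 8) :
    v ∈ Wu {source 1} ↔ 0 < v 0 := by
  rcases disc_cases h with ⟨h0, h1⟩ | ⟨h0, h1⟩ | ⟨h0, h1⟩
  · exact iff_of_true h1 h0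
  · exact iff_of_false (fun h2 => source_one_ne_two (eq_of_mem_unstable (isCritical_source 1)
      (isCritical_source 2) h2 h1)) (by linarith)
  · exact iff_of_false (fun h2 => source_ne_saddle' 1 1 (eq_of_mem_unstable (isCritical_source 1)
      (isCritical_saddle 1) h2 h1)) (by linarith)

lemma mem_unstable_source_two_iff {v : E2} (h : sqn v ≤ 1 / 8) :
    v ∈ Wu {source 2} ↔ v 0 < 0 := by
  rcases disc_cases h with ⟨h0, h1⟩ | ⟨h0, h1⟩ | ⟨h0, h1⟩
  · exact iff_of_false (fun h2 => source_one_ne_two (eq_of_mem_unstable (isCritical_source 1)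
      (isCritical_source 2) h1 h2)) (by linarith)
  · exact iff_of_true h1 h0
  · exact iff_of_false (fun h2 => source_ne_saddle' 2 1 (eq_of_mem_unstable (isCritical_source 2)
      (isCritical_saddle 1) h2 h1)) (by linarith)

lemma mem_unstable_saddle_one_iff {v : E2} (h : sqn v ≤ 1 / 8) :
    v ∈ Wu {saddle 1} ↔ v 0 = 0 := by
  rcases disc_cases h with ⟨h0, h1⟩ | ⟨h0, h1⟩ | ⟨h0, h1⟩
  · exact iff_of_false (fun h2 => source_ne_saddle' 1 1 (eq_of_mem_unstable (isCritical_source 1)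
      (isCritical_saddle 1) h1 h2)) h0.ne'
  · exact iff_of_false (fun h2 => source_ne_saddle' 2 1 (eq_of_mem_unstable (isCritical_source 2)
      (isCritical_saddle 1) h1 h2)) h0.ne
  · exact iff_of_true h1 h0

lemma backward_cases (v : E2) :
    (1 < sqn v ∧ (v ∈ Wu {source 0} ∨ v ∈ Wu {saddle 0})) ∨ (sqn v = 1 ∧ v ∈ Wu unitCircle) ∨
    (sqn v < 1 ∧ (v ∈ Wu {source 1} ∨ v ∈ Wu {source 2} ∨ v ∈ Wu {saddle 1})) := by
  rcases lt_trichotomy (sqn v) 1 with h | h | h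
  · obtain ⟨t, -, ht⟩ := exists_sqn_le_of_inner h
    refine Or.inr (Or.inr ⟨h, ?_⟩)
    simp_rw [← planar_hasFlow.flowMap_mem_unstableSet (x := v) t]
    rcases disc_cases ht with h1 | h1 | h1
    · exact Or.inl h1.2
    · exact Or.inr (Or.inl h1.2)
    · exact Or.inr (Or.inr h1.2)
  · exact Or.inr (Or.inl ⟨h, planar_hasFlow.subset_unstableSet isCritical_unitCircle h⟩)
  · obtain ⟨t, -, ht⟩ := exists_two_le_sqn h
    refine Or.inl ⟨h, ?_⟩
    simp_rw [← planar_hasFlow.flowMap_mem_unstableSet (x := v) t]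
    by_cases h1 : φ t v 1 = 0 ∧ φ t v 0 < 0
    · exact Or.inr ((mem_unstable_saddle_zero_iff ht).2 h1)
    · exact Or.inl ((mem_unstable_source_zero_iff ht).2 h1)

lemma exists_mem_unstable (v : E2) : ∃ β, IsCritical (n := 2) planarField β ∧ v ∈ Wu β := by
  rcases backward_cases v with ⟨-, h | h⟩ | ⟨-, h⟩ | ⟨-, h | h | h⟩
  exacts [⟨_, isCritical_source 0, h⟩, ⟨_, isCritical_saddle 0, h⟩, ⟨_, isCritical_unitCircle, h⟩,
    ⟨_, isCritical_source 1, h⟩, ⟨_, isCritical_source 2, h⟩, ⟨_, isCritical_saddle 1, h⟩]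

lemma unstable_circle : Wu unitCircle = unitCircle := by
  refine Subset.antisymm (fun v h => ?_) (planar_hasFlow.subset_unstableSet isCritical_unitCircle)
  have key : ∀ p, IsCritical (n := 2) planarField {p} → v ∉ Wu {p} :=
    fun p hp h' => singleton_ne_unitCircle p (eq_of_mem_unstable hp isCritical_unitCircle h' h)
  rcases backward_cases v with ⟨-, h | h⟩ | ⟨h, -⟩ | ⟨-, h | h | h⟩
  exacts [absurd h (key _ (isCritical_source 0)), absurd h (key _ (isCritical_saddle 0)), h,
    absurd h (key _ (isCritical_source 1)), absurd h (key _ (isCritical_source 2)),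
    absurd h (key _ (isCritical_saddle 1))]

/-- The critical elements outside and inside the unit circle have separate unstable manifolds -/
lemma one_lt_of_mem_unstable {v : E2} (h : v ∈ Wu {source 0} ∨ v ∈ Wu {saddle 0}) :
    1 < sqn v := by
  obtain ⟨p, hp, hv, h1, h2, h3, h4⟩ : ∃ p : E2, IsCritical (n := 2) planarField {p} ∧ v ∈ Wu {p} ∧
      p ≠ source 1 ∧ p ≠ source 2 ∧ p ≠ saddle 1 ∧ ({p} : Set E2) ≠ unitCircle := by
    rcases h with h | h
    · exact ⟨_, isCritical_source 0, h, source_injective.ne (by decide),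
        source_injective.ne (by decide), source_ne_saddle _ _, singleton_ne_unitCircle _⟩
    · exact ⟨_, isCritical_saddle 0, h, (source_ne_saddle _ _).symm, (source_ne_saddle _ _).symm,
        saddle_injective.ne (by decide), singleton_ne_unitCircle _⟩
  rcases backward_cases v with ⟨h, -⟩ | ⟨-, h⟩ | ⟨-, h | h | h⟩
  · exact h
  · exact absurd (eq_of_mem_unstable hp isCritical_unitCircle hv h) h4
  · exact absurd (singleton_injective (eq_of_mem_unstable hp (isCritical_source 1) hv h)) h1
  · exact absurd (singleton_injective (eq_of_mem_unstable hp (isCritical_source 2) hv h)) h2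
  · exact absurd (singleton_injective (eq_of_mem_unstable hp (isCritical_saddle 1) hv h)) h3

lemma lt_one_of_mem_unstable {v : E2}
    (h : v ∈ Wu {source 1} ∨ v ∈ Wu {source 2} ∨ v ∈ Wu {saddle 1}) : sqn v < 1 := by
  obtain ⟨p, hp, hv, h1, h2, h4⟩ : ∃ p : E2, IsCritical (n := 2) planarField {p} ∧ v ∈ Wu {p} ∧
      p ≠ source 0 ∧ p ≠ saddle 0 ∧ ({p} : Set E2) ≠ unitCircle := by
    rcases h with h | h | h
    · exact ⟨_, isCritical_source 1, h, source_injective.ne (by decide),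
        source_ne_saddle _ _, singleton_ne_unitCircle _⟩
    · exact ⟨_, isCritical_source 2, h, source_injective.ne (by decide),
        source_ne_saddle _ _, singleton_ne_unitCircle _⟩
    · exact ⟨_, isCritical_saddle 1, h, (source_ne_saddle _ _).symm,
        saddle_injective.ne (by decide), singleton_ne_unitCircle _⟩
  rcases backward_cases v with ⟨-, h | h⟩ | ⟨-, h⟩ | ⟨h, -⟩
  · exact absurd (singleton_injective (eq_of_mem_unstable hp (isCritical_source 0) hv h)) h1
  · exact absurd (singleton_injective (eq_of_mem_unstable hp (isCritical_saddle 0) hv h)) h2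
  · exact absurd (eq_of_mem_unstable hp isCritical_unitCircle hv h) h4
  · exact h

/-! ### Connecting orbits of the planar field -/

lemma continuous_mk2 {α : Type*} [TopologicalSpace α] {f g : α → ℝ} (hf : Continuous f)
    (hg : Continuous g) : Continuous fun t => (!₂[f t, g t] : E2) := by
  refine (PiLp.continuous_toLp 2 (fun _ : Fin 2 => ℝ)).comp (continuous_pi fun i => ?_)
  fin_cases i
  · exact hf
  · exact hg

/-- Open half circles are connected. -/
lemma isConnected_halfCircle {c a b : ℝ} (hc : 0 < c) (hab : a ^ 2 + b ^ 2 = 1) :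
    IsConnected {v : E2 | sqn v = c ∧ 0 < a * v 0 + b * v 1} := by
  have h1 : IsConnected (Ioo (-√c) (√c)) := by
    have := Real.sqrt_pos.2 hc
    exact isConnected_Ioo (by linarith)
  have hcont : Continuous fun s : ℝ =>
      (!₂[a * √(c - s ^ 2) - b * s, b * √(c - s ^ 2) + a * s] : E2) :=
    continuous_mk2 (by fun_prop) (by fun_prop)
  convert h1.image _ hcont.continuousOn using 1
  ext v
  constructor
  · rintro ⟨hq, hv⟩
    unfold sqn at hq
    have e : c - (a * v 1 - b * v 0) ^ 2 = (a * v 0 + b * v 1) ^ 2 := by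
      linear_combination (-v 0 ^ 2 - v 1 ^ 2) * hab - hq
    refine ⟨a * v 1 - b * v 0, ?_, ?_⟩
    · rw [mem_Ioo, ← abs_lt]
      rw [Real.lt_sqrt (abs_nonneg _), sq_abs]
      have := pow_pos hv 2
      linarith
    · simp only
      rw [e, Real.sqrt_sq hv.le]
      refine ext2 ?_ ?_
      · simp only [Matrix.cons_val_zero]
        linear_combination v 0 * hab
      · simp only [Matrix.cons_val_one, Matrix.cons_val_fin_one]
        linear_combination v 1 * hab
  · rintro ⟨s, hs, rfl⟩
    have h2 : s ^ 2 < c := Real.sq_lt.2 hs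
    have h3 : 0 < √(c - s ^ 2) := Real.sqrt_pos.2 (by linarith)
    have h4 : √(c - s ^ 2) ^ 2 = c - s ^ 2 := Real.sq_sqrt (by linarith)
    simp only [mem_ofPred_eq, sqn, Matrix.cons_val_zero, Matrix.cons_val_one,
      Matrix.cons_val_fin_one]
    set r := √(c - s ^ 2)
    constructor
    · linear_combination (r ^ 2 + s ^ 2) * hab + h4
    · have : a * (a * r - b * s) + b * (b * r + a * s) = r := by linear_combination r * hab
      rwa [this]

/-- Circles with one point removed are connected. -/
lemma isConnected_slitCircle {c : ℝ} (hc : 0 < c) :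
    IsConnected {v : E2 | sqn v = c ∧ ¬ (v 1 = 0 ∧ v 0 < 0)} := by
  have h1 : IsConnected (Ioo (-Real.pi) Real.pi) :=
    isConnected_Ioo (by linarith [Real.pi_pos])
  have hcont : Continuous fun t : ℝ => (!₂[√c * Real.cos t, √c * Real.sin t] : E2) :=
    continuous_mk2 (by fun_prop) (by fun_prop)
  have hs : 0 < √c := Real.sqrt_pos.2 hc
  have hss : √c ^ 2 = c := Real.sq_sqrt hc.le
  convert h1.image _ hcont.continuousOn using 1
  ext v
  constructor
  · rintro ⟨hq, hv⟩
    set z : ℂ := ⟨v 0, v 1⟩ with hz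
    have hn : ‖z‖ = √c := by
      rw [Complex.norm_def, hz, Complex.normSq_mk, ← hq, sqn, sq, sq]
    refine ⟨z.arg, ⟨Complex.neg_pi_lt_arg z, (Complex.arg_le_pi z).lt_of_ne fun h => ?_⟩, ?_⟩
    · have := Complex.arg_eq_pi_iff.1 h
      exact hv ⟨this.2, this.1⟩
    · refine ext2 ?_ ?_
      · simp only [Matrix.cons_val_zero, ← hn]
        exact Complex.norm_mul_cos_arg z
      · simp only [Matrix.cons_val_one, Matrix.cons_val_fin_one, ← hn]
        exact Complex.norm_mul_sin_arg z
  · rintro ⟨t, ht, rfl⟩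
    simp only [mem_ofPred_eq, sqn, Matrix.cons_val_zero, Matrix.cons_val_one,
      Matrix.cons_val_fin_one]
    refine ⟨by linear_combination √c ^ 2 * Real.sin_sq_add_cos_sq t + hss, ?_⟩
    rintro ⟨h2, h3⟩
    have h4 : Real.sin t = 0 := by
      rcases mul_eq_zero.1 h2 with h | h
      · exact absurd h hs.ne'
      · exact h
    have h5 := (Real.sin_eq_zero_iff_of_lt_of_lt ht.1 ht.2).1 h4
    rw [h5, Real.cos_zero] at h3
    linarith

lemma isConnected_axis {I : Set ℝ} (hI : IsConnected I) :
    IsConnected {v : E2 | v 1 = 0 ∧ v 0 ∈ I} := by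
  convert hI.image (fun x : ℝ => (!₂[x, 0] : E2))
    (continuous_mk2 continuous_id continuous_const).continuousOn using 1
  ext v
  constructor
  · rintro ⟨h, h'⟩
    exact ⟨v 0, h', ext2 (by simp) (by simp [h])⟩
  · rintro ⟨x, hx, rfl⟩
    exact ⟨by simp, by simpa using hx⟩

lemma hasComponents_source_zero_saddle_zero :
    HasComponents (Wu {source 0} ∩ Ws {saddle 0}) 2 := by
  have hA := isConnected_halfCircle (c := 4) (a := 0) (b := 1) (by norm_num) (by norm_num)
  have hB := isConnected_halfCircle (c := 4) (a := 0) (b := -1) (by norm_num) (by norm_num)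
  have h1 : Continuous fun v : E2 => v 1 := by fun_prop
  have h := hasComponents_two hA hB (U := {v : E2 | 0 < v 1}) (V := {v : E2 | v 1 < 0})
    (isOpen_lt continuous_const h1) (isOpen_lt h1 continuous_const)
    (fun v hv => by simpa using hv.2) (fun v hv => by simpa using hv.2)
    (disjoint_left.2 fun v hv hv' => by
      have h2 : 0 < v 1 := hv
      have h3 := hv'.2
      linarith)
    (disjoint_left.2 fun v hv hv' => by
      have h2 : v 1 < 0 := hv
      have h3 := hv'.2
      linarith)
  convert h using 1
  ext v
  rw [mem_inter_iff, mem_stable_saddle_zero_iff]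
  constructor
  · rintro ⟨h2, h3, h4⟩
    rw [mem_unstable_source_zero_iff (by linarith)] at h2
    rcases lt_trichotomy (v 1) 0 with h5 | h5 | h5
    · exact Or.inr ⟨h3, by linarith⟩
    · exact absurd (eq_source_zero h3 h5 (not_lt.1 fun h6 => h2 ⟨h5, h6⟩)) h4
    · exact Or.inl ⟨h3, by linarith⟩
  · intro hv
    have h2 : sqn v = 4 ∧ v 1 ≠ 0 := by
      rcases hv with ⟨h2, h3⟩ | ⟨h2, h3⟩
      · exact ⟨h2, by intro h4; simp [h4] at h3⟩
      · exact ⟨h2, by intro h4; simp [h4] at h3⟩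
    refine ⟨(mem_unstable_source_zero_iff (by linarith)).2 fun h3 => h2.2 h3.1, h2.1, ?_⟩
    rintro rfl
    exact h2.2 (by simp [source])

lemma sqn_le_of_segment {v : E2} (h : v 1 = 0 ∧ |v 0| < 1 / 4) : sqn v ≤ 1 / 8 := by
  rw [sqn, h.1, ← sq_abs]
  nlinarith [abs_nonneg (v 0), h.2]

lemma connections_source_zero_saddle_one : Wu {source 0} ∩ Ws {saddle 1} = ∅ := by
  refine eq_empty_of_forall_notMem fun v hv => ?_
  have h1 := one_lt_of_mem_unstable (Or.inl hv.1)
  have h2 := sqn_le_of_segment (mem_stable_saddle_one_iff.1 hv.2)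
  linarith

lemma connections_source_saddle_zero {i : Fin 3} (hi : i ≠ 0) :
    Wu {source i} ∩ Ws {saddle 0} = ∅ := by
  refine eq_empty_of_forall_notMem fun v hv => ?_
  have h1 : sqn v < 1 := by
    refine lt_one_of_mem_unstable ?_
    fin_cases i
    · exact absurd rfl hi
    · exact Or.inl hv.1
    · exact Or.inr (Or.inl hv.1)
  have h2 := mem_stable_saddle_zero_iff.1 hv.2
  linarith [h2.1]

lemma hasComponents_source_one_saddle_one :
    HasComponents (Wu {source 1} ∩ Ws {saddle 1}) 1 := by
  have h := isConnected_axis (isConnected_Ioo (show (0 : ℝ) < 1 / 4 by norm_num))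
  convert h.hasComponents using 1
  ext v
  rw [mem_inter_iff, mem_stable_saddle_one_iff]
  constructor
  · rintro ⟨h1, h2⟩
    exact ⟨h2.1, (mem_unstable_source_one_iff (sqn_le_of_segment h2)).1 h1, (abs_lt.1 h2.2).2⟩
  · rintro ⟨h1, h2, h3⟩
    have h4 : v 1 = 0 ∧ |v 0| < 1 / 4 := ⟨h1, abs_lt.2 ⟨by linarith, h3⟩⟩
    exact ⟨(mem_unstable_source_one_iff (sqn_le_of_segment h4)).2 h2, h4⟩

lemma hasComponents_source_two_saddle_one :
    HasComponents (Wu {source 2} ∩ Ws {saddle 1}) 1 := by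
  have h := isConnected_axis (isConnected_Ioo (show (-(1 / 4) : ℝ) < 0 by norm_num))
  convert h.hasComponents using 1
  ext v
  rw [mem_inter_iff, mem_stable_saddle_one_iff]
  constructor
  · rintro ⟨h1, h2⟩
    exact ⟨h2.1, (abs_lt.1 h2.2).1, (mem_unstable_source_two_iff (sqn_le_of_segment h2)).1 h1⟩
  · rintro ⟨h1, h2, h3⟩
    have h4 : v 1 = 0 ∧ |v 0| < 1 / 4 := ⟨h1, abs_lt.2 ⟨h2, by linarith⟩⟩
    exact ⟨(mem_unstable_source_two_iff (sqn_le_of_segment h4)).2 h3, h4⟩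

/-! ### Orbits that tend to the closed orbit -/

lemma tendsto_sqn_of_mem_stable_circle {v : E2} (h : v ∈ Ws unitCircle) :
    Tendsto (fun t => sqn (φ t v)) atTop (𝓝 1) := by
  rw [planar_hasFlow.mem_stableSet] at h
  refine tendsto_order.2 ⟨fun a ha => ?_, fun a ha => ?_⟩
  · exact h ((isOpen_lt continuous_const continuous_sqn).mem_nhdsSet.2
      fun w (hw : sqn w = 1) => by
        change a < sqn w
        rwa [hw])
  · exact h ((isOpen_lt continuous_sqn continuous_const).mem_nhdsSet.2
      fun w (hw : sqn w = 1) => by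
        change sqn w < a
        rwa [hw])

lemma exists_sqn_eq_two {v : E2} (h : 1 < sqn v) (h' : v ∈ Ws unitCircle) :
    ∃ t, sqn (φ t v) = 2 := by
  obtain ⟨t, -, ht⟩ := exists_two_le_sqn h
  obtain ⟨s, hs⟩ := ((tendsto_sqn_of_mem_stable_circle h').eventually
    (gt_mem_nhds (show (1 : ℝ) < 2 by norm_num))).exists
  exact mem_range_of_exists_le_of_exists_ge (continuous_sqn_flow v) ⟨s, hs.le⟩ ⟨t, ht⟩

lemma exists_sqn_eq_eighth {v : E2} (h : sqn v < 1) (h' : v ∈ Ws unitCircle) :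
    ∃ t, sqn (φ t v) = 1 / 8 := by
  obtain ⟨t, -, ht⟩ := exists_sqn_le_of_inner h
  obtain ⟨s, hs⟩ := ((tendsto_sqn_of_mem_stable_circle h').eventually
    (lt_mem_nhds (show (1 / 8 : ℝ) < 1 by norm_num))).exists
  exact mem_range_of_exists_le_of_exists_ge (continuous_sqn_flow v) ⟨t, ht⟩ ⟨s, hs.le⟩

lemma isConnected_connections {β β' A : Set E2} (hA : IsConnected A) (hA' : A ⊆ Wu β ∩ Ws β')
    (h : ∀ v ∈ Wu β ∩ Ws β', ∃ t, φ t v ∈ A) : IsConnected (Wu β ∩ Ws β') :=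
  planar_hasFlow.isConnected_of_crossing continuous_planarFlow hA
    (fun _ hv t => ⟨(planar_hasFlow.flowMap_mem_unstableSet t).2 (hA' hv).1,
      (planar_hasFlow.flowMap_mem_stableSet t).2 (hA' hv).2⟩) h

lemma mem_stable_circle_of_eq {v : E2} (h : sqn v = 1 / 8 ∨ sqn v = 2) : v ∈ Ws unitCircle := by
  rw [mem_stable_circle_iff]
  refine ⟨by rcases h with h | h <;> linarith, fun h1 => ?_⟩
  have h2 : sqn v ≤ 1 / 16 := by
    rw [sqn, h1.1, ← sq_abs]
    nlinarith [abs_nonneg (v 0), h1.2]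
  rcases h with h | h <;> linarith

lemma isConnected_source_zero_circle : IsConnected (Wu {source 0} ∩ Ws unitCircle) := by
  refine isConnected_connections (isConnected_slitCircle (show (0 : ℝ) < 2 by norm_num)) ?_ ?_
  · rintro v ⟨h1, h2⟩
    exact ⟨(mem_unstable_source_zero_iff h1.ge).2 h2, mem_stable_circle_of_eq (Or.inr h1)⟩
  · rintro v ⟨h1, h2⟩
    obtain ⟨t, ht⟩ := exists_sqn_eq_two (one_lt_of_mem_unstable (Or.inl h1)) h2
    refine ⟨t, ht, (mem_unstable_source_zero_iff ht.ge).1 ?_⟩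
    rwa [planar_hasFlow.flowMap_mem_unstableSet]

lemma isConnected_saddle_zero_circle : IsConnected (Wu {saddle 0} ∩ Ws unitCircle) := by
  have hw : sqn (!₂[-√2, 0] : E2) = 2 := by simp [sqn]
  have hw' : (!₂[-√2, 0] : E2) ∈ Wu {saddle 0} :=
    (mem_unstable_saddle_zero_iff hw.ge).2 (by simp)
  refine isConnected_connections (isConnected_singleton (x := !₂[-√2, 0])) ?_ ?_
  · rw [singleton_subset_iff]
    exact ⟨hw', mem_stable_circle_of_eq (Or.inr hw)⟩
  · rintro v ⟨h1, h2⟩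
    obtain ⟨t, ht⟩ := exists_sqn_eq_two (one_lt_of_mem_unstable (Or.inr h1)) h2
    refine ⟨t, ?_⟩
    have h3 := (mem_unstable_saddle_zero_iff ht.ge).1
      ((planar_hasFlow.flowMap_mem_unstableSet t).2 h1)
    rw [mem_singleton_iff]
    refine ext2 ?_ (by simp [h3.1])
    rw [sqn, h3.1] at ht
    have h4 : √2 = -(φ t v 0) := by
      rw [← ht, zero_pow two_ne_zero, add_zero, Real.sqrt_sq_eq_abs, abs_of_neg h3.2]
    simp [h4]

lemma isConnected_source_one_circle : IsConnected (Wu {source 1} ∩ Ws unitCircle) := by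
  refine isConnected_connections (isConnected_halfCircle (c := 1 / 8) (a := 1) (b := 0)
    (by norm_num) (by norm_num)) ?_ ?_
  · rintro v ⟨h1, h2⟩
    exact ⟨(mem_unstable_source_one_iff h1.le).2 (by linarith), mem_stable_circle_of_eq (Or.inl h1)⟩
  · rintro v ⟨h1, h2⟩
    obtain ⟨t, ht⟩ := exists_sqn_eq_eighth (lt_one_of_mem_unstable (Or.inl h1)) h2
    have h3 := (mem_unstable_source_one_iff ht.le).1
      ((planar_hasFlow.flowMap_mem_unstableSet t).2 h1)
    exact ⟨t, ht, by linarith⟩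

lemma isConnected_source_two_circle : IsConnected (Wu {source 2} ∩ Ws unitCircle) := by
  refine isConnected_connections (isConnected_halfCircle (c := 1 / 8) (a := -1) (b := 0)
    (by norm_num) (by norm_num)) ?_ ?_
  · rintro v ⟨h1, h2⟩
    exact ⟨(mem_unstable_source_two_iff h1.le).2 (by linarith), mem_stable_circle_of_eq (Or.inl h1)⟩
  · rintro v ⟨h1, h2⟩
    obtain ⟨t, ht⟩ := exists_sqn_eq_eighth (lt_one_of_mem_unstable (Or.inr (Or.inl h1))) h2
    have h3 := (mem_unstable_source_two_iff ht.le).1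
      ((planar_hasFlow.flowMap_mem_unstableSet t).2 h1)
    exact ⟨t, ht, by linarith⟩

lemma isConnected_source_circle (i : Fin 3) : IsConnected (Wu {source i} ∩ Ws unitCircle) := by
  fin_cases i
  exacts [isConnected_source_zero_circle, isConnected_source_one_circle,
    isConnected_source_two_circle]

/-- The orbit of `(0, b)`, where `b ^ 2 = 1 / 8`, meets the disc `sqn < 1 / 8` on one side of the
axis only. -/
lemma pos_of_orbit {b : ℝ} (hb : b ^ 2 = 1 / 8) {t : ℝ} (ht : sqn (φ t !₂[0, b]) < 1 / 8) :
    0 < b * φ t !₂[0, b] 1 := by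
  have hq : sqn (!₂[0, b] : E2) = 1 / 8 := by simp [sqn, hb]
  have ht0 : t ≤ 0 := by
    by_contra! h
    have := inner_le_sqn (v := !₂[0, b]) (c := 1 / 8) h.le (by rw [flow_zero, hq])
      (by norm_num) (by norm_num)
    linarith
  rw [flow_one_of_disc_atBot hq.le ht0]
  have : b * ((!₂[0, b] : E2) 1 * Real.exp t) = b ^ 2 * Real.exp t := by simp; ring
  rw [this, hb]
  positivity

lemma hasComponents_saddle_one_circle :
    HasComponents (Wu {saddle 1} ∩ Ws unitCircle) 2 := by
  set b : ℝ := √(1 / 8) with hb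
  have hb2 : b ^ 2 = 1 / 8 := Real.sq_sqrt (by norm_num)
  have hb0 : 0 < b := Real.sqrt_pos.2 (by norm_num)
  -- the two orbits, and the open sets that separate them
  set A : ℝ → Set E2 := fun b => range fun t => φ t !₂[0, b] with hA
  set U : ℝ → Set E2 := fun b => ⋃ t, φ t ⁻¹' {w | sqn w < 1 / 8 ∧ 0 < b * w 1} with hU
  have hAc : ∀ b, IsConnected (A b) := fun b =>
    isConnected_range (planar_hasFlow.continuous_flowMap _)
  have hUo : ∀ b, IsOpen (U b) := fun b => isOpen_iUnion fun t => by
    have h1 : Continuous (φ t) := planar_hasFlow.continuous_flowMap_right contDiff_one_planarField t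
    have h2 : Continuous fun w : E2 => b * w 1 := by fun_prop
    exact ((isOpen_lt continuous_sqn continuous_const).inter (isOpen_lt continuous_const h2)).preimage
      h1
  have hq : ∀ b : ℝ, b ^ 2 = 1 / 8 → sqn (!₂[0, b] : E2) = 1 / 8 := fun b hb => by simp [sqn, hb]
  have hS : ∀ b : ℝ, b ^ 2 = 1 / 8 → (!₂[0, b] : E2) ∈ Wu {saddle 1} ∩ Ws unitCircle := fun b hb =>
    ⟨(mem_unstable_saddle_one_iff (hq b hb).le).2 (by simp), mem_stable_circle_of_eq (Or.inl (hq b hb))⟩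
  have hAU : ∀ b : ℝ, b ^ 2 = 1 / 8 → A b ⊆ U b := by
    rintro b hb _ ⟨t, rfl⟩
    obtain ⟨s, hs⟩ : ∃ s, sqn (φ s !₂[0, b]) < 1 / 8 := by
      have h1 := (hS b hb).1
      rw [planar_hasFlow.mem_unstableSet, nhdsSet_singleton] at h1
      have h2 := (continuous_sqn.tendsto _).comp h1
      exact (h2.eventually (gt_mem_nhds (by simp [saddle, sqn]))).exists
    refine mem_iUnion.2 ⟨s - t, ?_⟩
    simp only [mem_preimage, mem_ofPred_eq, ← flow_add, sub_add_cancel]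
    exact ⟨hs, pos_of_orbit hb hs⟩
  have hd : ∀ b : ℝ, b ^ 2 = 1 / 8 → Disjoint (U (-b)) (A b) := by
    intro b hb
    refine disjoint_left.2 ?_
    rintro _ hv ⟨t, rfl⟩
    obtain ⟨s, hs⟩ := mem_iUnion.1 hv
    simp only [mem_preimage, mem_ofPred_eq, ← flow_add] at hs
    have := pos_of_orbit hb hs.1
    linarith [hs.2]
  have hb2' : (-b) ^ 2 = 1 / 8 := by rw [neg_sq, hb2]
  have h := hasComponents_two (hAc b) (hAc (-b)) (hUo b) (hUo (-b)) (hAU b hb2) (hAU (-b) hb2')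
    (by simpa using hd (-b) hb2') (hd b hb2)
  convert h using 1
  ext v
  constructor
  · rintro ⟨h1, h2⟩
    obtain ⟨t, ht⟩ := exists_sqn_eq_eighth (lt_one_of_mem_unstable (Or.inr (Or.inr h1))) h2
    have h3 := (mem_unstable_saddle_one_iff ht.le).1
      ((planar_hasFlow.flowMap_mem_unstableSet t).2 h1)
    have h4 : ∀ b : ℝ, φ t v 1 = b → v ∈ A b := fun b h => by
      refine ⟨-t, ?_⟩
      have : (!₂[0, b] : E2) = φ t v := ext2 (by simp [h3]) (by simp [h])
      simp only
      rw [this, planar_hasFlow.flowMap_neg_flowMap]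
    rw [sqn, h3] at ht
    have h5 : (φ t v 1 - b) * (φ t v 1 + b) = 0 := by linear_combination ht - hb2
    rcases mul_eq_zero.1 h5 with h6 | h6
    · exact Or.inl (h4 b (by linarith))
    · exact Or.inr (h4 (-b) (by linarith))
  · have h5 : ∀ b : ℝ, b ^ 2 = 1 / 8 → A b ⊆ Wu {saddle 1} ∩ Ws unitCircle := by
      rintro b hb _ ⟨t, rfl⟩
      exact ⟨(planar_hasFlow.flowMap_mem_unstableSet t).2 (hS b hb).1,
        (planar_hasFlow.flowMap_mem_stableSet t).2 (hS b hb).2⟩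
    rintro (hv | hv)
    · exact h5 b hb2 hv
    · exact h5 (-b) hb2' hv

lemma isConnected_unitCircle : IsConnected unitCircle := by
  obtain ⟨c, hc, -, -, h⟩ := isClosedOrbit_unitCircle
  rw [h]
  exact isConnected_range (hc.continuous)

/-! ### Orbits that tend to infinity -/

lemma isConnected_saddle_zero_escape : IsConnected (Wu {saddle 0} ∩ {v | 4 < sqn v}) := by
  have h := isConnected_axis (isConnected_Iio (a := (-2 : ℝ)))
  convert h using 1
  ext v
  constructor
  · rintro ⟨h1, h2 : 4 < sqn v⟩
    obtain ⟨h3, h4⟩ := (mem_unstable_saddle_zero_iff (by linarith)).1 h1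
    rw [sqn, h3] at h2
    refine ⟨h3, ?_⟩
    simp only [mem_Iio]
    nlinarith
  · rintro ⟨h1, h2 : v 0 < -2⟩
    have h3 : 4 < sqn v := by
      rw [sqn, h1]
      nlinarith
    exact ⟨(mem_unstable_saddle_zero_iff (by linarith)).2 ⟨h1, by linarith⟩, h3⟩

lemma saddle_one_escape : Wu {saddle 1} ∩ {v | 4 < sqn v} = ∅ := by
  refine eq_empty_of_forall_notMem fun v hv => ?_
  have h1 := lt_one_of_mem_unstable (Or.inr (Or.inr hv.1))
  have h2 : 4 < sqn v := hv.2
  linarith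

lemma unitCircle_escape : Wu unitCircle ∩ {v | 4 < sqn v} = ∅ := by
  rw [unstable_circle]
  refine eq_empty_of_forall_notMem fun v hv => ?_
  have h1 : sqn v = 1 := hv.1
  have h2 : 4 < sqn v := hv.2
  linarith

/-! ### Certificates for transient points -/

section Certificates

variable {n : ℕ} {M : Type*} [TopologicalSpace M] [ChartedSpace (EuclideanSpace ℝ (Fin n)) M]
  {X : (x : M) → TangentSpace (𝓡 n) x}

lemma HasFlow.isTransient_of_hasDerivAt (h : HasFlow X) {F : M → ℝ} {x : M}
    (hF : ∀ y t, 0 ≤ t → F y ≤ F (flowMap X t y)) (hc : ∀ᶠ y in 𝓝 x, ContinuousAt F y) {d : ℝ}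
    (hd : 0 < d) (hFd : HasDerivAt (fun t => F (flowMap X t x)) d 0) : IsTransient X x := by
  have h1 : ∀ᶠ t in 𝓝[>] (0 : ℝ), F x < F (flowMap X t x) := by
    have h2 := hasDerivAt_iff_tendsto_slope.1 hFd
    have h3 := (h2.eventually (lt_mem_nhds hd)).filter_mono
      (nhdsWithin_mono 0 fun t (ht : 0 < t) => ht.ne')
    filter_upwards [h3, self_mem_nhdsWithin] with t ht (ht0 : 0 < t)
    rw [slope_def_field, h.flowMap_zero, sub_zero] at ht
    have := (div_pos_iff_of_pos_right ht0).1 ht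
    linarith
  have h4 : ∀ᶠ t in 𝓝[>] (0 : ℝ), ContinuousAt F (flowMap X t x) := by
    have h5 : Tendsto (fun t => flowMap X t x) (𝓝 0) (𝓝 x) := by
      have := (h.continuous_flowMap x).tendsto 0
      rwa [h.flowMap_zero] at this
    exact (h5.eventually hc).filter_mono nhdsWithin_le_nhds
  obtain ⟨t, h1, h4, ht⟩ := (h1.and (h4.and self_mem_nhdsWithin)).exists
  exact ⟨F, hF, t, (show 0 < t from ht).le, hc.self_of_nhds, h4, h1⟩

/-- A function that increases along orbits as long as its value lies between two levels. -/
lemma HasFlow.isTransient_of_levels (h : HasFlow X) {f f' : M → ℝ} (hf : Continuous f)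
    (hd : ∀ v t, HasDerivAt (fun t => f (flowMap X t v)) (f' (flowMap X t v)) t) {a b : ℝ}
    (hpos : ∀ v, a < f v → f v < b → 0 ≤ f' v) {x : M} (ha : a < f x) (hb : f x < b)
    (hx : 0 < f' x) : IsTransient X x := by
  refine h.isTransient_of_hasDerivAt (F := fun v => max a (min (f v) b)) (fun y t ht => ?_)
    (Eventually.of_forall fun y => Continuous.continuousAt (by fun_prop)) hx ?_
  · have := clamp_le_clamp (hd y) ht (a := a) (b := b) fun r _ h1 h2 => hpos _ h1 h2
    rwa [h.flowMap_zero] at this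
  · have h1 := hd x 0
    rw [h.flowMap_zero] at h1
    refine h1.congr_of_eventuallyEq ?_
    have h2 : ContinuousAt (fun t => f (flowMap X t x)) 0 := (hd x 0).continuousAt
    filter_upwards [h2.eventually (lt_mem_nhds (show a < f (flowMap X 0 x) by
      rwa [h.flowMap_zero])), h2.eventually (gt_mem_nhds (show f (flowMap X 0 x) < b by
      rwa [h.flowMap_zero]))] with t h3 h4
    rw [min_eq_left h4.le, max_eq_right h3.le]

/-- A bounded function that increases along orbits as long as they stay in an open set to which
they never return. -/
lemma HasFlow.isTransient_of_region (h : HasFlow X) {R : Set M} (hRo : IsOpen R)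
    (hR : ∀ v s t, s ≤ t → flowMap X t v ∈ R → flowMap X s v ∈ R) {f f' : M → ℝ}
    (hf : ContinuousOn f R) (hd : ∀ v t, flowMap X t v ∈ R →
      HasDerivAt (fun t => f (flowMap X t v)) (f' (flowMap X t v)) t)
    (hpos : ∀ v ∈ R, 0 ≤ f' v) {B : ℝ} (hB : ∀ v ∈ R, f v ≤ B) {x : M} (hxR : x ∈ R)
    (hx : 0 < f' x) : IsTransient X x := by
  classical
  have hloc : ∀ y ∈ R, (fun v => if v ∈ R then f v else B) =ᶠ[𝓝 y] f := fun y hy => by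
    filter_upwards [hRo.mem_nhds hy] with v hv
    rw [if_pos hv]
  refine h.isTransient_of_hasDerivAt (F := fun v => if v ∈ R then f v else B) (fun y t ht => ?_)
    ?_ hx ?_
  · by_cases hy : flowMap X t y ∈ R
    · have hs : ∀ s ≤ t, flowMap X s y ∈ R := fun s hs => hR y s t hs hy
      have hmono : MonotoneOn (fun s => f (flowMap X s y)) (Iic t) := by
        have hi : ∀ s ∈ interior (Iic t), s ≤ t := fun s hs => by
          rw [interior_Iic] at hs
          exact hs.le
        refine monotoneOn_of_deriv_nonneg (convex_Iic t)
          (fun s hs' => (hd y s (hs s hs')).continuousAt.continuousWithinAt)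
          (fun s hs' => (hd y s (hs s (hi s hs'))).differentiableAt.differentiableWithinAt)
          fun s hs' => ?_
        rw [(hd y s (hs s (hi s hs'))).deriv]
        exact hpos _ (hs s (hi s hs'))
      have h1 := hmono (mem_Iic.2 ht) (mem_Iic.2 le_rfl) ht
      have h0 := hs 0 ht
      simp only [h.flowMap_zero] at h1 h0
      simpa only [if_pos hy, if_pos h0] using h1
    · simp only [if_neg hy]
      split_ifs with h1
      · exact hB y h1
      · exact le_rfl
  · filter_upwards [hRo.mem_nhds hxR] with y hy
    exact (hf.continuousAt (hRo.mem_nhds hy)).congr (hloc y hy).symm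
  · have h1 := hd x 0 (by rwa [h.flowMap_zero])
    rw [h.flowMap_zero] at h1
    refine h1.congr_of_eventuallyEq ?_
    have h2 : Tendsto (fun t => flowMap X t x) (𝓝 0) (𝓝 x) := by
      have := (h.continuous_flowMap x).tendsto 0
      rwa [h.flowMap_zero] at this
    exact h2.eventually (hloc x hxR)

end Certificates

/-! ### The nonwandering set of the planar field -/

lemma isTransient_outer {v : E2} (h : 4 < sqn v) : IsTransient (n := 2) planarField v :=
  planar_hasFlow.isTransient_of_levels continuous_sqn hasDerivAt_sqn_flow
    (fun _ h1 _ => (sqnRate_pos_outer h1).le) h (lt_add_one _) (sqnRate_pos_outer h)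

lemma isTransient_middle {v : E2} (h : 1 < sqn v) (h' : sqn v < 4) :
    IsTransient (n := 2) planarField v :=
  planar_hasFlow.isTransient_of_levels (f := fun v => -sqn v) (f' := fun v => -sqnRate v)
    (a := -4) (b := -1) continuous_sqn.neg (fun v t => (hasDerivAt_sqn_flow v t).neg)
    (fun v h1 h2 => by have := sqnRate_neg (v := v) (by linarith) (by linarith); linarith)
    (by linarith) (by linarith) (by have := sqnRate_neg h h'; linarith)

lemma isTransient_inner {v : E2} (h : 5 / 64 < sqn v) (h' : sqn v < 1) :
    IsTransient (n := 2) planarField v :=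
  planar_hasFlow.isTransient_of_levels continuous_sqn hasDerivAt_sqn_flow
    (fun _ h1 h2 => (sqnRate_pos_inner h1 h2).le) h h' (sqnRate_pos_inner h h')

/-- On the circle of radius `2` the cosine of the polar angle decreases. -/
lemma isTransient_four {v : E2} (h : sqn v = 4) (h' : v 1 ≠ 0) :
    IsTransient (n := 2) planarField v := by
  refine planar_hasFlow.isTransient_of_region (R := {v | 2 < sqn v})
    (isOpen_lt continuous_const continuous_sqn) (fun v s t hst ht => ?_)
    (f := fun v => -cosAngle v) (f' := fun v => swing (sqn v) * v 1 ^ 2 / √(sqn v)) ?_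
    (fun v t ht => ?_) (fun v hv => ?_) (B := 1) (fun v hv => ?_) ?_ ?_
  · simp only [mem_ofPred_eq] at ht ⊢
    have := middle_le_sqn hst (min_le_left (sqn (φ t v)) 4)
      (lt_min (by linarith) (by norm_num)) (min_le_right _ _)
    exact (lt_min ht (by norm_num)).trans_le this
  · refine (ContinuousOn.div (by fun_prop) (continuous_sqn.sqrt).continuousOn fun v hv => ?_).neg
    exact (Real.sqrt_pos.2 (by linarith [mem_ofPred_eq ▸ hv])).ne'
  · exact (hasDerivAt_cosAngle (show 2 ≤ sqn (φ t v) from le_of_lt ht)).neg.congr_deriv (by simp)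
  · have : 0 ≤ swing (sqn v) := swing_nonneg
    positivity
  · have hq : 0 < sqn v := by
      have : 2 < sqn v := hv
      linarith
    have h1 : cosAngle v ^ 2 ≤ 1 := by
      have h2 := sq_one_eq hq
      have h3 : 0 ≤ sqn v * (1 - cosAngle v ^ 2) := h2 ▸ sq_nonneg _
      have := nonneg_of_mul_nonneg_right h3 hq
      linarith
    nlinarith
  · simp only [mem_ofPred_eq]
    linarith
  · simp only
    rw [h, swing_of_mem (by norm_num) (by norm_num)]
    positivity

/-- Near the origin the field is the gradient of `y ^ 2 / 2 + 4 * x ^ 4 - x ^ 2 / 2`. -/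
lemma isTransient_disc {v : E2} (h : sqn v < 1 / 8) (h' : planarField v ≠ 0) :
    IsTransient (n := 2) planarField v := by
  refine planar_hasFlow.isTransient_of_region (R := {v | sqn v < 1 / 8})
    (isOpen_lt continuous_sqn continuous_const) (fun v s t hst ht => ?_)
    (f := fun v => v 1 ^ 2 / 2 + 4 * v 0 ^ 4 - v 0 ^ 2 / 2)
    (f' := fun v => planarField v 0 ^ 2 + planarField v 1 ^ 2) (by fun_prop)
    (fun v t ht => ?_) (fun v hv => by positivity) (B := 1) (fun v hv => ?_) h ?_
  · simp only [mem_ofPred_eq] at ht ⊢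
    have := sqn_le_inner hst (le_max_left (sqn (φ t v)) (5 / 64)) (le_max_right _ _)
      (max_lt (by linarith) (by norm_num))
    exact this.trans_lt (max_lt ht (by norm_num))
  · have h0 := hasDerivAt_flow_coord v 0 t
    have h1 := hasDerivAt_flow_coord v 1 t
    refine ((((h1.pow 2).div_const 2).add ((h0.pow 4).const_mul 4)).sub
      ((h0.pow 2).div_const 2)).congr_deriv ?_
    rw [planarField_of_disc (le_of_lt ht)]
    simp
    ring
  · simp only [mem_ofPred_eq, sqn] at hv
    nlinarith [sq_nonneg (v 0), sq_nonneg (v 1), mul_nonneg (sq_nonneg (v 0)) (sq_nonneg (v 0))]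
  · by_contra hn
    have h1 : planarField v 0 ^ 2 + planarField v 1 ^ 2 = 0 :=
      le_antisymm (not_lt.1 hn) (by positivity)
    refine h' (ext2 ?_ ?_)
    · simp only [PiLp.zero_apply]
      nlinarith [sq_nonneg (planarField v 0), sq_nonneg (planarField v 1)]
    · simp only [PiLp.zero_apply]
      nlinarith [sq_nonneg (planarField v 0), sq_nonneg (planarField v 1)]

lemma isTransient_planar {v : E2} (h : planarField v ≠ 0) (h' : v ∉ unitCircle) :
    IsTransient (n := 2) planarField v := by
  rcases lt_trichotomy (sqn v) 1 with h1 | h1 | h1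
  · rcases lt_or_ge (sqn v) (1 / 8) with h2 | h2
    · exact isTransient_disc h2 h
    · exact isTransient_inner (by linarith) h1
  · exact absurd h1 h'
  · rcases lt_trichotomy (sqn v) 4 with h2 | h2 | h2
    · exact isTransient_middle h1 h2
    · refine isTransient_four h2 fun h3 => h (planarField_eq_zero_iff.2 ?_)
      rcases le_total 0 (v 0) with h4 | h4
      · exact Or.inl ⟨0, (eq_source_zero h2 h3 h4).symm⟩
      · exact Or.inr ⟨0, (eq_saddle_zero h2 h3 h4).symm⟩
    · exact isTransient_outer h2

lemma closedOrbits_planar : {c | IsClosedOrbit (n := 2) planarField c} = {unitCircle} :=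
  planar_hasFlow.closedOrbits_eq isClosedOrbit_unitCircle fun _ => isTransient_planar

lemma isCritical_planar_iff {β : Set E2} : IsCritical (n := 2) planarField β ↔
    (∃ i, β = {source i}) ∨ (∃ i, β = {saddle i}) ∨ β = unitCircle := by
  constructor
  · rintro (⟨p, hp, rfl⟩ | hβ)
    · rcases planarField_eq_zero_iff.1 hp with ⟨i, rfl⟩ | ⟨i, rfl⟩
      · exact Or.inl ⟨i, rfl⟩
      · exact Or.inr (Or.inl ⟨i, rfl⟩)
    · refine Or.inr (Or.inr ?_)
      have : β ∈ ({unitCircle} : Set (Set E2)) := closedOrbits_planar ▸ hβ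
      exact this
  · rintro (⟨i, rfl⟩ | ⟨i, rfl⟩ | rfl)
    exacts [isCritical_source i, isCritical_saddle i, isCritical_unitCircle]

/-! ### Transversality of the planar field -/

lemma span_eq_top_of_single {n : ℕ} {S : Set (EuclideanSpace ℝ (Fin n))}
    (h : ∀ i, EuclideanSpace.single i (1 : ℝ) ∈ Submodule.span ℝ S) : Submodule.span ℝ S = ⊤ := by
  rw [eq_top_iff, ← (EuclideanSpace.basisFun (Fin n) ℝ).toBasis.span_eq, Submodule.span_le]
  rintro _ ⟨i, rfl⟩
  simpa using h i

lemma unstable_source_zero_mem_nhds {v : E2} (h : 2 < sqn v) (h' : v 1 ≠ 0 ∨ 0 < v 0) :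
    Wu {source 0} ∈ 𝓝 v := by
  have h1 : Continuous fun v : E2 => v 0 := by fun_prop
  have h2 : Continuous fun v : E2 => v 1 := by fun_prop
  have h3 : IsOpen {v : E2 | 2 < sqn v ∧ (v 1 ≠ 0 ∨ 0 < v 0)} :=
    (isOpen_lt continuous_const continuous_sqn).inter
      ((isOpen_ne_fun h2 continuous_const).union (isOpen_lt continuous_const h1))
  refine mem_of_superset (h3.mem_nhds ⟨h, h'⟩) fun w hw => ?_
  rw [mem_unstable_source_zero_iff hw.1.le]
  rintro ⟨h4, h5⟩
  rcases hw.2 with h6 | h6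
  · exact h6 h4
  · linarith

lemma unstable_source_one_mem_nhds {v : E2} (h : sqn v < 1 / 8) (h' : 0 < v 0) :
    Wu {source 1} ∈ 𝓝 v := by
  have h1 : Continuous fun v : E2 => v 0 := by fun_prop
  exact mem_of_superset (((isOpen_lt continuous_sqn continuous_const).inter
    (isOpen_lt continuous_const h1)).mem_nhds ⟨h, h'⟩) fun w hw =>
      (mem_unstable_source_one_iff (le_of_lt hw.1)).2 hw.2

lemma unstable_source_two_mem_nhds {v : E2} (h : sqn v < 1 / 8) (h' : v 0 < 0) :
    Wu {source 2} ∈ 𝓝 v := by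
  have h1 : Continuous fun v : E2 => v 0 := by fun_prop
  exact mem_of_superset (((isOpen_lt continuous_sqn continuous_const).inter
    (isOpen_lt h1 continuous_const)).mem_nhds ⟨h, h'⟩) fun w hw =>
      (mem_unstable_source_two_iff (le_of_lt hw.1)).2 hw.2

lemma unstable_source_mem_nhds (i : Fin 3) : Wu {source i} ∈ 𝓝 (source i) := by
  fin_cases i
  · exact unstable_source_zero_mem_nhds (by norm_num [sqn_source_zero])
      (Or.inr (by norm_num [source]))
  · exact unstable_source_one_mem_nhds (by norm_num [sqn_source_one]) (by norm_num [source])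
  · exact unstable_source_two_mem_nhds (sqn_source_two.trans_lt (by norm_num)) (by simp [source])

lemma isOpen_stable_circle : IsOpen (Ws unitCircle) := by
  have h0 : Continuous fun v : E2 => v 0 := by fun_prop
  have h1 : Continuous fun v : E2 => v 1 := by fun_prop
  have h : IsOpen ({v : E2 | sqn v < 4} ∩ {v : E2 | v 1 = 0 ∧ |v 0| ≤ 1 / 4}ᶜ) :=
    (isOpen_lt continuous_sqn continuous_const).inter
      ((isClosed_eq h1 continuous_const).inter
        (isClosed_le h0.abs continuous_const)).isOpen_compl
  convert h using 1
  ext v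
  exact mem_stable_circle_iff

/-- At a saddle the tangent spaces of its stable and unstable manifolds are complementary. -/
lemma span_tangentVectors_saddle (j : Fin 2) :
    Submodule.span ℝ (tangentVectors 2 (Wu {saddle j}) (saddle j) ∪
      tangentVectors 2 (Ws {saddle j}) (saddle j)) = ⊤ := by
  refine span_eq_top_of_single fun i => ?_
  have hline : Continuous fun t : ℝ => (!₂[-2 + t, 0] : E2) :=
    continuous_mk2 (by fun_prop) (by fun_prop)
  have hy : Continuous fun t : ℝ => (!₂[0, t] : E2) := continuous_mk2 (by fun_prop) (by fun_prop)
  fin_cases j <;> fin_cases i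
  · refine Submodule.subset_span (Or.inl (mem_tangentVectors_of_line ?_))
    have h1 : ∀ᶠ t in 𝓝 (0 : ℝ), 2 < sqn (!₂[-2 + t, 0] : E2) :=
      (continuous_sqn.comp hline).continuousAt.eventually (lt_mem_nhds (by norm_num [sqn]))
    filter_upwards [h1, gt_mem_nhds (show (0 : ℝ) < 2 by norm_num)] with t ht ht'
    have e : saddle ((fun i => i) ⟨0, by omega⟩) + t • EuclideanSpace.single
        ((fun i => i) ⟨0, by omega⟩) (1 : ℝ) = (!₂[-2 + t, 0] : E2) :=
      ext2 (by simp [saddle]) (by simp [saddle])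
    rw [e]
    exact (mem_unstable_saddle_zero_iff ht.le).2 ⟨by simp, by simp; linarith⟩
  · have h1 : (2 : ℝ) • EuclideanSpace.single (1 : Fin 2) (1 : ℝ) ∈
        tangentVectors 2 (Ws {saddle 0}) (saddle 0) := by
      refine mem_tangentVectors (c := fun t => !₂[-2 * Real.cos t, 2 * Real.sin t])
        (ext2 (by simp [saddle]) (by simp [saddle])) ?_ ?_ ?_
      · rw [contDiff_euclidean]
        intro i
        fin_cases i
        · exact contDiff_const.mul Real.contDiff_cos
        · exact contDiff_const.mul Real.contDiff_sin
      · have h2 : ∀ᶠ t in 𝓝 (0 : ℝ), 0 < Real.cos t :=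
          Real.continuous_cos.continuousAt.eventually (lt_mem_nhds (by simp))
        filter_upwards [h2] with t ht
        rw [mem_stable_saddle_zero_iff]
        refine ⟨?_, fun h => ?_⟩
        · simp only [sqn, Matrix.cons_val_zero, Matrix.cons_val_one, Matrix.cons_val_fin_one]
          linear_combination 4 * Real.sin_sq_add_cos_sq t
        · have := congrArg (fun w : E2 => w 0) h
          simp [source] at this
          linarith
      · refine hasDerivAt_euclidean fun i => ?_
        fin_cases i
        · simpa using (Real.hasDerivAt_cos 0).const_mul (-2)
        · simpa using (Real.hasDerivAt_sin 0).const_mul 2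
    have h2 := Submodule.smul_mem _ (2⁻¹ : ℝ) (Submodule.subset_span (R := ℝ)
      (subset_union_right (s := tangentVectors 2 (Wu {saddle 0}) (saddle 0)) h1))
    rwa [smul_smul, inv_mul_cancel₀ two_ne_zero, one_smul] at h2
  · refine Submodule.subset_span (Or.inr (mem_tangentVectors_of_line ?_))
    have h1 : ∀ᶠ t in 𝓝 (0 : ℝ), |t| < 1 / 4 :=
      continuous_abs.continuousAt.eventually (gt_mem_nhds (by norm_num))
    filter_upwards [h1] with t ht
    rw [Fin.mk_one, mem_stable_saddle_one_iff]
    simpa [saddle] using ht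
  · refine Submodule.subset_span (Or.inl (mem_tangentVectors_of_line ?_))
    have h1 : ∀ᶠ t in 𝓝 (0 : ℝ), sqn (!₂[0, t] : E2) < 1 / 8 :=
      (continuous_sqn.comp hy).continuousAt.eventually (gt_mem_nhds (by norm_num [sqn]))
    filter_upwards [h1] with t ht
    have e : saddle 1 + t • EuclideanSpace.single 1 (1 : ℝ) = (!₂[0, t] : E2) :=
      ext2 (by simp [saddle]) (by simp [saddle])
    rw [Fin.mk_one, e]
    exact (mem_unstable_saddle_one_iff ht.le).2 (by simp)

lemma eq_saddle_of_unstable_stable {v : E2} {β β' : Set E2} (hβ : IsCritical (n := 2) planarField β)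
    (hβ' : IsCritical (n := 2) planarField β') (hv : v ∈ Wu β ∩ Ws β') :
    Wu β ∈ 𝓝 v ∨ Ws β' ∈ 𝓝 v ∨ ∃ j, v = saddle j ∧ β = {saddle j} ∧ β' = {saddle j} := by
  have key : ∀ i, Wu {source i} ∈ 𝓝 v → Wu β ∈ 𝓝 v := fun i h => by
    rwa [eq_of_mem_unstable hβ (isCritical_source i) hv.1 (mem_of_mem_nhds h)]
  have key' : ∀ j, v = saddle j → β = {saddle j} := fun j h =>
    eq_of_mem_unstable hβ (isCritical_saddle j) hv.1
      (h ▸ planar_hasFlow.subset_unstableSet (isCritical_saddle j) rfl)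
  rcases isCritical_planar_iff.1 hβ' with ⟨i, rfl⟩ | ⟨j, rfl⟩ | rfl
  · refine Or.inl (key i ?_)
    rw [mem_stable_source_iff.1 hv.2]
    exact unstable_source_mem_nhds i
  · by_cases hj : v = saddle j
    · exact Or.inr (Or.inr ⟨j, hj, key' j hj, rfl⟩)
    · left
      fin_cases j
      · have h1 := mem_stable_saddle_zero_iff.1 hv.2
        refine key 0 (unstable_source_zero_mem_nhds (by linarith [h1.1]) (Or.inl fun h2 => ?_))
        rcases le_total 0 (v 0) with h4 | h4
        · exact h1.2 (eq_source_zero h1.1 h2 h4)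
        · exact hj (eq_saddle_zero h1.1 h2 h4)
      · have h1 := mem_stable_saddle_one_iff.1 hv.2
        have h2 : sqn v < 1 / 8 := by
          rw [sqn, h1.1, ← sq_abs]
          nlinarith [abs_nonneg (v 0), h1.2]
        rcases lt_trichotomy (v 0) 0 with h3 | h3 | h3
        · exact key 2 (unstable_source_two_mem_nhds h2 h3)
        · exact absurd (ext2 (by simp [saddle, h3]) (by simp [saddle, h1.1])) hj
        · exact key 1 (unstable_source_one_mem_nhds h2 h3)
  · exact Or.inr (Or.inl (isOpen_stable_circle.mem_nhds hv.2))

lemma span_eq_top_of_mem_nhds {S S' : Set E2} {v : E2} (h : S ∈ 𝓝 v ∨ S' ∈ 𝓝 v) :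
    Submodule.span ℝ (tangentVectors 2 S v ∪ tangentVectors 2 S' v) = ⊤ := by
  refine eq_top_iff.2 fun w _ => Submodule.subset_span ?_
  rcases h with h | h
  · exact Or.inl (mem_tangentVectors_of_mem_nhds h w)
  · exact Or.inr (mem_tangentVectors_of_mem_nhds h w)

lemma transverse_planar {β β' : Set E2} (hβ : IsCritical (n := 2) planarField β)
    (hβ' : IsCritical (n := 2) planarField β') : Transverse 2 (Wu β) (Ws β') := by
  intro v hv
  rcases eq_saddle_of_unstable_stable hβ hβ' hv with h | h | ⟨j, rfl, rfl, rfl⟩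
  · exact span_eq_top_of_mem_nhds (Or.inl h)
  · exact span_eq_top_of_mem_nhds (Or.inr h)
  · exact span_tangentVectors_saddle j

/-! ### Hyperbolicity -/

section Hyperbolic

variable {n : ℕ} {M : Type*} [TopologicalSpace M] [ChartedSpace (EuclideanSpace ℝ (Fin n)) M]
  {X : (x : M) → TangentSpace (𝓡 n) x}

lemma isHyperbolicRest_of_eigenvalues {p : M} {a : Fin n → ℝ}
    (h : eigenvaluesC (linearization X p) = Finset.univ.val.map fun i => (a i : ℂ))
    (ha : ∀ i, a i ≠ 0) : IsHyperbolicRest X p := by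
  intro μ hμ
  rw [h, Multiset.mem_map] at hμ
  obtain ⟨i, -, rfl⟩ := hμ
  simpa using ha i

lemma restIndex_of_eigenvalues {p : M} {a : Fin n → ℝ}
    (h : eigenvaluesC (linearization X p) = Finset.univ.val.map fun i => (a i : ℂ)) :
    restIndex X p = (Finset.univ.filter fun i => 0 < a i).card := by
  classical
  rw [restIndex, h, Multiset.countP_map]
  simp [Finset.card_def]

lemma isHyperbolicOrbit_of_eigenvalues {γ : Set M} {a : Fin n → ℝ} {i₀ : Fin n}
    (h : ∀ x ∈ γ, eigenvaluesC (monodromy X x) = Finset.univ.val.map fun i => (a i : ℂ))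
    (h1 : a i₀ = 1) (ha : ∀ i, i ≠ i₀ → 0 ≤ a i ∧ a i < 1) :
    IsHyperbolicOrbit X γ ∧ HasOrbitIndex X γ 0 := by
  classical
  have hle : ∀ i, 0 ≤ a i ∧ a i ≤ 1 := fun i => by
    by_cases hi : i = i₀
    · rw [hi, h1]; exact ⟨zero_le_one, le_rfl⟩
    · exact ⟨(ha i hi).1, (ha i hi).2.le⟩
  have hn : ∀ i, ‖(a i : ℂ)‖ = a i := fun i => by
    rw [Complex.norm_real, Real.norm_of_nonneg (hle i).1]
  refine ⟨fun x hx => ?_, fun x hx => ?_⟩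
  · rw [h x hx]
    constructor
    · rw [Multiset.count_map]
      have : Finset.univ.filter (fun i => (1 : ℂ) = (a i : ℂ)) = {i₀} := by
        ext i
        simp only [Finset.mem_filter, Finset.mem_univ, true_and, Finset.mem_singleton]
        constructor
        · intro hi
          by_contra hne
          have h2 : (1 : ℝ) = a i := by exact_mod_cast hi
          linarith [(ha i hne).2]
        · rintro rfl
          simp [h1]
      change (Finset.univ.filter (fun i => (1 : ℂ) = (a i : ℂ))).card = 1
      rw [this, Finset.card_singleton]
    · intro μ hμ hne
      rw [Multiset.mem_map] at hμ
      obtain ⟨i, -, rfl⟩ := hμ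
      rw [hn]
      refine fun h2 => hne ?_
      rw [h2, Complex.ofReal_one]
  · rw [h x hx, Multiset.countP_map]
    have : Finset.univ.filter (fun i => 1 < ‖(a i : ℂ)‖) = ∅ := by
      refine Finset.filter_false_of_mem fun i _ => ?_
      rw [hn]
      exact not_lt.2 (hle i).2
    change (Finset.univ.filter (fun i => 1 < ‖(a i : ℂ)‖)).card = 0
    rw [this, Finset.card_empty]

lemma fderiv_apply_of_hasDerivAt {X : EuclideanSpace ℝ (Fin n) → EuclideanSpace ℝ (Fin n)}
    {p w v : EuclideanSpace ℝ (Fin n)} (hX : DifferentiableAt ℝ X p)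
    (h : HasDerivAt (fun t : ℝ => X (p + t • w)) v 0) : fderiv ℝ X p w = v := by
  have h1 : HasDerivAt (fun t : ℝ => p + t • w) w 0 := by
    simpa using ((hasDerivAt_id (0 : ℝ)).smul_const w).const_add p
  have h2 : HasFDerivAt X (fderiv ℝ X p) (p + (0 : ℝ) • w) := by
    simpa using hX.hasFDerivAt
  exact (h2.comp_hasDerivAt 0 h1).unique h

end Hyperbolic

/-! ### Eigenvalues of the planar field -/

lemma hasDerivAt_planarField_of_disc {p w : E2} (hp : sqn p < 1 / 8) :
    HasDerivAt (fun t : ℝ => planarField (p + t • w)) !₂[(48 * p 0 ^ 2 - 1) * w 0, w 1] 0 := by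
  have hc : Continuous fun t : ℝ => sqn (p + t • w) := continuous_sqn.comp (by fun_prop)
  have he : (fun t : ℝ => planarField (p + t • w)) =ᶠ[𝓝 0] fun t =>
      !₂[(p 0 + t * w 0) * (16 * (p 0 + t * w 0) ^ 2 - 1), p 1 + t * w 1] := by
    filter_upwards [hc.continuousAt.eventually (gt_mem_nhds (show sqn (p + (0 : ℝ) • w) < 1 / 8 by
      simpa using hp))] with t ht
    rw [planarField_of_disc ht.le]
    simp
  refine HasDerivAt.congr_of_eventuallyEq ?_ he
  have h : ∀ i, HasDerivAt (fun t => p i + t * w i) (w i) 0 := fun i => by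
    simpa using ((hasDerivAt_id (0 : ℝ)).mul_const (w i)).const_add (p i)
  refine hasDerivAt_euclidean fun i => ?_
  fin_cases i
  · refine ((h 0).mul ((((h 0).pow 2).const_mul 16).sub_const 1)).congr_deriv ?_
    simp
    ring
  · simpa using h 1

lemma hasDerivAt_planarField_of_four {p w : E2} (hp : sqn p = 4) :
    HasDerivAt (fun t : ℝ => planarField (p + t • w))
      !₂[(p 0 * w 0 + p 1 * w 1) / 2 * p 0 - 2 * p 1 * w 1,
        (p 0 * w 0 + p 1 * w 1) / 2 * p 1 + w 1 * p 0 + p 1 * w 0] 0 := by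
  have hc : Continuous fun t : ℝ => sqn (p + t • w) := continuous_sqn.comp (by fun_prop)
  have he : (fun t : ℝ => planarField (p + t • w)) =ᶠ[𝓝 0] fun t =>
      !₂[(((p 0 + t * w 0) ^ 2 + (p 1 + t * w 1) ^ 2) / 4 - 1) * (p 0 + t * w 0) -
          (p 1 + t * w 1) * (p 1 + t * w 1),
        (((p 0 + t * w 0) ^ 2 + (p 1 + t * w 1) ^ 2) / 4 - 1) * (p 1 + t * w 1) +
          (p 1 + t * w 1) * (p 0 + t * w 0)] := by
    have h0 : sqn (p + (0 : ℝ) • w) = 4 := by simpa using hp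
    filter_upwards [hc.continuousAt.eventually (gt_mem_nhds (show sqn (p + (0 : ℝ) • w) < 5 by
      rw [h0]; norm_num)), hc.continuousAt.eventually (lt_mem_nhds
      (show 3 < sqn (p + (0 : ℝ) • w) by rw [h0]; norm_num))] with t ht ht'
    rw [planarField_of_two_le (by linarith), radial_of_mem (by linarith) ht.le,
      swing_of_mem ht'.le ht.le]
    simp [sqn]
  refine HasDerivAt.congr_of_eventuallyEq ?_ he
  have h : ∀ i, HasDerivAt (fun t => p i + t * w i) (w i) 0 := fun i => by
    simpa using ((hasDerivAt_id (0 : ℝ)).mul_const (w i)).const_add (p i)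
  have hr := (((((h 0).pow 2).add ((h 1).pow 2)).div_const 4).sub_const 1)
  unfold sqn at hp
  refine hasDerivAt_euclidean fun i => ?_
  fin_cases i
  · refine ((hr.mul (h 0)).sub ((h 1).mul (h 1))).congr_deriv ?_
    simp
    linear_combination w 0 / 4 * hp
  · refine ((hr.mul (h 1)).add ((h 1).mul (h 0))).congr_deriv ?_
    simp
    linear_combination w 1 / 4 * hp

lemma differentiableAt_planarField (p : E2) : DifferentiableAt ℝ planarField p :=
  (contDiff_planarField.differentiable (by simp)).differentiableAt

/-- The eigenvalues at the sources. -/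
def sourceRates : Fin 3 → Fin 2 → ℝ := ![![2, 2], ![2, 1], ![2, 1]]

/-- The eigenvalues at the saddles. -/
def saddleRates : Fin 2 → Fin 2 → ℝ := ![![2, -2], ![-1, 1]]

lemma fderiv_planarField_source (i : Fin 3) (k : Fin 2) :
    fderiv ℝ planarField (source i) (EuclideanSpace.single k 1) =
      sourceRates i k • EuclideanSpace.single k 1 := by
  refine fderiv_apply_of_hasDerivAt (differentiableAt_planarField _) ?_
  fin_cases i
  · refine (hasDerivAt_planarField_of_four sqn_source_zero).congr_deriv ?_
    fin_cases k <;> apply ext2 <;> simp [source, sourceRates]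
  · refine (hasDerivAt_planarField_of_disc (sqn_source_one.trans_lt (by norm_num))).congr_deriv ?_
    fin_cases k <;> apply ext2 <;> simp [source, sourceRates]; norm_num
  · refine (hasDerivAt_planarField_of_disc (sqn_source_two.trans_lt (by norm_num))).congr_deriv ?_
    fin_cases k <;> apply ext2 <;> simp [source, sourceRates]; norm_num

lemma sqn_saddle_zero : sqn (saddle 0) = 4 := by norm_num [saddle, sqn]
lemma sqn_saddle_one : sqn (saddle 1) = 0 := by norm_num [saddle, sqn]

lemma fderiv_planarField_saddle (i : Fin 2) (k : Fin 2) :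
    fderiv ℝ planarField (saddle i) (EuclideanSpace.single k 1) =
      saddleRates i k • EuclideanSpace.single k 1 := by
  refine fderiv_apply_of_hasDerivAt (differentiableAt_planarField _) ?_
  fin_cases i
  · refine (hasDerivAt_planarField_of_four sqn_saddle_zero).congr_deriv ?_
    fin_cases k <;> apply ext2 <;> simp [saddle, saddleRates]
  · refine (hasDerivAt_planarField_of_disc (sqn_saddle_one.trans_lt (by norm_num))).congr_deriv ?_
    fin_cases k <;> apply ext2 <;> simp [saddle, saddleRates]

lemma eigenvaluesC_planar_source (i : Fin 3) :
    eigenvaluesC (linearization (n := 2) planarField (source i)) =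
      Finset.univ.val.map fun k => (sourceRates i k : ℂ) := by
  rw [linearization_eq]
  exact eigenvaluesC_of_single (fderiv_planarField_source i)

lemma eigenvaluesC_planar_saddle (i : Fin 2) :
    eigenvaluesC (linearization (n := 2) planarField (saddle i)) =
      Finset.univ.val.map fun k => (saddleRates i k : ℂ) := by
  rw [linearization_eq]
  exact eigenvaluesC_of_single (fderiv_planarField_saddle i)

lemma sourceRates_pos (i : Fin 3) (k : Fin 2) : 0 < sourceRates i k := by
  fin_cases i <;> fin_cases k <;> simp [sourceRates]

lemma saddleRates_ne_zero (i : Fin 2) (k : Fin 2) : saddleRates i k ≠ 0 := by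
  fin_cases i <;> fin_cases k <;> simp [saddleRates]

lemma restIndex_planar_source (i : Fin 3) : restIndex (n := 2) planarField (source i) = 2 := by
  rw [restIndex_of_eigenvalues (eigenvaluesC_planar_source i),
    Finset.filter_true_of_mem fun k _ => sourceRates_pos i k]
  simp

lemma restIndex_planar_saddle (i : Fin 2) : restIndex (n := 2) planarField (saddle i) = 1 := by
  rw [restIndex_of_eigenvalues (eigenvaluesC_planar_saddle i), Finset.card_filter,
    Fin.sum_univ_two]
  fin_cases i <;> simp [saddleRates]

/-! ### The Poincaré map of the planar closed orbit -/

/-- The growth factor of the squared radius over time `t` near the closed orbit is the inverse of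
this quantity. -/
def shrink (q t : ℝ) : ℝ := q + (1 - q) * Real.exp (-(2 * t))

lemma shrink_mem {q t : ℝ} (h : 9 / 10 < q) (h' : q < 11 / 10) (ht : -(1 / 20) < t) :
    q / shrink q t ∈ Icc (1 / 2 : ℝ) (3 / 2) ∧ 0 < shrink q t := by
  have h0 := Real.exp_pos (-(2 * t))
  have h1 : Real.exp (-(2 * t)) ≤ 10 / 9 := by
    have h2 : 1 - 1 / 10 ≤ Real.exp (-(1 / 10)) := Real.one_sub_le_exp_neg _
    have h3 : Real.exp (-(2 * t)) ≤ Real.exp (1 / 10) := Real.exp_le_exp.2 (by linarith)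
    have h4 : Real.exp (1 / 10) * Real.exp (-(1 / 10)) = 1 := by
      rw [← Real.exp_add]; simp
    have := Real.exp_pos (1 / 10 : ℝ)
    nlinarith
  have hb : |(1 - q) * Real.exp (-(2 * t))| ≤ 1 / 9 := by
    rw [abs_mul, abs_of_pos h0]
    have : |1 - q| ≤ 1 / 10 := abs_le.2 ⟨by linarith, by linarith⟩
    nlinarith [abs_nonneg (1 - q)]
  have h5 := abs_le.1 hb
  have hpos : 0 < shrink q t := by unfold shrink; linarith
  refine ⟨⟨?_, ?_⟩, hpos⟩
  · rw [le_div_iff₀ hpos]; unfold shrink; linarith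
  · rw [div_le_iff₀ hpos]; unfold shrink; linarith

/-- The flow near the closed orbit. -/
def annulusCurve (v : E2) (t : ℝ) : E2 :=
  !₂[(v 0 * Real.cos t - v 1 * Real.sin t) * (√(shrink (sqn v) t))⁻¹,
    (v 0 * Real.sin t + v 1 * Real.cos t) * (√(shrink (sqn v) t))⁻¹]

lemma sqn_annulusCurve {v : E2} {t : ℝ} (h : 0 < shrink (sqn v) t) :
    sqn (annulusCurve v t) = sqn v / shrink (sqn v) t := by
  have h1 : (√(shrink (sqn v) t))⁻¹ ^ 2 = (shrink (sqn v) t)⁻¹ := by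
    rw [inv_pow, Real.sq_sqrt h.le]
  simp only [annulusCurve, sqn, Matrix.cons_val_zero, Matrix.cons_val_one,
    Matrix.cons_val_fin_one] at h1 ⊢
  rw [div_eq_mul_inv, ← h1]
  linear_combination (v 0 ^ 2 + v 1 ^ 2) * (√(shrink (v 0 ^ 2 + v 1 ^ 2) t))⁻¹ ^ 2 *
    Real.sin_sq_add_cos_sq t

lemma hasDerivAt_annulusCurve {v : E2} (h : 9 / 10 < sqn v) (h' : sqn v < 11 / 10) {t : ℝ}
    (ht : -(1 / 20) < t) : HasDerivAt (annulusCurve v) (planarField (annulusCurve v t)) t := by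
  obtain ⟨⟨h1, h2⟩, h3⟩ := shrink_mem h h' ht
  have hq := sqn_annulusCurve h3
  rw [planarField_of_annulus (by rwa [hq]) (by rwa [hq]), hq]
  set D := shrink (sqn v) t with hD
  have hs : 0 < √D := Real.sqrt_pos.2 h3
  have hss : √D ^ 2 = D := Real.sq_sqrt h3.le
  have hd : HasDerivAt (fun t => shrink (sqn v) t) (-(2 * (D - sqn v))) t := by
    have h4 := ((((hasDerivAt_id t).const_mul 2).neg.exp).const_mul (1 - sqn v)).const_add (sqn v)
    refine h4.congr_deriv ?_
    simp [hD, shrink]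
    ring
  have hi : HasDerivAt (fun t => (√(shrink (sqn v) t))⁻¹) ((1 - sqn v / D) * (√D)⁻¹) t := by
    refine ((hd.sqrt h3.ne').inv hs.ne').congr_deriv ?_
    rw [← hD, hss]
    field_simp
  have hsin := Real.hasDerivAt_sin t
  have hcos := Real.hasDerivAt_cos t
  refine hasDerivAt_euclidean fun i => ?_
  fin_cases i
  · refine (((hcos.const_mul (v 0)).sub (hsin.const_mul (v 1))).mul hi).congr_deriv ?_
    simp [annulusCurve, ← hD]
    ring
  · refine (((hsin.const_mul (v 0)).add (hcos.const_mul (v 1))).mul hi).congr_deriv ?_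
    simp [annulusCurve, ← hD]
    ring

lemma flow_eq_annulusCurve {v : E2} (h : 9 / 10 < sqn v) (h' : sqn v < 11 / 10) {t : ℝ}
    (ht : -(1 / 20) < t) : φ t v = annulusCurve v t := by
  have h0 : annulusCurve v 0 = v := by
    apply ext2 <;> simp [annulusCurve, shrink]
  refine eq_of_hasDerivAt contDiff_one_planarField (a := -(1 / 20)) (b := max t 0 + 1) (t₀ := 0)
    ⟨by norm_num, by linarith [le_max_right t 0]⟩
    (fun s _ => planar_hasFlow.hasDerivAt v s)
    (fun s hs => hasDerivAt_annulusCurve h h' hs.1) (by rw [h0, flow_zero])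
    ⟨ht, by linarith [le_max_left t 0]⟩

/-- The time `2π` map near the closed orbit. -/
lemma flow_two_pi {v : E2} (h : 9 / 10 < sqn v) (h' : sqn v < 11 / 10) :
    φ (2 * Real.pi) v = (√(shrink (sqn v) (2 * Real.pi)))⁻¹ • v := by
  rw [flow_eq_annulusCurve h h' (by linarith [Real.pi_pos])]
  apply ext2 <;> simp [annulusCurve] <;> ring

/-- The multipliers of the closed orbit. -/
def circleRates : Fin 2 → ℝ := ![1, Real.exp (-(4 * Real.pi))]

/-- Vectors tangent and normal to the circle at `v`. -/
def circleFrame (v : E2) : Fin 2 → E2 := ![!₂[-v 1, v 0], v]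

lemma hasDerivAt_flow_two_pi {v : E2} (hv : sqn v = 1) (w : E2) :
    HasDerivAt (fun t : ℝ => φ (2 * Real.pi) (v + t • w))
      (w - ((v 0 * w 0 + v 1 * w 1) * (1 - Real.exp (-(4 * Real.pi)))) • v) 0 := by
  have hc : Continuous fun t : ℝ => sqn (v + t • w) := continuous_sqn.comp (by fun_prop)
  have h0 : sqn (v + (0 : ℝ) • w) = 1 := by simpa using hv
  have he : (fun t : ℝ => φ (2 * Real.pi) (v + t • w)) =ᶠ[𝓝 0] fun t =>
      (√(shrink (sqn (v + t • w)) (2 * Real.pi)))⁻¹ • (v + t • w) := by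
    filter_upwards [hc.continuousAt.eventually (gt_mem_nhds
      (show sqn (v + (0 : ℝ) • w) < 11 / 10 by rw [h0]; norm_num)),
      hc.continuousAt.eventually (lt_mem_nhds
      (show 9 / 10 < sqn (v + (0 : ℝ) • w) by rw [h0]; norm_num))] with t ht ht'
    exact flow_two_pi ht' ht
  refine HasDerivAt.congr_of_eventuallyEq ?_ he
  have hl : ∀ i, HasDerivAt (fun t => v i + t * w i) (w i) 0 := fun i => by
    simpa using ((hasDerivAt_id (0 : ℝ)).mul_const (w i)).const_add (v i)
  have hq : HasDerivAt (fun t : ℝ => sqn (v + t • w)) (2 * (v 0 * w 0 + v 1 * w 1)) 0 := by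
    have := ((hl 0).pow 2).add ((hl 1).pow 2)
    refine (this.congr_deriv ?_).congr_of_eventuallyEq (Eventually.of_forall fun t => ?_)
    · simp; ring
    · simp [sqn]
  have hs1 : shrink (sqn (v + (0 : ℝ) • w)) (2 * Real.pi) = 1 := by rw [h0]; simp [shrink]
  have hsh : HasDerivAt (fun t : ℝ => shrink (sqn (v + t • w)) (2 * Real.pi))
      (2 * (v 0 * w 0 + v 1 * w 1) * (1 - Real.exp (-(4 * Real.pi)))) 0 := by
    have := hq.add ((hq.const_sub 1).mul_const (Real.exp (-(2 * (2 * Real.pi)))))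
    refine this.congr_deriv ?_
    rw [show -(2 * (2 * Real.pi)) = -(4 * Real.pi) by ring]
    ring
  have hi := (hsh.sqrt (by rw [hs1]; norm_num)).inv (by rw [hs1]; norm_num)
  have hlin : HasDerivAt (fun t : ℝ => v + t • w) w 0 := by
    simpa using ((hasDerivAt_id (0 : ℝ)).smul_const w).const_add v
  refine (hi.smul hlin).congr_deriv ?_
  have hs2 : shrink (sqn v) (2 * Real.pi) = 1 := by simpa using hs1
  apply ext2 <;> simp [hs2] <;> ring

lemma differentiableAt_flow_two_pi {v : E2} (hv : sqn v = 1) :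
    DifferentiableAt ℝ (φ (2 * Real.pi)) v := by
  have he : φ (2 * Real.pi) =ᶠ[𝓝 v] fun w => (√(shrink (sqn w) (2 * Real.pi)))⁻¹ • w := by
    filter_upwards [continuous_sqn.continuousAt.eventually (gt_mem_nhds
      (show sqn v < 11 / 10 by rw [hv]; norm_num)),
      continuous_sqn.continuousAt.eventually (lt_mem_nhds
      (show 9 / 10 < sqn v by rw [hv]; norm_num))] with t ht ht'
    exact flow_two_pi ht' ht
  refine DifferentiableAt.congr_of_eventuallyEq ?_ he
  have hs1 : shrink (sqn v) (2 * Real.pi) = 1 := by rw [hv]; simp [shrink]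
  have h1 : DifferentiableAt ℝ sqn v := (contDiff_sqn.differentiable (by simp)).differentiableAt
  have h2 : DifferentiableAt ℝ (fun w => shrink (sqn w) (2 * Real.pi)) v := by
    unfold shrink
    fun_prop
  exact ((h2.sqrt (by rw [hs1]; norm_num)).inv (by rw [hs1]; norm_num)).smul differentiableAt_id

lemma fderiv_flow_two_pi {v : E2} (hv : sqn v = 1) (i : Fin 2) :
    fderiv ℝ (φ (2 * Real.pi)) v (circleFrame v i) = circleRates i • circleFrame v i := by
  rw [fderiv_apply_of_hasDerivAt (differentiableAt_flow_two_pi hv) (hasDerivAt_flow_two_pi hv _)]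
  unfold sqn at hv
  fin_cases i
  · apply ext2
    · simp [circleFrame, circleRates]; left; left; ring
    · simp [circleFrame, circleRates]; left; left; ring
  · apply ext2
    · simp [circleFrame, circleRates]
      linear_combination (-(v 0) * (1 - Real.exp (-(4 * Real.pi)))) * hv
    · simp [circleFrame, circleRates]
      linear_combination (-(v 1) * (1 - Real.exp (-(4 * Real.pi)))) * hv

lemma linearIndependent_circleFrame {v : E2} (hv : sqn v = 1) :
    LinearIndependent ℝ (circleFrame v) := by
  rw [Fintype.linearIndependent_iff]
  intro g hg
  rw [Fin.sum_univ_two] at hg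
  have h0 := congrArg (fun w : E2 => w 0) hg
  have h1 := congrArg (fun w : E2 => w 1) hg
  simp [circleFrame] at h0 h1
  unfold sqn at hv
  have e0 : g 0 = 0 := by linear_combination v 0 * h1 - v 1 * h0 - g 0 * hv
  have e1 : g 1 = 0 := by linear_combination v 0 * h0 + v 1 * h1 - g 1 * hv
  intro i
  fin_cases i
  exacts [e0, e1]

lemma setOf_flow_eq {v : E2} (hv : sqn v = 1) :
    {T | 0 < T ∧ φ T v = v} = {T | 0 < T ∧ Real.cos T = 1} := by
  ext T
  simp only [mem_ofPred_eq, and_congr_right_iff]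
  intro _
  rw [flow_of_sqn_eq_one hv]
  unfold sqn at hv
  constructor
  · intro h
    have h0 := congrArg (fun w : E2 => w 0) h
    have h1 := congrArg (fun w : E2 => w 1) h
    simp at h0 h1
    linear_combination v 0 * h0 + v 1 * h1 + (1 - Real.cos T) * hv
  · intro h
    have h1 : Real.sin T = 0 := by
      have := Real.sin_sq_add_cos_sq T
      rw [h] at this
      nlinarith
    apply ext2 <;> simp [h, h1]

lemma isLeast_cos_eq_one : IsLeast {T : ℝ | 0 < T ∧ Real.cos T = 1} (2 * Real.pi) := by
  refine ⟨⟨by positivity, Real.cos_two_pi⟩, fun T hT => ?_⟩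
  obtain ⟨k, hk⟩ := (Real.cos_eq_one_iff T).1 hT.2
  have hT0 := hT.1
  have hk0 : 0 < k := by
    by_contra! h
    have h1 : (k : ℝ) ≤ 0 := by exact_mod_cast h
    nlinarith [Real.pi_pos]
  have h1 : (1 : ℝ) ≤ k := by exact_mod_cast hk0
  nlinarith [Real.pi_pos]

lemma period_planar {v : E2} (hv : sqn v = 1) : period (n := 2) planarField v = 2 * Real.pi := by
  change sInf {T | 0 < T ∧ φ T v = v} = _
  rw [setOf_flow_eq hv]
  exact isLeast_cos_eq_one.csInf_eq

lemma circleRates_zero : circleRates 0 = 1 := rfl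

lemma circleRates_lt_one {i : Fin 2} (hi : i ≠ 0) : 0 ≤ circleRates i ∧ circleRates i < 1 := by
  fin_cases i
  · exact absurd rfl hi
  · have := Real.pi_pos
    simp [circleRates, Real.exp_nonneg, this]

lemma unitCircle_hyperbolic : IsHyperbolicOrbit (n := 2) planarField unitCircle ∧
    HasOrbitIndex (n := 2) planarField unitCircle 0 := by
  refine isHyperbolicOrbit_of_eigenvalues (a := circleRates) (i₀ := 0) (fun v hv => ?_)
    circleRates_zero fun i hi => circleRates_lt_one hi
  change eigenvaluesC (mfderiv (𝓡 2) (𝓡 2) (φ (period (n := 2) planarField v)) v) = _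
  rw [period_planar hv, mfderiv_eq_fderiv]
  exact eigenvaluesC_of_linearIndependent (linearIndependent_circleFrame hv)
    (fderiv_flow_two_pi hv)

lemma setOf_planarField_eq_zero : {v | planarField v = 0} = range source ∪ range saddle := by
  ext v
  exact planarField_eq_zero_iff

lemma isMorseSmale_planar : IsMorseSmale (n := 2) planarField := by
  refine planar_hasFlow.isMorseSmale (contMDiff_section contDiff_planarField) ?_
    isClosedOrbit_unitCircle (fun _ => isTransient_planar)
    (fun v _ t => (planar_hasFlow.continuous_flowMap_right contDiff_one_planarField t).continuousAt)
    (fun p hp => ?_) unitCircle_hyperbolic.1 fun β β' => transverse_planar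
  · change {v | planarField v = 0}.Finite
    rw [setOf_planarField_eq_zero]
    exact (finite_range _).union (finite_range _)
  · rcases planarField_eq_zero_iff.1 hp with ⟨i, rfl⟩ | ⟨i, rfl⟩
    · exact isHyperbolicRest_of_eigenvalues (eigenvaluesC_planar_source i)
        fun k => (sourceRates_pos i k).ne'
    · exact isHyperbolicRest_of_eigenvalues (eigenvaluesC_planar_saddle i) (saddleRates_ne_zero i)

/-! ### The vertical component of the field on three-space -/

/-- The smooth step from `0` on `(-∞, 1/2]` to `1` on `[3/4, ∞)`. -/
def stepUp (z : ℝ) : ℝ := cutoff (1 / 2) (3 / 4) z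

/-- The odd function that equals `z` for small `z` and `±1` for `|z| ≥ 3/4`. -/
def height (z : ℝ) : ℝ := z * (1 - (stepUp z + stepUp (-z))) + (stepUp z - stepUp (-z))

/-- The even function that equals `1` for small `z` and `1 - |z|` for `|z| ≥ 3/4`. -/
def depth (z : ℝ) : ℝ := 1 - z * (stepUp z - stepUp (-z))

/-- The Wronskian of `height` and `depth`. -/
def wronskian (z : ℝ) : ℝ := deriv height z * depth z - height z * deriv depth z

/-- The vertical component of the field on three-space: the speed for which the quotient of
`height` by `depth` decays like `exp (-t)` along orbits. -/
def verticalField (z : ℝ) : ℝ := -(height z * depth z / wronskian z)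

@[fun_prop]
lemma contDiff_stepUp : ContDiff ℝ ∞ stepUp := by unfold stepUp; fun_prop

lemma stepUp_of_le {z : ℝ} (h : z ≤ 1 / 2) : stepUp z = 0 := cutoff_of_le (by norm_num) h
lemma stepUp_of_ge {z : ℝ} (h : 3 / 4 ≤ z) : stepUp z = 1 := cutoff_of_ge (by norm_num) h
lemma stepUp_nonneg (z : ℝ) : 0 ≤ stepUp z := cutoff_nonneg
lemma stepUp_le_one (z : ℝ) : stepUp z ≤ 1 := cutoff_le_one

lemma contDiff_height : ContDiff ℝ ∞ height := by unfold height; fun_prop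
lemma contDiff_depth : ContDiff ℝ ∞ depth := by unfold depth; fun_prop

lemma height_neg (z : ℝ) : height (-z) = -height z := by unfold height; rw [neg_neg]; ring
lemma depth_neg (z : ℝ) : depth (-z) = depth z := by unfold depth; rw [neg_neg]; ring

lemma height_of_nonneg {z : ℝ} (h : 0 ≤ z) : height z = z * (1 - stepUp z) + stepUp z := by
  rw [height, stepUp_of_le (show -z ≤ 1 / 2 by linarith)]; ring

lemma depth_of_nonneg {z : ℝ} (h : 0 ≤ z) : depth z = 1 - z * stepUp z := by
  rw [depth, stepUp_of_le (show -z ≤ 1 / 2 by linarith)]; ring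

lemma height_of_abs_le {z : ℝ} (h : |z| ≤ 1 / 2) : height z = z := by
  have := abs_le.1 h
  rw [height, stepUp_of_le this.2, stepUp_of_le (show -z ≤ 1 / 2 by linarith)]; ring

lemma depth_of_abs_le {z : ℝ} (h : |z| ≤ 1 / 2) : depth z = 1 := by
  have := abs_le.1 h
  rw [depth, stepUp_of_le this.2, stepUp_of_le (show -z ≤ 1 / 2 by linarith)]; ring

lemma height_of_ge {z : ℝ} (h : 3 / 4 ≤ z) : height z = 1 := by
  rw [height_of_nonneg (by linarith), stepUp_of_ge h]; ring

lemma depth_of_ge {z : ℝ} (h : 3 / 4 ≤ z) : depth z = 1 - z := by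
  rw [depth_of_nonneg (by linarith), stepUp_of_ge h]; ring

lemma height_zero : height 0 = 0 := height_of_abs_le (by norm_num)

lemma height_pos {z : ℝ} (h : 0 < z) : 0 < height z := by
  rw [height_of_nonneg h.le]
  have h1 := stepUp_nonneg z
  have h2 := stepUp_le_one z
  rcases h2.lt_or_eq with h3 | h3
  · have := mul_pos h (sub_pos.2 h3)
    linarith
  · rw [h3]; norm_num

lemma depth_pos_of_nonneg {z : ℝ} (h : 0 ≤ z) (h' : z < 1) : 0 < depth z := by
  rw [depth_of_nonneg h]
  nlinarith [stepUp_nonneg z, stepUp_le_one z]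

lemma depth_pos {z : ℝ} (h : |z| < 1) : 0 < depth z := by
  have := abs_lt.1 h
  rcases le_total 0 z with h0 | h0
  · exact depth_pos_of_nonneg h0 this.2
  · rw [← depth_neg]
    exact depth_pos_of_nonneg (by linarith) (by linarith)

lemma hasDerivAt_stepUp_neg (z : ℝ) :
    HasDerivAt (fun z => stepUp (-z)) (-deriv stepUp (-z)) z := by
  have h : DifferentiableAt ℝ stepUp (-z) := (contDiff_stepUp.differentiable (by simp)) _
  exact (h.hasDerivAt.scomp z (hasDerivAt_neg z)).congr_deriv (by simp)

lemma hasDerivAt_stepUp (z : ℝ) : HasDerivAt stepUp (deriv stepUp z) z :=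
  ((contDiff_stepUp.differentiable (by simp)) z).hasDerivAt

lemma hasDerivAt_height (z : ℝ) : HasDerivAt height
    (1 - (stepUp z + stepUp (-z)) - z * (deriv stepUp z - deriv stepUp (-z)) +
      (deriv stepUp z + deriv stepUp (-z))) z := by
  have h := hasDerivAt_stepUp z
  have h' := hasDerivAt_stepUp_neg z
  refine (((hasDerivAt_id z).mul ((h.add h').const_sub 1)).add (h.sub h')).congr_deriv ?_
  simp
  ring

lemma hasDerivAt_depth (z : ℝ) : HasDerivAt depth
    (-(stepUp z - stepUp (-z)) - z * (deriv stepUp z + deriv stepUp (-z))) z := by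
  have h := hasDerivAt_stepUp z
  have h' := hasDerivAt_stepUp_neg z
  refine (((hasDerivAt_id z).mul (h.sub h')).const_sub 1).congr_deriv ?_
  simp
  ring

lemma deriv_stepUp_nonneg (z : ℝ) : 0 ≤ deriv stepUp z :=
  Monotone.deriv_nonneg (monotone_cutoff (by norm_num))

lemma deriv_stepUp_of_lt {z : ℝ} (h : z < 1 / 2) : deriv stepUp z = 0 := by
  have : stepUp =ᶠ[𝓝 z] fun _ => 0 := by
    filter_upwards [gt_mem_nhds h] with w hw
    exact stepUp_of_le hw.le
  rw [this.deriv_eq, deriv_const]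

lemma deriv_stepUp_of_gt {z : ℝ} (h : 3 / 4 < z) : deriv stepUp z = 0 := by
  have : stepUp =ᶠ[𝓝 z] fun _ => 1 := by
    filter_upwards [lt_mem_nhds h] with w hw
    exact stepUp_of_ge hw.le
  rw [this.deriv_eq, deriv_const]

lemma wronskian_neg (z : ℝ) : wronskian (-z) = wronskian z := by
  unfold wronskian
  rw [height_neg, depth_neg, (hasDerivAt_height _).deriv, (hasDerivAt_height _).deriv,
    (hasDerivAt_depth _).deriv, (hasDerivAt_depth _).deriv, neg_neg]
  ring

lemma wronskian_pos (z : ℝ) : 0 < wronskian z := by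
  have key : ∀ z, 0 ≤ z → 0 < wronskian z := by
    intro z hz
    rw [wronskian, (hasDerivAt_height _).deriv, (hasDerivAt_depth _).deriv, height_of_nonneg hz,
      depth_of_nonneg hz, stepUp_of_le (show -z ≤ 1 / 2 by linarith),
      deriv_stepUp_of_lt (show -z < 1 / 2 by linarith)]
    have h1 := stepUp_nonneg z
    have h2 := stepUp_le_one z
    have h3 := deriv_stepUp_nonneg z
    rcases lt_or_ge z 1 with h4 | h4
    · set u := stepUp z
      set u' := deriv stepUp z
      have h5 : 0 < 1 - z * u := by nlinarith
      have e : (1 - (u + 0) - z * (u' - 0) + (u' + 0)) * (1 - z * u) -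
          (z * (1 - u) + u) * (-(u - 0) - z * (u' + 0)) =
          ((1 - u) * (1 - z * u) + u ^ 2) + u' * ((1 - z) * (1 - z * u)) +
            (z * (1 - u) * u + (z * (1 - u) + u) * (z * u')) := by ring
      rw [e]
      have h6 : 0 ≤ 1 - u := by linarith
      have h7 : 0 ≤ 1 - z := by linarith
      have h8 : 0 < (1 - u) * (1 - z * u) + u ^ 2 := by
        rcases h2.lt_or_eq with h9 | h9
        · have := mul_pos (sub_pos.2 h9) h5
          positivity
        · rw [h9]; norm_num
      positivity
    · rw [stepUp_of_ge (by linarith), deriv_stepUp_of_gt (by linarith)]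
      ring_nf
      norm_num
  rcases le_total 0 z with h | h
  · exact key z h
  · rw [← wronskian_neg]
    exact key _ (by linarith)

lemma contDiff_wronskian : ContDiff ℝ ∞ wronskian := by
  have h1 : ContDiff ℝ ∞ (deriv height) := (contDiff_infty_iff_deriv.1 contDiff_height).2
  have h2 : ContDiff ℝ ∞ (deriv depth) := (contDiff_infty_iff_deriv.1 contDiff_depth).2
  have h3 := contDiff_height
  have h4 := contDiff_depth
  unfold wronskian
  fun_prop

lemma contDiff_verticalField : ContDiff ℝ ∞ verticalField :=
  ((contDiff_height.mul contDiff_depth).div contDiff_wronskian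
    fun z => (wronskian_pos z).ne').neg

lemma verticalField_neg (z : ℝ) : verticalField (-z) = -verticalField z := by
  unfold verticalField
  rw [height_neg, depth_neg, wronskian_neg]
  ring

lemma verticalField_of_abs_lt {z : ℝ} (h : |z| < 1 / 2) : verticalField z = -z := by
  have h1 := abs_lt.1 h
  rw [verticalField, wronskian, (hasDerivAt_height z).deriv, (hasDerivAt_depth z).deriv,
    height_of_abs_le h.le, depth_of_abs_le h.le, stepUp_of_le h1.2.le,
    stepUp_of_le (show -z ≤ 1 / 2 by linarith), deriv_stepUp_of_lt h1.2,
    deriv_stepUp_of_lt (show -z < 1 / 2 by linarith)]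
  simp

lemma verticalField_of_gt {z : ℝ} (h : 3 / 4 < z) : verticalField z = z - 1 := by
  rw [verticalField, wronskian, (hasDerivAt_height z).deriv, (hasDerivAt_depth z).deriv,
    height_of_ge h.le, depth_of_ge h.le, stepUp_of_ge h.le,
    stepUp_of_le (show -z ≤ 1 / 2 by linarith), deriv_stepUp_of_gt h,
    deriv_stepUp_of_lt (show -z < 1 / 2 by linarith)]
  simp

lemma verticalField_of_lt {z : ℝ} (h : z < -(3 / 4)) : verticalField z = z + 1 := by
  rw [← neg_neg z, verticalField_neg, verticalField_of_gt (by linarith)]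
  ring

lemma verticalField_lt_zero {z : ℝ} (h : 0 < z) (h' : z < 1) : verticalField z < 0 :=
  neg_lt_zero.2 (div_pos (mul_pos (height_pos h) (depth_pos_of_nonneg h.le h')) (wronskian_pos z))

lemma verticalField_pos {z : ℝ} (h : 1 < z) : 0 < verticalField z := by
  rw [verticalField_of_gt (by linarith)]
  linarith

/-! ### The field on three-space -/

/-- The point of space over `p` at height `z`. -/
def lift (p : E2) (z : ℝ) : E3 := !₂[p 0, p 1, z]

/-- The projection to the plane. -/
def proj (v : E3) : E2 := !₂[v 0, v 1]

lemma ext3 {v w : E3} (h0 : v 0 = w 0) (h1 : v 1 = w 1) (h2 : v 2 = w 2) : v = w := by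
  ext i
  fin_cases i
  exacts [h0, h1, h2]

@[simp] lemma proj_lift (p : E2) (z : ℝ) : proj (lift p z) = p := ext2 rfl rfl
@[simp] lemma lift_two (p : E2) (z : ℝ) : lift p z 2 = z := rfl
@[simp] lemma lift_zero (p : E2) (z : ℝ) : lift p z 0 = p 0 := rfl
@[simp] lemma lift_one (p : E2) (z : ℝ) : lift p z 1 = p 1 := rfl
@[simp] lemma proj_zero (v : E3) : proj v 0 = v 0 := rfl
@[simp] lemma proj_one (v : E3) : proj v 1 = v 1 := rfl
@[simp] lemma lift_proj (v : E3) : lift (proj v) (v 2) = v := ext3 rfl rfl rfl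
lemma planeIncl_eq (p : E2) : planeIncl p = lift p 0 := rfl

lemma lift_proj_of_eq {v : E3} {z : ℝ} (h : v 2 = z) : v = lift (proj v) z := by
  rw [← h, lift_proj]

lemma contDiff_proj : ContDiff ℝ ∞ proj := by
  rw [contDiff_euclidean]
  intro i
  fin_cases i <;> simp [proj] <;> fun_prop

lemma contDiff_lift {E : Type*} [NormedAddCommGroup E] [NormedSpace ℝ E] {f : E → E2} {g : E → ℝ}
    (hf : ContDiff ℝ ∞ f) (hg : ContDiff ℝ ∞ g) : ContDiff ℝ ∞ fun x => lift (f x) (g x) := by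
  rw [contDiff_euclidean] at hf ⊢
  intro i
  fin_cases i
  exacts [hf 0, hf 1, hg]

lemma continuous_proj : Continuous proj := contDiff_proj.continuous

lemma continuous_lift : Continuous fun p : E2 × ℝ => lift p.1 p.2 :=
  (contDiff_lift contDiff_fst contDiff_snd).continuous

lemma hasDerivAt_lift {c : ℝ → E2} {u : ℝ → ℝ} {c' : E2} {u' t : ℝ} (hc : HasDerivAt c c' t)
    (hu : HasDerivAt u u' t) : HasDerivAt (fun t => lift (c t) (u t)) (lift c' u') t := by
  refine hasDerivAt_euclidean fun i => ?_
  fin_cases i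
  exacts [hasDerivAt_coord hc 0, hasDerivAt_coord hc 1, hu]

/-- The weight of the planar field at height `z`. -/
def slabWeight (z : ℝ) : ℝ := 1 - (stepUp z + stepUp (-z))

/-- The vector field on three-space: the planar field in a slab, the Euler field further away,
and the vertical field. -/
def spaceField (v : E3) : E3 :=
  lift (slabWeight (v 2) • planarField (proj v) + (1 - slabWeight (v 2)) • proj v)
    (verticalField (v 2))

lemma slabWeight_of_abs_le {z : ℝ} (h : |z| ≤ 1 / 2) : slabWeight z = 1 := by
  have := abs_le.1 h
  rw [slabWeight, stepUp_of_le this.2, stepUp_of_le (show -z ≤ 1 / 2 by linarith)]; ring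

lemma slabWeight_of_le_abs {z : ℝ} (h : 3 / 4 ≤ |z|) : slabWeight z = 0 := by
  rcases le_abs.1 h with h1 | h1
  · rw [slabWeight, stepUp_of_ge h1, stepUp_of_le (show -z ≤ 1 / 2 by linarith)]; ring
  · rw [slabWeight, stepUp_of_ge h1, stepUp_of_le (show z ≤ 1 / 2 by linarith)]; ring

@[fun_prop]
lemma contDiff_slabWeight : ContDiff ℝ ∞ slabWeight := by unfold slabWeight; fun_prop

lemma contDiff_spaceField : ContDiff ℝ ∞ spaceField := by
  have h1 := contDiff_proj
  have h2 := contDiff_planarField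
  have h3 := contDiff_verticalField
  have h4 : ContDiff ℝ ∞ fun v : E3 => v 2 := by fun_prop
  have h5 : ContDiff ℝ ∞ fun v : E3 => slabWeight (v 2) := contDiff_slabWeight.comp h4
  exact contDiff_lift (by fun_prop) (by fun_prop)

lemma contDiff_one_spaceField : ContDiff ℝ 1 spaceField :=
  contDiff_spaceField.of_le (by norm_cast)

lemma spaceField_of_abs_lt {v : E3} (h : |v 2| < 1 / 2) :
    spaceField v = lift (planarField (proj v)) (-v 2) := by
  rw [spaceField, slabWeight_of_abs_le h.le, verticalField_of_abs_lt h]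
  simp

lemma spaceField_of_le_abs {v : E3} (h : 3 / 4 ≤ |v 2|) :
    spaceField v = lift (proj v) (verticalField (v 2)) := by
  rw [spaceField, slabWeight_of_le_abs h]
  simp

/-- Away from a neighbourhood of the vertical axis the horizontal part is the Euler field. -/
lemma spaceField_of_six_le {v : E3} (h : 6 ≤ sqn (proj v)) :
    spaceField v = lift (proj v) (verticalField (v 2)) := by
  rw [spaceField, planarField_of_six_le h, ← add_smul]
  simp

lemma spaceField_of_gt {v : E3} (h : 3 / 4 < v 2) : spaceField v = lift (proj v) (v 2 - 1) := by
  rw [spaceField_of_le_abs (h.le.trans (le_abs_self _)), verticalField_of_gt h]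

lemma spaceField_of_lt {v : E3} (h : v 2 < -(3 / 4)) :
    spaceField v = lift (proj v) (v 2 + 1) := by
  rw [spaceField_of_le_abs (le_abs.2 (Or.inr (by linarith))), verticalField_of_lt h]

lemma lipschitz_verticalField_sub : ∃ K, LipschitzWith K fun z => verticalField z - z := by
  have hd : ContDiff ℝ ∞ fun z => verticalField z - z := contDiff_verticalField.sub contDiff_id
  have h1 : Continuous (deriv fun z => verticalField z - z) :=
    (contDiff_infty_iff_deriv.1 hd).2.continuous
  have h2 : ∀ z ∉ Icc (-1 : ℝ) 1, deriv (fun z => verticalField z - z) z = 0 := by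
    intro z hz
    rcases not_and_or.1 hz with h | h
    · have : (fun z => verticalField z - z) =ᶠ[𝓝 z] fun _ => 1 := by
        filter_upwards [gt_mem_nhds (not_le.1 h)] with w hw
        rw [verticalField_of_lt (by linarith)]; ring
      rw [this.deriv_eq, deriv_const]
    · have : (fun z => verticalField z - z) =ᶠ[𝓝 z] fun _ => -1 := by
        filter_upwards [lt_mem_nhds (not_le.1 h)] with w hw
        rw [verticalField_of_gt (by linarith)]; ring
      rw [this.deriv_eq, deriv_const]
  obtain ⟨C, hC⟩ := h1.bounded_above_of_compact_support (HasCompactSupport.intro isCompact_Icc h2)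
  refine ⟨C.toNNReal, lipschitzWith_of_nnnorm_deriv_le (hd.differentiable (by simp)) fun z => ?_⟩
  rw [← NNReal.coe_le_coe, coe_nnnorm]
  exact (hC z).trans (Real.le_coe_toNNReal C)

lemma isCompact_cylinder (a b : ℝ) : IsCompact {v : E3 | sqn (proj v) ≤ a ∧ |v 2| ≤ b} := by
  have h := ((isCompact_sqn_le a).prod (isCompact_Icc (a := -b) (b := b))).image continuous_lift
  convert h using 1
  ext v
  constructor
  · rintro ⟨h1, h2⟩
    exact ⟨(proj v, v 2), ⟨h1, abs_le.1 h2⟩, lift_proj v⟩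
  · rintro ⟨⟨p, z⟩, ⟨h1, h2⟩, rfl⟩
    exact ⟨by simpa using h1, abs_le.2 (by simpa using h2)⟩

lemma space_hasFlow : HasFlow (n := 3) spaceField := by
  have hd : ContDiff ℝ ∞ fun v : E3 =>
      lift (slabWeight (v 2) • (planarField (proj v) - proj v)) 0 := by
    have h1 := contDiff_proj
    have h2 := contDiff_planarField
    have h4 : ContDiff ℝ ∞ fun v : E3 => v 2 := by fun_prop
    have h5 : ContDiff ℝ ∞ fun v : E3 => slabWeight (v 2) := contDiff_slabWeight.comp h4
    exact contDiff_lift (by fun_prop) contDiff_const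
  have hs : HasCompactSupport fun v : E3 =>
      lift (slabWeight (v 2) • (planarField (proj v) - proj v)) 0 := by
    refine HasCompactSupport.intro (isCompact_cylinder 6 1) fun v hv => ?_
    have h0 : slabWeight (v 2) • (planarField (proj v) - proj v) = 0 := by
      rcases not_and_or.1 hv with h | h
      · rw [planarField_of_six_le (not_le.1 h).le, sub_self, smul_zero]
      · rw [slabWeight_of_le_abs (by linarith [not_le.1 h]), zero_smul]
    rw [h0]
    exact ext3 rfl rfl rfl
  obtain ⟨K, hK⟩ := (hd.of_le (show (1 : ℕ∞ω) ≤ ∞ by norm_cast)).lipschitzWith_of_hasCompactSupport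
    hs one_ne_zero
  obtain ⟨K', hK'⟩ := lipschitz_verticalField_sub
  have h2 : LipschitzWith 1 fun v : E3 => v 2 := LipschitzWith.of_dist_le_mul fun v w => by
    rw [NNReal.coe_one, one_mul]
    exact EuclideanSpace.dist_eq v w ▸ Real.le_sqrt_of_sq_le
      (Finset.single_le_sum (f := fun i => dist (v i) (w i) ^ 2) (fun i _ => sq_nonneg _)
        (Finset.mem_univ (2 : Fin 3)))
  have h3 : LipschitzWith 1 fun z : ℝ => lift 0 z := LipschitzWith.of_dist_le_mul fun z w => by
    rw [EuclideanSpace.dist_eq, Fin.sum_univ_three]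
    simp [Real.sqrt_sq_eq_abs, Real.dist_eq]
  have h := (hK.add (h3.comp (hK'.comp h2))).add (LipschitzWith.id (α := E3))
  have e : spaceField = fun v : E3 => lift (slabWeight (v 2) • (planarField (proj v) - proj v)) 0 +
      ((fun z => lift 0 z) ∘ (fun z => verticalField z - z) ∘ fun v : E3 => v 2) v + id v := by
    funext v
    apply ext3 <;> simp [spaceField] <;> ring
  exact hasFlow_of_lipschitz contDiff_one_spaceField (e ▸ h)

/-! ### The flow on three-space -/

local notation "Θ" => flowMap (n := 3) spaceField

lemma hasDerivAt_flow_two (v : E3) (t : ℝ) :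
    HasDerivAt (fun t => Θ t v 2) (verticalField (Θ t v 2)) t :=
  hasDerivAt_coord (space_hasFlow.hasDerivAt v t) 2

lemma space_flow_zero (v : E3) : Θ 0 v = v := space_hasFlow.flowMap_zero v

lemma verticalField_sign_mul {σ : ℝ} (hσ : σ = 1 ∨ σ = -1) (z : ℝ) :
    verticalField (σ * z) = σ * verticalField z := by
  rcases hσ with rfl | rfl
  · simp
  · rw [neg_one_mul, neg_one_mul, verticalField_neg]

lemma hasDerivAt_flow_sign {σ : ℝ} (hσ : σ = 1 ∨ σ = -1) (v : E3) (t : ℝ) :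
    HasDerivAt (fun t => σ * Θ t v 2) (verticalField (σ * Θ t v 2)) t := by
  rw [verticalField_sign_mul hσ]
  exact (hasDerivAt_flow_two v t).const_mul σ

lemma exists_sign (z : ℝ) : ∃ σ : ℝ, (σ = 1 ∨ σ = -1) ∧ σ * z = |z| := by
  rcases le_total 0 z with h | h
  · exact ⟨1, Or.inl rfl, by rw [one_mul, abs_of_nonneg h]⟩
  · exact ⟨-1, Or.inr rfl, by rw [neg_one_mul, abs_of_nonpos h]⟩

lemma sign_sq {σ : ℝ} (hσ : σ = 1 ∨ σ = -1) : σ * σ = 1 := by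
  rcases hσ with rfl | rfl <;> norm_num

lemma abs_sign_mul {σ : ℝ} (hσ : σ = 1 ∨ σ = -1) (z : ℝ) : |σ * z| = |z| := by
  rcases hσ with rfl | rfl <;> simp

/-- In the slab the horizontal component of the flow is the planar flow. -/
lemma flow_of_slab_of_gt {v : E3} {a : ℝ} (ha : a < 0) (hv : |v 2| * Real.exp (-a) ≤ 1 / 2) {t : ℝ}
    (ht : a < t) : Θ t v = lift (φ t (proj v)) (v 2 * Real.exp (-t)) := by
  refine eq_of_hasDerivAt contDiff_one_spaceField (a := a) (b := max t 0 + 1) (t₀ := 0)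
    (c' := fun t => lift (φ t (proj v)) (v 2 * Real.exp (-t)))
    ⟨ha, by linarith [le_max_right t 0]⟩
    (fun s _ => space_hasFlow.hasDerivAt v s) (fun s hs => ?_) ?_ ⟨ht, by linarith [le_max_left t 0]⟩
  · have h1 : |lift (φ s (proj v)) (v 2 * Real.exp (-s)) 2| < 1 / 2 := by
      rw [lift_two, abs_mul, abs_of_pos (Real.exp_pos _)]
      by_cases h0 : v 2 = 0
      · simp [h0]
      · have h2 : Real.exp (-s) < Real.exp (-a) := Real.exp_lt_exp.2 (by linarith [hs.1])
        exact (mul_lt_mul_of_pos_left h2 (abs_pos.2 h0)).trans_le hv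
    rw [spaceField_of_abs_lt h1, proj_lift]
    refine hasDerivAt_lift (planar_hasFlow.hasDerivAt _ s) ?_
    simpa using (hasDerivAt_neg s).exp.const_mul (v 2)
  · simp [space_flow_zero, flow_zero]

lemma flow_of_slab {v : E3} (hv : |v 2| < 1 / 2) {t : ℝ} (ht : 0 ≤ t) :
    Θ t v = lift (φ t (proj v)) (v 2 * Real.exp (-t)) := by
  have h1 : ContinuousAt (fun a => |v 2| * Real.exp (-a)) 0 := by fun_prop
  have h2 : ∀ᶠ a in 𝓝[<] (0 : ℝ), |v 2| * Real.exp (-a) < 1 / 2 :=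
    (h1.eventually (gt_mem_nhds (by simpa using hv))).filter_mono nhdsWithin_le_nhds
  obtain ⟨a, ha, ha0⟩ := (h2.and self_mem_nhdsWithin).exists
  have ha0 : a < 0 := ha0
  exact flow_of_slab_of_gt ha0 ha.le (ha0.trans_le ht)

lemma flow_planeIncl (p : E2) (t : ℝ) : Θ t (planeIncl p) = planeIncl (φ t p) := by
  have := flow_of_slab_of_gt (v := planeIncl p) (a := min t 0 - 1) (t := t)
    (by linarith [min_le_right t 0]) (by simp [planeIncl_eq]) (by linarith [min_le_left t 0])
  rw [this, planeIncl_eq, planeIncl_eq]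
  simp

/-- The flow near and above the height of the upper (or lower) source. -/
lemma flow_of_top_of_lt {σ : ℝ} (hσ : σ = 1 ∨ σ = -1) {v : E3} {b : ℝ} (hb : 0 < b)
    (hv : 1 ≤ σ * v 2 ∨ 3 / 4 < 1 + (σ * v 2 - 1) * Real.exp b) {t : ℝ} (ht : t < b) :
    Θ t v = lift (Real.exp t • proj v) (σ * (1 + (σ * v 2 - 1) * Real.exp t)) := by
  refine eq_of_hasDerivAt contDiff_one_spaceField (a := min t 0 - 1) (b := b) (t₀ := 0)
    (c' := fun t => lift (Real.exp t • proj v) (σ * (1 + (σ * v 2 - 1) * Real.exp t)))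
    ⟨by linarith [min_le_right t 0], hb⟩
    (fun s _ => space_hasFlow.hasDerivAt v s) (fun s hs => ?_) ?_ ⟨by linarith [min_le_left t 0], ht⟩
  · have h0 := Real.exp_pos s
    have h1 : 3 / 4 < 1 + (σ * v 2 - 1) * Real.exp s := by
      rcases le_or_gt 1 (σ * v 2) with h | h
      · have := mul_nonneg (sub_nonneg.2 h) h0.le
        linarith
      · rcases hv with h2 | h2
        · linarith
        · have h3 : Real.exp s < Real.exp b := Real.exp_lt_exp.2 hs.2
          nlinarith
    set u := 1 + (σ * v 2 - 1) * Real.exp s with hu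
    have h2 : verticalField (σ * u) = σ * (u - 1) := by
      rw [verticalField_sign_mul hσ, verticalField_of_gt h1]
    have h3 : 3 / 4 ≤ |σ * u| := by
      rw [abs_sign_mul hσ]
      exact h1.le.trans (le_abs_self u)
    rw [spaceField_of_le_abs (by simpa using h3), proj_lift, lift_two, h2]
    refine hasDerivAt_lift ((Real.hasDerivAt_exp s).smul_const _) ?_
    refine (((Real.hasDerivAt_exp s).const_mul _).const_add 1 |>.const_mul σ).congr_deriv ?_
    rw [hu]
    ring
  · rw [space_flow_zero]
    apply ext3
    · simp
    · simp
    · simp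
      rw [← mul_assoc, sign_sq hσ, one_mul]

lemma flow_of_one_le {σ : ℝ} (hσ : σ = 1 ∨ σ = -1) {v : E3} (hv : 1 ≤ σ * v 2) (t : ℝ) :
    Θ t v = lift (Real.exp t • proj v) (σ * (1 + (σ * v 2 - 1) * Real.exp t)) :=
  flow_of_top_of_lt hσ (b := max t 0 + 1) (by linarith [le_max_right t 0]) (Or.inl hv)
    (by linarith [le_max_left t 0])

lemma flow_of_top {σ : ℝ} (hσ : σ = 1 ∨ σ = -1) {v : E3} (hv : 3 / 4 < σ * v 2) {t : ℝ}
    (ht : t ≤ 0) :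
    Θ t v = lift (Real.exp t • proj v) (σ * (1 + (σ * v 2 - 1) * Real.exp t)) := by
  have h1 : ContinuousAt (fun b => 1 + (σ * v 2 - 1) * Real.exp b) 0 := by fun_prop
  have h2 : ∀ᶠ b in 𝓝[>] (0 : ℝ), 3 / 4 < 1 + (σ * v 2 - 1) * Real.exp b :=
    (h1.eventually (lt_mem_nhds (by simpa using hv))).filter_mono nhdsWithin_le_nhds
  obtain ⟨b, hb, hb0⟩ := (h2.and self_mem_nhdsWithin).exists
  have hb0 : 0 < b := hb0
  exact flow_of_top_of_lt hσ hb0 (Or.inr hb) (ht.trans_lt hb0)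

/-- The upper source `top 1` and the lower source `top (-1)`. -/
def top (σ : ℝ) : E3 := lift 0 σ

lemma spaceField_top {σ : ℝ} (hσ : σ = 1 ∨ σ = -1) : spaceField (top σ) = 0 := by
  have h1 : verticalField σ = 0 := by
    have := verticalField_sign_mul hσ 1
    rw [mul_one, verticalField_of_gt (z := 1) (by norm_num)] at this
    rw [this]; ring
  rw [spaceField_of_le_abs (by rcases hσ with rfl | rfl <;> norm_num [top])]
  apply ext3 <;> simp [top, h1]

lemma le_height_of_le {v : E3} {σ : ℝ} (hσ : σ = 1 ∨ σ = -1) {s t c : ℝ} (hst : s ≤ t)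
    (h : c ≤ σ * Θ t v 2) (hc : 0 < c) (hc' : c ≤ 1) : c ≤ σ * Θ s v 2 := by
  have h1 := antitone_clamp (a := 0) (b := 1) (hasDerivAt_flow_sign hσ v)
    (fun t h0 h1 => (verticalField_lt_zero h0 h1).le) hst
  exact le_of_le_clamp h1 h hc hc'

lemma height_le_of_le {v : E3} {σ : ℝ} (hσ : σ = 1 ∨ σ = -1) {s t c : ℝ} (hst : s ≤ t)
    (h : σ * Θ s v 2 ≤ c) (hc : 0 ≤ c) (hc' : c < 1) : σ * Θ t v 2 ≤ c := by
  have h1 := antitone_clamp (a := 0) (b := 1) (hasDerivAt_flow_sign hσ v)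
    (fun t h0 h1 => (verticalField_lt_zero h0 h1).le) hst
  exact le_of_clamp_le h1 h hc hc'

lemma exists_verticalField_le {a b : ℝ} (ha : 0 < a) (hb : b < 1) :
    ∃ δ > 0, ∀ z, a ≤ z → z ≤ b → verticalField z ≤ -δ := by
  rcases lt_or_ge b a with h | h
  · exact ⟨1, one_pos, fun z h1 h2 => absurd (h1.trans h2) (not_le.2 h)⟩
  obtain ⟨z, hz, hmax⟩ := isCompact_Icc.exists_isMaxOn (nonempty_Icc.2 h)
    (contDiff_verticalField.continuous.continuousOn (s := Icc a b))
  refine ⟨-verticalField z, neg_pos.2 (verticalField_lt_zero (ha.trans_le hz.1)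
    (hz.2.trans_lt hb)), fun w h1 h2 => ?_⟩
  rw [neg_neg]
  exact hmax ⟨h1, h2⟩

lemma exists_abs_lt_half {v : E3} (hv : |v 2| < 1) : ∃ t, 0 ≤ t ∧ |Θ t v 2| < 1 / 2 := by
  obtain ⟨σ, hσ, hz⟩ := exists_sign (v 2)
  obtain ⟨δ, hδ, h⟩ := exists_verticalField_le (a := 1 / 4) (by norm_num) hv
  have hup : ∀ t, 0 ≤ t → σ * Θ t v 2 ≤ |v 2| := fun t ht =>
    height_le_of_le hσ ht (by rw [space_flow_zero, hz]) (abs_nonneg _) hv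
  by_contra! hn
  have hlow : ∀ t, 0 ≤ t → 1 / 4 ≤ σ * Θ t v 2 := by
    intro t ht
    by_contra! h1
    -- the height cannot jump from above `1/4` to below `-1/2`
    have h2 : σ * Θ t v 2 ≤ -(1 / 2) := by
      have h3 := hn t ht
      rw [← abs_sign_mul hσ] at h3
      rcases le_abs.1 h3 with h4 | h4
      · linarith
      · linarith
    have hc : Continuous fun t => σ * Θ t v 2 := continuous_iff_continuousAt.2 fun t =>
      (hasDerivAt_flow_sign hσ v t).continuousAt
    obtain ⟨s, hs, h0⟩ := intermediate_value_Icc' ht hc.continuousOn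
      (show (0 : ℝ) ∈ Icc (σ * Θ t v 2) (σ * Θ 0 v 2) from
        ⟨by linarith, by rw [space_flow_zero, hz]; exact abs_nonneg _⟩)
    have h5 := hn s hs.1
    rw [← abs_sign_mul hσ] at h5
    simp only at h0
    rw [h0] at h5
    norm_num at h5
  have h6 := add_mul_le_of_le_deriv (u := fun t => -(σ * Θ t v 2))
    (u' := fun t => -verticalField (σ * Θ t v 2)) (fun t => (hasDerivAt_flow_sign hσ v t).neg)
    (δ := δ) (s := 0) (t := 1 / δ) (by positivity) fun r hr => by
      have := h _ (hlow r hr.1.le) (hup r hr.1.le)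
      linarith
  have h7 := hlow (1 / δ) (by positivity)
  rw [sub_zero, mul_one_div_cancel hδ.ne', space_flow_zero, hz] at h6
  linarith

lemma exists_top_lt {σ : ℝ} (hσ : σ = 1 ∨ σ = -1) {v : E3} (hv : 0 < σ * v 2) :
    ∃ t ≤ 0, 3 / 4 < σ * Θ t v 2 := by
  by_contra! hn
  have h0 : σ * v 2 ≤ 3 / 4 := by simpa [space_flow_zero] using hn 0 le_rfl
  obtain ⟨δ, hδ, h⟩ := exists_verticalField_le hv (show (3 / 4 : ℝ) < 1 by norm_num)
  have hlow : ∀ t ≤ 0, σ * v 2 ≤ σ * Θ t v 2 := fun t ht =>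
    le_height_of_le hσ ht (by rw [space_flow_zero]) hv (by linarith)
  have h6 := add_mul_le_of_le_deriv (u := fun t => -(σ * Θ t v 2))
    (u' := fun t => -verticalField (σ * Θ t v 2)) (fun t => (hasDerivAt_flow_sign hσ v t).neg)
    (δ := δ) (s := -(1 / δ)) (t := 0) (by simp; positivity) fun r hr => by
      have := h _ (hlow r hr.2.le) (hn r hr.2.le)
      linarith
  have h7 := hn (-(1 / δ)) (by simp; positivity)
  rw [sub_neg_eq_add, zero_add, mul_one_div_cancel hδ.ne', space_flow_zero] at h6
  linarith

lemma proj_map_zero : proj 0 = 0 := ext2 rfl rfl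

lemma spaceField_eq_zero_iff {v : E3} : spaceField v = 0 ↔
    (∃ p, planarField p = 0 ∧ v = planeIncl p) ∨ v = top 1 ∨ v = top (-1) := by
  constructor
  · intro h
    obtain ⟨σ, hσ, hz⟩ := exists_sign (v 2)
    have h2 : verticalField (|v 2|) = 0 := by
      rw [← hz, verticalField_sign_mul hσ]
      have : verticalField (v 2) = 0 := congrArg (fun w : E3 => w 2) h
      rw [this, mul_zero]
    rcases (abs_nonneg (v 2)).eq_or_lt with h3 | h3
    · have h4 : v 2 = 0 := abs_eq_zero.1 h3.symm
      refine Or.inl ⟨proj v, ?_, lift_proj_of_eq h4⟩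
      rw [spaceField_of_abs_lt (by rw [h4]; norm_num)] at h
      simpa [proj_map_zero] using congrArg proj h
    · rcases lt_trichotomy |v 2| 1 with h4 | h4 | h4
      · exact absurd h2 (verticalField_lt_zero h3 h4).ne
      · right
        rw [spaceField_of_le_abs (by rw [h4]; norm_num)] at h
        have h5 : proj v = 0 := by simpa [proj_map_zero] using congrArg proj h
        rcases (abs_eq zero_le_one).1 h4 with h6 | h6
        · exact Or.inl (by rw [lift_proj_of_eq h6, h5, top])
        · exact Or.inr (by rw [lift_proj_of_eq h6, h5, top])
      · exact absurd h2 (verticalField_pos h4).ne'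
  · rintro (⟨p, hp, rfl⟩ | rfl | rfl)
    · rw [spaceField_of_abs_lt (by simp [planeIncl_eq]), planeIncl_eq, proj_lift, hp]
      apply ext3 <;> simp
    · exact spaceField_top (Or.inl rfl)
    · exact spaceField_top (Or.inr rfl)

lemma planeIncl_injective : Function.Injective planeIncl := fun p q h => by
  have := congrArg proj h
  simpa [planeIncl_eq] using this

lemma isClosedOrbit_planeIncl {γ : Set E2} (hγ : IsClosedOrbit (n := 2) planarField γ) :
    IsClosedOrbit (n := 3) spaceField (planeIncl '' γ) := by
  obtain ⟨c, hc, ⟨T, hT, hper⟩, ⟨t, ht⟩, rfl⟩ := hγ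
  have e : (fun t => planeIncl (c t)) = fun t => Θ t (planeIncl (c 0)) := by
    funext t
    rw [flow_planeIncl, ← congrFun (planar_hasFlow.eq_flowMap hc) t]
  refine ⟨fun t => planeIncl (c t), e ▸ space_hasFlow.isMIntegralCurve _,
    ⟨T, hT, hper.comp planeIncl⟩, ⟨t, planeIncl_injective.ne ht⟩, ?_⟩
  rw [← range_comp]
  rfl

lemma isCritical_planeIncl {β : Set E2} (hβ : IsCritical (n := 2) planarField β) :
    IsCritical (n := 3) spaceField (planeIncl '' β) := by
  rcases hβ with ⟨p, hp, rfl⟩ | hγ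
  · exact Or.inl ⟨planeIncl p, spaceField_eq_zero_iff.2 (Or.inl ⟨p, hp, rfl⟩), image_singleton⟩
  · exact Or.inr (isClosedOrbit_planeIncl hγ)

lemma isCritical_top {σ : ℝ} (hσ : σ = 1 ∨ σ = -1) : IsCritical (n := 3) spaceField {top σ} :=
  Or.inl ⟨_, spaceField_top hσ, rfl⟩

/-! ### Stable and unstable manifolds on three-space -/

lemma nhdsSet_planeIncl {β : Set E2} (hβ : IsCompact β) {ι : Type*} {l : Filter ι} {c : ι → E2}
    {u : ι → ℝ} (hc : Tendsto c l (𝓝ˢ β)) (hu : Tendsto u l (𝓝 0)) :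
    Tendsto (fun t => lift (c t) (u t)) l (𝓝ˢ (planeIncl '' β)) := by
  have h1 : Tendsto (fun t => (c t, u t)) l (𝓝ˢ (β ×ˢ {(0 : ℝ)})) := by
    rw [hβ.nhdsSet_prod_eq isCompact_singleton, nhdsSet_singleton]
    exact hc.prodMk hu
  refine (continuous_lift.tendsto_nhdsSet (t := planeIncl '' β) ?_).comp h1
  rintro ⟨p, z⟩ ⟨hp, hz⟩
  have hz' : z = 0 := hz
  subst hz'
  exact ⟨p, hp, rfl⟩

lemma tendsto_proj_nhdsSet {β : Set E2} {ι : Type*} {l : Filter ι} {c : ι → E3}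
    (hc : Tendsto c l (𝓝ˢ (planeIncl '' β))) : Tendsto (fun t => proj (c t)) l (𝓝ˢ β) := by
  refine (continuous_proj.tendsto_nhdsSet (t := β) ?_).comp hc
  rintro _ ⟨p, hp, rfl⟩
  simpa [planeIncl_eq] using hp

lemma mem_stable_planeIncl {β : Set E2} (hβ : IsCompact β) {v : E3} (hv : |v 2| < 1 / 2) :
    v ∈ stableSet (n := 3) spaceField (planeIncl '' β) ↔
      proj v ∈ stableSet (n := 2) planarField β := by
  rw [space_hasFlow.mem_stableSet, planar_hasFlow.mem_stableSet]
  have h0 : ∀ᶠ t in atTop, lift (φ t (proj v)) (v 2 * Real.exp (-t)) = Θ t v := by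
    filter_upwards [eventually_ge_atTop 0] with t ht
    rw [flow_of_slab hv ht]
  constructor
  · intro h
    refine (tendsto_proj_nhdsSet h).congr' ?_
    filter_upwards [h0] with t ht
    rw [← ht, proj_lift]
  · intro h
    refine (nhdsSet_planeIncl hβ h ?_).congr' h0
    simpa using Real.tendsto_exp_neg_atTop_nhds_zero.const_mul (v 2)

lemma notMem_stable_planeIncl {β : Set E2} {v : E3} (hv : 1 ≤ |v 2|) :
    v ∉ stableSet (n := 3) spaceField (planeIncl '' β) := by
  intro h
  rw [space_hasFlow.mem_stableSet] at h
  have h1 : {w : E3 | |w 2| < 1} ∈ 𝓝ˢ (planeIncl '' β) := by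
    have hc : Continuous fun w : E3 => |w 2| := by fun_prop
    refine (isOpen_lt hc continuous_const).mem_nhdsSet.2 ?_
    rintro _ ⟨p, -, rfl⟩
    simp [planeIncl_eq]
  have h2 : ∀ᶠ t in atTop, |Θ t v 2| < 1 := h h1
  obtain ⟨t, ht⟩ := h2.exists
  obtain ⟨σ, hσ, hz⟩ := exists_sign (v 2)
  rw [← hz] at hv
  rw [flow_of_one_le hσ hv, lift_two, abs_sign_mul hσ] at ht
  have := mul_nonneg (sub_nonneg.2 hv) (Real.exp_pos t).le
  have := (abs_lt.1 ht).2
  linarith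

lemma mem_unstable_top {σ : ℝ} (hσ : σ = 1 ∨ σ = -1) {v : E3} (hv : 0 < σ * v 2) :
    v ∈ unstableSet (n := 3) spaceField {top σ} := by
  obtain ⟨s, -, hs⟩ := exists_top_lt hσ hv
  rw [← space_hasFlow.flowMap_mem_unstableSet s, space_hasFlow.mem_unstableSet, nhdsSet_singleton]
  have h1 : Tendsto (fun t => lift (Real.exp t • proj (Θ s v))
      (σ * (1 + (σ * Θ s v 2 - 1) * Real.exp t))) atBot
      (𝓝 (lift ((0 : ℝ) • proj (Θ s v)) (σ * (1 + (σ * Θ s v 2 - 1) * 0)))) := by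
    have he := Real.tendsto_exp_atBot
    exact (continuous_lift.tendsto (_, _)).comp ((he.smul_const _).prodMk_nhds
      (((he.const_mul _).const_add 1).const_mul σ))
  rw [zero_smul, mul_zero, add_zero, mul_one] at h1
  refine h1.congr' ?_
  filter_upwards [eventually_le_atBot 0] with t ht
  rw [flow_of_top hσ hs ht]

lemma mem_unstable_planeIncl {β : Set E2} (hβ : IsCompact β) {p : E2} :
    planeIncl p ∈ unstableSet (n := 3) spaceField (planeIncl '' β) ↔
      p ∈ unstableSet (n := 2) planarField β := by
  rw [space_hasFlow.mem_unstableSet, planar_hasFlow.mem_unstableSet]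
  simp_rw [flow_planeIncl]
  constructor
  · intro h
    simpa [planeIncl_eq] using tendsto_proj_nhdsSet h
  · intro h
    exact nhdsSet_planeIncl hβ h tendsto_const_nhds

lemma top_ne_planeIncl {σ : ℝ} (hσ : σ = 1 ∨ σ = -1) {β : Set E2} : {top σ} ≠ planeIncl '' β := by
  intro h
  have h1 : top σ ∈ planeIncl '' β := h ▸ mem_singleton _
  obtain ⟨p, -, hp⟩ := h1
  have := congrArg (fun w : E3 => w 2) hp
  simp only [planeIncl_eq, top, lift_two] at this
  rcases hσ with rfl | rfl <;> norm_num at this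

lemma unstable_planeIncl {β : Set E2} (hβ : IsCritical (n := 2) planarField β) :
    unstableSet (n := 3) spaceField (planeIncl '' β) =
      planeIncl '' unstableSet (n := 2) planarField β := by
  ext v
  constructor
  · intro h
    have h0 : v 2 = 0 := by
      by_contra hn
      obtain ⟨σ, hσ, hz⟩ := exists_sign (v 2)
      exact top_ne_planeIncl hσ (space_hasFlow.eq_of_mem_unstableSet (isCritical_top hσ)
        (isCritical_planeIncl hβ) (mem_unstable_top hσ (hz ▸ abs_pos.2 hn)) h)
    rw [lift_proj_of_eq h0] at h ⊢
    exact ⟨proj v, (mem_unstable_planeIncl hβ.isCompact).1 h, rfl⟩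
  · rintro ⟨p, hp, rfl⟩
    exact (mem_unstable_planeIncl hβ.isCompact).2 hp

lemma exists_mem_unstable_planeIncl {v : E3} (hv : v 2 = 0) :
    ∃ β, IsCritical (n := 2) planarField β ∧
      v ∈ unstableSet (n := 3) spaceField (planeIncl '' β) := by
  obtain ⟨β, hβ, h⟩ := exists_mem_unstable (proj v)
  exact ⟨β, hβ, by
    rw [lift_proj_of_eq hv]
    exact (mem_unstable_planeIncl hβ.isCompact).2 h⟩

lemma unstable_top {σ : ℝ} (hσ : σ = 1 ∨ σ = -1) :
    unstableSet (n := 3) spaceField {top σ} = {v | 0 < σ * v 2} := by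
  refine Subset.antisymm (fun v h => ?_) fun v => mem_unstable_top hσ
  by_contra hn
  have hn : ¬ 0 < σ * v 2 := hn
  rcases (not_lt.1 hn).eq_or_lt with h0 | h0
  · have h1 : v 2 = 0 := by
      rcases hσ with rfl | rfl
      · linarith
      · linarith
    obtain ⟨β, hβ, h2⟩ := exists_mem_unstable_planeIncl h1
    exact top_ne_planeIncl hσ (space_hasFlow.eq_of_mem_unstableSet (isCritical_top hσ)
      (isCritical_planeIncl hβ) h h2)
  · have hσ' : -σ = 1 ∨ -σ = -1 := by rcases hσ with rfl | rfl <;> norm_num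
    have h1 := singleton_injective (space_hasFlow.eq_of_mem_unstableSet (isCritical_top hσ)
      (isCritical_top hσ') h (mem_unstable_top hσ' (by linarith)))
    have h2 : σ = -σ := congrArg (fun w : E3 => w 2) h1
    rcases hσ with rfl | rfl <;> norm_num at h2

lemma notMem_of_tendsto_cocompact {β : Set E3} (hβ : IsCompact β) {v : E3}
    (h : Tendsto (fun t => Θ t v) atTop (cocompact E3)) : v ∉ stableSet (n := 3) spaceField β := by
  intro hv
  rw [space_hasFlow.mem_stableSet] at hv
  obtain ⟨K, hK, hβK⟩ := exists_compact_superset hβ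
  have h1 : ∀ᶠ t in atTop, Θ t v ∈ K :=
    (hv.eventually (isOpen_interior.mem_nhdsSet.2 hβK)).mono fun t ht => interior_subset ht
  have h2 : ∀ᶠ t in atTop, Θ t v ∈ Kᶜ := h hK.compl_mem_cocompact
  obtain ⟨t, ht, ht'⟩ := (h1.and h2).exists
  exact ht' ht

lemma tendsto_cocompact_of_sqn {v : E3}
    (h : Tendsto (fun t => sqn (proj (Θ t v))) atTop atTop) :
    Tendsto (fun t => Θ t v) atTop (cocompact E3) := by
  refine tendsto_cocompact_of_tendsto_dist_comp_atTop 0 (tendsto_atTop_mono (fun t => ?_)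
    (Real.tendsto_sqrt_atTop.comp h))
  rw [dist_zero_right, EuclideanSpace.norm_eq, Fin.sum_univ_three]
  refine Real.sqrt_le_sqrt ?_
  simp [sqn]
  positivity

lemma tendsto_cocompact_of_slab {v : E3} (hv : |v 2| < 1 / 2) (h : 4 < sqn (proj v)) :
    Tendsto (fun t => Θ t v) atTop (cocompact E3) := by
  refine tendsto_cocompact_of_sqn ((tendsto_sqn_atTop h).congr' ?_)
  filter_upwards [eventually_ge_atTop 0] with t ht
  rw [flow_of_slab hv ht, proj_lift]

lemma exists_mem_stable_planar {p : E2} (h : sqn p ≤ 4) :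
    ∃ β, IsCritical (n := 2) planarField β ∧ p ∈ stableSet (n := 2) planarField β := by
  rcases forward_cases p with h1 | ⟨j, rfl⟩ | ⟨-, h1⟩ | ⟨-, -, h1⟩ | ⟨-, -, h1⟩
  exacts [absurd h1 (not_lt.2 h), ⟨_, isCritical_source j, mem_stable_source_iff.2 rfl⟩,
    ⟨_, isCritical_saddle 0, h1⟩, ⟨_, isCritical_saddle 1, h1⟩, ⟨_, isCritical_unitCircle, h1⟩]

lemma tendsto_cocompact_iff_of_slab {v : E3} (hv : |v 2| < 1 / 2) :
    Tendsto (fun t => Θ t v) atTop (cocompact E3) ↔ 4 < sqn (proj v) := by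
  refine ⟨fun h => ?_, tendsto_cocompact_of_slab hv⟩
  by_contra! h1
  obtain ⟨β, hβ, h2⟩ := exists_mem_stable_planar h1
  exact notMem_of_tendsto_cocompact (isCritical_planeIncl hβ).isCompact h
    ((mem_stable_planeIncl hβ.isCompact hv).2 h2)

/-! ### The nonwandering set on three-space -/

lemma isTransient_lift {p : E2} (h : IsTransient (n := 2) planarField p) :
    IsTransient (n := 3) spaceField (planeIncl p) := by
  classical
  obtain ⟨F, hF, t, ht, hc, hct, hlt⟩ := h
  set G : E3 → ℝ := fun v => if |v 2| < 1 / 2 then Real.arctan (F (proj v)) else -2 with hG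
  have hcont : ∀ p, ContinuousAt F p → ContinuousAt G (planeIncl p) := by
    intro p hp
    have h1 : ContinuousAt (fun v : E3 => Real.arctan (F (proj v))) (planeIncl p) := by
      refine Real.continuous_arctan.continuousAt.comp ?_
      refine ContinuousAt.comp (f := proj) ?_ continuous_proj.continuousAt
      rwa [planeIncl_eq, proj_lift]
    have h2 : Continuous fun v : E3 => |v 2| := by fun_prop
    refine h1.congr ?_
    filter_upwards [h2.continuousAt.eventually (gt_mem_nhds (show |planeIncl p 2| < 1 / 2 by
      simp [planeIncl_eq]))] with v hv
    simp only [hG, if_pos hv]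
  refine ⟨G, fun v s hs => ?_, t, ht, hcont p hc, ?_, ?_⟩
  · by_cases hv : |v 2| < 1 / 2
    · have h1 : |Θ s v 2| < 1 / 2 := by
        rw [flow_of_slab hv hs, lift_two, abs_mul, abs_of_pos (Real.exp_pos _)]
        have := Real.exp_le_one_iff.2 (neg_nonpos.2 hs)
        nlinarith [abs_nonneg (v 2)]
      simp only [hG, if_pos hv, if_pos h1]
      refine Real.arctan_strictMono.monotone ?_
      rw [flow_of_slab hv hs, proj_lift]
      exact hF _ s hs
    · simp only [hG, if_neg hv]
      split_ifs with h1
      · have := Real.neg_pi_div_two_lt_arctan (F (proj (Θ s v)))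
        linarith [Real.pi_lt_four]
      · exact le_rfl
  · rw [flow_planeIncl]
    exact hcont _ hct
  · rw [flow_planeIncl]
    simp only [hG, planeIncl_eq, lift_two, proj_lift]
    norm_num
    exact hlt

lemma isTransient_space_of_abs_ne {v : E3} (h0 : v 2 ≠ 0) (h1 : |v 2| ≠ 1) :
    IsTransient (n := 3) spaceField v := by
  obtain ⟨σ, hσ, hz⟩ := exists_sign (v 2)
  have hpos := abs_pos.2 h0
  rcases lt_or_gt_of_ne h1 with h | h
  · refine space_hasFlow.isTransient_of_levels (f := fun v => -(σ * v 2))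
      (f' := fun v => -verticalField (σ * v 2)) (a := -1) (b := 0) (by fun_prop)
      (fun v t => (hasDerivAt_flow_sign hσ v t).neg) (fun v h2 h3 => ?_) ?_ ?_ ?_
    · have := verticalField_lt_zero (z := σ * v 2) (by linarith) (by linarith)
      linarith
    · simp only [hz]; linarith
    · simp only [hz]; linarith
    · simp only [hz]
      have := verticalField_lt_zero hpos h
      linarith
  · refine space_hasFlow.isTransient_of_levels (f := fun v => σ * v 2)
      (f' := fun v => verticalField (σ * v 2)) (a := 1) (b := |v 2| + 1) (by fun_prop)
      (hasDerivAt_flow_sign hσ) (fun v h2 _ => (verticalField_pos h2).le) ?_ ?_ ?_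
    · simp only [hz]; exact h
    · simp only [hz]; linarith
    · simp only [hz]; exact verticalField_pos h

/-- At the heights of the two added sources the orbits move away from the axis. -/
lemma isTransient_space_of_top {σ : ℝ} (hσ : σ = 1 ∨ σ = -1) {v : E3} (h : σ * v 2 = 1)
    (h' : proj v ≠ 0) : IsTransient (n := 3) spaceField v := by
  have hz : Continuous fun v : E3 => σ * v 2 := by fun_prop
  have hq : ∀ v, 0 ≤ sqn (proj v) := fun v => sqn_nonneg _
  refine space_hasFlow.isTransient_of_region (R := {v : E3 | 3 / 4 < σ * v 2})
    (isOpen_lt continuous_const hz) (fun v s t hst ht => ?_)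
    (f := fun v => -(1 + sqn (proj v))⁻¹)
    (f' := fun v => 2 * sqn (proj v) / (1 + sqn (proj v)) ^ 2) ?_ (fun v t ht => ?_)
    (fun v _ => ?_) (B := 0) (fun v _ => ?_) ?_ ?_
  · have ht : 3 / 4 < σ * Θ t v 2 := ht
    have := le_height_of_le hσ hst (min_le_left (σ * Θ t v 2) 1)
      (lt_min (by linarith) one_pos) (min_le_right _ _)
    exact (lt_min ht (by norm_num)).trans_le this
  · have hc : Continuous fun v : E3 => 1 + sqn (proj v) :=
      (continuous_sqn.comp continuous_proj).const_add 1
    exact (hc.inv₀ fun v => by have := hq v; positivity).neg.continuousOn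
  · have ht : 3 / 4 < σ * Θ t v 2 := ht
    have hd := space_hasFlow.hasDerivAt v t
    have e : spaceField (Θ t v) = lift (proj (Θ t v)) (verticalField (Θ t v 2)) :=
      spaceField_of_le_abs (by rw [← abs_sign_mul hσ]; exact ht.le.trans (le_abs_self _))
    rw [e] at hd
    have h1 : HasDerivAt (fun t => sqn (proj (Θ t v))) (2 * sqn (proj (Θ t v))) t := by
      refine (((hasDerivAt_coord hd 0).pow 2).add ((hasDerivAt_coord hd 1).pow 2)).congr_deriv ?_
      simp [sqn]
      ring
    refine ((h1.const_add 1).inv (by have := hq (Θ t v); positivity)).neg.congr_deriv ?_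
    rw [neg_div, neg_neg]
  · have := hq v
    positivity
  · have := hq v
    simp only [Left.neg_nonpos_iff]
    positivity
  · simp only [mem_ofPred_eq]
    rw [h]; norm_num
  · have h3 : 0 < sqn (proj v) := by
      rw [sqn_eq_norm_sq]
      exact pow_pos (norm_pos_iff.2 h') 2
    positivity

lemma isTransient_space {v : E3} (h : spaceField v ≠ 0) (h' : v ∉ planeIncl '' unitCircle) :
    IsTransient (n := 3) spaceField v := by
  by_cases h0 : v 2 = 0
  · rw [lift_proj_of_eq h0]
    refine isTransient_lift (isTransient_planar (fun h1 => h ?_) fun h1 => h' ?_)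
    · exact spaceField_eq_zero_iff.2 (Or.inl ⟨proj v, h1, lift_proj_of_eq h0⟩)
    · exact ⟨proj v, h1, (lift_proj_of_eq h0).symm⟩
  by_cases h1 : |v 2| = 1
  · obtain ⟨σ, hσ, hz⟩ := exists_sign (v 2)
    refine isTransient_space_of_top hσ (hz.trans h1) fun h2 => h ?_
    have h3 : v 2 = σ := by
      rw [h1] at hz
      rcases hσ with rfl | rfl <;> linarith
    rw [lift_proj_of_eq h3, h2]
    exact spaceField_top hσ
  · exact isTransient_space_of_abs_ne h0 h1

lemma closedOrbits_space :
    {c | IsClosedOrbit (n := 3) spaceField c} = {planeIncl '' unitCircle} :=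
  space_hasFlow.closedOrbits_eq (isClosedOrbit_planeIncl isClosedOrbit_unitCircle)
    fun _ => isTransient_space

lemma isCritical_space_iff {β : Set E3} : IsCritical (n := 3) spaceField β ↔
    (∃ β', IsCritical (n := 2) planarField β' ∧ β = planeIncl '' β') ∨
      ∃ σ, (σ = 1 ∨ σ = -1) ∧ β = {top σ} := by
  constructor
  · rintro (⟨p, hp, rfl⟩ | hβ)
    · rcases spaceField_eq_zero_iff.1 hp with ⟨p, h, rfl⟩ | rfl | rfl
      · exact Or.inl ⟨{p}, Or.inl ⟨p, h, rfl⟩, image_singleton.symm⟩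
      · exact Or.inr ⟨1, Or.inl rfl, rfl⟩
      · exact Or.inr ⟨-1, Or.inr rfl, rfl⟩
    · have : β ∈ ({planeIncl '' unitCircle} : Set (Set E3)) := closedOrbits_space ▸ hβ
      exact Or.inl ⟨_, isCritical_unitCircle, this⟩
  · rintro (⟨β', h, rfl⟩ | ⟨σ, hσ, rfl⟩)
    · exact isCritical_planeIncl h
    · exact isCritical_top hσ

/-! ### Transversality on three-space -/

lemma isOpen_pos_height (σ : ℝ) : IsOpen {v : E3 | 0 < σ * v 2} :=
  isOpen_lt continuous_const (by fun_prop)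

lemma hasFDerivAt_planeIncl (p : E2) : ContMDiffAt (𝓡 2) (𝓡 3) ∞ planeIncl p ∧
    ∀ w : E2, (mfderiv (𝓡 2) (𝓡 3) planeIncl p : E2 →L[ℝ] E3) w = planeIncl w := by
  have hc : ContDiff ℝ ∞ planeIncl := contDiff_lift contDiff_id contDiff_const
  refine ⟨hc.contMDiff.contMDiffAt, fun w => ?_⟩
  rw [mfderiv_eq_fderiv]
  change (fderiv ℝ planeIncl p : E2 →L[ℝ] E3) w = planeIncl w
  have h1 : HasDerivAt (fun t : ℝ => p + t • w) w 0 := by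
    simpa using ((hasDerivAt_id (0 : ℝ)).smul_const w).const_add p
  have h2 : HasFDerivAt planeIncl (fderiv ℝ planeIncl p) (p + (0 : ℝ) • w) := by
    simpa using ((hc.differentiable (by simp)) p).hasFDerivAt
  refine (h2.comp_hasDerivAt 0 h1).unique ?_
  have h3 := hasDerivAt_lift h1 (hasDerivAt_const 0 (0 : ℝ))
  exact h3

lemma transverse_space {β β' : Set E3} (hβ : IsCritical (n := 3) spaceField β)
    (hβ' : IsCritical (n := 3) spaceField β') :
    Transverse 3 (unstableSet (n := 3) spaceField β) (stableSet (n := 3) spaceField β') := by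
  intro v hv
  rcases isCritical_space_iff.1 hβ with ⟨β₀, h₀, rfl⟩ | ⟨σ, hσ, rfl⟩
  · rw [unstable_planeIncl h₀] at hv ⊢
    obtain ⟨⟨p, hp, rfl⟩, hs⟩ := hv
    have hsmall : |planeIncl p 2| < 1 / 2 := by simp [planeIncl_eq]
    rcases isCritical_space_iff.1 hβ' with ⟨β₁, h₁, rfl⟩ | ⟨σ, hσ, rfl⟩
    · rw [mem_stable_planeIncl h₁.isCompact hsmall, planeIncl_eq, proj_lift] at hs
      have hpl := transverse_planar h₀ h₁ p ⟨hp, hs⟩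
      set S : Submodule ℝ E3 := Submodule.span ℝ
        (tangentVectors 3 (planeIncl '' unstableSet (n := 2) planarField β₀) (planeIncl p) ∪
          tangentVectors 3 (stableSet (n := 3) spaceField (planeIncl '' β₁)) (planeIncl p)) with hS
      obtain ⟨hi, hd⟩ := hasFDerivAt_planeIncl p
      have hs0 : ∀ {q}, q ∈ stableSet (n := 2) planarField β₁ →
          planeIncl q ∈ stableSet (n := 3) spaceField (planeIncl '' β₁) := fun {q} hq => by
        rw [mem_stable_planeIncl h₁.isCompact (by simp [planeIncl_eq]), planeIncl_eq, proj_lift]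
        exact hq
      -- the horizontal directions come from the plane
      have hhor : ∀ w, planeIncl w ∈ S := by
        intro w
        have hw : w ∈ Submodule.span ℝ
            (tangentVectors 2 (unstableSet (n := 2) planarField β₀) p ∪
              tangentVectors 2 (stableSet (n := 2) planarField β₁) p) := by
          rw [hpl]; trivial
        induction hw using Submodule.span_induction with
        | mem w hw =>
          rw [← hd]
          rcases hw with hw | hw
          · exact Submodule.subset_span (Or.inl (mfderiv_mem_tangentVectors hi
              (Eventually.of_forall fun q hq => mem_image_of_mem planeIncl hq) hw))
          · exact Submodule.subset_span (Or.inr (mfderiv_mem_tangentVectors hi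
              (Eventually.of_forall fun q hq => hs0 hq) hw))
        | zero =>
          have : planeIncl 0 = 0 := ext3 rfl rfl rfl
          rw [this]
          exact S.zero_mem
        | add x y _ _ hx hy =>
          have : planeIncl (x + y) = planeIncl x + planeIncl y := by
            apply ext3 <;> simp [planeIncl_eq]
          rw [this]
          exact S.add_mem hx hy
        | smul a x _ hx =>
          have : planeIncl (a • x) = a • planeIncl x := by
            apply ext3 <;> simp [planeIncl_eq]
          rw [this]
          exact S.smul_mem a hx
      refine span_eq_top_of_single fun i => ?_
      fin_cases i
      · have : (EuclideanSpace.single 0 1 : E3) = planeIncl !₂[1, 0] := by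
          apply ext3 <;> simp [planeIncl_eq]
        exact this ▸ hhor _
      · have : (EuclideanSpace.single 1 1 : E3) = planeIncl !₂[0, 1] := by
          apply ext3 <;> simp [planeIncl_eq]
        exact this ▸ hhor _
      · -- the stable manifold contains a vertical segment
        refine Submodule.subset_span (Or.inr (mem_tangentVectors_of_line ?_))
        filter_upwards [continuous_abs.continuousAt.eventually
          (gt_mem_nhds (show |(0 : ℝ)| < 1 / 2 by norm_num))] with t ht
        have e : planeIncl p + t • EuclideanSpace.single 2 (1 : ℝ) = lift p t := by
          apply ext3 <;> simp [planeIncl_eq]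
        change planeIncl p + t • EuclideanSpace.single 2 (1 : ℝ) ∈ _
        rw [e, mem_stable_planeIncl h₁.isCompact (by simpa using ht), proj_lift]
        exact hs
    · exfalso
      rw [space_hasFlow.mem_stableSet, nhdsSet_singleton] at hs
      simp_rw [flow_planeIncl] at hs
      have h2 : Tendsto (fun t => (planeIncl (φ t p) : E3) 2) atTop (𝓝 σ) :=
        ((by fun_prop : Continuous fun v : E3 => v 2).tendsto (top σ)).comp hs
      have h3 : (0 : ℝ) = σ := tendsto_nhds_unique tendsto_const_nhds h2
      rcases hσ with rfl | rfl <;> norm_num at h3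
  · rw [unstable_top hσ] at hv ⊢
    refine eq_top_iff.2 fun w _ => Submodule.subset_span (Or.inl ?_)
    exact mem_tangentVectors_of_mem_nhds ((isOpen_pos_height σ).mem_nhds hv.1) w

/-! ### Hyperbolicity on three-space -/

lemma differentiableAt_spaceField (v : E3) : DifferentiableAt ℝ spaceField v :=
  (contDiff_spaceField.differentiable (by simp)).differentiableAt

lemma eigenvaluesC_fderiv_space {p : E2} {a : Fin 2 → ℝ}
    (h : ∀ k, fderiv ℝ planarField p (EuclideanSpace.single k 1) =
      a k • EuclideanSpace.single k 1) :
    eigenvaluesC (fderiv ℝ spaceField (planeIncl p)) =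
      Finset.univ.val.map fun k => ((![a 0, a 1, -1] : Fin 3 → ℝ) k : ℂ) := by
  refine eigenvaluesC_of_single fun k => fderiv_apply_of_hasDerivAt
    (differentiableAt_spaceField _) ?_
  have hloc : ∀ w : E3, (fun t : ℝ => spaceField (planeIncl p + t • w)) =ᶠ[𝓝 0] fun t =>
      lift (planarField (p + t • proj w)) (-(t * w 2)) := by
    intro w
    have hc : Continuous fun t : ℝ => |t * w 2| := by fun_prop
    filter_upwards [hc.continuousAt.eventually (gt_mem_nhds
      (show |0 * w 2| < 1 / 2 by norm_num))] with t ht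
    have e : planeIncl p + t • w = lift (p + t • proj w) (t * w 2) := by
      apply ext3 <;> simp [planeIncl_eq]
    rw [e, spaceField_of_abs_lt (by simpa using ht), proj_lift, lift_two]
  have hline : ∀ w : E2, HasDerivAt (fun t : ℝ => planarField (p + t • w))
      (fderiv ℝ planarField p w) 0 := by
    intro w
    have h1 : HasDerivAt (fun t : ℝ => p + t • w) w 0 := by
      simpa using ((hasDerivAt_id (0 : ℝ)).smul_const w).const_add p
    have h2 : HasFDerivAt planarField (fderiv ℝ planarField p) (p + (0 : ℝ) • w) := by
      simpa using (differentiableAt_planarField p).hasFDerivAt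
    exact h2.comp_hasDerivAt 0 h1
  have hv : ∀ c : ℝ, HasDerivAt (fun t : ℝ => -(t * c)) (-c) 0 := fun c =>
    ((hasDerivAt_id (0 : ℝ)).mul_const c).neg.congr_deriv (by simp)
  have e0 : proj (EuclideanSpace.single 0 1) = EuclideanSpace.single 0 1 := by
    apply ext2 <;> simp
  have e1 : proj (EuclideanSpace.single 1 1) = EuclideanSpace.single 1 1 := by
    apply ext2 <;> simp
  have e2 : proj (EuclideanSpace.single 2 1) = 0 := by
    apply ext2 <;> simp
  refine HasDerivAt.congr_of_eventuallyEq ?_ (hloc _)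
  refine (hasDerivAt_lift (hline _) (hv _)).congr_deriv ?_
  fin_cases k
  · simp only [Fin.zero_eta, e0, h]
    apply ext3 <;> simp
  · simp only [Fin.mk_one, e1, h]
    apply ext3 <;> simp
  · simp only [Fin.reduceFinMk, e2, map_zero]
    apply ext3 <;> simp

lemma eigenvaluesC_fderiv_top {σ : ℝ} (hσ : σ = 1 ∨ σ = -1) :
    eigenvaluesC (fderiv ℝ spaceField (top σ)) =
      Finset.univ.val.map fun k => (((fun _ => 1) : Fin 3 → ℝ) k : ℂ) := by
  have hloc : spaceField =ᶠ[𝓝 (top σ)] fun v => v - top σ := by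
    have hc : Continuous fun v : E3 => σ * v 2 := by fun_prop
    filter_upwards [hc.continuousAt.eventually (lt_mem_nhds
      (show 3 / 4 < σ * top σ 2 by simp [top, sign_sq hσ]; norm_num))] with v hv
    have h1 : verticalField (v 2) = v 2 - σ := by
      have h2 := verticalField_sign_mul hσ (v 2)
      rw [verticalField_of_gt hv] at h2
      rcases hσ with rfl | rfl <;> linarith
    rw [spaceField_of_le_abs (by rw [← abs_sign_mul hσ]; exact hv.le.trans (le_abs_self _)), h1]
    apply ext3 <;> simp [top]
  refine eigenvaluesC_of_single fun k => ?_
  rw [hloc.fderiv_eq, fderiv_sub_const, fderiv_fun_id]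
  simp

/-- The frame in which the Poincaré map of the closed orbit in space is diagonal. -/
def orbitFrame (p : E2) : Fin 3 → E3 :=
  ![planeIncl (circleFrame p 0), planeIncl (circleFrame p 1), EuclideanSpace.single 2 1]

/-- The multipliers of the closed orbit in space. -/
def orbitRates : Fin 3 → ℝ := ![circleRates 0, circleRates 1, Real.exp (-(2 * Real.pi))]

lemma flow_two_pi_eventuallyEq (p : E2) : Θ (2 * Real.pi) =ᶠ[𝓝 (planeIncl p)] fun v =>
    lift (φ (2 * Real.pi) (proj v)) (v 2 * Real.exp (-(2 * Real.pi))) := by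
  have hc : Continuous fun v : E3 => |v 2| := by fun_prop
  filter_upwards [hc.continuousAt.eventually (gt_mem_nhds
    (show |planeIncl p 2| < 1 / 2 by simp [planeIncl_eq]))] with v hv
  exact flow_of_slab hv (by positivity)

lemma differentiableAt_space_flow_two_pi {p : E2} (hp : sqn p = 1) :
    DifferentiableAt ℝ (Θ (2 * Real.pi)) (planeIncl p) := by
  refine DifferentiableAt.congr_of_eventuallyEq ?_ (flow_two_pi_eventuallyEq p)
  have h1 : DifferentiableAt ℝ proj (planeIncl p) :=
    (contDiff_proj.differentiable (by simp)).differentiableAt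
  have h2 : DifferentiableAt ℝ (fun v => φ (2 * Real.pi) (proj v)) (planeIncl p) := by
    refine DifferentiableAt.comp _ (g := φ (2 * Real.pi)) ?_ h1
    rw [planeIncl_eq, proj_lift]
    exact differentiableAt_flow_two_pi hp
  have h3 : DifferentiableAt ℝ (fun v : E3 => (φ (2 * Real.pi) (proj v),
      v 2 * Real.exp (-(2 * Real.pi)))) (planeIncl p) := h2.prodMk (by fun_prop)
  have h4 : Differentiable ℝ fun x : E2 × ℝ => lift x.1 x.2 :=
    (contDiff_lift contDiff_fst contDiff_snd).differentiable (by simp)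
  exact h4.differentiableAt.comp _ h3

lemma eigenvaluesC_fderiv_flow {p : E2} (hp : sqn p = 1) :
    eigenvaluesC (fderiv ℝ (Θ (2 * Real.pi)) (planeIncl p)) =
      Finset.univ.val.map fun k => (orbitRates k : ℂ) := by
  refine eigenvaluesC_of_linearIndependent (v := orbitFrame p) ?_ fun k => ?_
  · have h2 := linearIndependent_circleFrame hp
    rw [Fintype.linearIndependent_iff] at h2 ⊢
    intro g hg
    rw [Fin.sum_univ_three] at hg
    have hz := congrArg (fun w : E3 => w 2) hg
    have hxy := congrArg proj hg
    simp [orbitFrame, planeIncl_eq] at hz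
    have h3 := h2 ![g 0, g 1] (by
      rw [Fin.sum_univ_two]
      refine Eq.trans ?_ (hxy.trans proj_map_zero)
      apply ext2 <;> simp [orbitFrame, planeIncl_eq])
    intro i
    fin_cases i
    exacts [h3 0, h3 1, hz]
  · refine fderiv_apply_of_hasDerivAt (differentiableAt_space_flow_two_pi hp) ?_
    have hloc : ∀ w : E3, (fun t : ℝ => Θ (2 * Real.pi) (planeIncl p + t • w)) =ᶠ[𝓝 0] fun t =>
        lift (φ (2 * Real.pi) (p + t • proj w)) (t * w 2 * Real.exp (-(2 * Real.pi))) := by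
      intro w
      have hc : Tendsto (fun t : ℝ => planeIncl p + t • w) (𝓝 0) (𝓝 (planeIncl p)) := by
        have : Continuous fun t : ℝ => planeIncl p + t • w := by fun_prop
        simpa using this.tendsto 0
      filter_upwards [hc.eventually (flow_two_pi_eventuallyEq p)] with t ht
      rw [ht]
      have e : planeIncl p + t • w = lift (p + t • proj w) (t * w 2) := by
        apply ext3 <;> simp [planeIncl_eq]
      rw [e, proj_lift, lift_two]
    have hline : ∀ w : E2, HasDerivAt (fun t : ℝ => φ (2 * Real.pi) (p + t • w))
        (fderiv ℝ (φ (2 * Real.pi)) p w) 0 := by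
      intro w
      have h1 : HasDerivAt (fun t : ℝ => p + t • w) w 0 := by
        simpa using ((hasDerivAt_id (0 : ℝ)).smul_const w).const_add p
      have h2 : HasFDerivAt (φ (2 * Real.pi)) (fderiv ℝ (φ (2 * Real.pi)) p) (p + (0 : ℝ) • w) := by
        simpa using (differentiableAt_flow_two_pi hp).hasFDerivAt
      exact h2.comp_hasDerivAt 0 h1
    have hv : ∀ c : ℝ, HasDerivAt (fun t : ℝ => t * c * Real.exp (-(2 * Real.pi)))
        (c * Real.exp (-(2 * Real.pi))) 0 := fun c => by
      simpa using ((hasDerivAt_id (0 : ℝ)).mul_const c).mul_const (Real.exp (-(2 * Real.pi)))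
    refine HasDerivAt.congr_of_eventuallyEq ?_ (hloc _)
    refine (hasDerivAt_lift (hline _) (hv _)).congr_deriv ?_
    fin_cases k
    · simp only [Fin.zero_eta, orbitFrame, Matrix.cons_val_zero, planeIncl_eq, proj_lift,
        fderiv_flow_two_pi hp]
      apply ext3 <;> simp [orbitRates]
    · simp only [Fin.mk_one, orbitFrame, Matrix.cons_val_one, Matrix.cons_val_zero, planeIncl_eq,
        proj_lift, fderiv_flow_two_pi hp]
      apply ext3 <;> simp [orbitRates]
    · have e2 : proj (EuclideanSpace.single 2 1) = 0 := by
        apply ext2 <;> simp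
      simp only [Fin.reduceFinMk, orbitFrame, Matrix.cons_val, e2, map_zero]
      apply ext3 <;> simp [orbitRates]

lemma orbitRates_lt_one {i : Fin 3} (hi : i ≠ 0) : 0 ≤ orbitRates i ∧ orbitRates i < 1 := by
  fin_cases i
  · exact absurd rfl hi
  · exact circleRates_lt_one (i := 1) (by decide)
  · have := Real.pi_pos
    simp [orbitRates, Real.exp_nonneg, this]

lemma setOf_space_flow_eq {p : E2} (hp : sqn p = 1) :
    {T | 0 < T ∧ Θ T (planeIncl p) = planeIncl p} = {T | 0 < T ∧ Real.cos T = 1} := by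
  rw [← setOf_flow_eq hp]
  ext T
  simp only [mem_ofPred_eq, flow_planeIncl, planeIncl_injective.eq_iff]

lemma period_space {p : E2} (hp : sqn p = 1) :
    period (n := 3) spaceField (planeIncl p) = 2 * Real.pi := by
  change sInf {T | 0 < T ∧ Θ T (planeIncl p) = planeIncl p} = _
  rw [setOf_space_flow_eq hp]
  exact isLeast_cos_eq_one.csInf_eq

lemma space_orbit_hyperbolic :
    IsHyperbolicOrbit (n := 3) spaceField (planeIncl '' unitCircle) ∧
      HasOrbitIndex (n := 3) spaceField (planeIncl '' unitCircle) 0 := by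
  refine isHyperbolicOrbit_of_eigenvalues (a := orbitRates) (i₀ := 0) ?_ circleRates_zero
    fun i hi => orbitRates_lt_one hi
  rintro _ ⟨p, hp, rfl⟩
  change eigenvaluesC (mfderiv (𝓡 3) (𝓡 3) (Θ (period (n := 3) spaceField (planeIncl p)))
    (planeIncl p)) = _
  rw [period_space hp, mfderiv_eq_fderiv]
  exact eigenvaluesC_fderiv_flow hp

/-! ### The Morse-Smale property and the connections on three-space -/

/-- The eigenvalues of the linearization at the rest points of the field on three-space. -/
inductive SpaceRest : E3 → (Fin 3 → ℝ) → Prop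
  | source (i : Fin 3) : SpaceRest (planeIncl (source i)) ![sourceRates i 0, sourceRates i 1, -1]
  | saddle (i : Fin 2) : SpaceRest (planeIncl (saddle i)) ![saddleRates i 0, saddleRates i 1, -1]
  | top {σ : ℝ} (hσ : σ = 1 ∨ σ = -1) : SpaceRest (top σ) fun _ => 1

lemma exists_spaceRest {v : E3} (h : spaceField v = 0) : ∃ a, SpaceRest v a := by
  rcases spaceField_eq_zero_iff.1 h with ⟨p, hp, rfl⟩ | rfl | rfl
  · rcases planarField_eq_zero_iff.1 hp with ⟨i, rfl⟩ | ⟨i, rfl⟩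
    exacts [⟨_, .source i⟩, ⟨_, .saddle i⟩]
  · exact ⟨_, .top (Or.inl rfl)⟩
  · exact ⟨_, .top (Or.inr rfl)⟩

namespace SpaceRest

lemma eigenvalues {v : E3} {a : Fin 3 → ℝ} (h : SpaceRest v a) :
    eigenvaluesC (fderiv ℝ spaceField v) = Finset.univ.val.map fun k => (a k : ℂ) := by
  cases h with
  | source i => exact eigenvaluesC_fderiv_space (fderiv_planarField_source i)
  | saddle i => exact eigenvaluesC_fderiv_space (fderiv_planarField_saddle i)
  | top hσ => exact eigenvaluesC_fderiv_top hσ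

lemma ne_zero {v : E3} {a : Fin 3 → ℝ} (h : SpaceRest v a) (k : Fin 3) : a k ≠ 0 := by
  cases h with
  | source i =>
    fin_cases k
    exacts [(sourceRates_pos i 0).ne', (sourceRates_pos i 1).ne', by norm_num]
  | saddle i =>
    fin_cases k
    exacts [saddleRates_ne_zero i 0, saddleRates_ne_zero i 1, by norm_num]
  | top hσ => exact one_ne_zero

end SpaceRest

lemma card_pos_source (i : Fin 3) : (Finset.univ.filter fun k =>
    0 < (![sourceRates i 0, sourceRates i 1, -1] : Fin 3 → ℝ) k).card = 2 := by
  rw [Finset.card_filter, Fin.sum_univ_three]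
  simp [sourceRates_pos]

lemma card_pos_saddle (i : Fin 2) : (Finset.univ.filter fun k =>
    0 < (![saddleRates i 0, saddleRates i 1, -1] : Fin 3 → ℝ) k).card = 1 := by
  rw [Finset.card_filter, Fin.sum_univ_three]
  fin_cases i <;> simp [saddleRates] <;> norm_num

lemma card_pos_top : (Finset.univ.filter fun k => 0 < (fun _ : Fin 3 => (1 : ℝ)) k).card = 3 := by
  simp

lemma finite_setOf_spaceField_eq_zero : {v | spaceField v = 0}.Finite := by
  have h : {v | planarField v = 0}.Finite := by
    rw [setOf_planarField_eq_zero]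
    exact (finite_range _).union (finite_range _)
  refine ((h.image planeIncl).union (toFinite {top 1, top (-1)})).subset fun v hv => ?_
  rcases spaceField_eq_zero_iff.1 hv with ⟨p, hp, rfl⟩ | h
  exacts [Or.inl ⟨p, hp, rfl⟩, Or.inr h]

lemma isMorseSmale_space : IsMorseSmale (n := 3) spaceField := by
  refine space_hasFlow.isMorseSmale (contMDiff_section contDiff_spaceField)
    finite_setOf_spaceField_eq_zero (isClosedOrbit_planeIncl isClosedOrbit_unitCircle)
    (fun _ => isTransient_space)
    (fun v _ t => (space_hasFlow.continuous_flowMap_right contDiff_one_spaceField t).continuousAt)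
    (fun p hp => ?_) space_orbit_hyperbolic.1 fun β β' => transverse_space
  obtain ⟨a, ha⟩ := exists_spaceRest hp
  refine isHyperbolicRest_of_eigenvalues (a := a) ?_ ha.ne_zero
  rw [linearization_eq]
  exact ha.eigenvalues

lemma SpaceRest.restIndex {v : E3} {a : Fin 3 → ℝ} (h : SpaceRest v a) :
    restIndex (n := 3) spaceField v = (Finset.univ.filter fun k => 0 < a k).card :=
  restIndex_of_eigenvalues (by rw [linearization_eq]; exact h.eigenvalues)

lemma connections_planeIncl {β β' : Set E2} (hβ : IsCritical (n := 2) planarField β)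
    (hβ' : IsCritical (n := 2) planarField β') :
    unstableSet (n := 3) spaceField (planeIncl '' β) ∩
        stableSet (n := 3) spaceField (planeIncl '' β') =
      planeIncl '' (unstableSet (n := 2) planarField β ∩ stableSet (n := 2) planarField β') := by
  rw [unstable_planeIncl hβ, ← image_inter_preimage]
  congr 2
  ext p
  exact (mem_stable_planeIncl hβ'.isCompact (by simp [planeIncl_eq])).trans
    (by rw [planeIncl_eq, proj_lift])

/-- The points whose orbits tend to infinity. -/
def escape : Set E3 := {v | Tendsto (fun t => Θ t v) atTop (cocompact E3)}

lemma escape_planeIncl {β : Set E2} (hβ : IsCritical (n := 2) planarField β) :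
    unstableSet (n := 3) spaceField (planeIncl '' β) ∩ escape =
      planeIncl '' (unstableSet (n := 2) planarField β ∩ {v | 4 < sqn v}) := by
  rw [unstable_planeIncl hβ, ← image_inter_preimage]
  congr 2
  ext p
  exact (tendsto_cocompact_iff_of_slab (by simp [planeIncl_eq])).trans
    (by rw [planeIncl_eq, proj_lift]; rfl)

lemma isConnected_top_source {σ : ℝ} (hσ : σ = 1 ∨ σ = -1) (j : Fin 3) :
    IsConnected (unstableSet (n := 3) spaceField {top σ} ∩
      stableSet (n := 3) spaceField (planeIncl '' {source j})) := by
  have hA : IsConnected ((fun z => lift (source j) (σ * z)) '' Ioo 0 (1 / 2)) :=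
    (isConnected_Ioo (by norm_num)).image _
      (continuous_lift.comp (continuous_const.prodMk (by fun_prop))).continuousOn
  have habs : ∀ z, |σ * z| = |z| := abs_sign_mul hσ
  refine space_hasFlow.isConnected_of_crossing (space_hasFlow.continuous_uncurry
    contDiff_one_spaceField) hA ?_ ?_
  · rintro _ ⟨z, hz, rfl⟩ t
    refine ⟨(space_hasFlow.flowMap_mem_unstableSet t).2 ?_,
      (space_hasFlow.flowMap_mem_stableSet t).2 ?_⟩
    · rw [unstable_top hσ]
      change 0 < σ * (σ * z)
      rw [← mul_assoc, sign_sq hσ, one_mul]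
      exact hz.1
    · rw [mem_stable_planeIncl isCompact_singleton (by
        rw [lift_two, habs, abs_of_pos hz.1]; exact hz.2), proj_lift]
      exact mem_stable_source_iff.2 rfl
  · rintro v ⟨h1, h2⟩
    have h3 : |v 2| < 1 := not_le.1 fun h => notMem_stable_planeIncl h h2
    obtain ⟨s, -, hs⟩ := exists_abs_lt_half h3
    have h4 := (space_hasFlow.flowMap_mem_stableSet s).2 h2
    have h5 := (space_hasFlow.flowMap_mem_unstableSet s).2 h1
    rw [mem_stable_planeIncl isCompact_singleton hs, mem_stable_source_iff] at h4
    rw [unstable_top hσ] at h5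
    refine ⟨s, σ * Θ s v 2, ⟨h5, ?_⟩, ?_⟩
    · exact (le_abs_self _).trans_lt (by rwa [habs])
    · change lift (source j) (σ * (σ * Θ s v 2)) = _
      rw [← mul_assoc, sign_sq hσ, one_mul, ← h4, lift_proj]

/-! ### A coordinate that straightens the field at infinity -/

/-- The discriminant of the quadratic equation `height z * ζ ^ 2 + 2 * depth z * ζ = q * height z`
that defines the straightened height `ζ`. -/
def disc (q z : ℝ) : ℝ := depth z ^ 2 + q * height z ^ 2

open Classical in
/-- The quotient of the straightened height by `height`; the two formulas agree where both
denominators are nonzero. -/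
def slope (q z : ℝ) : ℝ :=
  if |z| < 1 then q / (depth z + √(disc q z)) else (√(disc q z) - depth z) / height z ^ 2

/-- The straightened height: the function of `q = x ^ 2 + y ^ 2` and `z` that grows like `exp t`
along the orbits of the field `(x, y, verticalField z)`. -/
def straight (q z : ℝ) : ℝ := height z * slope q z

section Straight

variable {q z : ℝ}

lemma height_ne_zero (h : z ≠ 0) : height z ≠ 0 := by
  rcases lt_or_gt_of_ne h with h | h
  · rw [← neg_neg z, height_neg]
    exact neg_ne_zero.2 (height_pos (by linarith)).ne'
  · exact (height_pos h).ne'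

lemma disc_pos (hq : 0 ≤ q) (h : 0 < q ∨ 1 < |z|) : 0 < disc q z := by
  unfold disc
  rcases lt_or_ge |z| 1 with h1 | h1
  · have := depth_pos h1
    positivity
  · have h0 : height z ≠ 0 := height_ne_zero (abs_pos.1 (by linarith))
    rcases h with h | h
    · positivity
    · have : depth z ≠ 0 := by
        rcases lt_abs.1 h with h2 | h2
        · rw [depth_of_ge (by linarith)]; linarith
        · rw [← depth_neg, depth_of_ge (by linarith)]; linarith
      positivity

lemma sq_sqrt_disc (h : 0 < disc q z) : √(disc q z) ^ 2 = depth z ^ 2 + q * height z ^ 2 :=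
  Real.sq_sqrt h.le

lemma slope_of_lt (h : |z| < 1) : slope q z = q / (depth z + √(disc q z)) := if_pos h

lemma slope_of_ne (h : z ≠ 0) (hd : 0 < disc q z) :
    slope q z = (√(disc q z) - depth z) / height z ^ 2 := by
  by_cases h1 : |z| < 1
  · have h2 := depth_pos h1
    have h3 := Real.sqrt_pos.2 hd
    have h4 := height_ne_zero h
    rw [slope_of_lt h1, div_eq_div_iff (by positivity) (by positivity)]
    linear_combination -sq_sqrt_disc hd
  · exact if_neg h1

lemma slope_mul_add (h : 0 < disc q z) : slope q z * (depth z + √(disc q z)) = q := by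
  by_cases h1 : |z| < 1
  · have h2 := depth_pos h1
    have h3 := Real.sqrt_pos.2 h
    rw [slope_of_lt h1, div_mul_cancel₀ _ (by positivity)]
  · have h0 : z ≠ 0 := by
      rintro rfl
      simp at h1
    have h4 := height_ne_zero h0
    rw [slope_of_ne h0 h, div_mul_eq_mul_div, div_eq_iff (by positivity)]
    linear_combination sq_sqrt_disc h

lemma slope_mul_sq (h : 0 < disc q z) :
    slope q z * height z ^ 2 = √(disc q z) - depth z := by
  by_cases h0 : z = 0
  · have hd : depth z = 1 := depth_of_abs_le (by rw [h0]; norm_num)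
    have he : height z = 0 := by rw [h0, height_zero]
    rw [disc, hd, he]
    norm_num
  · rw [slope_of_ne h0 h, div_mul_cancel₀]
    exact pow_ne_zero 2 (height_ne_zero h0)

lemma slope_pos (hq : 0 ≤ q) (h : 0 < q ∨ 1 < |z|) : 0 < slope q z := by
  have hd := disc_pos hq h
  have h3 := Real.sqrt_pos.2 hd
  by_cases h1 : |z| < 1
  · rw [slope_of_lt h1]
    have := depth_pos h1
    exact div_pos (h.resolve_right h1.le.not_gt) (by positivity)
  · have h0 : z ≠ 0 := by
      rintro rfl
      simp at h1
    rw [slope_of_ne h0 hd]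
    have h4 := height_ne_zero h0
    refine div_pos ?_ (by positivity)
    have h5 := sq_sqrt_disc hd
    -- the depth is negative where `|z| > 1`
    have h6 : depth z ≤ 0 := by
      rcases le_abs.1 (not_lt.1 h1) with h2 | h2
      · rw [depth_of_ge (by linarith)]; linarith
      · rw [← depth_neg, depth_of_ge (by linarith)]; linarith
    linarith

lemma disc_neg : disc q (-z) = disc q z := by
  rw [disc, disc, depth_neg, height_neg]; ring

lemma straight_neg : straight q (-z) = -straight q z := by
  rw [straight, straight, slope, slope, abs_neg, disc_neg, depth_neg, height_neg]
  split_ifs <;> ring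

lemma le_straight (hq : 0 ≤ q) (h : 1 ≤ z) (hd : 0 < disc q z) : 2 * (z - 1) ≤ straight q z := by
  rw [straight, slope_of_ne (by linarith) hd, height_of_ge (by linarith),
    depth_of_ge (by linarith)]
  have h1 : z - 1 ≤ √(disc q z) := by
    refine Real.le_sqrt_of_sq_le ?_
    rw [disc, height_of_ge (by linarith), depth_of_ge (by linarith)]
    linarith [sq_abs (1 - z)]
  linarith

lemma contDiffAt_straight (hq : 0 ≤ q) (h : 0 < q ∨ 1 < |z|) :
    ContDiffAt ℝ ∞ (fun p : ℝ × ℝ => straight p.1 p.2) (q, z) := by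
  have hd := disc_pos hq h
  have he : ContDiff ℝ ∞ fun p : ℝ × ℝ => height p.2 := contDiff_height.comp contDiff_snd
  have hdep : ContDiff ℝ ∞ fun p : ℝ × ℝ => depth p.2 := contDiff_depth.comp contDiff_snd
  have hD : ContDiff ℝ ∞ fun p : ℝ × ℝ => disc p.1 p.2 := by
    unfold disc
    fun_prop
  have hS : ContDiffAt ℝ ∞ (fun p : ℝ × ℝ => √(disc p.1 p.2)) (q, z) :=
    hD.contDiffAt.sqrt hd.ne'
  have habs : Continuous fun p : ℝ × ℝ => |p.2| := by fun_prop
  by_cases h1 : |z| < 1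
  · have h2 := depth_pos h1
    have h3 := Real.sqrt_pos.2 hd
    refine (he.contDiffAt.mul (contDiffAt_fst.div (hdep.contDiffAt.add hS)
      (by simp only; positivity))).congr_of_eventuallyEq ?_
    filter_upwards [habs.continuousAt.eventually (gt_mem_nhds h1)] with p hp
    exact congrArg _ (slope_of_lt hp)
  · have h0 : z ≠ 0 := by
      rintro rfl
      simp at h1
    refine (he.contDiffAt.mul ((hS.sub hdep.contDiffAt).div (he.contDiffAt.pow 2)
      (pow_ne_zero 2 (height_ne_zero h0)))).congr_of_eventuallyEq ?_
    filter_upwards [continuous_snd.continuousAt.eventually (isOpen_ne.mem_nhds h0),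
      hD.continuous.continuousAt.eventually (lt_mem_nhds hd)] with p hp hp'
    exact congrArg _ (slope_of_ne hp hp')

/-- The derivative of the straightened height, by implicit differentiation of the quadratic
equation. -/
lemma hasDerivAt_straight {a b : ℝ → ℝ} {a' b' t : ℝ} (ha : HasDerivAt a a' t)
    (hb : HasDerivAt b b' t) (hq : 0 ≤ a t) (h : 0 < a t ∨ 1 < |b t|) :
    HasDerivAt (fun t => straight (a t) (b t))
      (height (b t) / (2 * √(disc (a t) (b t))) * a' +
        wronskian (b t) * slope (a t) (b t) / √(disc (a t) (b t)) * b') t := by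
  have hd := disc_pos hq h
  have h0 : ∀ᶠ s in 𝓝 t, 0 < disc (a s) (b s) := by
    have h1 : ContinuousAt (fun s => disc (a s) (b s)) t := by
      unfold disc
      have h2 := contDiff_depth.continuous.continuousAt.comp hb.continuousAt
      have h3 := contDiff_height.continuous.continuousAt.comp hb.continuousAt
      exact (h2.pow 2).add (ha.continuousAt.mul (h3.pow 2))
    exact h1.eventually (lt_mem_nhds hd)
  have hdiff : DifferentiableAt ℝ (fun s => straight (a s) (b s)) t :=
    ((contDiffAt_straight hq h).differentiableAt (by simp)).comp t
      (f := fun s => (a s, b s)) (ha.differentiableAt.prodMk hb.differentiableAt)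
  have hs := hdiff.hasDerivAt
  have he := (hasDerivAt_height (b t)).differentiableAt.hasDerivAt.comp t hb
  have hdp := (hasDerivAt_depth (b t)).differentiableAt.hasDerivAt.comp t hb
  have hquad := ((he.mul (hs.pow 2)).add ((hdp.mul hs).const_mul 2)).sub (ha.mul he)
  have hz := hquad.unique ((hasDerivAt_const t (0 : ℝ)).congr_of_eventuallyEq ?_)
  · have hS := Real.sqrt_pos.2 hd
    refine hs.congr_deriv ?_
    have h1 := slope_mul_add hd
    have h2 := slope_mul_sq hd
    set S := √(disc (a t) (b t))
    set m := slope (a t) (b t)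
    set D := deriv (fun s => straight (a s) (b s)) t
    have h3 : straight (a t) (b t) = height (b t) * m := rfl
    simp only [Function.comp_apply, h3, wronskian, Pi.pow_apply, Nat.cast_ofNat] at hz ⊢
    have key : D * (2 * S) = height (b t) * a' + 2 * m * ((deriv height (b t)) * depth (b t) -
        height (b t) * deriv depth (b t)) * b' := by
      linear_combination hz - 2 * D * h2 - deriv height (b t) * b' * h1 -
        deriv height (b t) * b' * m * h2
    rw [← eq_div_iff (by positivity)] at key
    rw [key]
    field_simp
  · filter_upwards [h0] with s hs
    have h1 := slope_mul_add hs
    have h2 := slope_mul_sq hs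
    have h3 : straight (a s) (b s) = height (b s) * slope (a s) (b s) := rfl
    simp only [Pi.add_apply, Pi.sub_apply, Pi.mul_apply, Pi.pow_apply, Function.comp_apply, h3]
    linear_combination height (b s) * slope (a s) (b s) * h2 + height (b s) * h1

end Straight

/-! ### A diffeomorphism that straightens the field at infinity -/

/-- A cutoff that vanishes where `q ≤ 5` and `|z| ≤ 2` and equals `1` where `6 ≤ q` or
`3 ≤ |z|`. -/
def gate (q z : ℝ) : ℝ := cutoff 5 6 q + (1 - cutoff 5 6 q) * cutoff 4 9 (z ^ 2)

section Gate

variable {q z : ℝ}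

lemma gate_of_near (hq : q ≤ 5) (hz : |z| ≤ 2) : gate q z = 0 := by
  have h : z ^ 2 ≤ 4 := by nlinarith [sq_abs z, abs_nonneg z]
  rw [gate, cutoff_of_le (by norm_num) hq, cutoff_of_le (by norm_num) h]
  ring

lemma gate_of_far (h : 6 ≤ q ∨ 3 ≤ |z|) : gate q z = 1 := by
  rcases h with h | h
  · rw [gate, cutoff_of_ge (by norm_num) h]
    ring
  · have h1 : 9 ≤ z ^ 2 := by nlinarith [sq_abs z]
    rw [gate, cutoff_of_ge (a := 4) (by norm_num) h1]
    ring

lemma gate_nonneg : 0 ≤ gate q z :=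
  add_nonneg cutoff_nonneg (mul_nonneg (sub_nonneg.2 cutoff_le_one) cutoff_nonneg)

lemma gate_le_one : gate q z ≤ 1 := by
  have h1 : cutoff 5 6 q ≤ 1 := cutoff_le_one
  have h2 : cutoff 4 9 (z ^ 2) ≤ 1 := cutoff_le_one
  unfold gate
  nlinarith

lemma contDiff_gate : ContDiff ℝ ∞ fun p : ℝ × ℝ => gate p.1 p.2 := by
  have h1 := (contDiff_cutoff 5 6).comp (contDiff_fst (𝕜 := ℝ) (E := ℝ) (F := ℝ))
  have h2 := (contDiff_cutoff 4 9).comp ((contDiff_snd (𝕜 := ℝ) (E := ℝ) (F := ℝ)).pow 2)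
  exact h1.add ((contDiff_const.sub h1).mul h2)

lemma hasDerivAt_gate : HasDerivAt (fun z => gate q z)
    ((1 - cutoff 5 6 q) * (deriv (cutoff 4 9) (z ^ 2) * (2 * z))) z := by
  have h1 := ((contDiff_cutoff 4 9).differentiable (by simp) (z ^ 2)).hasDerivAt
  have h2 := HasDerivAt.comp (h₂ := cutoff 4 9) (h := fun z => z ^ 2) z h1 (hasDerivAt_pow 2 z)
  exact ((h2.const_mul (1 - cutoff 5 6 q)).const_add _).congr_deriv (by simp)

end Gate

/-- The height of the straightened point: unchanged near the critical elements, and the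
straightened height at infinity. -/
def newHeight (q z : ℝ) : ℝ := z + gate q z * (straight q z - z)

lemma newHeight_of_near {q z : ℝ} (hq : q ≤ 5) (hz : |z| ≤ 2) : newHeight q z = z := by
  rw [newHeight, gate_of_near hq hz]
  ring

lemma newHeight_of_far {q z : ℝ} (h : 6 ≤ q ∨ 3 ≤ |z|) : newHeight q z = straight q z := by
  rw [newHeight, gate_of_far h]
  ring

lemma newHeight_neg {q z : ℝ} : newHeight q (-z) = -newHeight q z := by
  rw [newHeight, newHeight, straight_neg, gate, gate, neg_sq]
  ring

lemma near_or_pos (q z : ℝ) : (q < 5 ∧ |z| < 2) ∨ (0 < q ∨ 1 < |z|) := by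
  by_cases h : q < 5 ∧ |z| < 2
  · exact Or.inl h
  · rw [not_and_or, not_lt, not_lt] at h
    exact Or.inr (h.imp (fun h => by linarith) fun h => by linarith)

lemma contDiffAt_newHeight {q z : ℝ} (hq : 0 ≤ q) :
    ContDiffAt ℝ ∞ (fun p : ℝ × ℝ => newHeight p.1 p.2) (q, z) := by
  rcases near_or_pos q z with ⟨h1, h2⟩ | h
  · refine contDiffAt_snd.congr_of_eventuallyEq ?_
    have habs : Continuous fun p : ℝ × ℝ => |p.2| := by fun_prop
    filter_upwards [continuous_fst.continuousAt.eventually (gt_mem_nhds h1),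
      habs.continuousAt.eventually (gt_mem_nhds h2)] with p hp hp'
    exact newHeight_of_near hp.le (le_of_lt hp')
  · exact contDiffAt_snd.add (contDiff_gate.contDiffAt.mul
      ((contDiffAt_straight hq h).sub contDiffAt_snd))

lemma exists_hasDerivAt_newHeight {q : ℝ} (hq : 0 ≤ q) (z : ℝ) :
    ∃ D, 0 < D ∧ HasDerivAt (fun z => newHeight q z) D z := by
  rcases near_or_pos q z with ⟨h1, h2⟩ | h
  · refine ⟨1, one_pos, (hasDerivAt_id z).congr_of_eventuallyEq ?_⟩
    filter_upwards [continuous_abs.continuousAt.eventually (gt_mem_nhds h2)] with w hw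
    exact newHeight_of_near h1.le hw.le
  · have hs := hasDerivAt_straight (hasDerivAt_const z q) (hasDerivAt_id' z) hq h
    have hd := (hasDerivAt_gate (q := q)).mul (hs.sub (hasDerivAt_id' z))
    refine ⟨_, ?_, (hasDerivAt_id' z).add hd⟩
    have hpos := div_pos (mul_pos (wronskian_pos z) (slope_pos hq h))
      (Real.sqrt_pos.2 (disc_pos hq h))
    have h0 := gate_nonneg (q := q) (z := z)
    have h1 := gate_le_one (q := q) (z := z)
    -- the straightened height exceeds `z` in modulus where the cutoff varies with `z`
    have h2 : 0 ≤ deriv (cutoff 4 9) (z ^ 2) * (2 * z) * (straight q z - z) := by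
      have hmono : 0 ≤ deriv (cutoff 4 9) (z ^ 2) :=
        (monotone_cutoff (by norm_num)).deriv_nonneg
      rcases lt_or_ge (z ^ 2) 4 with h4 | h4
      · have : cutoff 4 9 =ᶠ[𝓝 (z ^ 2)] fun _ => 0 := by
          filter_upwards [gt_mem_nhds h4] with w hw
          exact cutoff_of_le (by norm_num) hw.le
        rw [this.deriv_eq]
        simp
      · have h5 : 2 ≤ |z| := abs_le_of_sq_le_sq' (by nlinarith [sq_abs z]) (abs_nonneg z) |>.2
        have h6 : 0 ≤ z * (straight q z - z) := by
          rcases le_abs.1 h5 with h6 | h6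
          · have := le_straight (z := z) hq (by linarith) (disc_pos hq (Or.inr (by linarith)))
            nlinarith
          · have h7 := le_straight (z := -z) hq (by linarith)
              (disc_pos hq (Or.inr (by rw [abs_neg]; linarith)))
            rw [straight_neg] at h7
            nlinarith
        nlinarith [mul_nonneg hmono h6]
    have h3 : 0 ≤ 1 - cutoff 5 6 q := sub_nonneg.2 cutoff_le_one
    have h4 := mul_nonneg h3 h2
    simp only [Pi.sub_apply, mul_zero, zero_add, mul_one] at *
    rcases h1.lt_or_eq with h5 | h5
    · nlinarith [mul_nonneg h0 hpos.le]
    · rw [h5]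
      nlinarith

/-- The map that straightens the field at infinity. -/
def unbend (v : E3) : E3 := lift (proj v) (newHeight (sqn (proj v)) (v 2))

lemma contDiff_unbend : ContDiff ℝ ∞ unbend := by
  refine contDiff_lift contDiff_proj (contDiff_iff_contDiffAt.2 fun v => ?_)
  have h1 : ContDiff ℝ ∞ fun v : E3 => (sqn (proj v), v 2) := by
    have h2 := contDiff_sqn.comp contDiff_proj
    exact h2.prodMk (by fun_prop)
  exact (contDiffAt_newHeight (sqn_nonneg _)).comp v h1.contDiffAt

/-- Near infinity the straightening map carries the field to the Euler field. -/
lemma fderiv_unbend {v : E3} (h : 6 < sqn (proj v) ∨ 3 < |v 2|) :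
    fderiv ℝ unbend v (spaceField v) = unbend v := by
  have hfield : spaceField v = lift (proj v) (verticalField (v 2)) := by
    rcases h with h | h
    · exact spaceField_of_six_le h.le
    · exact spaceField_of_le_abs (by linarith)
  have hfar : ∀ᶠ w in 𝓝 v, 6 ≤ sqn (proj w) ∨ 3 ≤ |w 2| := by
    have h1 : Continuous fun w : E3 => sqn (proj w) := continuous_sqn.comp continuous_proj
    have h2 : Continuous fun w : E3 => |w 2| := by fun_prop
    rcases h with h | h
    · exact (h1.continuousAt.eventually (lt_mem_nhds h)).mono fun w hw => Or.inl (le_of_lt hw)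
    · exact (h2.continuousAt.eventually (lt_mem_nhds h)).mono fun w hw => Or.inr (le_of_lt hw)
  have hdis : 0 < sqn (proj v) ∨ 1 < |v 2| := h.imp (fun h => by linarith) fun h => by linarith
  refine fderiv_apply_of_hasDerivAt (contDiff_unbend.differentiable (by simp) v) ?_
  have hline : HasDerivAt (fun t : ℝ => v + t • spaceField v) (spaceField v) 0 := by
    simpa using ((hasDerivAt_id (0 : ℝ)).smul_const (spaceField v)).const_add v
  have hz : HasDerivAt (fun t : ℝ => (v + t • spaceField v) 2) (verticalField (v 2)) 0 :=
    (hasDerivAt_coord hline 2).congr_deriv (by rw [hfield, lift_two])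
  have hp : HasDerivAt (fun t : ℝ => proj (v + t • spaceField v)) (proj v) 0 := by
    refine hasDerivAt_euclidean fun i => ?_
    fin_cases i
    · exact (hasDerivAt_coord hline 0).congr_deriv (by rw [hfield]; rfl)
    · exact (hasDerivAt_coord hline 1).congr_deriv (by rw [hfield]; rfl)
  have hq : HasDerivAt (fun t : ℝ => sqn (proj (v + t • spaceField v))) (2 * sqn (proj v)) 0 := by
    refine (((hasDerivAt_coord hp 0).pow 2).add ((hasDerivAt_coord hp 1).pow 2)).congr_deriv ?_
    simp [sqn]
    ring
  have hs := hasDerivAt_straight hq hz (sqn_nonneg _) (by simpa using hdis)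
  refine HasDerivAt.congr_of_eventuallyEq ?_ ((hline.continuousAt.eventually
    (p := fun w => unbend w = lift (proj w) (straight (sqn (proj w)) (w 2)))) ?_)
  · refine (hasDerivAt_lift hp hs).congr_deriv ?_
    rw [unbend, newHeight_of_far hfar.self_of_nhds]
    congr 1
    simp only [zero_smul, add_zero]
    have hd := disc_pos (sqn_nonneg _) hdis
    have h1 := slope_mul_add hd
    have h2 := Real.sqrt_pos.2 hd
    have h3 := (wronskian_pos (v 2)).ne'
    rw [straight, verticalField]
    field_simp
    linear_combination -height (v 2) * h1
  · simp only [zero_smul, add_zero]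
    filter_upwards [hfar] with w hw
    rw [unbend, newHeight_of_far hw]

section Inverse

variable {n : ℕ}

local notation "E" => EuclideanSpace ℝ (Fin n)

/-- The inverse function theorem. -/
lemma isLocalDiffeomorph_of_fderiv {f : E → E} (hf : ContDiff ℝ ∞ f)
    (h : ∀ p w, fderiv ℝ f p w = 0 → w = 0) : IsLocalDiffeomorph (𝓡 n) (𝓡 n) ∞ f := by
  intro p
  have hequiv : ∀ p, ∃ L : E ≃L[ℝ] E, HasFDerivAt f (L : E →L[ℝ] E) p := fun p => by
    have hinj : Function.Injective (fderiv ℝ f p : E →ₗ[ℝ] E) :=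
      (injective_iff_map_eq_zero _).2 (h p)
    refine ⟨(LinearEquiv.ofInjectiveEndo _ hinj).toContinuousLinearEquiv, ?_⟩
    exact (hf.differentiable (by simp) p).hasFDerivAt.congr_fderiv (by ext; rfl)
  choose L hL using hequiv
  set e := hf.contDiffAt.toOpenPartialHomeomorph f (hL p) (by simp) with he
  refine ⟨{ e.toPartialEquiv with
      open_source := e.open_source
      open_target := e.open_target
      contMDiffOn_toFun := hf.contDiffOn.contMDiffOn
      contMDiffOn_invFun := ?_ }, ?_, fun x _ => rfl⟩
  · refine ContDiffOn.contMDiffOn fun y hy => ?_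
    exact (e.contDiffAt_symm hy (hL _) hf.contDiffAt).contDiffWithinAt
  · exact hf.contDiffAt.mem_toOpenPartialHomeomorph_source (hL p) (by simp)

lemma hasDerivAt_line {f : E → E} (hf : ContDiff ℝ ∞ f) (p w : E) :
    HasDerivAt (fun t : ℝ => f (p + t • w)) (fderiv ℝ f p w) 0 := by
  have h1 : HasDerivAt (fun t : ℝ => p + t • w) w 0 := by
    simpa using ((hasDerivAt_id (0 : ℝ)).smul_const w).const_add p
  have h2 : HasFDerivAt f (fderiv ℝ f p) (p + (0 : ℝ) • w) := by
    simpa using (hf.differentiable (by simp) p).hasFDerivAt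
  exact h2.comp_hasDerivAt 0 h1

/-- The radial map for which the field `u / (1 + |u| ^ 2)` becomes the Euler field. -/
def radialExp (u : E) : E := Real.exp (‖u‖ ^ 2 / 2) • u

lemma contDiff_radialExp : ContDiff ℝ ∞ (radialExp : E → E) :=
  (((contDiff_norm_sq ℝ).div_const 2).exp).smul contDiff_id

lemma fderiv_radialExp (u w : E) :
    fderiv ℝ radialExp u w = Real.exp (‖u‖ ^ 2 / 2) • (w + inner ℝ u w • u) := by
  refine fderiv_apply_of_hasDerivAt (contDiff_radialExp.differentiable (by simp) u) ?_
  have h1 : HasDerivAt (fun t : ℝ => u + t • w) w 0 := by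
    simpa using ((hasDerivAt_id (0 : ℝ)).smul_const w).const_add u
  refine ((h1.norm_sq.div_const 2).exp.smul h1).congr_deriv ?_
  simp only [zero_smul, add_zero]
  module

lemma fderiv_radialExp_injective (u w : E) (h : fderiv ℝ radialExp u w = 0) : w = 0 := by
  rw [fderiv_radialExp, smul_eq_zero_iff_right (Real.exp_pos _).ne'] at h
  have h1 := congrArg (fun y => inner ℝ w y) h
  simp only [inner_add_right, inner_smul_right, real_inner_self_eq_norm_sq, inner_zero_right,
    real_inner_comm u w] at h1
  have h2 : ‖w‖ = 0 := by nlinarith [sq_nonneg (inner ℝ u w), sq_nonneg ‖w‖]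
  exact norm_eq_zero.1 h2

lemma strictMonoOn_radial : StrictMonoOn (fun r : ℝ => Real.exp (r ^ 2 / 2) * r) (Ici 0) := by
  intro r hr s hs hrs
  have hr : 0 ≤ r := hr
  have h1 : Real.exp (r ^ 2 / 2) ≤ Real.exp (s ^ 2 / 2) := Real.exp_le_exp.2 (by gcongr)
  exact mul_lt_mul_of_le_of_lt_of_pos_of_nonneg h1 hrs (Real.exp_pos _) (hr.trans hrs.le)

lemma norm_radialExp (u : E) : ‖radialExp u‖ = Real.exp (‖u‖ ^ 2 / 2) * ‖u‖ := by
  rw [radialExp, norm_smul, Real.norm_of_nonneg (Real.exp_pos _).le]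

lemma bijective_radialExp : Function.Bijective (radialExp : E → E) := by
  constructor
  · intro u w h
    have h1 := congrArg norm h
    rw [norm_radialExp, norm_radialExp] at h1
    have h2 : ‖u‖ = ‖w‖ := strictMonoOn_radial.injOn (norm_nonneg u) (norm_nonneg w) h1
    rw [radialExp, radialExp, h2] at h
    exact smul_right_injective _ (Real.exp_pos _).ne' h
  · intro w
    have hc : Continuous fun r : ℝ => Real.exp (r ^ 2 / 2) * r := by fun_prop
    obtain ⟨r, hr, h⟩ := intermediate_value_Icc (norm_nonneg w) hc.continuousOn
      (show ‖w‖ ∈ _ from ⟨by simp, le_mul_of_one_le_left (norm_nonneg w)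
        (Real.one_le_exp (by positivity))⟩)
    have h : Real.exp (r ^ 2 / 2) * r = ‖w‖ := h
    by_cases hw : w = 0
    · exact ⟨0, by simp [hw, radialExp]⟩
    · have hw' := norm_pos_iff.2 hw
      refine ⟨(r / ‖w‖) • w, ?_⟩
      have hn : ‖(r / ‖w‖) • w‖ = r := by
        rw [norm_smul, Real.norm_of_nonneg (div_nonneg hr.1 hw'.le), div_mul_cancel₀ _ hw'.ne']
      rw [radialExp, hn, smul_smul, mul_div_assoc', h, div_self hw'.ne', one_smul]

lemma tendsto_cocompact_of_bijective {f : E → E} (hf : IsLocalDiffeomorph (𝓡 n) (𝓡 n) ∞ f)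
    (h : Function.Bijective f) : Tendsto f (cocompact E) (cocompact E) :=
  ((hf.isLocalHomeomorph.isOpenEmbedding_of_injective
    h.1).toHomeomorphOfSurjective h.2).isClosedEmbedding.tendsto_cocompact

end Inverse

lemma unbend_zero (v : E3) : unbend v 0 = v 0 := rfl
lemma unbend_one (v : E3) : unbend v 1 = v 1 := rfl
lemma unbend_two (v : E3) : unbend v 2 = newHeight (sqn (proj v)) (v 2) := rfl

lemma fderiv_unbend_injective (v w : E3) (h : fderiv ℝ unbend v w = 0) : w = 0 := by
  have h1 := hasDerivAt_line contDiff_unbend v w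
  rw [h] at h1
  have hline : HasDerivAt (fun t : ℝ => v + t • w) w 0 := by
    simpa using ((hasDerivAt_id (0 : ℝ)).smul_const w).const_add v
  have h0 : w 0 = 0 := (hasDerivAt_coord hline 0).unique (hasDerivAt_coord h1 0)
  have h2 : w 1 = 0 := (hasDerivAt_coord hline 1).unique (hasDerivAt_coord h1 1)
  refine ext3 h0 h2 ?_
  obtain ⟨D, hD, hd⟩ := exists_hasDerivAt_newHeight (sqn_nonneg (proj v)) (v 2)
  have h3 : HasDerivAt (fun t : ℝ => v 2 + t * w 2) (w 2) 0 := by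
    simpa using ((hasDerivAt_id (0 : ℝ)).mul_const (w 2)).const_add (v 2)
  have h4 : HasDerivAt (fun t : ℝ => newHeight (sqn (proj v)) (v 2 + t * w 2)) (D * w 2) 0 :=
    HasDerivAt.comp (h₂ := newHeight (sqn (proj v))) 0 (by simpa using hd) h3
  have h5 : (fun t : ℝ => unbend (v + t • w) 2) =
      fun t : ℝ => newHeight (sqn (proj v)) (v 2 + t * w 2) := by
    funext t
    have : proj (v + t • w) = proj v := by apply ext2 <;> simp [proj, h0, h2]
    rw [unbend_two, this]
    rfl
  have h6 := hasDerivAt_coord h1 2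
  rw [h5] at h6
  have := h4.unique h6
  simpa [hD.ne'] using this

lemma strictMono_newHeight {q : ℝ} (hq : 0 ≤ q) : StrictMono (newHeight q) := by
  refine strictMono_of_deriv_pos fun z => ?_
  obtain ⟨D, hD, hd⟩ := exists_hasDerivAt_newHeight hq z
  rwa [hd.deriv]

lemma le_newHeight {q z : ℝ} (hq : 0 ≤ q) (hz : 3 ≤ z) : 2 * (z - 1) ≤ newHeight q z := by
  have h : 3 ≤ |z| := hz.trans (le_abs_self z)
  rw [newHeight_of_far (Or.inr h)]
  exact le_straight hq (by linarith) (disc_pos hq (Or.inr (by linarith)))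

lemma surjective_newHeight {q : ℝ} (hq : 0 ≤ q) : Function.Surjective (newHeight q) := by
  have hc : Continuous (newHeight q) := continuous_iff_continuousAt.2 fun z =>
    (exists_hasDerivAt_newHeight hq z).choose_spec.2.continuousAt
  intro y
  set a := |y| + 3 with ha
  have h1 := le_newHeight hq (show 3 ≤ a by linarith [abs_nonneg y])
  have h2 : newHeight q (-a) ≤ -(2 * (a - 1)) := by rw [newHeight_neg]; linarith
  obtain ⟨z, -, hz⟩ := intermediate_value_Icc (show -a ≤ a by linarith [abs_nonneg y])
    hc.continuousOn (show y ∈ _ from ⟨by linarith [neg_abs_le y, abs_nonneg y],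
      by linarith [le_abs_self y, abs_nonneg y]⟩)
  exact ⟨z, hz⟩

lemma bijective_unbend : Function.Bijective unbend := by
  constructor
  · intro v w h
    have hp : proj v = proj w := ext2 (show unbend v 0 = unbend w 0 by rw [h])
      (show unbend v 1 = unbend w 1 by rw [h])
    have h2 := congrArg (fun u : E3 => u 2) h
    simp only [unbend_two, hp] at h2
    rw [← lift_proj v, ← lift_proj w, hp, (strictMono_newHeight (sqn_nonneg _)).injective h2]
  · intro u
    obtain ⟨z, hz⟩ := surjective_newHeight (sqn_nonneg (proj u)) (u 2)
    refine ⟨lift (proj u) z, ?_⟩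
    rw [unbend, proj_lift, lift_two, hz, lift_proj]

/-- The composition of the straightening map with the radial map. -/
def expand (v : E3) : E3 := radialExp (unbend v)

lemma contDiff_expand : ContDiff ℝ ∞ expand := contDiff_radialExp.comp contDiff_unbend

lemma bijective_expand : Function.Bijective expand := bijective_radialExp.comp bijective_unbend

lemma fderiv_expand (v w : E3) :
    fderiv ℝ expand v w = fderiv ℝ radialExp (unbend v) (fderiv ℝ unbend v w) := by
  have h := fderiv_comp v (contDiff_radialExp.differentiable (by simp) (unbend v))
    (contDiff_unbend.differentiable (by simp) v)
  exact congrArg (fun L : E3 →L[ℝ] E3 => L w) h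

lemma isLocalDiffeomorph_expand : IsLocalDiffeomorph (𝓡 3) (𝓡 3) ∞ expand := by
  refine isLocalDiffeomorph_of_fderiv contDiff_expand fun v w h => ?_
  rw [fderiv_expand] at h
  exact fderiv_unbend_injective _ _ (fderiv_radialExp_injective _ _ h)

/-! ### The rescaled field -/

/-- The rescaling factor: `1` near the critical elements, and `1 / (1 + |u| ^ 2)` at infinity,
where `u` is the straightened point. -/
def rescale (v : E3) : ℝ :=
  1 - gate (sqn (proj v)) (v 2) +
    gate (sqn (proj v)) (v 2) / (1 + ‖unbend v‖ ^ 2)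

lemma contDiff_rescale : ContDiff ℝ ∞ rescale := by
  have h1 : ContDiff ℝ ∞ fun v : E3 => (sqn (proj v), v 2) := by
    have h2 := contDiff_sqn.comp contDiff_proj
    exact h2.prodMk (by fun_prop)
  have h2 := contDiff_gate.comp h1
  have h3 : ContDiff ℝ ∞ fun v => 1 + ‖unbend v‖ ^ 2 :=
    contDiff_const.add (contDiff_unbend.norm_sq ℝ)
  exact (contDiff_const.sub h2).add (h2.div h3 fun v => by positivity)

lemma rescale_pos (v : E3) : 0 < rescale v := by
  have h0 := gate_nonneg (q := sqn (proj v)) (z := v 2)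
  have h1 := gate_le_one (q := sqn (proj v)) (z := v 2)
  unfold rescale
  rcases h1.lt_or_eq with h | h
  · have : 0 ≤ gate (sqn (proj v)) (v 2) / (1 + ‖unbend v‖ ^ 2) := by positivity
    linarith
  · rw [h]
    have : 0 < 1 / (1 + ‖unbend v‖ ^ 2) := by positivity
    linarith

lemma rescale_le_one (v : E3) : rescale v ≤ 1 := by
  have h0 := gate_nonneg (q := sqn (proj v)) (z := v 2)
  have : gate (sqn (proj v)) (v 2) / (1 + ‖unbend v‖ ^ 2) ≤ gate (sqn (proj v)) (v 2) :=
    div_le_self h0 (by nlinarith [sq_nonneg ‖unbend v‖])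
  unfold rescale
  linarith

lemma rescale_of_near {v : E3} (hq : sqn (proj v) ≤ 5) (hz : |v 2| ≤ 2) : rescale v = 1 := by
  rw [rescale, gate_of_near hq hz]
  simp

lemma rescale_of_far {v : E3} (h : 6 ≤ sqn (proj v) ∨ 3 ≤ |v 2|) :
    rescale v = 1 / (1 + ‖unbend v‖ ^ 2) := by
  rw [rescale, gate_of_far h]
  ring

/-- The rescaled field. -/
def slowField (v : E3) : E3 := rescale v • spaceField v

lemma contDiff_slowField : ContDiff ℝ ∞ slowField := contDiff_rescale.smul contDiff_spaceField

/-- Near infinity the rescaled field is conjugate to the Euler field. -/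
lemma fderiv_expand_slowField {v : E3} (h : 6 < sqn (proj v) ∨ 3 < |v 2|) :
    fderiv ℝ expand v (slowField v) = expand v := by
  rw [fderiv_expand, slowField, map_smul, fderiv_unbend h, map_smul, fderiv_radialExp,
    real_inner_self_eq_norm_sq, rescale_of_far (h.imp le_of_lt le_of_lt), expand, radialExp,
    smul_smul]
  have h0 : 1 + ‖unbend v‖ ^ 2 ≠ 0 := by positivity
  rw [show unbend v + ‖unbend v‖ ^ 2 • unbend v = (1 + ‖unbend v‖ ^ 2) • unbend v by module,
    smul_smul]
  congr 1
  field_simp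

lemma eventually_far : ∀ᶠ v in cocompact E3, 6 < sqn (proj v) ∨ 3 < |v 2| := by
  filter_upwards [(isCompact_cylinder 6 3).compl_mem_cocompact] with v hv
  simpa only [mem_compl_iff, mem_ofPred_eq, not_and_or, not_le] using hv

lemma tendsto_slowField : Tendsto slowField (cocompact E3) (𝓝 0) := by
  -- the field grows at most linearly in the straightened coordinate
  obtain ⟨C, hC⟩ := (isCompact_Icc (a := (-3 : ℝ)) (b := 3)).exists_bound_of_continuousOn
    contDiff_verticalField.continuous.continuousOn
  have hv : ∀ v : E3, 6 < sqn (proj v) ∨ 3 < |v 2| → |verticalField (v 2)| ≤ C + ‖unbend v‖ := by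
    intro v _
    have hn : |unbend v 2| ≤ ‖unbend v‖ := by
      simpa using PiLp.norm_apply_le (unbend v) 2
    have hC0 : 0 ≤ C := (norm_nonneg _).trans (hC 0 (by norm_num))
    rcases le_or_gt |v 2| 3 with h3 | h3
    · have := hC (v 2) (abs_le.1 h3)
      rw [Real.norm_eq_abs] at this
      linarith [norm_nonneg (unbend v)]
    · obtain ⟨σ, hσ, hz⟩ := exists_sign (v 2)
      have h4 : |verticalField (v 2)| = |v 2| - 1 := by
        rw [← abs_sign_mul hσ, ← verticalField_sign_mul hσ, hz, verticalField_of_gt (by linarith),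
          abs_of_pos (by linarith)]
      have h5 := le_newHeight (sqn_nonneg (proj v)) h3.le
      have h6 : newHeight (sqn (proj v)) |v 2| = σ * unbend v 2 := by
        rw [← hz, unbend_two]
        rcases hσ with rfl | rfl
        · simp
        · simp [newHeight_neg]
      have h7 := le_abs_self (σ * unbend v 2)
      rw [abs_sign_mul hσ] at h7
      linarith
  have hb : ∀ v : E3, 6 < sqn (proj v) ∨ 3 < |v 2| →
      ‖slowField v‖ ≤ (C + 2 * ‖unbend v‖) / (1 + ‖unbend v‖ ^ 2) := by
    intro v h
    have hfield : spaceField v = lift (proj v) (verticalField (v 2)) := by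
      rcases h with h | h
      · exact spaceField_of_six_le h.le
      · exact spaceField_of_le_abs (by linarith)
    have h1 : ‖spaceField v‖ ≤ C + 2 * ‖unbend v‖ := by
      have h2 := hv v h
      have h3 : ‖spaceField v‖ ^ 2 = sqn (proj v) + verticalField (v 2) ^ 2 := by
        rw [hfield, EuclideanSpace.norm_sq_eq, Fin.sum_univ_three]
        simp [sqn, lift, proj]
      have h4 : sqn (proj v) ≤ ‖unbend v‖ ^ 2 := by
        rw [EuclideanSpace.norm_sq_eq, Fin.sum_univ_three]
        simp only [Real.norm_eq_abs, sq_abs, unbend_zero, unbend_one]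
        have := sq_nonneg (unbend v 2)
        simp only [sqn, proj]
        simp
        positivity
      have h5 : 0 ≤ C + ‖unbend v‖ := (abs_nonneg _).trans h2
      refine abs_le_of_sq_le_sq' ?_ (by linarith [norm_nonneg (unbend v)]) |>.2
      rw [h3, ← sq_abs (verticalField _)]
      nlinarith [abs_nonneg (verticalField (v 2)), norm_nonneg (unbend v)]
    rw [slowField, norm_smul, Real.norm_of_nonneg (rescale_pos v).le,
      rescale_of_far (h.imp le_of_lt le_of_lt), one_div, inv_mul_eq_div]
    gcongr
  have hu : Tendsto (fun v => ‖unbend v‖) (cocompact E3) atTop :=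
    tendsto_norm_cocompact_atTop.comp (tendsto_cocompact_of_bijective
      (isLocalDiffeomorph_of_fderiv contDiff_unbend fderiv_unbend_injective) bijective_unbend)
  have hlim : Tendsto (fun v => (|C| + 2) * ‖unbend v‖⁻¹) (cocompact E3) (𝓝 0) := by
    simpa using (tendsto_inv_atTop_zero.comp hu).const_mul (|C| + 2)
  refine squeeze_zero_norm' ?_ hlim
  filter_upwards [eventually_far, hu.eventually (eventually_ge_atTop 1)] with v h1 h2
  refine (hb v h1).trans ?_
  rw [div_le_iff₀ (by positivity)]
  have h3 : ‖unbend v‖⁻¹ * ‖unbend v‖ ^ 2 = ‖unbend v‖ := by field_simp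
  have h4 : 0 ≤ ‖unbend v‖⁻¹ := by positivity
  nlinarith [abs_nonneg C, le_abs_self C, mul_nonneg (abs_nonneg C) (sub_nonneg.2 h2)]

/-! ### Stereographic parametrizations of the sphere -/

instance : Fact (Module.finrank ℝ (EuclideanSpace ℝ (Fin (3 + 1))) = 3 + 1) :=
  ⟨finrank_euclideanSpace_fin⟩

/-- The inverse of the stereographic projection from `q`, in the coordinates of Mathlib's atlas. -/
def stereoInv (q : S3) : E3 → S3 := (stereographic' 3 q).symm

lemma isLocalDiffeomorph_stereoInv (q : S3) :
    IsLocalDiffeomorph (𝓡 3) (𝓡 3) ∞ (stereoInv q) := by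
  intro u
  have h : chartAt E3 (-q) = stereographic' 3 q := by
    change stereographic' 3 (- -q) = _
    rw [neg_neg]
  have h1 : ContMDiffOn (𝓡 3) (𝓡 3) ∞ (stereographic' 3 q) (stereographic' 3 q).source :=
    h ▸ contMDiffOn_chart
  have h2 : ContMDiffOn (𝓡 3) (𝓡 3) ∞ (stereographic' 3 q).symm (stereographic' 3 q).target :=
    h ▸ contMDiffOn_chart_symm
  exact ⟨{ (stereographic' 3 q).symm.toPartialEquiv with
      open_source := (stereographic' 3 q).open_target
      open_target := (stereographic' 3 q).open_source
      contMDiffOn_toFun := h2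
      contMDiffOn_invFun := h1 }, by simp, fun _ _ => rfl⟩

lemma injective_stereoInv (q : S3) : Function.Injective (stereoInv q) := fun u w h => by
  have := (stereographic' 3 q).symm.injOn (x₁ := u) (x₂ := w) (by simp) (by simp) h
  exact this

lemma range_stereoInv (q : S3) : range (stereoInv q) = {q}ᶜ := by
  have h := (stereographic' 3 q).symm.image_source_eq_target
  rw [OpenPartialHomeomorph.symm_source, stereographic'_target, image_univ,
    OpenPartialHomeomorph.symm_target, stereographic'_source] at h
  exact h

lemma coe_stereoInv (q : S3) : ∃ U : E3 ≃ₗᵢ[ℝ] (Submodule.span ℝ {(q : EuclideanSpace ℝ (Fin 4))})ᗮ,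
    ∀ x, (stereoInv q x : EuclideanSpace ℝ (Fin 4)) =
      ((‖x‖ ^ 2 + 4)⁻¹ * 4) • (U x : EuclideanSpace ℝ (Fin 4)) +
        ((‖x‖ ^ 2 + 4)⁻¹ * (‖x‖ ^ 2 - 4)) • (q : EuclideanSpace ℝ (Fin 4)) := by
  refine ⟨(OrthonormalBasis.fromOrthogonalSpanSingleton 3
    (ne_zero_of_mem_unit_sphere q)).repr.symm, fun x => ?_⟩
  have h := stereographic'_symm_apply (n := 3) q x
  simp only [Submodule.norm_coe, LinearIsometryEquiv.norm_map, smul_smul] at h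
  exact h

lemma stereoInv_neg_zero (q : S3) : stereoInv (-q) 0 = q := by
  obtain ⟨U, hU⟩ := coe_stereoInv (-q)
  ext1
  rw [hU, map_zero]
  simp

/-- In the two stereographic parametrizations, dilations near one pole are contractions near the
other one. -/
lemma exists_stereoInv_eq (q : S3) {w : E3} (hw : w ≠ 0) : ∃ u : E3, ‖u‖ = 4 / ‖w‖ ∧
    ∀ s : ℝ, 0 < s → stereoInv (-q) (s • w) = stereoInv q (s⁻¹ • u) := by
  obtain ⟨U, hU⟩ := coe_stereoInv q
  obtain ⟨U', hU'⟩ := coe_stereoInv (-q)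
  have hn : 0 < ‖w‖ := norm_pos_iff.2 hw
  have hy : (U' w : EuclideanSpace ℝ (Fin 4)) ∈
      (Submodule.span ℝ {(q : EuclideanSpace ℝ (Fin 4))})ᗮ := by
    have h := (U' w).2
    rw [Submodule.mem_orthogonal_singleton_iff_inner_right] at h ⊢
    simpa using h
  set u := (4 / ‖w‖ ^ 2) • U.symm ⟨U' w, hy⟩ with hu
  have hnu : ‖u‖ = 4 / ‖w‖ := by
    rw [hu, norm_smul, LinearIsometryEquiv.norm_map, Real.norm_of_nonneg (by positivity)]
    have : ‖(⟨U' w, hy⟩ : (Submodule.span ℝ {(q : EuclideanSpace ℝ (Fin 4))})ᗮ)‖ = ‖w‖ := by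
      rw [← U'.norm_map w]
      rfl
    rw [this]
    field_simp
  refine ⟨u, hnu, fun s hs => ?_⟩
  ext1
  have h1 : ((U (s⁻¹ • u) : _) : EuclideanSpace ℝ (Fin 4)) =
      (s⁻¹ * (4 / ‖w‖ ^ 2)) • (U' w : EuclideanSpace ℝ (Fin 4)) := by
    rw [hu, smul_smul, map_smul, LinearIsometryEquiv.apply_symm_apply]
    rfl
  have h2 : ((U' (s • w) : _) : EuclideanSpace ℝ (Fin 4)) =
      s • (U' w : EuclideanSpace ℝ (Fin 4)) := by
    rw [map_smul]
    rfl
  have h3 : ((-q : S3) : EuclideanSpace ℝ (Fin 4)) = -(q : EuclideanSpace ℝ (Fin 4)) := rfl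
  rw [hU, hU', h1, h2]
  generalize (U' w : EuclideanSpace ℝ (Fin 4)) = y
  rw [h3, norm_smul, norm_smul, hnu, Real.norm_of_nonneg hs.le,
    Real.norm_of_nonneg (inv_pos.2 hs).le, smul_smul, smul_smul, smul_neg, ← neg_smul]
  congr 2
  · field_simp
    ring
  · field_simp
    ring

/-! ### Fields related by a local diffeomorphism -/

section Related

variable {n : ℕ} {N : Type*} [TopologicalSpace N] [ChartedSpace (EuclideanSpace ℝ (Fin n)) N]

local notation "E" => EuclideanSpace ℝ (Fin n)

lemma contMDiffAt_section_of_related [IsManifold (𝓡 n) ∞ N] {f : E → N} {p : E}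
    (hf : ContMDiff (𝓡 n) (𝓡 n) ∞ f) (hfp : IsLocalDiffeomorphAt (𝓡 n) (𝓡 n) ∞ f p) {X : E → E}
    {Y : (x : N) → TangentSpace (𝓡 n) x} (hX : ContDiff ℝ ∞ X)
    (h : ∀ᶠ v in 𝓝 p, Y (f v) = mfderiv (𝓡 n) (𝓡 n) f v (X v)) :
    ContMDiffAt (𝓡 n) (𝓡 n).tangent ∞ (fun x => (⟨x, Y x⟩ : TangentBundle (𝓡 n) N)) (f p) := by
  have h1 : ContMDiff (𝓡 n) (𝓡 n).tangent ∞ fun v =>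
      tangentMap (𝓡 n) (𝓡 n) f (⟨v, X v⟩ : TangentBundle (𝓡 n) E) :=
    (hf.contMDiff_tangentMap (by simp)).comp (contMDiff_section hX)
  have h2 := (h1 (hfp.localInverse (f p))).comp (f p) hfp.localInverse_contMDiffAt
  refine h2.congr_of_eventuallyEq ?_
  have h3 : Tendsto hfp.localInverse (𝓝 (f p)) (𝓝 p) := by
    have := hfp.localInverse_contMDiffAt.continuousAt
    rwa [ContinuousAt, hfp.localInverse_left_inv hfp.localInverse_mem_target] at this
  filter_upwards [hfp.localInverse_eventuallyEq_right, h3.eventually h] with y hy hy'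
  have hy : f (hfp.localInverse y) = y := hy
  calc (⟨y, Y y⟩ : TangentBundle (𝓡 n) N)
      = ⟨f (hfp.localInverse y), Y (f (hfp.localInverse y))⟩ := by rw [hy]
    _ = ⟨f (hfp.localInverse y), mfderiv (𝓡 n) (𝓡 n) f (hfp.localInverse y)
        (X (hfp.localInverse y))⟩ := by rw [hy']

lemma isMIntegralCurveOn_of_related {f : E → N} (hf : ContMDiff (𝓡 n) (𝓡 n) ∞ f) {X : E → E}
    {Y : (x : N) → TangentSpace (𝓡 n) x} {c : ℝ → E} {s : Set ℝ}
    (hc : ∀ t ∈ s, HasDerivAt c (X (c t)) t)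
    (h : ∀ t ∈ s, Y (f (c t)) = mfderiv (𝓡 n) (𝓡 n) f (c t) (X (c t))) :
    IsMIntegralCurveOn (I := 𝓡 n) (fun t => f (c t)) Y s := by
  intro t ht
  have h1 := (hf.mdifferentiable (by simp) (c t)).hasMFDerivAt.comp t
    (hasMFDerivAt_curve_iff.2 (hc t ht))
  refine HasMFDerivAt.hasMFDerivWithinAt (h1.congr_mfderiv ?_)
  refine ContinuousLinearMap.ext fun (r : ℝ) => ?_
  rw [h t ht]
  exact map_smul (mfderiv (𝓡 n) (𝓡 n) f (c t) : E →L[ℝ] E) r (X (c t))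

end Related

/-! ### The flow of the rescaled field -/

local notation "Υ" => flowMap (n := 3) slowField

lemma exists_timeChange {f : ℝ → ℝ} (hf : Continuous f) (h0 : ∀ t, 0 < f t) (h1 : ∀ t, f t ≤ 1) :
    ∃ B : ℝ ≃o ℝ, B 0 = 0 ∧ (∀ t, HasDerivAt B (f (B t)) t) ∧
      ∀ s, 0 ≤ s → (∀ r ∈ Icc 0 s, f r = 1) → B s = s := by
  have hc : Continuous fun t => (f t)⁻¹ := hf.inv₀ fun t => (h0 t).ne'
  set A : ℝ → ℝ := fun s => ∫ t in (0 : ℝ)..s, (f t)⁻¹ with hA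
  have hd : ∀ s, HasDerivAt A (f s)⁻¹ s := fun s =>
    intervalIntegral.integral_hasDerivAt_right (hc.intervalIntegrable _ _)
      hc.stronglyMeasurable.stronglyMeasurableAtFilter hc.continuousAt
  have hA0 : A 0 = 0 := intervalIntegral.integral_same
  have hmono : StrictMono A := strictMono_of_deriv_pos fun s => by
    rw [(hd s).deriv]
    exact inv_pos.2 (h0 s)
  have hAc : Continuous A := continuous_iff_continuousAt.2 fun s => (hd s).continuousAt
  have hle : ∀ s t, s ≤ t → t - s ≤ A t - A s := fun s t hst => by
    have := add_mul_le_of_le_deriv (δ := 1) hd hst fun r _ => (one_le_inv₀ (h0 r)).2 (h1 r)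
    linarith
  have hsurj : Function.Surjective A := by
    refine hAc.surjective (tendsto_atTop_mono' _ ?_ tendsto_id)
      (tendsto_atBot_mono' _ ?_ tendsto_id)
    · filter_upwards [eventually_ge_atTop 0] with t ht
      have := hle 0 t ht
      simp only [hA0, id] at this ⊢
      linarith
    · filter_upwards [eventually_le_atBot 0] with t ht
      have := hle t 0 ht
      simp only [hA0, id] at this ⊢
      linarith
  set e := hmono.orderIsoOfSurjective A hsurj with he
  refine ⟨e.symm, ?_, fun t => ?_, fun s hs h => ?_⟩
  · rw [OrderIso.symm_apply_eq]
    exact hA0.symm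
  · have h2 := HasDerivAt.of_local_left_inverse (f := A) e.symm.continuous.continuousAt
      (hd (e.symm t)) (inv_ne_zero (h0 _).ne') (Eventually.of_forall fun y => e.apply_symm_apply y)
    rwa [inv_inv] at h2
  · rw [OrderIso.symm_apply_eq]
    change s = ∫ t in (0 : ℝ)..s, (f t)⁻¹
    rw [intervalIntegral.integral_congr (g := fun _ => 1) fun r hr => ?_]
    · simp
    · rw [uIcc_of_le hs] at hr
      simp [h r hr]

lemma exists_slow_curve (v : E3) : ∃ B : ℝ ≃o ℝ, B 0 = 0 ∧
    (∀ t, HasDerivAt (fun t => Θ (B t) v) (slowField (Θ (B t) v)) t) ∧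
      ∀ s, 0 ≤ s → (∀ r ∈ Icc 0 s, rescale (Θ r v) = 1) → B s = s := by
  obtain ⟨B, h0, hd, h1⟩ := exists_timeChange (f := fun t => rescale (Θ t v))
    (contDiff_rescale.continuous.comp (space_hasFlow.continuous_flowMap v))
    (fun t => rescale_pos _) fun t => rescale_le_one _
  exact ⟨B, h0, fun t => (space_hasFlow.hasDerivAt v (B t)).scomp t (hd t), h1⟩

lemma contDiff_one_slowField : ContDiff ℝ 1 slowField := contDiff_slowField.of_le (by norm_cast)

lemma slow_hasFlow : HasFlow (n := 3) slowField := by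
  refine hasFlow_of_exists contDiff_one_slowField fun v => ?_
  obtain ⟨B, h0, hd, -⟩ := exists_slow_curve v
  exact ⟨fun t => Θ (B t) v, by simp only [h0, space_flow_zero], hd⟩

/-- The rescaled field has the same orbits, with another time. -/
lemma exists_slow_flow (v : E3) : ∃ B : ℝ ≃o ℝ, B 0 = 0 ∧ (∀ t, Υ t v = Θ (B t) v) ∧
    ∀ s, 0 ≤ s → (∀ r ∈ Icc 0 s, rescale (Θ r v) = 1) → B s = s := by
  obtain ⟨B, h0, hd, h1⟩ := exists_slow_curve v
  refine ⟨B, h0, fun t => ?_, h1⟩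
  have := congrFun (slow_hasFlow.eq_flowMap (isMIntegralCurve_iff.2 hd)) t
  simp only [h0, space_flow_zero] at this
  exact this.symm

lemma slow_flow_eq {v : E3} {s : ℝ} (hs : 0 ≤ s) (h : ∀ r ∈ Icc 0 s, rescale (Θ r v) = 1) :
    Υ s v = Θ s v := by
  obtain ⟨B, -, hB, h1⟩ := exists_slow_flow v
  rw [hB, h1 s hs h]

lemma tendsto_slow_atTop {v : E3} {F : Filter E3} :
    Tendsto (fun t => Υ t v) atTop F ↔ Tendsto (fun t => Θ t v) atTop F := by
  obtain ⟨B, -, hB, -⟩ := exists_slow_flow v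
  simp_rw [hB]
  refine ⟨fun h => ?_, fun h => h.comp B.tendsto_atTop⟩
  have := h.comp B.symm.tendsto_atTop
  simpa [Function.comp_def] using this

lemma tendsto_slow_atBot {v : E3} {F : Filter E3} :
    Tendsto (fun t => Υ t v) atBot F ↔ Tendsto (fun t => Θ t v) atBot F := by
  obtain ⟨B, -, hB, -⟩ := exists_slow_flow v
  simp_rw [hB]
  refine ⟨fun h => ?_, fun h => h.comp B.tendsto_atBot⟩
  have := h.comp B.symm.tendsto_atBot
  simpa [Function.comp_def] using this

lemma slowField_eq_zero_iff {v : E3} : slowField v = 0 ↔ spaceField v = 0 := by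
  rw [slowField, smul_eq_zero_iff_right (rescale_pos v).ne']

lemma isTransient_slow {v : E3} (h : IsTransient (n := 3) spaceField v) :
    IsTransient (n := 3) slowField v := by
  obtain ⟨F, hF, t, ht, hc, hct, hlt⟩ := h
  have hmono : ∀ (B : ℝ ≃o ℝ) (t : ℝ), B 0 = 0 → 0 ≤ t → 0 ≤ B t := fun B t h0 ht => by
    rw [← h0]
    exact B.monotone ht
  obtain ⟨B, h0, hB, -⟩ := exists_slow_flow v
  have e : Υ (B.symm t) v = Θ t v := by rw [hB, B.apply_symm_apply]
  refine ⟨F, fun y s hs => ?_, B.symm t, ?_, hc, by rwa [e], by rwa [e]⟩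
  · obtain ⟨B', h0', hB', -⟩ := exists_slow_flow y
    rw [hB']
    exact hF y _ (hmono B' s h0' hs)
  · exact hmono B.symm t (by rw [OrderIso.symm_apply_eq, h0]) ht

lemma rescale_of_slab {v : E3} {s : ℝ} (hv : |v 2| < 1 / 2) (hs : 0 ≤ s)
    (h : sqn (flowMap (n := 2) planarField s (proj v)) ≤ 5) : rescale (Θ s v) = 1 := by
  rw [flow_of_slab hv hs]
  refine rescale_of_near (by rwa [proj_lift]) ?_
  rw [lift_two, abs_mul, abs_of_pos (Real.exp_pos _)]
  have := Real.exp_le_one_iff.2 (neg_nonpos.2 hs)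
  nlinarith [abs_nonneg (v 2)]

/-- Near the closed orbit the two flows agree over one period. -/
lemma slow_flow_two_pi_eventuallyEq {p : E2} (hp : sqn p = 1) :
    ∀ᶠ v in 𝓝 (planeIncl p), Υ (2 * Real.pi) v = Θ (2 * Real.pi) v := by
  have hc : Continuous fun v : E3 => |v 2| := by fun_prop
  have hc' : Continuous fun v : E3 => sqn (proj v) := continuous_sqn.comp continuous_proj
  filter_upwards [hc.continuousAt.eventually (gt_mem_nhds
    (show |planeIncl p 2| < 1 / 2 by simp [planeIncl_eq])), hc'.continuousAt.eventually
    (gt_mem_nhds (show sqn (proj (planeIncl p)) < 2 by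
      rw [planeIncl_eq, proj_lift, hp]; norm_num))] with v hv hv'
  refine slow_flow_eq (by positivity) fun r hr => rescale_of_slab hv hr.1 ?_
  refine (sqn_le_middle hr.1 (c := 2) ?_ (by norm_num) (by norm_num)).trans (by norm_num)
  rw [planar_hasFlow.flowMap_zero]
  exact le_of_lt hv'

lemma slow_flow_circle {p : E2} (hp : sqn p = 1) {s : ℝ} (hs : 0 ≤ s) :
    Υ s (planeIncl p) = Θ s (planeIncl p) := by
  refine slow_flow_eq hs fun r hr => rescale_of_slab (by simp [planeIncl_eq]) hr.1 ?_
  rw [planeIncl_eq, proj_lift]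
  refine (sqn_le_middle hr.1 (c := 1) ?_ le_rfl (by norm_num)).trans (by norm_num)
  rw [planar_hasFlow.flowMap_zero]
  exact hp.le

lemma isClosedOrbit_slow : IsClosedOrbit (n := 3) slowField (planeIncl '' unitCircle) := by
  obtain ⟨c, hc, ⟨T, hT, hper⟩, ht, hr⟩ := isClosedOrbit_planeIncl isClosedOrbit_unitCircle
  refine ⟨c, isMIntegralCurve_iff.2 fun t => ?_, ⟨T, hT, hper⟩, ht, hr⟩
  have h1 : rescale (c t) = 1 := by
    have : c t ∈ planeIncl '' unitCircle := hr ▸ mem_range_self t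
    obtain ⟨p, hp, e⟩ := this
    have hp : sqn p = 1 := hp
    rw [← e, planeIncl_eq]
    exact rescale_of_near (by rw [proj_lift, hp]; norm_num) (by simp)
  rw [slowField, h1, one_smul]
  exact isMIntegralCurve_iff.1 hc t

/-! ### The field on the sphere -/

/-- The pole that is added at infinity. -/
def infinity : S3 := ⟨EuclideanSpace.single 3 1, by simp⟩

/-- The compactification: the straightening map, followed by the radial map and a stereographic
parametrization. -/
def compactify (v : E3) : S3 := stereoInv infinity (expand v)

lemma isLocalDiffeomorph_compactify : IsLocalDiffeomorph (𝓡 3) (𝓡 3) ∞ compactify := fun v =>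
  (isLocalDiffeomorph_expand v).comp (𝓡 3) S3 (isLocalDiffeomorph_stereoInv infinity _)

lemma injective_compactify : Function.Injective compactify :=
  (injective_stereoInv infinity).comp bijective_expand.1

lemma range_compactify : range compactify = {infinity}ᶜ := by
  rw [← range_stereoInv]
  exact bijective_expand.2.range_comp (stereoInv infinity)

lemma compactify_ne (v : E3) : compactify v ≠ infinity := by
  have : compactify v ∈ ({infinity}ᶜ : Set S3) := range_compactify ▸ mem_range_self v
  exact this

lemma exists_compactify {x : S3} (h : x ≠ infinity) : ∃ v, compactify v = x := by
  have : x ∈ range compactify := range_compactify ▸ h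
  exact this

lemma isOpenEmbedding_compactify : Topology.IsOpenEmbedding compactify :=
  isLocalDiffeomorph_compactify.isLocalHomeomorph.isOpenEmbedding_of_injective injective_compactify

/-- The image of the rescaled field under the differential of the compactification. -/
def pushedField (v : E3) : E3 :=
  (mfderiv (𝓡 3) (𝓡 3) compactify v : E3 →L[ℝ] E3) (slowField v)

open Classical in
/-- The field on the sphere: the image of the rescaled field, extended by a rest point. -/
def sphereField (x : S3) : TangentSpace (𝓡 3) x :=
  if x = infinity then (0 : E3) else pushedField (Function.invFun compactify x)

lemma sphereField_infinity {x : S3} (h : x = infinity) : sphereField x = (0 : E3) := if_pos h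

lemma sphereField_compactify (v : E3) :
    sphereField (compactify v) = mfderiv (𝓡 3) (𝓡 3) compactify v (slowField v) := by
  have h1 : (sphereField (compactify v) : E3) = pushedField v := by
    have h := Function.leftInverse_invFun injective_compactify v
    have h2 : (sphereField (compactify v) : E3) =
        pushedField (Function.invFun compactify (compactify v)) := if_neg (compactify_ne v)
    rw [h2, h]
  exact h1

section Curves

variable {n : ℕ} {N : Type*} [TopologicalSpace N] [ChartedSpace (EuclideanSpace ℝ (Fin n)) N]

local notation "E" => EuclideanSpace ℝ (Fin n)

/-- The chain rule for a point that moves along two parametrized curves. -/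
lemma mfderiv_eq_of_curves {f g : E → N} (hf : MDifferentiable (𝓡 n) (𝓡 n) f)
    (hg : MDifferentiable (𝓡 n) (𝓡 n) g) {c d : ℝ → E} {c' d' u w : E} (hc : HasDerivAt c c' 0)
    (hd : HasDerivAt d d' 0) (h : ∀ t, f (c t) = g (d t)) (hu : c 0 = u) (hw : d 0 = w) :
    (mfderiv (𝓡 n) (𝓡 n) f u : E →L[ℝ] E) c' = (mfderiv (𝓡 n) (𝓡 n) g w : E →L[ℝ] E) d' := by
  subst hu hw
  have h1 := (hf (c 0)).hasMFDerivAt.comp (0 : ℝ) (hasMFDerivAt_curve_iff.2 hc)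
  have h2 := (hg (d 0)).hasMFDerivAt.comp (0 : ℝ) (hasMFDerivAt_curve_iff.2 hd)
  have e : f ∘ c = g ∘ d := funext h
  rw [e] at h1
  have h3 := hasMFDerivAt_unique h1 h2
  have h4 := congrArg (fun L : ℝ →L[ℝ] E => L 1) h3
  have h5 : ∀ (L : E →L[ℝ] E) (v : E), L ((1 : ℝ) • v) = L v := fun L v => by rw [one_smul]
  exact (h5 _ _).symm.trans (h4.trans (h5 _ _))

end Curves

lemma exists_far : ∃ R > 0, ∀ v, R < ‖expand v‖ → 6 < sqn (proj v) ∨ 3 < |v 2| := by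
  obtain ⟨R, hR⟩ := ((isCompact_cylinder 6 3).image contDiff_expand.continuous).isBounded.exists_norm_le
  refine ⟨max R 1, by positivity, fun v hv => ?_⟩
  by_contra hn
  rw [not_or, not_lt, not_lt] at hn
  exact absurd (hR _ ⟨v, hn, rfl⟩) (not_le.2 ((le_max_left _ _).trans_lt hv))

/-- The velocity in a stereographic parametrization. -/
def stereoVelocity (q : S3) (u w : E3) : E3 :=
  (mfderiv (𝓡 3) (𝓡 3) (stereoInv q) u : E3 →L[ℝ] E3) w

lemma pushedField_eq {v : E3} (h : 6 < sqn (proj v) ∨ 3 < |v 2|) :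
    pushedField v = stereoVelocity infinity (expand v) (expand v) := by
  have h6 := fderiv_expand_slowField h
  rw [← mfderiv_eq_fderiv] at h6
  have h4 := mfderiv_comp_apply v
    ((isLocalDiffeomorph_stereoInv infinity).mdifferentiable (by simp) (expand v))
    (isLocalDiffeomorph_expand.mdifferentiable (by simp) v) (slowField v)
  refine Eq.trans h4 ?_
  exact congrArg (stereoVelocity infinity (expand v)) h6

lemma stereoVelocity_eq {u w : E3}
    (h : ∀ s : ℝ, 0 < s → stereoInv (-infinity) (s • w) = stereoInv infinity (s⁻¹ • u)) :
    stereoVelocity infinity u u = stereoVelocity (-infinity) w (-w) := by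
  exact mfderiv_eq_of_curves
    ((isLocalDiffeomorph_stereoInv infinity).mdifferentiable (by simp))
    ((isLocalDiffeomorph_stereoInv (-infinity)).mdifferentiable (by simp))
    (c := fun t => Real.exp t • u) (d := fun t => Real.exp (-t) • w)
    (((Real.hasDerivAt_exp 0).smul_const _).congr_deriv (by simp))
    (((hasDerivAt_neg (0 : ℝ)).exp.smul_const w).congr_deriv (by simp))
    (fun t => by rw [h _ (Real.exp_pos _), ← Real.exp_neg, neg_neg]) (by simp) (by simp)

lemma sphereField_eq_pushedField {x : S3} {v : E3} (h : x = compactify v) :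
    (sphereField x : E3) = pushedField v := by
  subst h
  exact sphereField_compactify v

/-- Near the added rest point the field on the sphere is the field `-w` in a stereographic
parametrization. -/
lemma exists_sphereField_eq : ∃ ρ > 0, ∀ w : E3, ‖w‖ < ρ →
    (sphereField (stereoInv (-infinity) w) : E3) = stereoVelocity (-infinity) w (-w) := by
  obtain ⟨R, hR, hfar⟩ := exists_far
  refine ⟨4 / R, by positivity, fun w hw => ?_⟩
  by_cases h0 : w = 0
  · have h1 : stereoVelocity (-infinity) w (-w) = 0 := by
      rw [h0, neg_zero]
      exact map_zero (mfderiv (𝓡 3) (𝓡 3) (stereoInv (-infinity)) 0 : E3 →L[ℝ] E3)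
    rw [h1]
    exact sphereField_infinity (by rw [h0, stereoInv_neg_zero])
  obtain ⟨u, hu, hs⟩ := exists_stereoInv_eq infinity h0
  obtain ⟨v, rfl⟩ := bijective_expand.2 u
  have hn : 0 < ‖w‖ := norm_pos_iff.2 h0
  have h1 : R < ‖expand v‖ := by
    rw [hu, lt_div_iff₀ hn]
    rw [lt_div_iff₀ hR] at hw
    linarith
  have hx : stereoInv (-infinity) w = compactify v := by
    have := hs 1 one_pos
    rwa [one_smul, inv_one, one_smul] at this
  exact (sphereField_eq_pushedField hx).trans
    ((pushedField_eq (hfar v h1)).trans (stereoVelocity_eq hs))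

lemma contMDiff_sphereField : ContMDiff (𝓡 3) (𝓡 3).tangent ∞
    (fun x => (⟨x, sphereField x⟩ : TangentBundle (𝓡 3) S3)) := by
  intro x
  by_cases h : x = infinity
  · obtain ⟨ρ, hρ, h1⟩ := exists_sphereField_eq
    have h2 := contMDiffAt_section_of_related (p := 0) (Y := sphereField) (X := fun w => -w)
      (isLocalDiffeomorph_stereoInv (-infinity)).contMDiff (isLocalDiffeomorph_stereoInv _ 0)
      contDiff_neg (by
        filter_upwards [Metric.ball_mem_nhds (0 : E3) hρ] with w hw
        exact h1 w (by simpa using hw))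
    rwa [stereoInv_neg_zero, ← h] at h2
  · obtain ⟨v, rfl⟩ := exists_compactify h
    exact contMDiffAt_section_of_related isLocalDiffeomorph_compactify.contMDiff
      (isLocalDiffeomorph_compactify v) contDiff_slowField
      (Eventually.of_forall sphereField_compactify)

lemma isMIntegralCurve_compactify (v : E3) :
    IsMIntegralCurve (I := 𝓡 3) (fun t => compactify (Υ t v)) sphereField := by
  rw [isMIntegralCurve_iff_isMIntegralCurveOn]
  exact isMIntegralCurveOn_of_related isLocalDiffeomorph_compactify.contMDiff
    (fun t _ => slow_hasFlow.hasDerivAt v t) fun t _ => sphereField_compactify _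

lemma sphere_hasFlow : HasFlow sphereField where
  exists_curve x := by
    by_cases h : x = infinity
    · exact ⟨fun _ => x, rfl, isMIntegralCurve_const (sphereField_infinity h)⟩
    · obtain ⟨v, rfl⟩ := exists_compactify h
      exact ⟨_, congrArg compactify (slow_hasFlow.flowMap_zero v), isMIntegralCurve_compactify v⟩
  unique c c' hc hc' h := isMIntegralCurve_Ioo_eq_of_contMDiff_boundaryless (t₀ := 0)
    (contMDiff_sphereField.of_le (by norm_cast)) hc hc' h

lemma sphere_flow_compactify (t : ℝ) (v : E3) :
    flowMap sphereField t (compactify v) = compactify (Υ t v) := by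
  have h := congrFun (sphere_hasFlow.eq_flowMap (isMIntegralCurve_compactify v)) t
  simp only [slow_hasFlow.flowMap_zero] at h
  exact h.symm

lemma sphere_flow_infinity (t : ℝ) : flowMap sphereField t infinity = infinity :=
  sphere_hasFlow.flowMap_of_zero (sphereField_infinity rfl) t

lemma continuousAt_sphere_flow (t : ℝ) (v : E3) :
    ContinuousAt (flowMap sphereField t) (compactify v) := by
  rw [isOpenEmbedding_compactify.continuousAt_iff.symm]
  have h : flowMap sphereField t ∘ compactify = compactify ∘ Υ t :=
    funext (sphere_flow_compactify t)
  rw [h]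
  exact (isOpenEmbedding_compactify.continuous.comp
    (slow_hasFlow.continuous_flowMap_right contDiff_one_slowField t)).continuousAt

/-- The added rest point attracts a neighbourhood. -/
lemma stableSet_infinity_mem_nhds : stableSet sphereField {infinity} ∈ 𝓝 infinity := by
  obtain ⟨ρ, hρ, h⟩ := exists_sphereField_eq
  have hflow : ∀ w : E3, ‖w‖ < ρ → ∀ t, 0 ≤ t →
      flowMap sphereField t (stereoInv (-infinity) w) =
        stereoInv (-infinity) (Real.exp (-t) • w) := by
    intro w hw t ht
    have hc : Continuous fun a : ℝ => Real.exp (-a) * ‖w‖ := by fun_prop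
    obtain ⟨a, ha, ha'⟩ : ∃ a < 0, Real.exp (-a) * ‖w‖ < ρ := by
      have h1 := hc.continuousAt.eventually (gt_mem_nhds (show Real.exp (-0) * ‖w‖ < ρ by simpa))
      obtain ⟨a, ha⟩ := ((h1.filter_mono nhdsWithin_le_nhds).and
        (self_mem_nhdsWithin (s := Iio 0))).exists
      exact ⟨a, ha.2, ha.1⟩
    refine isMIntegralCurveOn_Ioo_eqOn_of_contMDiff_boundaryless (I := 𝓡 3) (a := a) (b := t + 1)
      (t₀ := 0) (γ := fun t => flowMap sphereField t (stereoInv (-infinity) w))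
      (γ' := fun t => stereoInv (-infinity) (Real.exp (-t) • w)) ⟨ha, by linarith⟩
      (contMDiff_sphereField.of_le (by norm_cast))
      ((sphere_hasFlow.isMIntegralCurve _).isMIntegralCurveOn _)
      (isMIntegralCurveOn_of_related (isLocalDiffeomorph_stereoInv _).contMDiff (X := fun w => -w)
        (fun s _ => ?_) fun s hs => h _ ?_) ?_ ⟨by linarith, by linarith⟩
    · exact ((hasDerivAt_neg s).exp.smul_const w).congr_deriv (by simp)
    · rw [norm_smul, Real.norm_of_nonneg (Real.exp_pos _).le]
      refine lt_of_le_of_lt ?_ ha'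
      have := Real.exp_le_exp.2 (neg_le_neg hs.1.le)
      gcongr
    · simp [sphere_hasFlow.flowMap_zero]
  have h1 := (isLocalDiffeomorph_stereoInv (-infinity)).isOpenMap.image_mem_nhds
    (Metric.ball_mem_nhds (0 : E3) hρ)
  rw [stereoInv_neg_zero] at h1
  refine mem_of_superset h1 ?_
  rintro _ ⟨w, hw, rfl⟩
  rw [sphere_hasFlow.mem_stableSet, nhdsSet_singleton]
  have h2 : Tendsto (fun t : ℝ => stereoInv (-infinity) (Real.exp (-t) • w)) atTop
      (𝓝 (stereoInv (-infinity) ((0 : ℝ) • w))) :=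
    ((isLocalDiffeomorph_stereoInv (-infinity)).contMDiff.continuous.tendsto _).comp
      ((Real.tendsto_exp_neg_atTop_nhds_zero).smul_const w)
  rw [zero_smul, stereoInv_neg_zero] at h2
  refine h2.congr' ?_
  filter_upwards [eventually_ge_atTop 0] with t ht
  exact (hflow w (by simpa using hw) t ht).symm

/-! ### Stable and unstable manifolds on the sphere -/

lemma tendsto_compactify_nhdsSet {ι : Type*} {l : Filter ι} {c : ι → E3} {β : Set E3} :
    Tendsto (fun t => compactify (c t)) l (𝓝ˢ (compactify '' β)) ↔ Tendsto c l (𝓝ˢ β) := by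
  rw [← isOpenEmbedding_compactify.isOpenMap.map_nhdsSet_eq isOpenEmbedding_compactify.continuous]
  exact map_le_map_iff (f := map c l) injective_compactify

lemma tendsto_compactify_infinity {ι : Type*} {l : Filter ι} {c : ι → E3} :
    Tendsto (fun t => compactify (c t)) l (𝓝 infinity) ↔ Tendsto c l (cocompact E3) := by
  constructor
  · intro h
    refine (hasBasis_cocompact.tendsto_right_iff).2 fun K hK => ?_
    have h1 : (compactify '' K)ᶜ ∈ 𝓝 infinity := by
      refine (hK.image isOpenEmbedding_compactify.continuous).isClosed.isOpen_compl.mem_nhds ?_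
      rintro ⟨v, -, hv⟩
      exact compactify_ne v hv
    filter_upwards [h h1] with t ht hc
    exact ht ⟨_, hc, rfl⟩
  · intro h
    refine fun s hs => ?_
    obtain ⟨O, hO, hOo, hi⟩ := mem_nhds_iff.1 hs
    have h1 : IsCompact (compactify ⁻¹' Oᶜ) := by
      refine isOpenEmbedding_compactify.isInducing.isCompact_preimage' hOo.isClosed_compl.isCompact ?_
      rw [range_compactify]
      exact fun x hx hx' => hx (hx' ▸ hi)
    have h2 : ∀ᶠ t in l, c t ∈ (compactify ⁻¹' Oᶜ)ᶜ := h h1.compl_mem_cocompact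
    exact mem_map.2 (h2.mono fun t ht => hO (not_not.1 ht))

lemma mem_stable_compactify {β : Set E3} {v : E3} :
    compactify v ∈ stableSet sphereField (compactify '' β) ↔
      v ∈ stableSet (n := 3) spaceField β := by
  rw [sphere_hasFlow.mem_stableSet, space_hasFlow.mem_stableSet]
  simp_rw [sphere_flow_compactify]
  exact tendsto_compactify_nhdsSet.trans tendsto_slow_atTop

lemma mem_unstable_compactify {β : Set E3} {v : E3} :
    compactify v ∈ unstableSet sphereField (compactify '' β) ↔
      v ∈ unstableSet (n := 3) spaceField β := by
  rw [sphere_hasFlow.mem_unstableSet, space_hasFlow.mem_unstableSet]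
  simp_rw [sphere_flow_compactify]
  exact tendsto_compactify_nhdsSet.trans tendsto_slow_atBot

lemma infinity_not_tendsto {β : Set E3} {l : Filter ℝ} [l.NeBot] :
    ¬ Tendsto (fun t => flowMap sphereField t infinity) l (𝓝ˢ (compactify '' β)) := by
  intro h
  simp_rw [sphere_flow_infinity] at h
  have h1 : range compactify ∈ 𝓝ˢ (compactify '' β) :=
    isOpenEmbedding_compactify.isOpen_range.mem_nhdsSet.2 (image_subset_range _ _)
  obtain ⟨t, v, hv⟩ := (h.eventually h1).exists
  exact compactify_ne v hv

lemma stable_compactify (β : Set E3) : stableSet sphereField (compactify '' β) =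
    compactify '' stableSet (n := 3) spaceField β := by
  ext x
  by_cases h : x = infinity
  · subst h
    refine iff_of_false (fun h => ?_) ?_
    · exact infinity_not_tendsto (sphere_hasFlow.mem_stableSet.1 h)
    · rintro ⟨v, -, hv⟩
      exact compactify_ne v hv
  · obtain ⟨v, rfl⟩ := exists_compactify h
    exact mem_stable_compactify.trans (injective_compactify.mem_set_image).symm

lemma unstable_compactify (β : Set E3) : unstableSet sphereField (compactify '' β) =
    compactify '' unstableSet (n := 3) spaceField β := by
  ext x
  by_cases h : x = infinity
  · subst h
    refine iff_of_false (fun h => ?_) ?_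
    · exact infinity_not_tendsto (sphere_hasFlow.mem_unstableSet.1 h)
    · rintro ⟨v, -, hv⟩
      exact compactify_ne v hv
  · obtain ⟨v, rfl⟩ := exists_compactify h
    exact mem_unstable_compactify.trans (injective_compactify.mem_set_image).symm

lemma mem_stable_infinity {v : E3} :
    compactify v ∈ stableSet sphereField {infinity} ↔ v ∈ escape := by
  rw [sphere_hasFlow.mem_stableSet, nhdsSet_singleton]
  simp_rw [sphere_flow_compactify]
  exact tendsto_compactify_infinity.trans tendsto_slow_atTop

lemma unstable_inter_stable_infinity (β : Set E3) :
    unstableSet sphereField (compactify '' β) ∩ stableSet sphereField {infinity} =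
      compactify '' (unstableSet (n := 3) spaceField β ∩ escape) := by
  rw [unstable_compactify, ← image_inter_preimage]
  congr 2
  ext v
  exact mem_stable_infinity

lemma exists_mem_unstable_space (v : E3) : ∃ β, IsCritical (n := 3) spaceField β ∧
    v ∈ unstableSet (n := 3) spaceField β := by
  by_cases h0 : v 2 = 0
  · obtain ⟨β, hβ, h⟩ := exists_mem_unstable_planeIncl h0
    exact ⟨_, isCritical_planeIncl hβ, h⟩
  · obtain ⟨σ, hσ, hz⟩ := exists_sign (v 2)
    exact ⟨_, isCritical_top hσ, mem_unstable_top hσ (hz ▸ abs_pos.2 h0)⟩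

lemma unstable_infinity : unstableSet sphereField {infinity} = {infinity} := by
  ext x
  refine ⟨fun hx => ?_, fun hx => ?_⟩
  · by_contra h
    obtain ⟨v, rfl⟩ := exists_compactify h
    obtain ⟨β, hβ, hv⟩ := exists_mem_unstable_space v
    rw [sphere_hasFlow.mem_unstableSet, nhdsSet_singleton] at hx
    simp_rw [sphere_flow_compactify] at hx
    have h1 := tendsto_slow_atBot.1 (tendsto_compactify_infinity.1 hx)
    rw [space_hasFlow.mem_unstableSet] at hv
    obtain ⟨K, hK, hβK⟩ := exists_compact_superset hβ.isCompact
    obtain ⟨t, h2, h3⟩ := ((h1.eventually hK.compl_mem_cocompact).and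
      (hv.eventually (mem_nhdsSet_iff_exists.2 ⟨_, isOpen_interior, hβK, interior_subset⟩))).exists
    exact h2 h3
  · rw [mem_singleton_iff.1 hx]
    exact sphere_hasFlow.unstableSet_singleton_of_zero (sphereField_infinity rfl)

/-! ### Critical elements on the sphere -/

lemma sphereField_compactify_eq_zero_iff {v : E3} :
    sphereField (compactify v) = 0 ↔ spaceField v = 0 := by
  rw [sphereField_compactify, ← slowField_eq_zero_iff]
  exact ((isLocalDiffeomorph_compactify v).mfderivToContinuousLinearEquiv
    (by simp)).map_eq_zero_iff

lemma sphereField_eq_zero_iff {x : S3} :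
    sphereField x = 0 ↔ x = infinity ∨ ∃ v, spaceField v = 0 ∧ x = compactify v := by
  constructor
  · intro h
    by_cases hx : x = infinity
    · exact Or.inl hx
    · obtain ⟨v, rfl⟩ := exists_compactify hx
      exact Or.inr ⟨v, sphereField_compactify_eq_zero_iff.1 h, rfl⟩
  · rintro (h | ⟨v, hv, rfl⟩)
    · exact sphereField_infinity h
    · exact sphereField_compactify_eq_zero_iff.2 hv

/-- The closed orbit on the sphere. -/
def sphereOrbit : Set S3 := compactify '' (planeIncl '' unitCircle)

lemma isClosedOrbit_sphereOrbit : IsClosedOrbit sphereField sphereOrbit := by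
  obtain ⟨c, hc, ⟨T, hT, hper⟩, ⟨t, ht⟩, h⟩ := isClosedOrbit_slow
  have e : (fun t => compactify (c t)) = fun t => compactify (Υ t (c 0)) := by
    funext t
    exact congrArg compactify (congrFun (slow_hasFlow.eq_flowMap hc) t)
  refine ⟨fun t => compactify (c t), e ▸ isMIntegralCurve_compactify _,
    ⟨T, hT, fun s => congrArg compactify (hper s)⟩, ⟨t, injective_compactify.ne ht⟩, ?_⟩
  rw [sphereOrbit, h, ← range_comp]
  rfl

lemma isTransient_compactify {v : E3} (h : IsTransient (n := 3) slowField v) :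
    IsTransient sphereField (compactify v) := by
  obtain ⟨F, hF, t, ht, hc, hct, hlt⟩ := h
  have hinv : ∀ v, Function.invFun compactify (compactify v) = v :=
    Function.leftInverse_invFun injective_compactify
  have hcont : ∀ v, ContinuousAt F v →
      ContinuousAt (fun x => F (Function.invFun compactify x)) (compactify v) := by
    intro v hv
    rw [← isOpenEmbedding_compactify.continuousAt_iff]
    refine hv.congr (Eventually.of_forall fun w => ?_)
    simp [hinv]
  refine ⟨fun x => F (Function.invFun compactify x), fun y s hs => ?_, t, ht, hcont v hc, ?_, ?_⟩
  · by_cases hy : y = infinity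
    · rw [hy, sphere_flow_infinity]
    · obtain ⟨w, rfl⟩ := exists_compactify hy
      simp only [sphere_flow_compactify, hinv]
      exact hF w s hs
  · rw [sphere_flow_compactify]
    exact hcont _ hct
  · simpa only [sphere_flow_compactify, hinv] using hlt

lemma isTransient_sphere {x : S3} (h : sphereField x ≠ 0) (h' : x ∉ sphereOrbit) :
    IsTransient sphereField x := by
  obtain ⟨v, rfl⟩ := exists_compactify fun hx => h (sphereField_infinity hx)
  exact isTransient_compactify (isTransient_slow (isTransient_space
    (fun hv => h (sphereField_compactify_eq_zero_iff.2 hv)) fun hv => h' ⟨v, hv, rfl⟩))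

lemma closedOrbits_sphere : {c | IsClosedOrbit sphereField c} = {sphereOrbit} :=
  sphere_hasFlow.closedOrbits_eq isClosedOrbit_sphereOrbit fun _ => isTransient_sphere

lemma isClosedOrbit_sphere_iff {c : Set S3} : IsClosedOrbit sphereField c ↔ c = sphereOrbit := by
  have h := closedOrbits_sphere
  exact Set.ext_iff.1 h c

lemma isCritical_sphere_cases {B : Set S3} (h : IsCritical sphereField B) :
    B = {infinity} ∨ ∃ β, IsCritical (n := 3) spaceField β ∧ B = compactify '' β := by
  rcases h with ⟨p, hp, rfl⟩ | h
  · rcases sphereField_eq_zero_iff.1 hp with rfl | ⟨v, hv, rfl⟩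
    · exact Or.inl rfl
    · exact Or.inr ⟨{v}, Or.inl ⟨v, hv, rfl⟩, image_singleton.symm⟩
  · rw [isClosedOrbit_sphere_iff] at h
    exact Or.inr ⟨_, isCritical_planeIncl isCritical_unitCircle, h⟩

lemma transverse_sphere {B B' : Set S3} (hB : IsCritical sphereField B)
    (hB' : IsCritical sphereField B') :
    Transverse 3 (unstableSet sphereField B) (stableSet sphereField B') := by
  -- the stable manifold of the added rest point is open
  have hopen : ∀ x ∈ stableSet sphereField {infinity},
      stableSet sphereField {infinity} ∈ 𝓝 x := by
    intro x hx
    by_cases h : x = infinity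
    · rw [h]
      exact stableSet_infinity_mem_nhds
    · obtain ⟨v, rfl⟩ := exists_compactify h
      rw [sphere_hasFlow.mem_stableSet, nhdsSet_singleton] at hx
      obtain ⟨t, ht⟩ := (hx.eventually (eventually_mem_nhds_iff.2 stableSet_infinity_mem_nhds)).exists
      exact HasFlow.mem_nhds_of_flowMap (fun x t => (sphere_hasFlow.flowMap_mem_stableSet t).1)
        (continuousAt_sphere_flow t v) ht
  rintro x ⟨h1, h2⟩
  rcases isCritical_sphere_cases hB' with rfl | ⟨β', hβ', rfl⟩
  · have h := span_tangentVectors_image_eq_top (isLocalDiffeomorph_stereoInv (-x) 0) (S₁ := ∅)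
      (S₂ := univ) (T₁ := unstableSet sphereField B) (T₂ := stableSet sphereField {infinity})
      (Eventually.of_forall fun _ hy => hy.elim) ?_ ?_
    · rwa [stereoInv_neg_zero] at h
    · have hc := (isLocalDiffeomorph_stereoInv (-x)).contMDiff.continuous.continuousAt (x := 0)
      refine (hc.eventually ?_).mono fun y hy _ => hy
      rw [stereoInv_neg_zero]
      exact hopen x h2
    · exact eq_top_iff.2 fun w _ =>
        Submodule.subset_span (Or.inr (mem_tangentVectors_of_mem_nhds univ_mem w))
  · rcases isCritical_sphere_cases hB with rfl | ⟨β, hβ, rfl⟩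
    · rw [unstable_infinity] at h1
      rw [mem_singleton_iff.1 h1] at h2
      exact absurd (sphere_hasFlow.mem_stableSet.1 h2) infinity_not_tendsto
    · have hx : x ≠ infinity := by
        rintro rfl
        exact infinity_not_tendsto (sphere_hasFlow.mem_stableSet.1 h2)
      obtain ⟨v, rfl⟩ := exists_compactify hx
      exact span_tangentVectors_image_eq_top (isLocalDiffeomorph_compactify v)
        (Eventually.of_forall fun _ => mem_unstable_compactify.2)
        (Eventually.of_forall fun _ => mem_stable_compactify.2)
        (transverse_space hβ hβ' v ⟨mem_unstable_compactify.1 h1, mem_stable_compactify.1 h2⟩)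

/-! ### The Morse-Smale property on the sphere -/

lemma SpaceRest.near {v : E3} {a : Fin 3 → ℝ} (h : SpaceRest v a) :
    sqn (proj v) < 5 ∧ |v 2| < 2 := by
  cases h with
  | source i =>
    rw [planeIncl_eq, proj_lift]
    fin_cases i <;> norm_num [MorseSmale.source, sqn]
  | saddle i =>
    rw [planeIncl_eq, proj_lift]
    fin_cases i <;> norm_num [MorseSmale.saddle, sqn]
  | top hσ =>
    rw [MorseSmale.top, proj_lift, lift_two]
    rcases hσ with rfl | rfl <;> norm_num [sqn]

lemma SpaceRest.eigenvalues_sphere {v : E3} {a : Fin 3 → ℝ} (h : SpaceRest v a)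
    (h0 : spaceField v = 0) :
    eigenvaluesC (linearization sphereField (compactify v)) =
      Finset.univ.val.map fun k => (a k : ℂ) := by
  rw [eigenvaluesC_linearization_of_related (isLocalDiffeomorph_compactify v)
    (contDiff_slowField.differentiable (by simp) v) (slowField_eq_zero_iff.2 h0)
    (Eventually.of_forall sphereField_compactify), ← h.eigenvalues]
  have hc : Continuous fun v : E3 => sqn (proj v) := continuous_sqn.comp continuous_proj
  have hc' : Continuous fun v : E3 => |v 2| := by fun_prop
  have : slowField =ᶠ[𝓝 v] spaceField := by
    filter_upwards [hc.continuousAt.eventually (gt_mem_nhds h.near.1),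
      hc'.continuousAt.eventually (gt_mem_nhds h.near.2)] with w hw hw'
    rw [slowField, rescale_of_near (le_of_lt hw) (le_of_lt hw'), one_smul]
  rw [this.fderiv_eq]

lemma eigenvaluesC_infinity : eigenvaluesC (linearization sphereField infinity) =
    Finset.univ.val.map fun k => (((fun _ => -1) : Fin 3 → ℝ) k : ℂ) := by
  obtain ⟨ρ, hρ, h1⟩ := exists_sphereField_eq
  have h := eigenvaluesC_linearization_of_related (p := 0) (X := fun w => -w) (Y := sphereField)
    (isLocalDiffeomorph_stereoInv (-infinity) 0) (by fun_prop) neg_zero (by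
      filter_upwards [Metric.ball_mem_nhds (0 : E3) hρ] with w hw
      exact h1 w (by simpa using hw))
  rw [stereoInv_neg_zero] at h
  rw [h]
  refine eigenvaluesC_of_single fun k => ?_
  rw [fderiv_fun_neg, fderiv_fun_id]
  simp

lemma period_sphere {p : E2} (hp : sqn p = 1) :
    period sphereField (compactify (planeIncl p)) = 2 * Real.pi := by
  have h : {T | 0 < T ∧ flowMap sphereField T (compactify (planeIncl p)) =
      compactify (planeIncl p)} = {T | 0 < T ∧ Θ T (planeIncl p) = planeIncl p} := by
    ext T
    refine and_congr_right fun hT => ?_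
    rw [sphere_flow_compactify, injective_compactify.eq_iff, slow_flow_circle hp (le_of_lt hT)]
  change sInf {T | 0 < T ∧ flowMap sphereField T (compactify (planeIncl p)) =
      compactify (planeIncl p)} = _
  rw [h]
  exact period_space hp

lemma sphereOrbit_hyperbolic :
    IsHyperbolicOrbit sphereField sphereOrbit ∧ HasOrbitIndex sphereField sphereOrbit 0 := by
  refine isHyperbolicOrbit_of_eigenvalues (a := orbitRates) (i₀ := 0) ?_ circleRates_zero
    fun i hi => orbitRates_lt_one hi
  rintro _ ⟨_, ⟨p, hp, rfl⟩, rfl⟩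
  have hev : Υ (2 * Real.pi) =ᶠ[𝓝 (planeIncl p)] Θ (2 * Real.pi) := slow_flow_two_pi_eventuallyEq hp
  have h0 : Υ (2 * Real.pi) (planeIncl p) = planeIncl p := by
    rw [hev.self_of_nhds, flow_planeIncl]
    have : 2 * Real.pi ∈ {T | 0 < T ∧ flowMap (n := 2) planarField T p = p} := by
      rw [setOf_flow_eq hp]
      exact isLeast_cos_eq_one.1
    rw [this.2]
  change eigenvaluesC (mfderiv (𝓡 3) (𝓡 3)
    (flowMap sphereField (period sphereField (compactify (planeIncl p))))
    (compactify (planeIncl p))) = _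
  rw [period_sphere hp, eigenvaluesC_mfderiv_of_conj (isLocalDiffeomorph_compactify _)
    ((differentiableAt_space_flow_two_pi hp).congr_of_eventuallyEq hev) h0
    (Eventually.of_forall fun v => sphere_flow_compactify _ v), hev.fderiv_eq]
  exact eigenvaluesC_fderiv_flow hp

lemma isMorseSmale_sphere : IsMorseSmale sphereField := by
  refine sphere_hasFlow.isMorseSmale contMDiff_sphereField ?_ isClosedOrbit_sphereOrbit
    (fun _ => isTransient_sphere) (fun x hx t => ?_) (fun p hp => ?_) sphereOrbit_hyperbolic.1
    fun β β' => transverse_sphere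
  · refine ((finite_singleton infinity).union
      (finite_setOf_spaceField_eq_zero.image compactify)).subset fun x hx => ?_
    rcases sphereField_eq_zero_iff.1 hx with rfl | ⟨v, hv, rfl⟩
    exacts [Or.inl rfl, Or.inr ⟨v, hv, rfl⟩]
  · obtain ⟨v, rfl⟩ := exists_compactify fun h => hx (sphereField_infinity h)
    exact continuousAt_sphere_flow t v
  · rcases sphereField_eq_zero_iff.1 hp with rfl | ⟨v, hv, rfl⟩
    · exact isHyperbolicRest_of_eigenvalues eigenvaluesC_infinity fun _ => by norm_num
    · obtain ⟨a, ha⟩ := exists_spaceRest hv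
      exact isHyperbolicRest_of_eigenvalues (ha.eigenvalues_sphere hv) ha.ne_zero

/-! ### Generators of the Eidi-Jost sequence -/

lemma restIndex_infinity : restIndex sphereField infinity = 0 := by
  rw [restIndex_of_eigenvalues eigenvaluesC_infinity]
  norm_num

lemma SpaceRest.restIndex_sphere {v : E3} {a : Fin 3 → ℝ} (h : SpaceRest v a)
    (h0 : spaceField v = 0) :
    MorseSmale.restIndex sphereField (compactify v) = (Finset.univ.filter fun k => 0 < a k).card :=
  restIndex_of_eigenvalues (h.eigenvalues_sphere h0)

lemma spaceField_source (i : Fin 3) : spaceField (planeIncl (source i)) = 0 :=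
  spaceField_eq_zero_iff.2 (Or.inl ⟨_, planarField_eq_zero_iff.2 (Or.inl ⟨i, rfl⟩), rfl⟩)

lemma spaceField_saddle (i : Fin 2) : spaceField (planeIncl (saddle i)) = 0 :=
  spaceField_eq_zero_iff.2 (Or.inl ⟨_, planarField_eq_zero_iff.2 (Or.inr ⟨i, rfl⟩), rfl⟩)

/-- The signs of the heights of the two added sources. -/
def sign : Fin 2 → ℝ := ![1, -1]

lemma sign_cases (i : Fin 2) : sign i = 1 ∨ sign i = -1 := by
  fin_cases i
  exacts [Or.inl rfl, Or.inr rfl]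

/-- The rest points of the field on the sphere, with their indices. -/
lemma rest_cases {x : S3} (h : sphereField x = 0) :
    (x = infinity ∧ restIndex sphereField x = 0) ∨
      (∃ i, x = compactify (planeIncl (saddle i)) ∧ restIndex sphereField x = 1) ∨
      (∃ i, x = compactify (planeIncl (source i)) ∧ restIndex sphereField x = 2) ∨
      ∃ i, x = compactify (top (sign i)) ∧ restIndex sphereField x = 3 := by
  have htop : ∀ i, spaceField (top (sign i)) = 0 := fun i => spaceField_top (sign_cases i)
  rcases sphereField_eq_zero_iff.1 h with rfl | ⟨v, hv, rfl⟩
  · exact Or.inl ⟨rfl, restIndex_infinity⟩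
  · right
    have ht : ∀ i, restIndex sphereField (compactify (top (sign i))) = 3 := fun i =>
      ((SpaceRest.top (sign_cases i)).restIndex_sphere (htop i)).trans card_pos_top
    rcases spaceField_eq_zero_iff.1 hv with ⟨p, hp, rfl⟩ | rfl | rfl
    · rcases planarField_eq_zero_iff.1 hp with ⟨i, rfl⟩ | ⟨i, rfl⟩
      · exact Or.inr (Or.inl ⟨i, rfl,
          ((SpaceRest.source i).restIndex_sphere hv).trans (card_pos_source i)⟩)
      · exact Or.inl ⟨i, rfl, ((SpaceRest.saddle i).restIndex_sphere hv).trans (card_pos_saddle i)⟩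
    · exact Or.inr (Or.inr ⟨0, rfl, ht 0⟩)
    · exact Or.inr (Or.inr ⟨1, rfl, ht 1⟩)

lemma hasOrbitIndex_sphereOrbit_iff {k : ℕ} : HasOrbitIndex sphereField sphereOrbit k ↔ k = 0 := by
  refine ⟨fun h => ?_, fun h => h ▸ sphereOrbit_hyperbolic.2⟩
  obtain ⟨x, hx⟩ : sphereOrbit.Nonempty := (isConnected_unitCircle.nonempty.image _).image _
  rw [← h x hx, ← sphereOrbit_hyperbolic.2 x hx]

lemma sphereField_compactify_eq_zero {v : E3} (h : spaceField v = 0) :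
    sphereField (compactify v) = 0 :=
  sphereField_eq_zero_iff.2 (Or.inr ⟨v, h, rfl⟩)

lemma sign_injective : Function.Injective sign := fun i j h => by
  fin_cases i <;> fin_cases j <;> first | rfl | norm_num [sign] at h

lemma top_injective : Function.Injective top := fun _ _ h => congrFun (congrArg (·.ofLp) h) 2

/-- The generators of degree `3`: the two added sources. -/
def genThree (i : Fin 2) : Gen sphereField 3 :=
  .inl ⟨compactify (top (sign i)), sphereField_compactify_eq_zero (spaceField_top (sign_cases i)),
    ((SpaceRest.top (sign_cases i)).restIndex_sphere (spaceField_top (sign_cases i))).trans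
      card_pos_top⟩

/-- The generators of degree `2`: the sources of the planar field. -/
def genTwo (i : Fin 3) : Gen sphereField 2 :=
  .inl ⟨compactify (planeIncl (source i)), sphereField_compactify_eq_zero (spaceField_source i),
    ((SpaceRest.source i).restIndex_sphere (spaceField_source i)).trans (card_pos_source i)⟩

/-- The saddles of the planar field, as generators of degree `1`. -/
def genSaddle (i : Fin 2) : Gen sphereField 1 :=
  .inl ⟨compactify (planeIncl (saddle i)), sphereField_compactify_eq_zero (spaceField_saddle i),
    ((SpaceRest.saddle i).restIndex_sphere (spaceField_saddle i)).trans (card_pos_saddle i)⟩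

/-- The generators of degree `1`: the saddles of the planar field and the closed orbit. -/
def genOne : Fin 3 → Gen sphereField 1 :=
  ![genSaddle 0, genSaddle 1,
    .inr (.inr ⟨sphereOrbit, isClosedOrbit_sphereOrbit, 0, sphereOrbit_hyperbolic.2, rfl⟩)]

/-- The generators of degree `0`: the point at infinity and the closed orbit. -/
def genZero : Fin 2 → Gen sphereField 0 :=
  ![.inl ⟨infinity, sphereField_infinity rfl, restIndex_infinity⟩,
    .inr (.inl ⟨sphereOrbit, isClosedOrbit_sphereOrbit, sphereOrbit_hyperbolic.2⟩)]

/-- Case analysis on a generator: it comes from a rest point of the right index, or from the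
closed orbit in degree `0` or `1`. -/
lemma gen_cases {k : ℕ} (b : Gen sphereField k) :
    (∃ p, b = .inl p) ∨ (∃ γ, b = .inr (.inl γ) ∧ γ.1 = sphereOrbit ∧ k = 0) ∨
      ∃ γ, b = .inr (.inr γ) ∧ γ.1 = sphereOrbit ∧ k = 1 := by
  rcases b with p | ⟨γ, hγ, hk⟩ | ⟨γ, hγ, j, hj, hk⟩
  · exact Or.inl ⟨p, rfl⟩
  · obtain rfl := isClosedOrbit_sphere_iff.1 hγ
    exact Or.inr (Or.inl ⟨_, rfl, rfl, hasOrbitIndex_sphereOrbit_iff.1 hk⟩)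
  · obtain rfl := isClosedOrbit_sphere_iff.1 hγ
    obtain rfl := hasOrbitIndex_sphereOrbit_iff.1 hj
    exact Or.inr (Or.inr ⟨_, rfl, rfl, hk.symm⟩)

lemma isEmpty_gen {k : ℕ} (hk : 4 ≤ k) : IsEmpty (Gen sphereField k) := by
  refine ⟨fun b => ?_⟩
  rcases gen_cases b with ⟨⟨x, hx, hi⟩, -⟩ | ⟨-, -, -, h⟩ | ⟨-, -, -, h⟩
  · rcases rest_cases hx with ⟨-, h⟩ | ⟨-, -, h⟩ | ⟨-, -, h⟩ | ⟨-, -, h⟩ <;> omega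
  · omega
  · omega

lemma genThree_bijective : Function.Bijective genThree := by
  refine ⟨fun i j h => sign_injective (top_injective (injective_compactify
    (congrArg Subtype.val (Sum.inl_injective h)))), fun b => ?_⟩
  rcases gen_cases b with ⟨⟨x, hx, hi⟩, rfl⟩ | ⟨-, -, -, h⟩ | ⟨-, -, -, h⟩
  · rcases rest_cases hx with ⟨-, h⟩ | ⟨-, -, h⟩ | ⟨-, -, h⟩ | ⟨i, rfl, -⟩
    · omega
    · omega
    · omega
    · exact ⟨i, rfl⟩
  · omega
  · omega

lemma genTwo_bijective : Function.Bijective genTwo := by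
  refine ⟨fun i j h => source_injective (planeIncl_injective (injective_compactify
    (congrArg Subtype.val (Sum.inl_injective h)))), fun b => ?_⟩
  rcases gen_cases b with ⟨⟨x, hx, hi⟩, rfl⟩ | ⟨-, -, -, h⟩ | ⟨-, -, -, h⟩
  · rcases rest_cases hx with ⟨-, h⟩ | ⟨-, -, h⟩ | ⟨i, rfl, -⟩ | ⟨-, -, h⟩
    · omega
    · omega
    · exact ⟨i, rfl⟩
    · omega
  · omega
  · omega

lemma genOne_bijective : Function.Bijective genOne := by
  have hs : Function.Injective genSaddle := fun i j h => saddle_injective (planeIncl_injective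
    (injective_compactify (congrArg Subtype.val (Sum.inl_injective h))))
  refine ⟨fun i j h => ?_, fun b => ?_⟩
  · fin_cases i <;> fin_cases j <;> first
      | rfl
      | exact absurd (hs h) (by decide)
      | exact absurd h Sum.inl_ne_inr
      | exact absurd h Sum.inr_ne_inl
  · rcases gen_cases b with ⟨⟨x, hx, hi⟩, rfl⟩ | ⟨-, -, -, h⟩ | ⟨⟨γ, hγ⟩, rfl, rfl, -⟩
    · rcases rest_cases hx with ⟨-, h⟩ | ⟨i, rfl, -⟩ | ⟨-, -, h⟩ | ⟨-, -, h⟩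
      · omega
      · fin_cases i
        exacts [⟨0, rfl⟩, ⟨1, rfl⟩]
      · omega
      · omega
    · omega
    · exact ⟨2, rfl⟩

lemma genZero_bijective : Function.Bijective genZero := by
  refine ⟨fun i j h => ?_, fun b => ?_⟩
  · fin_cases i <;> fin_cases j <;> first
      | rfl
      | exact absurd h Sum.inl_ne_inr
      | exact absurd h Sum.inr_ne_inl
  · rcases gen_cases b with ⟨⟨x, hx, hi⟩, rfl⟩ | ⟨⟨γ, hγ⟩, rfl, rfl, -⟩ | ⟨-, -, -, h⟩
    · rcases rest_cases hx with ⟨rfl, -⟩ | ⟨-, -, h⟩ | ⟨-, -, h⟩ | ⟨-, -, h⟩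
      · exact ⟨0, rfl⟩
      · omega
      · omega
      · omega
    · exact ⟨1, rfl⟩
    · omega

/-! ### Counting connections on the sphere -/

lemma isEmbedding_planeIncl : Topology.IsEmbedding planeIncl :=
  Topology.IsEmbedding.of_leftInverse (f := proj) (fun p => by rw [planeIncl_eq, proj_lift])
    continuous_proj (continuous_lift.comp (continuous_id.prodMk continuous_const))

/-- The intersection of the unstable manifold of `B` with the stable manifold of `B'` has exactly
`k` connected components, for the field on the sphere. -/
def Connect (B B' : Set S3) (k : ℕ) : Prop :=
  HasComponents (unstableSet sphereField B ∩ stableSet sphereField B') k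

lemma Connect.of_space {β β' : Set E3} {k : ℕ}
    (h : HasComponents (unstableSet (n := 3) spaceField β ∩ stableSet (n := 3) spaceField β') k) :
    Connect (compactify '' β) (compactify '' β') k := by
  rw [Connect, unstable_compactify, stable_compactify, ← image_inter injective_compactify]
  exact h.image isOpenEmbedding_compactify.isEmbedding

lemma Connect.of_plane {β β' : Set E2} {k : ℕ} (hβ : IsCritical (n := 2) planarField β)
    (hβ' : IsCritical (n := 2) planarField β') (h : HasComponents (Wu β ∩ Ws β') k) :
    Connect (compactify '' (planeIncl '' β)) (compactify '' (planeIncl '' β')) k := by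
  refine Connect.of_space ?_
  rw [connections_planeIncl hβ hβ']
  exact h.image isEmbedding_planeIncl

lemma Connect.of_escape {β : Set E2} {k : ℕ} (hβ : IsCritical (n := 2) planarField β)
    (h : HasComponents (Wu β ∩ {v | 4 < sqn v}) k) :
    Connect (compactify '' (planeIncl '' β)) {infinity} k := by
  rw [Connect, unstable_inter_stable_infinity, escape_planeIncl hβ]
  exact (h.image isEmbedding_planeIncl).image isOpenEmbedding_compactify.isEmbedding

lemma carrier_genTwo (i : Fin 3) :
    (genTwo i).carrier = compactify '' (planeIncl '' {source i}) := by
  rw [image_singleton, image_singleton]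
  rfl

lemma carrier_genSaddle (i : Fin 2) :
    (genSaddle i).carrier = compactify '' (planeIncl '' {saddle i}) := by
  rw [image_singleton, image_singleton]
  rfl

lemma connect_three_two (i : Fin 2) (j : Fin 3) :
    Connect (genThree i).carrier (genTwo j).carrier 1 := by
  have h : (genThree i).carrier = compactify '' {top (sign i)} := by
    rw [image_singleton]
    rfl
  rw [h, carrier_genTwo]
  exact Connect.of_space (isConnected_top_source (sign_cases i) j).hasComponents

/-- The entry `2` counts the two arcs from the outer source to the outer saddle on the circle of
radius `2`. -/
lemma connect_two_one (j i : Fin 3) : Connect (genTwo j).carrier (genOne i).carrier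
    ((!![2, 0, 0; 0, 1, 1; 1, 1, 1] : Matrix (Fin 3) (Fin 3) ℕ) i j) := by
  rw [carrier_genTwo]
  have hs : ∀ k, ∀ m, HasComponents (Wu {source j} ∩ Ws {saddle k}) m →
      Connect (compactify '' (planeIncl '' {source j})) (genSaddle k).carrier m := fun k m h => by
    rw [carrier_genSaddle]
    exact Connect.of_plane (isCritical_source j) (isCritical_saddle k) h
  fin_cases i
  · refine hs 0 _ ?_
    fin_cases j
    · exact hasComponents_source_zero_saddle_zero
    · exact (connections_source_saddle_zero (i := 1) (by decide)).symm ▸ hasComponents_empty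
    · exact (connections_source_saddle_zero (i := 2) (by decide)).symm ▸ hasComponents_empty
  · refine hs 1 _ ?_
    fin_cases j
    · exact connections_source_zero_saddle_one.symm ▸ hasComponents_empty
    · exact hasComponents_source_one_saddle_one
    · exact hasComponents_source_two_saddle_one
  · have h := Connect.of_plane (isCritical_source j) isCritical_unitCircle
      (isConnected_source_circle j).hasComponents
    fin_cases j <;> exact h

/-- The entry `2` counts the two halves of the unstable manifold of the saddle at the origin; the
closed orbit is the whole intersection of its own unstable and stable manifolds -/
lemma connect_one_zero (j : Fin 3) (i : Fin 2) : Connect (genOne j).carrier (genZero i).carrier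
    ((!![1, 0, 0; 1, 2, 1] : Matrix (Fin 2) (Fin 3) ℕ) i j) := by
  have hs : ∀ k, ∀ B m, Connect (compactify '' (planeIncl '' {saddle k})) B m →
      Connect (genSaddle k).carrier B m := fun k B m h => by rwa [carrier_genSaddle]
  fin_cases i
  · fin_cases j
    · exact hs 0 _ _ (Connect.of_escape (isCritical_saddle 0)
        isConnected_saddle_zero_escape.hasComponents)
    · exact hs 1 _ _ (Connect.of_escape (isCritical_saddle 1)
        (saddle_one_escape ▸ hasComponents_empty))
    · exact Connect.of_escape isCritical_unitCircle (unitCircle_escape ▸ hasComponents_empty)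
  · fin_cases j
    · exact hs 0 _ _ (Connect.of_plane (isCritical_saddle 0) isCritical_unitCircle
        isConnected_saddle_zero_circle.hasComponents)
    · exact hs 1 _ _ (Connect.of_plane (isCritical_saddle 1) isCritical_unitCircle
        hasComponents_saddle_one_circle)
    · refine Connect.of_plane isCritical_unitCircle isCritical_unitCircle ?_
      rw [unstable_circle,
        inter_eq_left.2 (planar_hasFlow.subset_stableSet isCritical_unitCircle)]
      exact isConnected_unitCircle.hasComponents

lemma finite_connections (k : ℕ) (b : Gen sphereField (k + 1)) (b' : Gen sphereField k) :
    Finite (Connections sphereField b.carrier b'.carrier) := by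
  match k, b, b' with
  | 0, b, b' =>
    obtain ⟨j, rfl⟩ := genOne_bijective.2 b
    obtain ⟨i, rfl⟩ := genZero_bijective.2 b'
    exact (connect_one_zero j i).1
  | 1, b, b' =>
    obtain ⟨j, rfl⟩ := genTwo_bijective.2 b
    obtain ⟨i, rfl⟩ := genOne_bijective.2 b'
    exact (connect_two_one j i).1
  | 2, b, b' =>
    obtain ⟨j, rfl⟩ := genThree_bijective.2 b
    obtain ⟨i, rfl⟩ := genTwo_bijective.2 b'
    exact (connect_three_two j i).1
  | k + 3, b, _ => exact ((isEmpty_gen (by omega)).false b).elim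

lemma connectionNumber_eq {B B' : Set S3} {k : ℕ} (h : Connect B B' k) (hne : B ≠ B') :
    connectionNumber sphereField B B' = k := by
  rw [connectionNumber, if_neg hne]
  exact congrArg _ h.2

/-! ### The matrices of the boundary maps -/

section Matrix

variable {n : ℕ} {M : Type*} [TopologicalSpace M] [ChartedSpace (EuclideanSpace ℝ (Fin n)) M]
  {X : (x : M) → TangentSpace (𝓡 n) x}

lemma genBasis_apply {k m : ℕ} (e : Fin m ≃ Gen X k) (i : Fin m) :
    genBasis e i = Finsupp.single (e i) 1 := by
  simp [genBasis]

lemma genBasis_repr {k m : ℕ} (e : Fin m ≃ Gen X k) (f : Chain X k) (i : Fin m) :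
    (genBasis e).repr f i = f (e i) := by
  simp [genBasis]

lemma boundary_single_apply {k m : ℕ} (e : Fin m ≃ Gen X k) (b : Gen X (k + 1)) (i : Fin m) :
    boundary X k (Finsupp.single b 1) (e i) = connectionNumber X b.carrier (e i).carrier := by
  have : Fintype (Gen X k) := Fintype.ofEquiv _ e
  rw [boundary, Finsupp.linearCombination_single, one_smul, finsum_eq_sum_of_fintype,
    Finsupp.finsetSum_apply, Finset.sum_eq_single (e i), Finsupp.single_eq_same]
  · intro b' _ hb
    exact Finsupp.single_eq_of_ne hb.symm
  · simp

/-- The entries of the matrix of the boundary map are the connection numbers. -/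
lemma toMatrix_boundary {k l m : ℕ} (e : Fin l ≃ Gen X (k + 1)) (e' : Fin m ≃ Gen X k) (i : Fin m)
    (j : Fin l) : LinearMap.toMatrix (genBasis e) (genBasis e') (boundary X k) i j =
      connectionNumber X (e j).carrier (e' i).carrier := by
  rw [LinearMap.toMatrix_apply, genBasis_repr, genBasis_apply, boundary_single_apply]

end Matrix

/-- The enumeration of the generators of degree `3`. -/
def equivThree : Fin 2 ≃ Gen sphereField 3 := Equiv.ofBijective _ genThree_bijective

/-- The enumeration of the generators of degree `2`. -/
def equivTwo : Fin 3 ≃ Gen sphereField 2 := Equiv.ofBijective _ genTwo_bijective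

/-- The enumeration of the generators of degree `1`. -/
def equivOne : Fin 3 ≃ Gen sphereField 1 := Equiv.ofBijective _ genOne_bijective

/-- The enumeration of the generators of degree `0`. -/
def equivZero : Fin 2 ≃ Gen sphereField 0 := Equiv.ofBijective _ genZero_bijective

lemma singleton_ne_sphereOrbit (x : S3) : {x} ≠ sphereOrbit := fun h => by
  obtain ⟨v, -, hv⟩ : x ∈ sphereOrbit := h ▸ rfl
  have h1 : compactify '' {v} = sphereOrbit := by rw [image_singleton, hv, h]
  obtain ⟨p, -, rfl⟩ : v ∈ planeIncl '' unitCircle :=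
    injective_compactify.image_injective h1 ▸ rfl
  rw [← image_singleton] at h1
  exact singleton_ne_unitCircle p
    (planeIncl_injective.image_injective (injective_compactify.image_injective h1))

lemma toMatrix_boundary_two : LinearMap.toMatrix (genBasis equivThree) (genBasis equivTwo)
    (boundary sphereField 2) = !![1, 1; 1, 1; 1, 1] := by
  ext i j
  rw [toMatrix_boundary]
  refine (connectionNumber_eq (connect_three_two j i) fun h => ?_).trans ?_
  · -- the sources of the planar field lie in the plane, the added ones do not
    have h1 := injective_compactify (singleton_injective h)
    have h2 : sign j = 0 := congrFun (congrArg (·.ofLp) h1) 2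
    rcases sign_cases j with h3 | h3 <;> norm_num [h3] at h2
  · fin_cases i <;> fin_cases j <;> rfl

lemma toMatrix_boundary_one : LinearMap.toMatrix (genBasis equivTwo) (genBasis equivOne)
    (boundary sphereField 1) = !![0, 0, 0; 0, 1, 1; 1, 1, 1] := by
  have hs : ∀ j i, (genTwo j).carrier ≠ (genSaddle i).carrier := fun j i h =>
    source_ne_saddle j i (planeIncl_injective (injective_compactify (singleton_injective h)))
  ext i j
  rw [toMatrix_boundary]
  refine (connectionNumber_eq (connect_two_one j i) ?_).trans ?_
  · fin_cases i
    exacts [hs j 0, hs j 1, singleton_ne_sphereOrbit _]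
  · fin_cases i <;> fin_cases j <;> rfl

lemma toMatrix_boundary_zero : LinearMap.toMatrix (genBasis equivOne) (genBasis equivZero)
    (boundary sphereField 0) = !![1, 0, 0; 1, 0, 0] := by
  have hs : ∀ j i, (genSaddle j).carrier ≠ (genZero i).carrier := fun j i h => by
    fin_cases i
    exacts [compactify_ne _ (singleton_injective h), singleton_ne_sphereOrbit _ h]
  ext i j
  rw [toMatrix_boundary]
  by_cases hij : i = 1 ∧ j = 2
  · obtain ⟨rfl, rfl⟩ := hij
    exact if_pos rfl
  refine (connectionNumber_eq (connect_one_zero j i) ?_).trans ?_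
  · fin_cases j
    · exact hs 0 i
    · exact hs 1 i
    · fin_cases i
      · exact (singleton_ne_sphereOrbit _).symm
      · exact absurd ⟨rfl, rfl⟩ hij
  · fin_cases i <;> fin_cases j <;> first | rfl | exact absurd ⟨rfl, rfl⟩ hij

lemma boundary_comp_ne_zero : boundary sphereField 1 ∘ₗ boundary sphereField 2 ≠ 0 := fun h => by
  have h1 := LinearMap.toMatrix_comp (genBasis equivThree) (genBasis equivTwo) (genBasis equivOne)
    (boundary sphereField 1) (boundary sphereField 2)
  rw [h, map_zero, toMatrix_boundary_two, toMatrix_boundary_one] at h1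
  -- at the closed orbit the entry is `1 + 1 + 1`, with one summand for each planar source
  exact absurd (congrFun (congrFun h1 2) 0) (by decide)

end MorseSmale

end

theorem mainTheorem3 :
    -- the example
    (∃ (X : EuclideanSpace ℝ (Fin 2) → EuclideanSpace ℝ (Fin 2))
       (p : Fin 3 → EuclideanSpace ℝ (Fin 2)) (s : Fin 2 → EuclideanSpace ℝ (Fin 2))
       (γ : Set (EuclideanSpace ℝ (Fin 2))),
      -- the planar field: three sources, two saddles, one attracting closed orbit
      MorseSmale.IsMorseSmale (n := 2) X ∧
      Function.Injective p ∧ Function.Injective s ∧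
      {x | X x = 0} = Set.range p ∪ Set.range s ∧
      (∀ i, MorseSmale.restIndex (n := 2) X (p i) = 2) ∧
      (∀ i, MorseSmale.restIndex (n := 2) X (s i) = 1) ∧
      {c | MorseSmale.IsClosedOrbit (n := 2) X c} = {γ} ∧
      MorseSmale.HasOrbitIndex (n := 2) X γ 0 ∧
      s 1 = 0 ∧
      (∃ R : ℝ, ∀ x, R ≤ ‖x‖ → X x = x) ∧
      ∀ ε : ℝ, 0 < ε → ε < 1 / 2 →
        ∃ V : EuclideanSpace ℝ (Fin 3) → EuclideanSpace ℝ (Fin 3),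
          -- the extension to three-space
          (∀ v, |v 2| < ε →
            V v = !₂[X !₂[v 0, v 1] 0, X !₂[v 0, v 1] 1, -v 2]) ∧
          (∀ v, 3 / 4 < v 2 → V v = !₂[v 0, v 1, v 2 - 1]) ∧
          (∀ v, v 2 < -(3 / 4) → V v = !₂[v 0, v 1, v 2 + 1]) ∧
          MorseSmale.IsMorseSmale (n := 3) V ∧
          {v | V v = 0} = MorseSmale.planeIncl '' {x | X x = 0} ∪ {!₂[0, 0, 1], !₂[0, 0, -1]} ∧
          {c | MorseSmale.IsClosedOrbit (n := 3) V c} = {MorseSmale.planeIncl '' γ} ∧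
          (∀ i, MorseSmale.restIndex (n := 3) V (MorseSmale.planeIncl (p i)) = 2) ∧
          (∀ i, MorseSmale.restIndex (n := 3) V (MorseSmale.planeIncl (s i)) = 1) ∧
          MorseSmale.HasOrbitIndex (n := 3) V (MorseSmale.planeIncl '' γ) 0 ∧
          MorseSmale.restIndex (n := 3) V !₂[0, 0, 1] = 3 ∧
          MorseSmale.restIndex (n := 3) V !₂[0, 0, -1] = 3 ∧
          -- rescaling, and adding a rest point at infinity
          ∃ (lam : EuclideanSpace ℝ (Fin 3) → ℝ) (q₀ : MorseSmale.S3)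
            (Φ : EuclideanSpace ℝ (Fin 3) → MorseSmale.S3)
            (W : (x : MorseSmale.S3) → TangentSpace (𝓡 3) x),
            ContDiff ℝ ∞ lam ∧ (∀ v, 0 < lam v) ∧
            Filter.Tendsto (fun v => lam v • V v) (Filter.cocompact _) (𝓝 0) ∧
            IsLocalDiffeomorph (𝓡 3) (𝓡 3) ∞ Φ ∧ Function.Injective Φ ∧ Set.range Φ = {q₀}ᶜ ∧
            (∀ v, W (Φ v) = mfderiv (𝓡 3) (𝓡 3) Φ v (lam v • V v)) ∧
            MorseSmale.IsMorseSmale W ∧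
            -- all counts are finite
            (∀ k (b : MorseSmale.Gen W (k + 1)) (b' : MorseSmale.Gen W k),
              Finite (MorseSmale.Connections W b.carrier b'.carrier)) ∧
            -- the generators and the matrices
            (∃ (e₃ : Fin 2 ≃ MorseSmale.Gen W 3) (e₂ : Fin 3 ≃ MorseSmale.Gen W 2)
               (e₁ : Fin 3 ≃ MorseSmale.Gen W 1) (e₀ : Fin 2 ≃ MorseSmale.Gen W 0),
              (∀ k, 4 ≤ k → IsEmpty (MorseSmale.Gen W k)) ∧
              (e₃ 0).carrier = {Φ !₂[0, 0, 1]} ∧ (e₃ 1).carrier = {Φ !₂[0, 0, -1]} ∧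
              (∀ i, (e₂ i).carrier = {Φ (MorseSmale.planeIncl (p i))}) ∧
              (e₁ 0).carrier = {Φ (MorseSmale.planeIncl (s 0))} ∧
              (e₁ 1).carrier = {Φ (MorseSmale.planeIncl (s 1))} ∧
              (e₁ 2).carrier = Φ '' (MorseSmale.planeIncl '' γ) ∧
              (e₀ 0).carrier = {q₀} ∧ (e₀ 1).carrier = Φ '' (MorseSmale.planeIncl '' γ) ∧
              LinearMap.toMatrix (MorseSmale.genBasis e₃) (MorseSmale.genBasis e₂)
                (MorseSmale.boundary W 2) = !![1, 1; 1, 1; 1, 1] ∧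
              LinearMap.toMatrix (MorseSmale.genBasis e₂) (MorseSmale.genBasis e₁)
                (MorseSmale.boundary W 1) = !![0, 0, 0; 0, 1, 1; 1, 1, 1] ∧
              LinearMap.toMatrix (MorseSmale.genBasis e₁) (MorseSmale.genBasis e₀)
                (MorseSmale.boundary W 0) = !![1, 0, 0; 1, 0, 0]) ∧
            MorseSmale.boundary W 1 ∘ₗ MorseSmale.boundary W 2 ≠ 0) ∧
    -- hence the maps need not square to zero on closed manifolds
    ¬ ∀ (n : ℕ) (M : Type) [TopologicalSpace M] [ChartedSpace (EuclideanSpace ℝ (Fin n)) M]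
        [IsManifold (𝓡 n) ∞ M] [CompactSpace M] [T2Space M]
        (X : (x : M) → TangentSpace (𝓡 n) x), MorseSmale.IsMorseSmale X →
        ∀ k, MorseSmale.boundary X k ∘ₗ MorseSmale.boundary X (k + 1) = 0 := by
  refine ⟨⟨MorseSmale.planarField, MorseSmale.source, MorseSmale.saddle, MorseSmale.unitCircle,
    MorseSmale.isMorseSmale_planar, MorseSmale.source_injective, MorseSmale.saddle_injective, ?_,
    MorseSmale.restIndex_planar_source, MorseSmale.restIndex_planar_saddle,
    MorseSmale.closedOrbits_planar, MorseSmale.unitCircle_hyperbolic.2, rfl, ⟨3, fun x hx => ?_⟩,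
    fun ε _ hε => ⟨MorseSmale.spaceField, fun v hv => ?_, fun v hv => ?_, fun v hv => ?_,
      MorseSmale.isMorseSmale_space, ?_, MorseSmale.closedOrbits_space, fun i => ?_, fun i => ?_,
      MorseSmale.space_orbit_hyperbolic.2, ?_, ?_, MorseSmale.rescale, MorseSmale.infinity,
      MorseSmale.compactify, MorseSmale.sphereField, MorseSmale.contDiff_rescale,
      MorseSmale.rescale_pos, MorseSmale.tendsto_slowField,
      MorseSmale.isLocalDiffeomorph_compactify, MorseSmale.injective_compactify,
      MorseSmale.range_compactify, MorseSmale.sphereField_compactify,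
      MorseSmale.isMorseSmale_sphere, MorseSmale.finite_connections,
      ⟨MorseSmale.equivThree, MorseSmale.equivTwo, MorseSmale.equivOne, MorseSmale.equivZero,
        fun _ => MorseSmale.isEmpty_gen, ?_, ?_, fun _ => rfl, rfl, rfl, rfl, rfl, rfl,
        MorseSmale.toMatrix_boundary_two, MorseSmale.toMatrix_boundary_one,
        MorseSmale.toMatrix_boundary_zero⟩,
      MorseSmale.boundary_comp_ne_zero⟩⟩, fun h => ?_⟩
  · exact Set.ext fun _ => MorseSmale.planarField_eq_zero_iff
  · exact MorseSmale.planarField_of_six_le (by rw [MorseSmale.sqn_eq_norm_sq]; nlinarith)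
  · exact MorseSmale.spaceField_of_abs_lt (hv.trans hε)
  · exact MorseSmale.spaceField_of_gt hv
  · exact MorseSmale.spaceField_of_lt hv
  · ext v
    refine MorseSmale.spaceField_eq_zero_iff.trans (or_congr ?_ Iff.rfl)
    exact exists_congr fun _ => and_congr Iff.rfl eq_comm
  · exact (MorseSmale.SpaceRest.source i).restIndex.trans (MorseSmale.card_pos_source i)
  · exact (MorseSmale.SpaceRest.saddle i).restIndex.trans (MorseSmale.card_pos_saddle i)
  · exact (MorseSmale.SpaceRest.top (Or.inl rfl)).restIndex.trans MorseSmale.card_pos_top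
  · exact (MorseSmale.SpaceRest.top (Or.inr rfl)).restIndex.trans MorseSmale.card_pos_top
  · rfl
  · rfl
  · exact MorseSmale.boundary_comp_ne_zero
      (h 3 MorseSmale.S3 MorseSmale.sphereField MorseSmale.isMorseSmale_sphere 1)
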